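/- Let $s,r\in(0,1]$, $p,q\in[1,+\infty)$ with $rq=sp$, and let $m\ge 1$ be an integer. Let $\mathcal M$ be either the Euclidean space $\mathbb R^m$ or a nonempty compact Riemannian manifold of dimension $m$. Let $\mathcal N$ and $\mathcal F$ be Riemannian manifolds, $\mathcal N$ being connected and, if either $sp>m$ or $s=p=m=1$, compact; let $\pi:\mathcal F\to\mathcal N$ be any map. (Manifolds are smooth, without boundary and second countable; only $\mathcal N$ is required to be connected.) For $A\subseteq\mathcal M$ open and $u:A\to\mathcal N$ measurable, put, with geodesic distances and Riemannian volume, $$\mathcal E_{s,p}(u,A)=\int_A\int_A\frac{d_{\mathcal N}(u(x),u(y))^p}{d_{\mathcal M}(x,y)^{m+sp}}\,dx\,dy\quad (0<s<1),\qquad \mathcal E_{1,p}(u,A)=\int_A|Du|^p\quad (s=1).$$ Here the second energy is defined intrinsically as the infimum of $\int_A g^p$ over all measurable $g:A\to[0,+\infty]$ such that, for every $1$-Lipschitz function $f:\mathcal N\to\mathbb R$, the function $f\circ u$ is weakly differentiable on $A$ with $|D(f\circ u)|\le g$ almost everywhere (and is $+\infty$ if there is no such $g$); thus $|Du|$ is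 the operator norm of the weak derivative. The space $W^{s,p}(\mathcal M,\mathcal N)$ is the set of measurable maps $u:\mathcal M\to\mathcal N$ with $\mathcal E_{s,p}(u,\mathcal M)<+\infty$. The same definitions apply with $r,q,\mathcal F$ in place of $s,p,\mathcal N$, and with the domain $\mathbb R^m$. Let $\mathbb B^m$ be the unit ball of $\mathbb R^m$ and, for measurable $u:\mathbb B^m\to\mathcal N$, $$\mathcal E^{\mathrm{lift}}_{r,q}(u,\mathbb B^m)=\inf\bigl\{\mathcal E_{r,q}(\varphi,\mathbb B^m)\;:\;\varphi:\mathbb B^m\to\mathcal F\text{ measurable},\ \pi\circ\varphi=u\bigr\}\in[0,+\infty].$$ Assume that for every $u\in W^{s,p}(\mathcal M,\mathcal N)$ there exists $\varphi\in W^{r,q}(\mathcal M,\mathcal F)$ with $\pi\circ\varphi=u$. Then there exists a constant $C>0$ such that for every measurable $u:\mathbb B^m\to\mathcal N$ for which either $sp<m$ or $\mathcal E_{s,p}(u,\mathbb B^m)\le 1/C$, $$\mathcal E^{\mathrm{lift}}_{r,q}(u,\mathbb B^m)\le C\,\mathcal E_{s,p}(u,\mathbb B^m).$$ -/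

import Mathlib

open scoped Manifold ContDiff Bundle ENNReal MeasureTheory
open MeasureTheory Bundle Set

noncomputable section

/-!
Throughout, a Riemannian manifold is a type `M` with an extended metric (the geodesic distance
of the Riemannian metric, infinite between different components, as expressed by
`IsRiemannianManifold`), a smooth atlas and a smooth Riemannian metric on the tangent bundle.
The measure on an `m`-dimensional Riemannian manifold is the Riemannian volume, that is, the
`m`-dimensional Hausdorff measure `μHE[m]` of the geodesic distance, normalised so as to be the
Lebesgue measure on `ℝ^m`.
"Measurable" is measurability with respect to the completion of the volume (`AEMeasurable`);
maps are defined everywhere, and are not identified when they agree almost everywhere.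
A map on a subset `A` of `M` is represented by a map on `M` of which only the values
on `A` play a role.
-/

section Energies

variable (m : ℕ) {M : Type*} [EMetricSpace M] [MeasurableSpace M] [BorelSpace M]

/-- The Gagliardo energy
`∫_A ∫_A d(u x, u y)^p / d(x, y)^(m + s p) dx dy` of a map `u : A → N`, for `A ⊆ M`. -/
def gagliardoEnergy {N : Type*} [EMetricSpace N] (s p : ℝ) (u : M → N) (A : Set M) : ℝ≥0∞ :=
  ∫⁻ y in A, ∫⁻ x in A, edist (u x) (u y) ^ p / edist x y ^ ((m : ℝ) + s * p) ∂μHE[m] ∂μHE[m]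

variable [ChartedSpace (EuclideanSpace ℝ (Fin m)) M]

/-- The covector field `dh` is the weak differential of the scalar function `h` on the open set
`A ⊆ M`: in every chart, both are locally integrable and the integration by parts formula against
smooth compactly supported test functions holds. -/
structure HasWeakDifferentialOn (h : M → ℝ) (dh : ∀ x : M, TangentSpace (𝓡 m) x →L[ℝ] ℝ)
    (A : Set M) : Prop where
  locallyIntegrableOn : ∀ e ∈ atlas (EuclideanSpace ℝ (Fin m)) M,
    LocallyIntegrableOn (fun y => h (e.symm y)) (e.target ∩ e.symm ⁻¹' A) volume
  locallyIntegrableOn_differential : ∀ e ∈ atlas (EuclideanSpace ℝ (Fin m)) M,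
    ∀ v : EuclideanSpace ℝ (Fin m),
      LocallyIntegrableOn (fun y => dh (e.symm y) (mfderiv (𝓡 m) (𝓡 m) e.symm y v))
        (e.target ∩ e.symm ⁻¹' A) volume
  integral_eq : ∀ e ∈ atlas (EuclideanSpace ℝ (Fin m)) M, ∀ v : EuclideanSpace ℝ (Fin m),
    ∀ ψ : EuclideanSpace ℝ (Fin m) → ℝ, ContDiff ℝ ∞ ψ → HasCompactSupport ψ →
      tsupport ψ ⊆ e.target ∩ e.symm ⁻¹' A →
        ∫ y, h (e.symm y) * fderiv ℝ ψ y v =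
          - ∫ y, ψ y * dh (e.symm y) (mfderiv (𝓡 m) (𝓡 m) e.symm y v)

variable [RiemannianBundle (fun x : M => TangentSpace (𝓡 m) x)]

/-- `|Du| ≤ g` almost everywhere on the open set `A ⊆ M` in the weak sense, for a map `u` into a
Riemannian manifold `N`: for every function `f : N → ℝ` which is `1`-Lipschitz for the geodesic
distance, `f ∘ u` has on `A` a weak differential whose norm, for the Riemannian metric, is at most `g`. The smallest such `g` is the
operator norm `|Du|` of the weak derivative. -/
def WeakDerivBoundOn {N : Type*} [EMetricSpace N] (u : M → N) (g : M → ℝ≥0∞) (A : Set M) : Prop :=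
  ∀ f : N → ℝ, LipschitzWith 1 f →
    ∃ dh : ∀ x : M, TangentSpace (𝓡 m) x →L[ℝ] ℝ,
      HasWeakDifferentialOn m (fun x => f (u x)) dh A ∧
        ∀ᵐ x ∂((μHE[m] : Measure M).restrict A),
          ∀ v : TangentSpace (𝓡 m) x, ‖dh x v‖ₑ ≤ g x * ‖v‖ₑ

/-- The first order energy `∫_A |Du|^p`, intrinsically defined as the infimum of `∫_A g^p`
over all measurable `g` with `|Du| ≤ g` almost everywhere. It is `∞` if `u` is not weakly
differentiable on `A`. -/
def dirichletEnergy {N : Type*} [EMetricSpace N] (p : ℝ) (u : M → N) (A : Set M) : ℝ≥0∞ :=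
  ⨅ (g : M → ℝ≥0∞) (_ : AEMeasurable g ((μHE[m] : Measure M).restrict A))
    (_ : WeakDerivBoundOn m u g A), ∫⁻ x in A, g x ^ p ∂μHE[m]

open Classical in
/-- The Sobolev energy `𝓔_{s,p}(u, A)`, for `s ∈ (0, 1]`. -/
def sobolevEnergy {N : Type*} [EMetricSpace N] (s p : ℝ) (u : M → N) (A : Set M) : ℝ≥0∞ :=
  if s = 1 then dirichletEnergy m p u A else gagliardoEnergy m s p u A

/-- `u ∈ W^{s,p}(M, N)`. -/
def MemSobolev {N : Type*} [EMetricSpace N] [MeasurableSpace N] (s p : ℝ) (u : M → N) : Prop :=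
  AEMeasurable u (μHE[m] : Measure M) ∧ sobolevEnergy m s p u univ < ⊤

/-- The lifting energy `𝓔^lift_{r,q}(u, A)` with respect to `proj : F → N`: the infimum of
`𝓔_{r,q}(φ, A)` over the measurable `φ : A → F` with `proj ∘ φ = u` on `A`. -/
def liftingEnergy {N F : Type*} [EMetricSpace F] [MeasurableSpace F] (proj : F → N) (r q : ℝ)
    (u : M → N) (A : Set M) : ℝ≥0∞ :=
  ⨅ (φ : M → F) (_ : AEMeasurable φ ((μHE[m] : Measure M).restrict A))
    (_ : ∀ x ∈ A, proj (φ x) = u x), sobolevEnergy m r q φ A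

variable (M) in
/-- Every map in `W^{s,p}(M, N)` can be lifted through `proj : F → N` to a map in `W^{r,q}(M, F)`. -/
def EverySobolevMapLifts {N F : Type*} [EMetricSpace N] [MeasurableSpace N] [EMetricSpace F]
    [MeasurableSpace F] (proj : F → N) (s p r q : ℝ) : Prop :=
  ∀ u : M → N, MemSobolev m s p u → ∃ φ : M → F, MemSobolev m r q φ ∧ ∀ x, proj (φ x) = u x

end Energies

/-- The linear bound `𝓔^lift_{r,q}(u, 𝔹^m) ≤ C 𝓔_{s,p}(u, 𝔹^m)` holds, for some constant `C > 0`,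
for all measurable `u : 𝔹^m → N` such that either `s p < m` or `𝓔_{s,p}(u, 𝔹^m) ≤ 1 / C`. -/
def LinearLiftingBound (m : ℕ) {N F : Type*} [EMetricSpace N] [MeasurableSpace N] [EMetricSpace F]
    [MeasurableSpace F] (proj : F → N) (s p r q : ℝ) : Prop :=
  ∃ C : ℝ, 0 < C ∧ ∀ u : EuclideanSpace ℝ (Fin m) → N,
    AEMeasurable u ((μHE[m] : Measure (EuclideanSpace ℝ (Fin m))).restrict (Metric.ball 0 1)) →
    (s * p < m ∨ sobolevEnergy m s p u (Metric.ball 0 1) ≤ ENNReal.ofReal (1 / C)) →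
      liftingEnergy m proj r q u (Metric.ball 0 1) ≤
        ENNReal.ofReal C * sobolevEnergy m s p u (Metric.ball 0 1)

end

/-! This is a nonlinear uniform boundedness principle, proved by contradiction. If no linear bound
held, there would be maps on the unit ball whose lifting energy exceeds any prescribed multiple Λ of
their energy. Small rescaled copies of such maps are accumulated into a single map of finite energy.
By assumption it has a lifting of finite energy; but the energies of a lifting on disjoint balls sum
up to at most its total energy, while by construction this sum is infinite.

Scaling. A copy of radius σ has its energy multiplied by σ^(m - sp), and its lifting energy by the
same factor because rq = sp. Taking k^m copies on a cubic grid multiplies both by k^m σ^(m - sp).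
`exists_scale` chooses k and σ so that the energy is comparable to a prescribed ε while the grid
fits into a prescribed ball; if Λ is large, the lifting energies of the copies then sum up to at
least 1. Such a configuration is a cell (`exists_forall_hasCell`). Cells of energy 2^(-j) are placed
in disjoint balls converging to a boundary point of a fixed ball (`not_liftsLocally_of_hasCell`).

Gluing requires three ingredients.

Opening (`exists_opening`): a map u on the unit ball is replaced by a map on the whole space which
equals u on the ball, is constant off a larger ball, and has comparable energy. It is u composed
with a Lipschitz map onto the closed ball depending on a parameter; the energy of the composition is
controlled on average over the parameter by Fubini's theorem, hence for some parameter.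

Transitions: the constants b outside the opened maps have to be joined to a common value a. If sp <
m, or if sp = m and p > 1, points have zero capacity, so that a path in the connected manifold N can
be followed at arbitrarily small cost (`hasSmallTransitions`); in the critical case the cutoff
functions are produced by repeatedly averaging a function with a concentrated rescaling of itself
(`HasCutoff.half`). In the other cases N is compact: the constants accumulate at some a, and values
near a are joined to a at small cost by short paths, in balls of a size independent of the value
(`exists_isTransition_near`).

Localisation: the map is built inside a small ball of one chart of the domain, where the chart is
bi-Lipschitz. It is transplanted to the domain (`ChartBall.memSobolev_transplant`), lifted there,
and the lifting is read back in the chart (`EverySobolevMapLifts.liftsLocally`).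

For s = 1 all constructions are done with upper gradients along almost every segment
(`SegmentBound`), which are compared pointwise and therefore patched exactly like the integrand of
the Gagliardo energy. `HasWeakFDerivOn.enorm_sub_le_lintegral_curve` passes from weak derivatives to
such bounds, by mollification, and `SegmentBound.exists_hasWeakFDerivOn` goes back, by difference
quotients and the Riesz representation theorem. -/

open scoped Manifold ContDiff Bundle ENNReal MeasureTheory
open MeasureTheory Bundle Set

noncomputable section

set_option linter.unusedSectionVars false
set_option linter.unusedSimpArgs false

/-! ### Dilations and integrals of powers of the norm. -/

section Integrals

variable {V : Type*} [NormedAddCommGroup V] [NormedSpace ℝ V] [FiniteDimensional ℝ V]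
  [MeasurableSpace V] [BorelSpace V] (μ : Measure V) [μ.IsAddHaarMeasure]

theorem lintegral_comp_inv_smul_sub (f : V → ℝ≥0∞) (c : V) {ρ : ℝ} (hρ : 0 < ρ) :
    ∫⁻ x, f (ρ⁻¹ • (x - c)) ∂μ = ENNReal.ofReal ρ ^ Module.finrank ℝ V * ∫⁻ x, f x ∂μ := by
  have h1 : ∫⁻ x, f (ρ⁻¹ • (x - c)) ∂μ = ∫⁻ x, f (ρ⁻¹ • x) ∂μ :=
    lintegral_sub_right_eq_self (μ := μ) (fun x => f (ρ⁻¹ • x)) c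
  have hne : ρ⁻¹ ≠ 0 := inv_ne_zero hρ.ne'
  have h2 : ∫⁻ x, f (ρ⁻¹ • x) ∂μ = ∫⁻ x, f x ∂(μ.map (ρ⁻¹ • ·)) :=
    (lintegral_map_equiv f (Homeomorph.smulOfNeZero (α := V) ρ⁻¹ hne).toMeasurableEquiv).symm
  rw [h1, h2, Measure.map_addHaar_smul μ hne, lintegral_smul_measure, smul_eq_mul]
  congr 1
  rw [inv_pow, inv_inv, abs_of_pos (pow_pos hρ _), ENNReal.ofReal_pow hρ.le]

theorem lintegral_comp_add_smul (f : V → ℝ≥0∞) (c : V) {ρ : ℝ} (hρ : 0 < ρ) :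
    ENNReal.ofReal ρ ^ Module.finrank ℝ V * ∫⁻ x, f (c + ρ • x) ∂μ = ∫⁻ x, f x ∂μ := by
  rw [← lintegral_comp_inv_smul_sub μ (fun x => f (c + ρ • x)) c hρ]
  simp [smul_smul, hρ.ne']

theorem quasiMeasurePreserving_inv_smul_sub (c : V) {ρ : ℝ} (hρ : 0 < ρ) :
    Measure.QuasiMeasurePreserving (fun x : V => ρ⁻¹ • (x - c)) μ μ := by
  refine ⟨by fun_prop, Measure.AbsolutelyContinuous.mk fun s hs h0 => ?_⟩
  rw [Measure.map_apply (by fun_prop) hs, ← lintegral_indicator_one (hs.preimage (by fun_prop))]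
  have := lintegral_comp_inv_smul_sub μ (s.indicator 1) c hρ
  rw [lintegral_indicator_one hs, h0, mul_zero] at this
  exact this

theorem quasiMeasurePreserving_add_smul (c : V) {ρ : ℝ} (hρ : 0 < ρ) :
    Measure.QuasiMeasurePreserving (fun x : V => c + ρ • x) μ μ := by
  have h := quasiMeasurePreserving_inv_smul_sub μ (-(ρ⁻¹ • c)) (inv_pos.2 hρ)
  convert h using 2 with x
  simp [smul_smul, hρ.ne', add_comm]

theorem lintegral_compl_ball_rpow_lt_top {a : ℝ} (ha : (Module.finrank ℝ V : ℝ) < a) :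
    ∫⁻ x in (Metric.ball (0 : V) 1)ᶜ, (‖x‖ₑ ^ a)⁻¹ ∂μ < ⊤ := by
  have ha0 : 0 < a := lt_of_le_of_lt (by positivity) ha
  have h := finite_integral_one_add_norm (μ := μ) ha
  -- Off the unit ball 1 + ‖x‖ ≤ 2 ‖x‖, whence the factor 2^a.
  calc ∫⁻ x in (Metric.ball (0 : V) 1)ᶜ, (‖x‖ₑ ^ a)⁻¹ ∂μ
      ≤ ∫⁻ x in (Metric.ball (0 : V) 1)ᶜ,
          ENNReal.ofReal (2 ^ a) * ENNReal.ofReal ((1 + ‖x‖) ^ (-a)) ∂μ := by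
        refine setLIntegral_mono' (Metric.isOpen_ball.measurableSet.compl) fun x hx => ?_
        have hx1 : 1 ≤ ‖x‖ := by simpa using hx
        have hx0 : 0 < ‖x‖ := by linarith
        rw [← ofReal_norm, ENNReal.ofReal_rpow_of_pos hx0,
          ← ENNReal.ofReal_inv_of_pos (by positivity), ← ENNReal.ofReal_mul (by positivity)]
        apply ENNReal.ofReal_le_ofReal
        rw [Real.rpow_neg (by positivity), ← Real.inv_rpow (by positivity), ← Real.inv_rpow (by positivity),
          ← Real.mul_rpow (by positivity) (by positivity)]
        refine Real.rpow_le_rpow (by positivity) ?_ ha0.le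
        rw [← div_eq_mul_inv, inv_eq_one_div, div_le_div_iff₀ hx0 (by positivity)]
        linarith
    _ ≤ ∫⁻ x, ENNReal.ofReal (2 ^ a) * ENNReal.ofReal ((1 + ‖x‖) ^ (-a)) ∂μ :=
        setLIntegral_le_lintegral _ _
    _ < ⊤ := by
        rw [lintegral_const_mul' _ _ ENNReal.ofReal_ne_top]
        exact ENNReal.mul_lt_top ENNReal.ofReal_lt_top h

omit [FiniteDimensional ℝ V] [MeasurableSpace V] [BorelSpace V] in
theorem enorm_smul_rpow_inv {ρ : ℝ} (hρ : 0 < ρ) (a : ℝ) (x : V) :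
    (‖ρ • x‖ₑ ^ a)⁻¹ = ENNReal.ofReal ρ ^ (-a) * (‖x‖ₑ ^ a)⁻¹ := by
  have h0 : ENNReal.ofReal ρ ≠ 0 := by simpa using hρ
  rw [enorm_smul, Real.enorm_eq_ofReal hρ.le, ENNReal.mul_rpow_of_ne_top ENNReal.ofReal_ne_top (by simp),
    ENNReal.mul_inv (by left; exact (ENNReal.rpow_pos (by simpa using hρ) (by simp)).ne')
      (by left; exact ENNReal.rpow_ne_top_of_ne_zero h0 (by simp)), ENNReal.rpow_neg]

theorem setLIntegral_compl_ball_rpow {a ρ : ℝ} (hρ : 0 < ρ) :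
    ∫⁻ x in (Metric.ball (0 : V) ρ)ᶜ, (‖x‖ₑ ^ a)⁻¹ ∂μ =
      ENNReal.ofReal ρ ^ ((Module.finrank ℝ V : ℝ) - a) *
        ∫⁻ x in (Metric.ball (0 : V) 1)ᶜ, (‖x‖ₑ ^ a)⁻¹ ∂μ := by
  have h0 : ENNReal.ofReal ρ ≠ 0 := by simpa using hρ
  have hm : ∀ r : ℝ, MeasurableSet (Metric.ball (0 : V) r)ᶜ :=
    fun r => Metric.isOpen_ball.measurableSet.compl
  rw [← lintegral_indicator (hm _), ← lintegral_indicator (hm _),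
    ← lintegral_comp_add_smul μ _ 0 hρ, sub_eq_add_neg, ENNReal.rpow_add _ _ h0 (by simp),
    ENNReal.rpow_natCast, mul_assoc]
  congr 1
  rw [← lintegral_const_mul' _ _ (ENNReal.rpow_ne_top_of_ne_zero h0 (by simp))]
  refine lintegral_congr fun x => ?_
  by_cases hx : 1 ≤ ‖x‖
  · have : ρ ≤ ‖ρ • x‖ := by rw [norm_smul, Real.norm_of_nonneg hρ.le]; nlinarith
    rw [zero_add, indicator_of_mem (by simpa using this), indicator_of_mem (by simpa using hx),
      enorm_smul_rpow_inv hρ]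
  · have : ¬ ρ ≤ ‖ρ • x‖ := by rw [norm_smul, Real.norm_of_nonneg hρ.le]; nlinarith
    rw [zero_add, indicator_of_notMem (by simpa using this), indicator_of_notMem (by simpa using hx),
      mul_zero]

theorem lintegral_ball_rpow_lt_top [Nontrivial V] {a : ℝ} (ha : a < Module.finrank ℝ V) :
    ∫⁻ x in Metric.ball (0 : V) 1, (‖x‖ₑ ^ a)⁻¹ ∂μ < ⊤ := by
  have hd : 1 ≤ Module.finrank ℝ V := Module.finrank_pos
  have h1 : Integrable (fun x : V => (Ioo (0 : ℝ) 1).indicator (fun r => r ^ (-a)) ‖x‖) μ := by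
    rw [integrable_fun_norm_addHaar (μ := μ)]
    have h2 : IntegrableOn (fun r : ℝ => r ^ ((Module.finrank ℝ V : ℝ) - 1 - a)) (Ioo 0 1) :=
      (intervalIntegral.integrableOn_Ioo_rpow_iff one_pos).2 (by linarith)
    have h3 : IntegrableOn ((Ioo (0 : ℝ) 1).indicator
        (fun r : ℝ => r ^ ((Module.finrank ℝ V : ℝ) - 1 - a))) (Ioi 0) :=
      ((integrable_indicator_iff measurableSet_Ioo).2 h2).integrableOn
    refine h3.congr_fun (fun r hr => ?_) measurableSet_Ioi
    by_cases h : r ∈ Ioo (0 : ℝ) 1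
    · simp only [indicator_of_mem h, smul_eq_mul]
      rw [sub_eq_add_neg, Real.rpow_add hr, ← Real.rpow_natCast, Nat.cast_sub hd, Nat.cast_one]
    · simp only [indicator_of_notMem h, smul_zero]
  have h2 := h1.2
  rw [hasFiniteIntegral_iff_enorm] at h2
  refine lt_of_le_of_lt ?_ h2
  rw [← lintegral_indicator Metric.isOpen_ball.measurableSet]
  refine lintegral_mono_ae ?_
  filter_upwards [Measure.ae_ne μ (0 : V)] with x hx
  have hx0 : 0 < ‖x‖ := norm_pos_iff.2 hx
  by_cases h : x ∈ Metric.ball (0 : V) 1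
  · have h' : ‖x‖ ∈ Ioo (0 : ℝ) 1 := ⟨hx0, by simpa using h⟩
    rw [indicator_of_mem h, indicator_of_mem h', ← ofReal_norm, ENNReal.ofReal_rpow_of_pos hx0,
      ← ENNReal.ofReal_inv_of_pos (by positivity), Real.enorm_eq_ofReal (by positivity),
      Real.rpow_neg hx0.le]
  · rw [indicator_of_notMem h]; exact zero_le

end Integrals

/-- The Euclidean space of dimension `m`. -/
abbrev Euc (m : ℕ) : Type := EuclideanSpace ℝ (Fin m)

/-! ### Energies on the Euclidean space: scaling, patching, composition with Lipschitz curves. -/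

section EuclideanEnergies

variable {m : ℕ} {N : Type*} [EMetricSpace N]

/-- `g` bounds the variation of `u` along almost every segment. -/
def SegmentBound (u : Euc m → N) (g : Euc m → ℝ≥0∞) : Prop :=
  ∀ᵐ z : Euc m × Euc m ∂(volume.prod volume),
    edist (u z.2) (u (z.2 + z.1)) ≤ ‖z.1‖ₑ * ∫⁻ τ in Icc (0 : ℝ) 1, g (z.2 + τ • z.1)

/-- The Gagliardo energy on the whole Euclidean space, as an integral over the product. -/
def pairEnergy (s p : ℝ) (u : Euc m → N) : ℝ≥0∞ :=
  ∫⁻ z : Euc m × Euc m,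
    edist (u z.1) (u z.2) ^ p / edist z.1 z.2 ^ ((m : ℝ) + s * p) ∂(volume.prod volume)

/-- The map `u : ℝ^m → N` is measurable and its Sobolev energy is at most `e`; when `s = 1` this is
witnessed by a function which bounds `u` along segments and vanishes outside `S`. -/
structure HasEnergyLE [MeasurableSpace N] (s p : ℝ) (u : Euc m → N) (S : Set (Euc m))
    (e : ℝ≥0∞) : Prop where
  aemeasurable : AEMeasurable u volume
  exists_segmentBound : s = 1 → ∃ g : Euc m → ℝ≥0∞, Measurable g ∧ (∀ x ∉ S, g x = 0) ∧
    SegmentBound u g ∧ ∫⁻ x, g x ^ p ≤ e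
  pairEnergy_le : s ≠ 1 → pairEnergy s p u ≤ e

variable [MeasurableSpace N] {s p : ℝ} {u : Euc m → N} {S : Set (Euc m)} {e : ℝ≥0∞}

theorem HasEnergyLE.mono (h : HasEnergyLE s p u S e) {S' : Set (Euc m)} {e' : ℝ≥0∞}
    (hS : S ⊆ S') (he : e ≤ e') : HasEnergyLE s p u S' e' where
  aemeasurable := h.aemeasurable
  exists_segmentBound h1 := by
    obtain ⟨g, hg, hgS, hug, hge⟩ := h.exists_segmentBound h1
    exact ⟨g, hg, fun x hx => hgS x fun h => hx (hS h), hug, hge.trans he⟩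
  pairEnergy_le h1 := (h.pairEnergy_le h1).trans he

theorem ae_prod_add {P : Euc m → Prop} (h : ∀ᵐ x, P x) :
    ∀ᵐ z : Euc m × Euc m ∂(volume.prod volume), P z.2 ∧ P (z.2 + z.1) := by
  have h1 : ∀ᵐ z : Euc m × Euc m ∂(volume.prod volume), P z.2 :=
    Measure.quasiMeasurePreserving_snd.ae h
  have h2 : ∀ᵐ z : Euc m × Euc m ∂(volume.prod volume), P (z.2 + z.1) := by
    have := (quasiMeasurePreserving_add_swap (volume : Measure (Euc m)) volume).ae h
    exact this
  filter_upwards [h1, h2] with z h1 h2 using ⟨h1, h2⟩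

theorem HasEnergyLE.congr_ae (h : HasEnergyLE s p u S e) {u' : Euc m → N}
    (hu : u' =ᵐ[volume] u) : HasEnergyLE s p u' S e where
  aemeasurable := h.aemeasurable.congr hu.symm
  exists_segmentBound h1 := by
    obtain ⟨g, hg, hgS, hug, hge⟩ := h.exists_segmentBound h1
    refine ⟨g, hg, hgS, ?_, hge⟩
    filter_upwards [hug, ae_prod_add hu] with z hz h2
    rw [h2.1, h2.2]
    exact hz
  pairEnergy_le h1 := by
    refine (le_of_eq (lintegral_congr_ae ?_)).trans (h.pairEnergy_le h1)
    filter_upwards [Measure.quasiMeasurePreserving_fst.ae hu,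
      Measure.quasiMeasurePreserving_snd.ae hu] with z h1 h2
    rw [h1, h2]

/-- Both energies are homogeneous of degree m - sp under dilations. For s = 1 the segment bound of
the rescaled map is ρ⁻¹ g(ρ⁻¹(x - c)). -/
theorem HasEnergyLE.comp_inv_smul_sub (hp : 0 < p) (h : HasEnergyLE s p u S e) (c : Euc m)
    {ρ : ℝ} (hρ : 0 < ρ) :
    HasEnergyLE s p (fun x => u (ρ⁻¹ • (x - c))) ((fun x => ρ⁻¹ • (x - c)) ⁻¹' S)
      (ENNReal.ofReal ρ ^ ((m : ℝ) - s * p) * e) where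
  aemeasurable :=
    h.aemeasurable.comp_quasiMeasurePreserving (quasiMeasurePreserving_inv_smul_sub volume c hρ)
  exists_segmentBound h1 := by
    obtain ⟨g, hg, hgS, hug, hge⟩ := h.exists_segmentBound h1
    have h0 : ENNReal.ofReal ρ ≠ 0 := by simpa using hρ
    refine ⟨fun x => ENNReal.ofReal ρ ^ (-1 : ℝ) * g (ρ⁻¹ • (x - c)), by fun_prop, fun x hx => ?_, ?_, ?_⟩
    · change _ * g (ρ⁻¹ • (x - c)) = 0
      rw [show g (ρ⁻¹ • (x - c)) = 0 from hgS _ hx, mul_zero]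
    -- A segment is a pair (direction, base point). The direction is only dilated, whereas the base
    -- point is also translated, whence the centre (0, c) in the product.
    · have := (quasiMeasurePreserving_inv_smul_sub
        ((volume : Measure (Euc m)).prod (volume : Measure (Euc m))) (0, c) hρ).ae hug
      filter_upwards [this] with z hz
      simp only [Prod.smul_fst, Prod.fst_sub, sub_zero, Prod.smul_snd, Prod.snd_sub] at hz
      rw [lintegral_const_mul' _ _ (ENNReal.rpow_ne_top_of_ne_zero h0 (by simp))]
      rw [enorm_smul, Real.enorm_eq_ofReal (inv_pos.2 hρ).le, ENNReal.ofReal_inv_of_pos hρ,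
        ← ENNReal.rpow_neg_one] at hz
      convert hz using 1
      · congr 2; rw [← smul_add]; congr 1; abel
      · rw [← mul_assoc, mul_comm ‖z.1‖ₑ]
        congr 2
        funext τ
        congr 1
        rw [smul_comm τ, ← smul_add]; congr 1; abel
    · simp_rw [ENNReal.mul_rpow_of_nonneg _ _ hp.le]
      rw [lintegral_const_mul' _ _ (ENNReal.rpow_ne_top_of_nonneg hp.le
        (ENNReal.rpow_ne_top_of_ne_zero h0 (by simp))),
        lintegral_comp_inv_smul_sub volume (fun x => g x ^ p) c hρ, ← ENNReal.rpow_mul, ← mul_assoc,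
        ← ENNReal.rpow_natCast, ← ENNReal.rpow_add _ _ h0 (by simp)]
      simp only [finrank_euclideanSpace_fin, h1]
      rw [show -1 * p + (m : ℝ) = m - 1 * p by ring]
      gcongr
  pairEnergy_le h1 := by
    have h0 : ENNReal.ofReal ρ ≠ 0 := by simpa using hρ
    refine le_trans (le_of_eq ?_) (mul_le_mul_right (h.pairEnergy_le h1) _)
    unfold pairEnergy
    -- The product has dimension 2m, and the kernel contributes the degree -(m + sp).
    have key := lintegral_comp_inv_smul_sub ((volume : Measure (Euc m)).prod (volume : Measure (Euc m)))
      (fun z : Euc m × Euc m => edist (u z.1) (u z.2) ^ p / edist z.1 z.2 ^ ((m : ℝ) + s * p))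
      (c, c) hρ
    simp only [Prod.smul_fst, Prod.fst_sub, Prod.smul_snd, Prod.snd_sub, Module.finrank_prod,
      finrank_euclideanSpace_fin] at key
    have hA : ENNReal.ofReal ρ ^ (-((m : ℝ) + s * p)) ≠ ⊤ :=
      ENNReal.rpow_ne_top_of_ne_zero h0 (by simp)
    calc _ = ∫⁻ z : Euc m × Euc m, ENNReal.ofReal ρ ^ (-((m : ℝ) + s * p)) *
          (edist (u (ρ⁻¹ • (z.1 - c))) (u (ρ⁻¹ • (z.2 - c))) ^ p /
            edist (ρ⁻¹ • (z.1 - c)) (ρ⁻¹ • (z.2 - c)) ^ ((m : ℝ) + s * p)) ∂(volume.prod volume) := by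
          refine lintegral_congr fun z => ?_
          rw [div_eq_mul_inv, div_eq_mul_inv, mul_left_comm]
          congr 1
          rw [edist_eq_enorm_sub, edist_eq_enorm_sub, ← enorm_smul_rpow_inv hρ]
          congr 3
          rw [← smul_sub, smul_smul, mul_inv_cancel₀ hρ.ne', one_smul]; abel
      _ = _ := by
          rw [lintegral_const_mul' _ _ hA, key, ← mul_assoc, ← ENNReal.rpow_natCast,
            ← ENNReal.rpow_add _ _ h0 (by simp)]
          congr 2
          push_cast; ring

variable [SecondCountableTopology N] [BorelSpace N]

theorem aemeasurable_pairEnergy (hu : AEMeasurable u volume) :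
    AEMeasurable (fun z : Euc m × Euc m =>
      edist (u z.1) (u z.2) ^ p / edist z.1 z.2 ^ ((m : ℝ) + s * p)) (volume.prod volume) := by
  have h1 : AEMeasurable (fun z : Euc m × Euc m => u z.1) (volume.prod volume) :=
    hu.comp_quasiMeasurePreserving Measure.quasiMeasurePreserving_fst
  have h2 : AEMeasurable (fun z : Euc m × Euc m => u z.2) (volume.prod volume) :=
    hu.comp_quasiMeasurePreserving Measure.quasiMeasurePreserving_snd
  have h3 : Measurable (fun z : Euc m × Euc m => edist z.1 z.2) := by fun_prop
  exact ((h1.edist h2).pow_const _).div (h3.pow_const _).aemeasurable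

-- Go from u x to u y through w x and w y. If x lies in U i and y does not, then w x = c i = v i y,
-- so the first step is a difference of values of v i at the same two points x and y; similarly for
-- the last step. Being pointwise, the argument serves both kinds of energies.
omit [MeasurableSpace N] [SecondCountableTopology N] [BorelSpace N] in
theorem edist_patch_le {ι : Type*} {w u : Euc m → N} {v : ι → Euc m → N} {U : ι → Set (Euc m)}
    {c : ι → N} (hU : Pairwise fun i j => Disjoint (U i) (U j))
    (hvc : ∀ i, ∀ x ∉ U i, v i x = c i) (hwc : ∀ i, ∀ x ∈ U i, w x = c i)
    (huv : ∀ i, ∀ x ∈ U i, u x = v i x) (huw : ∀ x, (∀ i, x ∉ U i) → u x = w x)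
    {x y : Euc m} {T : ℝ≥0∞} (hw : edist (w x) (w y) ≤ T)
    (hv : ∀ i, edist (v i x) (v i y) ≤ T) : edist (u x) (u y) ≤ 3 * T := by
  have key : ∀ i, x ∈ U i → y ∉ U i → edist (u x) (w x) ≤ T := fun i hx hy => by
    have := hv i
    rw [hvc i y hy] at this
    rwa [huv i x hx, hwc i x hx]
  have key' : ∀ i, y ∈ U i → x ∉ U i → edist (w y) (u y) ≤ T := fun i hy hx => by
    have := hv i
    rw [hvc i x hx] at this
    rwa [huv i y hy, hwc i y hy]
  have h3 : T ≤ 3 * T := by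
    calc T = 1 * T := (one_mul T).symm
      _ ≤ 3 * T := by gcongr; norm_num
  have htri : edist (u x) (w x) ≤ T → edist (w y) (u y) ≤ T → edist (u x) (u y) ≤ 3 * T :=
    fun h1 h2 => by
      calc edist (u x) (u y) ≤ edist (u x) (w x) + edist (w x) (w y) + edist (w y) (u y) :=
            edist_triangle4 _ _ _ _
        _ ≤ T + T + T := by gcongr
        _ = 3 * T := by ring
  by_cases hx : ∃ i, x ∈ U i
  · obtain ⟨i, hi⟩ := hx
    by_cases hy : y ∈ U i
    · rw [huv i x hi, huv i y hy]
      exact (hv i).trans h3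
    · refine htri (key i hi hy) ?_
      by_cases hy' : ∃ j, y ∈ U j
      · obtain ⟨j, hj⟩ := hy'
        have hij : i ≠ j := by rintro rfl; exact hy hj
        exact key' j hj fun h => (disjoint_left.1 (hU hij)) hi h
      · rw [huw y (by simpa using hy')]; simp
  · push Not at hx
    refine htri (by rw [huw x hx]; simp) ?_
    by_cases hy' : ∃ j, y ∈ U j
    · obtain ⟨j, hj⟩ := hy'
      exact key' j hj (hx j)
    · rw [huw y (by simpa using hy')]; simp

/-- `edist_patch_le` is applied with T the ℓ^p combination of the bounds for w and for all the v i: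
it dominates each of them and its p-th power is additive. The factor 3^p is thus independent of the
number of pieces, so that infinitely many pieces can be glued. -/
theorem HasEnergyLE.patch {ι : Type*} [Countable ι] (hp : 0 < p) {w u : Euc m → N}
    {v : ι → Euc m → N} {U : ι → Set (Euc m)} {c : ι → N} {S₀ : Set (Euc m)} {e₀ : ℝ≥0∞}
    {S : ι → Set (Euc m)} {e : ι → ℝ≥0∞}
    (hw : HasEnergyLE s p w S₀ e₀) (hv : ∀ i, HasEnergyLE s p (v i) (S i) (e i))
    (hUm : ∀ i, MeasurableSet (U i)) (hU : Pairwise fun i j => Disjoint (U i) (U j))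
    (hvc : ∀ i, ∀ x ∉ U i, v i x = c i) (hwc : ∀ i, ∀ x ∈ U i, w x = c i)
    (huv : ∀ i, ∀ x ∈ U i, u x = v i x) (huw : ∀ x, (∀ i, x ∉ U i) → u x = w x) :
    HasEnergyLE s p u (S₀ ∪ ⋃ i, S i) (3 ^ p * (e₀ + ∑' i, e i)) where
  aemeasurable := by
    have h1 : AEMeasurable u (volume.restrict (⋃ i, U i)) := by
      rw [aemeasurable_iUnion_iff]
      intro i
      refine (hv i).aemeasurable.restrict.congr ?_
      filter_upwards [ae_restrict_mem (hUm i)] with x hx using (huv i x hx).symm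
    have h2 : AEMeasurable u (volume.restrict (⋃ i, U i)ᶜ) := by
      refine hw.aemeasurable.restrict.congr ?_
      filter_upwards [ae_restrict_mem (MeasurableSet.iUnion hUm).compl] with x hx
      exact (huw x (by simpa using hx)).symm
    rw [← Measure.restrict_univ (μ := volume), ← union_compl_self (⋃ i, U i)]
    exact aemeasurable_union_iff.2 ⟨h1, h2⟩
  exists_segmentBound h1 := by
    obtain ⟨g₀, hg₀, hgS₀, hug₀, hge₀⟩ := hw.exists_segmentBound h1
    choose g hg hgS hug hge using fun i => (hv i).exists_segmentBound h1
    have hGm : Measurable fun x => g₀ x ^ p + ∑' i, g i x ^ p :=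
      (hg₀.pow_const _).add (Measurable.tsum fun i => (hg i).pow_const _)
    have hle₀ : ∀ x, g₀ x ≤ (g₀ x ^ p + ∑' i, g i x ^ p) ^ p⁻¹ := fun x => by
      rw [ENNReal.le_rpow_inv_iff hp]; exact le_self_add
    have hle : ∀ i x, g i x ≤ (g₀ x ^ p + ∑' i, g i x ^ p) ^ p⁻¹ := fun i x => by
      rw [ENNReal.le_rpow_inv_iff hp]
      exact (ENNReal.le_tsum i).trans (le_add_self)
    refine ⟨fun x => 3 * (g₀ x ^ p + ∑' i, g i x ^ p) ^ p⁻¹, (hGm.pow_const _).const_mul _,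
      fun x hx => ?_, ?_, ?_⟩
    · simp only [mem_union, mem_iUnion, not_or, not_exists] at hx
      simp only [hgS₀ x hx.1, fun i => hgS i x (hx.2 i)]
      simp [ENNReal.zero_rpow_of_pos hp, ENNReal.zero_rpow_of_pos (inv_pos.2 hp)]
    · filter_upwards [hug₀, ae_all_iff.2 hug] with z h0 hi
      rw [lintegral_const_mul' _ _ (by simp), mul_left_comm]
      refine edist_patch_le hU hvc hwc huv huw (h0.trans ?_) fun i => (hi i).trans ?_
      · gcongr; exact hle₀ _
      · gcongr; exact hle i _
    · simp_rw [ENNReal.mul_rpow_of_nonneg _ _ hp.le, ENNReal.rpow_inv_rpow hp.ne']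
      rw [lintegral_const_mul' _ _ (by simp [hp.le]), lintegral_add_left (hg₀.pow_const _),
        lintegral_tsum fun i => ((hg i).pow_const _).aemeasurable]
      gcongr with i
      exact hge i
  pairEnergy_le h1 := by
    have hm₀ := aemeasurable_pairEnergy (s := s) (p := p) hw.aemeasurable
    have hm := fun i => aemeasurable_pairEnergy (s := s) (p := p) (hv i).aemeasurable
    calc pairEnergy s p u ≤ ∫⁻ z : Euc m × Euc m, 3 ^ p *
          (edist (w z.1) (w z.2) ^ p / edist z.1 z.2 ^ ((m : ℝ) + s * p) +
            ∑' i, edist (v i z.1) (v i z.2) ^ p / edist z.1 z.2 ^ ((m : ℝ) + s * p))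
            ∂(volume.prod volume) := by
          refine lintegral_mono fun z => ?_
          simp only [div_eq_mul_inv]
          rw [ENNReal.tsum_mul_right, ← add_mul, ← mul_assoc]
          gcongr
          have h3 := edist_patch_le hU hvc hwc huv huw (x := z.1) (y := z.2)
            (T := (edist (w z.1) (w z.2) ^ p + ∑' i, edist (v i z.1) (v i z.2) ^ p) ^ p⁻¹)
            (by rw [ENNReal.le_rpow_inv_iff hp]; exact le_self_add)
            (fun i => by
              rw [ENNReal.le_rpow_inv_iff hp]
              exact (ENNReal.le_tsum (f := fun i => edist (v i z.1) (v i z.2) ^ p) i).trans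
                le_add_self)
          have h4 := ENNReal.rpow_le_rpow h3 hp.le
          rwa [ENNReal.mul_rpow_of_nonneg _ _ hp.le, ENNReal.rpow_inv_rpow hp.ne'] at h4
      _ = 3 ^ p * (pairEnergy s p w + ∑' i, pairEnergy s p (v i)) := by
          rw [lintegral_const_mul' _ _ (by simp [hp.le]), lintegral_add_left' hm₀,
            lintegral_tsum hm]
          rfl
      _ ≤ 3 ^ p * (e₀ + ∑' i, e i) := by
          gcongr with i
          · exact hw.pairEnergy_le h1
          · exact (hv i).pairEnergy_le h1

omit [SecondCountableTopology N] in
theorem HasEnergyLE.lipschitz_comp {η : Euc m → ℝ} (hp : 0 < p) (h : HasEnergyLE s p η S e)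
    {L : NNReal} {γ : ℝ → N} (hγ : LipschitzWith L γ) :
    HasEnergyLE s p (fun x => γ (η x)) S ((L : ℝ≥0∞) ^ p * e) where
  aemeasurable := hγ.continuous.measurable.comp_aemeasurable h.aemeasurable
  exists_segmentBound h1 := by
    obtain ⟨g, hg, hgS, hug, hge⟩ := h.exists_segmentBound h1
    refine ⟨fun x => L * g x, hg.const_mul _, fun x hx => by simp [hgS x hx], ?_, ?_⟩
    · filter_upwards [hug] with z hz
      rw [lintegral_const_mul' _ _ (by simp), mul_left_comm]
      exact (hγ _ _).trans (by gcongr)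
    · simp_rw [ENNReal.mul_rpow_of_nonneg _ _ hp.le]
      rw [lintegral_const_mul' _ _ (by simp [hp.le])]
      gcongr
  pairEnergy_le h1 := by
    refine le_trans ?_ (mul_le_mul_right (h.pairEnergy_le h1) _)
    unfold pairEnergy
    rw [← lintegral_const_mul' _ _ (by simp [hp.le])]
    refine lintegral_mono fun z => ?_
    rw [← mul_div_assoc, ← ENNReal.mul_rpow_of_nonneg _ _ hp.le]
    gcongr
    exact hγ _ _

end EuclideanEnergies

/-! ### Mean value inequality along Lipschitz curves. -/

section Curves

open Filter Topology

variable {E : Type*} [NormedAddCommGroup E] [NormedSpace ℝ E]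

/-- The curves that occur are images of segments under maps that are only Lipschitz, so there is no
chain rule; a bound of the speed from the right suffices for the comparison of right slopes with the
derivative of the integral. -/
theorem sub_le_integral_of_fderiv_bound {h : E → ℝ} {γ : ℝ → E} {G : E → ℝ} {l : ℝ → ℝ}
    (hγ : Continuous γ) (hG : Continuous G) (hl : Continuous l) (hG0 : ∀ x, 0 ≤ G x)
    (hh : ∀ τ ∈ Icc (0 : ℝ) 1, DifferentiableAt ℝ h (γ τ) ∧ ‖fderiv ℝ h (γ τ)‖ ≤ G (γ τ))
    (hs : ∀ τ ∈ Ico (0 : ℝ) 1, ∀ᶠ s in 𝓝[>] τ, ‖γ s - γ τ‖ ≤ l τ * (s - τ)) :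
    h (γ 1) - h (γ 0) ≤ ∫ τ in (0 : ℝ)..1, l τ * G (γ τ) := by
  have hc : Continuous fun τ => l τ * G (γ τ) := hl.mul (hG.comp hγ)
  have key := image_le_of_liminf_slope_right_le_deriv_boundary (a := 0) (b := 1)
    (f := fun τ => h (γ τ) - h (γ 0)) (B := fun x => ∫ τ in (0 : ℝ)..x, l τ * G (γ τ))
    (B' := fun τ => l τ * G (γ τ))
    (fun τ hτ => ((((hh τ hτ).1.continuousAt).comp hγ.continuousAt).sub
      continuousAt_const).continuousWithinAt) (by simp)
    (fun x _ => ((intervalIntegral.integral_hasDerivAt_right (hc.intervalIntegrable _ _)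
      hc.aestronglyMeasurable.stronglyMeasurableAtFilter hc.continuousAt).continuousAt).continuousWithinAt)
    (fun x _ => (intervalIntegral.integral_hasDerivAt_right (hc.intervalIntegrable _ _)
      hc.aestronglyMeasurable.stronglyMeasurableAtFilter hc.continuousAt).hasDerivWithinAt)
    (fun τ hτ r hr => ?_)
  · exact key (right_mem_Icc.2 zero_le_one)
  · refine Eventually.frequently ?_
    obtain ⟨hd, hdG⟩ := hh τ (Ico_subset_Icc_self hτ)
    obtain ⟨ε, hε, hεr⟩ : ∃ ε > 0, (G (γ τ) + ε) * l τ < r := by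
      have : Tendsto (fun ε : ℝ => (G (γ τ) + ε) * l τ) (𝓝[>] 0) (𝓝 ((G (γ τ) + 0) * l τ)) :=
        ((tendsto_const_nhds.add tendsto_id).mul_const _).mono_left nhdsWithin_le_nhds
      have h2 := (this.eventually_lt_const (by rw [add_zero, mul_comm]; exact hr)).and
        self_mem_nhdsWithin
      obtain ⟨ε, h1, h2⟩ := h2.exists
      exact ⟨ε, h2, h1⟩
    have ho := hd.hasFDerivAt.isLittleO
    have ho2 := (ho.def hε)
    have ho3 : ∀ᶠ s in 𝓝[>] τ, ‖h (γ s) - h (γ τ) - fderiv ℝ h (γ τ) (γ s - γ τ)‖ ≤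
        ε * ‖γ s - γ τ‖ := nhdsWithin_le_nhds (hγ.continuousAt.eventually ho2)
    filter_upwards [ho3, hs τ hτ, self_mem_nhdsWithin] with s h1 h2 h3
    have h3' : 0 < s - τ := sub_pos.2 h3
    rw [slope_def_field, div_lt_iff₀ h3']
    have h4 : h (γ s) - h (γ τ) ≤ (G (γ τ) + ε) * ‖γ s - γ τ‖ := by
      have h5 := (fderiv ℝ h (γ τ)).le_opNorm (γ s - γ τ)
      have h6 := (abs_le.1 h1).2
      have h7 := (abs_le.1 h5).2
      nlinarith [mul_le_mul_of_nonneg_right hdG (norm_nonneg (γ s - γ τ))]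
    calc h (γ s) - h (γ 0) - (h (γ τ) - h (γ 0)) = h (γ s) - h (γ τ) := by ring
      _ ≤ (G (γ τ) + ε) * ‖γ s - γ τ‖ := h4
      _ ≤ (G (γ τ) + ε) * (l τ * (s - τ)) :=
        mul_le_mul_of_nonneg_left h2 (add_nonneg (hG0 _) hε.le)
      _ = (G (γ τ) + ε) * l τ * (s - τ) := by ring
      _ < r * (s - τ) := mul_lt_mul_of_pos_right hεr h3'

theorem enorm_sub_le_lintegral_of_fderiv_bound {h : E → ℝ} {γ : ℝ → E} {G : E → ℝ} {l : ℝ → ℝ}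
    (hγ : Continuous γ) (hG : Continuous G) (hl : Continuous l) (hG0 : ∀ x, 0 ≤ G x)
    (hl0 : ∀ τ, 0 ≤ l τ)
    (hh : ∀ τ ∈ Icc (0 : ℝ) 1, DifferentiableAt ℝ h (γ τ) ∧ ‖fderiv ℝ h (γ τ)‖ ≤ G (γ τ))
    (hs : ∀ τ ∈ Ico (0 : ℝ) 1, ∀ᶠ s in 𝓝[>] τ, ‖γ s - γ τ‖ ≤ l τ * (s - τ)) :
    ‖h (γ 1) - h (γ 0)‖ₑ ≤
      ∫⁻ τ in Icc (0 : ℝ) 1, ENNReal.ofReal (l τ) * ENNReal.ofReal (G (γ τ)) := by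
  have h1 := sub_le_integral_of_fderiv_bound hγ hG hl hG0 hh hs
  have h2 := sub_le_integral_of_fderiv_bound (h := fun x => - h x) hγ hG hl hG0
    (fun τ hτ => ⟨(hh τ hτ).1.neg, by
      have := (hh τ hτ).2
      rwa [fderiv_fun_neg, norm_neg]⟩) hs
  have hc : Continuous fun τ => l τ * G (γ τ) := hl.mul (hG.comp hγ)
  have h3 : |h (γ 1) - h (γ 0)| ≤ ∫ τ in (0 : ℝ)..1, l τ * G (γ τ) := abs_le.2 ⟨by linarith, h1⟩
  simp_rw [← ENNReal.ofReal_mul (hl0 _)]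
  rw [← ofReal_integral_eq_lintegral_ofReal (hc.integrableOn_Icc)
    (Eventually.of_forall fun τ => mul_nonneg (hl0 _) (hG0 _)), integral_Icc_eq_integral_Ioc,
    ← intervalIntegral.integral_of_le zero_le_one, ← ofReal_norm]
  exact ENNReal.ofReal_le_ofReal h3

end Curves

/-! ### Mollification combined with a contraction of the unit ball. -/

section Mollification

open Filter Topology
open scoped Convolution

variable {m : ℕ}

/-- The radius of the `j`th mollifier. -/
def mollRadius (j : ℕ) : ℝ := 1 / ((j : ℝ) + 4)

theorem mollRadius_pos (j : ℕ) : 0 < mollRadius j := by unfold mollRadius; positivity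

theorem mollRadius_le (j : ℕ) : mollRadius j ≤ 1 / 4 := by
  unfold mollRadius
  exact one_div_le_one_div_of_le (by norm_num) (by linarith [Nat.cast_nonneg (α := ℝ) j])

theorem tendsto_mollRadius : Tendsto mollRadius atTop (𝓝 0) := by
  have := (tendsto_one_div_add_atTop_nhds_zero_nat (𝕜 := ℝ)).comp (tendsto_add_atTop_nat 3)
  refine this.congr fun j => ?_
  simp only [mollRadius, Function.comp]
  push_cast; ring_nf

variable (m) in
/-- The bump function whose normalisation is the `j`th mollifier. -/
def mollBump (j : ℕ) : ContDiffBump (0 : Euc m) where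
  rIn := mollRadius j / 2
  rOut := mollRadius j
  rIn_pos := half_pos (mollRadius_pos j)
  rIn_lt_rOut := half_lt_self (mollRadius_pos j)

/-- The dilation factor accompanying the `j`th mollifier. -/
def mollScale (j : ℕ) : ℝ := 1 - 2 * mollRadius j

theorem mollScale_pos (j : ℕ) : 0 < mollScale j := by
  have := mollRadius_le j
  unfold mollScale; linarith

theorem tendsto_mollScale : Tendsto mollScale atTop (𝓝 1) := by
  have := (tendsto_mollRadius.const_mul 2).const_sub 1
  rw [mul_zero, sub_zero] at this
  exact this

/-- The mollification of the function `f`, precomposed with a contraction, so that its values on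
the closed unit ball only depend on `f` on a smaller ball. -/
def mollify (f : Euc m → ℝ) (j : ℕ) (x : Euc m) : ℝ :=
  ((mollBump m j).normed volume ⋆[ContinuousLinearMap.mul ℝ ℝ, volume] f) (mollScale j • x)

theorem mollify_eq (f : Euc m → ℝ) (j : ℕ) (x : Euc m) :
    mollify f j x = ∫ z, (mollBump m j).normed volume (mollScale j • x - z) * f z := by
  unfold mollify
  rw [convolution_eq_swap]
  simp

theorem mollBump_ne_zero {j : ℕ} {x z : Euc m}
    (h : (mollBump m j).normed volume (mollScale j • x - z) ≠ 0) :
    z ∈ Metric.ball (mollScale j • x) (mollRadius j) := by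
  have := (mollBump m j).support_normed_eq (μ := (volume : Measure (Euc m)))
  have h2 : mollScale j • x - z ∈ Metric.ball (0 : Euc m) (mollBump m j).rOut := by
    rw [← this]; exact h
  rwa [mem_ball_zero_iff, ← dist_eq_norm, dist_comm] at h2

theorem mollify_congr {f f' : Euc m → ℝ} {j : ℕ} {x : Euc m}
    (h : ∀ z ∈ Metric.ball (mollScale j • x) (mollRadius j), f z = f' z) :
    mollify f j x = mollify f' j x := by
  rw [mollify_eq, mollify_eq]
  congr 1
  funext z
  by_cases hz : (mollBump m j).normed volume (mollScale j • x - z) = 0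
  · simp [hz]
  · rw [h z (mollBump_ne_zero hz)]

theorem continuous_mollify {f : Euc m → ℝ} (hf : LocallyIntegrable f) (j : ℕ) :
    Continuous (mollify f j) :=
  ((mollBump m j).hasCompactSupport_normed.continuous_convolution_left _
    (mollBump m j).continuous_normed hf).comp (continuous_const_smul _)

theorem mollify_nonneg {f : Euc m → ℝ} (hf : ∀ x, 0 ≤ f x) (j : ℕ) (x : Euc m) :
    0 ≤ mollify f j x := by
  rw [mollify_eq]
  exact integral_nonneg fun z => mul_nonneg ((mollBump m j).nonneg_normed _) (hf z)

/-- The averaging ball is centred at `mollScale j • x` and not at x. For ‖x‖ ≤ 1 the two differ by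
at most twice the radius, so the differentiation theorem for balls that are not centred applies. -/
theorem ae_tendsto_mollify {f : Euc m → ℝ} (hf : LocallyIntegrable f) :
    ∀ᵐ x, ‖x‖ ≤ 1 → Tendsto (fun j => mollify f j x) atTop (𝓝 (f x)) := by
  obtain ⟨C, hC⟩ : ∃ C : ℝ, ∀ (j : ℕ) (x : Euc m), (mollBump m j).normed volume x ≤
      C / volume.real (Metric.closedBall (0 : Euc m) (mollRadius j)) :=
    ⟨2 ^ Module.finrank ℝ (Euc m), fun j x =>
      (mollBump m j).normed_le_div_measure_closedBall_rOut volume 2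
        (le_of_eq (by simp only [mollBump]; ring)) x⟩
  filter_upwards [IsUnifLocDoublingMeasure.ae_tendsto_average_norm_sub
    (volume : Measure (Euc m)) hf 2] with x hx hx1
  have h1 := hx (fun j => mollScale j • x) mollRadius
    (tendsto_nhdsWithin_iff.2 ⟨tendsto_mollRadius, Eventually.of_forall mollRadius_pos⟩)
    (Eventually.of_forall fun j => by
      rw [mem_closedBall_iff_norm, mollScale, sub_smul, one_smul, sub_sub_cancel, norm_smul,
        Real.norm_of_nonneg (by have := mollRadius_pos j; positivity)]
      have := mollRadius_pos j
      nlinarith)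
  rw [tendsto_iff_norm_sub_tendsto_zero]
  refine squeeze_zero (fun j => norm_nonneg _) (fun j => ?_) (by simpa using h1.const_mul C)
  have hvol : 0 < volume.real (Metric.closedBall (0 : Euc m) (mollRadius j)) :=
    ENNReal.toReal_pos (Metric.measure_closedBall_pos _ _ (mollRadius_pos j)).ne'
      measure_closedBall_lt_top.ne
  have hvol' : volume.real (Metric.closedBall (mollScale j • x) (mollRadius j)) =
      volume.real (Metric.closedBall (0 : Euc m) (mollRadius j)) := by
    simp only [Measure.real, Measure.addHaar_closedBall_center]
  set k : Euc m → ℝ := fun z => (mollBump m j).normed volume (mollScale j • x - z) with hk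
  have hkc : Continuous k := (mollBump m j).continuous_normed.comp (by fun_prop)
  have hks : HasCompactSupport k := by
    refine HasCompactSupport.intro (isCompact_closedBall (mollScale j • x) (mollRadius j))
      fun z hz => ?_
    by_contra h
    exact hz (Metric.ball_subset_closedBall (mollBump_ne_zero h))
  have hk1 : ∫ z, k z = 1 := by
    rw [hk, integral_sub_left_eq_self (fun z => (mollBump m j).normed volume z) volume]
    exact (mollBump m j).integral_normed
  have hint : Integrable fun z => k z * f z := by
    have := hf.integrable_smul_left_of_hasCompactSupport hkc hks
    simpa using this
  have hint2 : Integrable k := hkc.integrable_of_hasCompactSupport hks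
  -- The mollifier has mass 1, so the constant f x can be put under the integral.
  have e1 : mollify f j x - f x = ∫ z, k z * (f z - f x) := by
    rw [mollify_eq]
    simp_rw [mul_sub]
    rw [integral_sub hint (hint2.mul_const _), integral_mul_const, hk1, one_mul]
  rw [e1]
  have hint3 : IntegrableOn (fun z => ‖f z - f x‖)
      (Metric.closedBall (mollScale j • x) (mollRadius j)) :=
    ((hf.integrableOn_isCompact (isCompact_closedBall _ _)).sub
      (integrableOn_const measure_closedBall_lt_top.ne)).norm
  calc ‖∫ z, k z * (f z - f x)‖ ≤ ∫ z, ‖k z * (f z - f x)‖ := norm_integral_le_integral_norm _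
    _ = ∫ z in Metric.closedBall (mollScale j • x) (mollRadius j), ‖k z * (f z - f x)‖ := by
        rw [setIntegral_eq_integral_of_forall_compl_eq_zero fun z hz => ?_]
        have : k z = 0 := by
          by_contra h
          exact hz (Metric.ball_subset_closedBall (mollBump_ne_zero h))
        simp [this]
    _ ≤ ∫ z in Metric.closedBall (mollScale j • x) (mollRadius j),
          C / volume.real (Metric.closedBall (0 : Euc m) (mollRadius j)) * ‖f z - f x‖ := by
        refine integral_mono_of_nonneg (Eventually.of_forall fun z => norm_nonneg _)
          (hint3.const_mul _) (Eventually.of_forall fun z => ?_)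
        simp only [norm_mul]
        gcongr
        rw [Real.norm_of_nonneg ((mollBump m j).nonneg_normed _)]
        exact hC j _
    _ = C * ⨍ z in Metric.closedBall (mollScale j • x) (mollRadius j), ‖f z - f x‖ := by
        rw [integral_const_mul, setAverage_eq, hvol', smul_eq_mul]
        ring

theorem lintegral_mollify_le {f : Euc m → ℝ} (hf : Integrable f) (hf0 : ∀ x, 0 ≤ f x) (j : ℕ) :
    ∫⁻ x, ENNReal.ofReal (mollify f j x) ≤
      ENNReal.ofReal ((mollScale j)⁻¹ ^ m) * ∫⁻ x, ENNReal.ofReal (f x) := by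
  have hb : Integrable ((mollBump m j).normed (volume : Measure (Euc m))) :=
    (mollBump m j).integrable_normed
  have h1 : Integrable ((mollBump m j).normed volume ⋆[ContinuousLinearMap.mul ℝ ℝ, volume] f) :=
    hb.integrable_convolution _ hf
  have h0 : ∀ y, 0 ≤ ((mollBump m j).normed volume ⋆[ContinuousLinearMap.mul ℝ ℝ, volume] f) y :=
    fun y => by
      have := mollify_nonneg hf0 j ((mollScale j)⁻¹ • y)
      rwa [mollify, smul_smul, mul_inv_cancel₀ (mollScale_pos j).ne', one_smul] at this
  have h2 := lintegral_comp_inv_smul_sub (volume : Measure (Euc m)) (fun x => ENNReal.ofReal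
    (((mollBump m j).normed volume ⋆[ContinuousLinearMap.mul ℝ ℝ, volume] f) x)) 0
    (inv_pos.2 (mollScale_pos j))
  simp only [inv_inv, sub_zero, finrank_euclideanSpace_fin] at h2
  unfold mollify
  rw [h2, ENNReal.ofReal_pow (inv_pos.2 (mollScale_pos j)).le,
    ← ofReal_integral_eq_lintegral_ofReal h1 (Eventually.of_forall h0),
    ← ofReal_integral_eq_lintegral_ofReal hf (Eventually.of_forall hf0),
    integral_convolution _ hb hf]
  simp [(mollBump m j).integral_normed]

end Mollification

/-! ### Weak derivatives on the unit ball and their mollifications. -/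

section WeakDerivatives

open Filter Topology
open scoped Convolution

variable {m : ℕ}

/-- The field of covectors `D` is the weak derivative of `h` on `A`. -/
structure HasWeakFDerivOn (h : Euc m → ℝ) (D : Euc m → Euc m →L[ℝ] ℝ) (A : Set (Euc m)) :
    Prop where
  locallyIntegrableOn : LocallyIntegrableOn h A volume
  locallyIntegrableOn_deriv : ∀ v, LocallyIntegrableOn (fun x => D x v) A volume
  integral_eq : ∀ v : Euc m, ∀ ψ : Euc m → ℝ, ContDiff ℝ ∞ ψ → HasCompactSupport ψ →
    tsupport ψ ⊆ A → ∫ y, h y * fderiv ℝ ψ y v = - ∫ y, ψ y * D y v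

theorem hasFDerivAt_mollify {f : Euc m → ℝ} (hf : LocallyIntegrable f) (j : ℕ) (x : Euc m) :
    DifferentiableAt ℝ (mollify f j) x ∧ ∀ v, fderiv ℝ (mollify f j) x v =
      mollScale j * ∫ z, fderiv ℝ ((mollBump m j).normed volume) (mollScale j • x - z) v * f z := by
  set η := (mollBump m j).normed (volume : Measure (Euc m)) with hη
  have hs : HasCompactSupport η := (mollBump m j).hasCompactSupport_normed
  have hc : ContDiff ℝ 1 η := (mollBump m j).contDiff_normed
  have h1 := hs.hasFDerivAt_convolution_left (ContinuousLinearMap.mul ℝ ℝ) hc hf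
    (mollScale j • x)
  have h2 : HasFDerivAt (fun x : Euc m => mollScale j • x)
      (mollScale j • ContinuousLinearMap.id ℝ (Euc m)) x :=
    (hasFDerivAt_id x).const_smul (mollScale j)
  have h3 := h1.comp x h2
  have h4 : HasFDerivAt (mollify f j) _ x := h3
  refine ⟨h4.differentiableAt, fun v => ?_⟩
  rw [h4.fderiv]
  have hex := (hs.fderiv ℝ).convolutionExists_left
    ((ContinuousLinearMap.mul ℝ ℝ).precompL (Euc m)) (hc.continuous_fderiv one_ne_zero) hf
    (mollScale j • x)
  rw [ContinuousLinearMap.comp_apply, smul_apply, map_smul, smul_eq_mul,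
    ContinuousLinearMap.id_apply]
  congr 1
  rw [convolution_def, ContinuousLinearMap.integral_apply hex]
  rw [← integral_sub_left_eq_self _ volume (mollScale j • x)]
  simp [ContinuousLinearMap.precompL_apply]

theorem mollTest_contDiff (j : ℕ) (y : Euc m) :
    ContDiff ℝ ∞ (fun z => (mollBump m j).normed volume (y - z)) :=
  (mollBump m j).contDiff_normed.comp (by fun_prop)

theorem mollTest_tsupport (j : ℕ) (y : Euc m) :
    tsupport (fun z => (mollBump m j).normed volume (y - z)) ⊆
      Metric.closedBall y (mollRadius j) := by
  refine closure_minimal (fun z hz => ?_) Metric.isClosed_closedBall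
  have h2 : y - z ∈ Metric.ball (0 : Euc m) (mollBump m j).rOut := by
    rw [← (mollBump m j).support_normed_eq (μ := (volume : Measure (Euc m)))]; exact hz
  rw [mem_ball_zero_iff, ← dist_eq_norm, dist_comm] at h2
  exact h2.le

/-- The contraction by 1 - 2 `mollRadius j` leaves a margin of one radius between the averaging ball
and the unit sphere, so only values on a compact subset of the open ball matter. -/
theorem mollScale_closedBall_subset (j : ℕ) {x : Euc m} (hx : ‖x‖ ≤ 1) :
    Metric.closedBall (mollScale j • x) (mollRadius j) ⊆
      Metric.closedBall 0 (1 - mollRadius j) := by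
  refine Metric.closedBall_subset_closedBall' ?_
  rw [dist_zero_right, norm_smul, Real.norm_of_nonneg (mollScale_pos j).le, mollScale]
  have := mollScale_pos j
  unfold mollScale at this
  nlinarith

theorem mollRadius_closedBall_subset (j : ℕ) :
    Metric.closedBall (0 : Euc m) (1 - mollRadius j) ⊆ Metric.ball 0 1 :=
  Metric.closedBall_subset_ball (by linarith [mollRadius_pos j])

/-- The derivative of the mollification of a weakly differentiable function. -/
theorem fderiv_mollify {h : Euc m → ℝ} {D : Euc m → Euc m →L[ℝ] ℝ}
    (H : HasWeakFDerivOn h D (Metric.ball 0 1)) {f : Euc m → ℝ} (hf : LocallyIntegrable f) {j : ℕ}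
    (hfh : ∀ z ∈ Metric.closedBall (0 : Euc m) (1 - mollRadius j), f z = h z) {x : Euc m}
    (hx : ‖x‖ ≤ 1) (v : Euc m) :
    fderiv ℝ (mollify f j) x v = mollScale j * mollify (fun z => D z v) j x := by
  rw [(hasFDerivAt_mollify hf j x).2 v, mollify_eq]
  congr 1
  set ψ : Euc m → ℝ := fun z => (mollBump m j).normed volume (mollScale j • x - z) with hψ
  have hsub := (mollTest_tsupport (m := m) j (mollScale j • x)).trans
    (mollScale_closedBall_subset j hx)
  have hcs : HasCompactSupport ψ := (isCompact_closedBall _ _).of_isClosed_subset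
    (isClosed_tsupport _) hsub
  have h1 := H.integral_eq v ψ (mollTest_contDiff j _) hcs
    (hsub.trans (mollRadius_closedBall_subset j))
  rw [← neg_eq_iff_eq_neg, ← integral_neg] at h1
  rw [← h1]
  congr 1
  funext z
  have h2 : fderiv ℝ ψ z v =
      - fderiv ℝ ((mollBump m j).normed volume) (mollScale j • x - z) v := by
    have hd : HasFDerivAt ((mollBump m j).normed volume) _ (mollScale j • x - z) :=
      (((mollBump m j).contDiff_normed (n := 1)).differentiable one_ne_zero _).hasFDerivAt
    have h3 := hd.comp z ((hasFDerivAt_id z).const_sub (mollScale j • x))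
    have h4 : fderiv ℝ ψ z = _ := h3.fderiv
    rw [h4]
    simp
  by_cases hz : z ∈ tsupport ψ
  · rw [hfh z (hsub hz), h2]; ring
  · have h5 : fderiv ℝ ψ z = 0 := by
      have := support_fderiv_subset ℝ (f := ψ)
      by_contra h
      exact hz (this h)
    have h6 : fderiv ℝ ((mollBump m j).normed volume) (mollScale j • x - z) v = 0 := by
      rw [h5] at h2; simpa using h2.symm
    simp [h5, h6]

/-- Scheffé's lemma for mollifications. -/
theorem tendsto_lintegral_mollify_sub {g : Euc m → ℝ} (hg : Integrable g) (hg0 : ∀ x, 0 ≤ g x)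
    (hg1 : ∀ x ∉ Metric.ball (0 : Euc m) 1, g x = 0) :
    Tendsto (fun j => ∫⁻ x in Metric.ball (0 : Euc m) 1,
      (ENNReal.ofReal (mollify g j x) - ENNReal.ofReal (g x))) atTop (𝓝 0) := by
  set I := ∫⁻ x, ENNReal.ofReal (g x) with hI
  have hIt : I ≠ ⊤ := by
    rw [hI, ← ofReal_integral_eq_lintegral_ofReal hg (Eventually.of_forall hg0)]
    exact ENNReal.ofReal_ne_top
  have hIB : ∫⁻ x in Metric.ball (0 : Euc m) 1, ENNReal.ofReal (g x) = I := by
    rw [hI, ← lintegral_indicator Metric.isOpen_ball.measurableSet]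
    refine lintegral_congr fun x => ?_
    by_cases hx : x ∈ Metric.ball (0 : Euc m) 1
    · simp [hx]
    · simp [hx, hg1 x hx]
  have hmj : ∀ j, Measurable fun x => ENNReal.ofReal (mollify g j x) := fun j =>
    (continuous_mollify hg.locallyIntegrable j).measurable.ennreal_ofReal
  obtain ⟨g', hg'm, hg'⟩ := hg.1.aemeasurable
  have hm : Measurable fun x => ENNReal.ofReal (g' x) := hg'm.ennreal_ofReal
  -- The positive part of the difference is the mollification minus its minimum with g. The minimum
  -- is dominated by g, so its integral tends to that of g; the integral of the mollification is
  -- asymptotically at most the same number, the Jacobian of the contraction tending to 1.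
  have hmin : Tendsto (fun j => ∫⁻ x in Metric.ball (0 : Euc m) 1,
      min (ENNReal.ofReal (mollify g j x)) (ENNReal.ofReal (g' x))) atTop
      (𝓝 (∫⁻ x in Metric.ball (0 : Euc m) 1, ENNReal.ofReal (g' x))) := by
    refine tendsto_lintegral_of_dominated_convergence (fun x => ENNReal.ofReal (g' x))
      (fun j => (hmj j).min hm) (fun j => Eventually.of_forall fun x => min_le_right _ _) ?_ ?_
    · rw [← setLIntegral_congr_fun_ae Metric.isOpen_ball.measurableSet
        (f := fun x => ENNReal.ofReal (g x)), hIB]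
      · exact hIt
      · filter_upwards [hg'] with x hx _
        rw [hx]
    · filter_upwards [ae_restrict_mem Metric.isOpen_ball.measurableSet,
        ae_restrict_of_ae (ae_tendsto_mollify hg.locallyIntegrable),
        ae_restrict_of_ae hg'] with x hx h1 h2
      have h3 := ENNReal.tendsto_ofReal (h1 (by simpa using (Metric.mem_ball.1 hx).le))
      rw [h2] at h3
      have h4 := h3.min (tendsto_const_nhds (x := ENNReal.ofReal (g' x)))
      rwa [min_self] at h4
  have hI' : ∫⁻ x in Metric.ball (0 : Euc m) 1, ENNReal.ofReal (g' x) = I := by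
    rw [← hIB]
    refine lintegral_congr_ae ?_
    filter_upwards [ae_restrict_of_ae hg'] with x hx
    rw [hx]
  rw [hI'] at hmin
  have hup : Tendsto (fun j => ENNReal.ofReal ((mollScale j)⁻¹ ^ m) * I) atTop (𝓝 I) := by
    have h1 : Tendsto (fun j => ENNReal.ofReal ((mollScale j)⁻¹ ^ m)) atTop (𝓝 1) := by
      have := ENNReal.tendsto_ofReal ((tendsto_mollScale.inv₀ one_ne_zero).pow m)
      simpa using this
    simpa using ENNReal.Tendsto.mul_const h1 (Or.inl one_ne_zero)
  have hdiff := ENNReal.Tendsto.sub hup hmin (Or.inl hIt)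
  rw [tsub_self] at hdiff
  refine tendsto_of_tendsto_of_tendsto_of_le_of_le tendsto_const_nhds hdiff
    (fun j => zero_le) fun j => ?_
  have hle : ∫⁻ x in Metric.ball (0 : Euc m) 1,
      min (ENNReal.ofReal (mollify g j x)) (ENNReal.ofReal (g' x)) ≤ I := by
    rw [← hI']; exact lintegral_mono fun x => min_le_right _ _
  refine ENNReal.le_sub_of_add_le_right (ne_top_of_le_ne_top hIt hle) ?_
  refine le_trans (le_of_eq ?_) ((setLIntegral_le_lintegral (Metric.ball 0 1) _).trans
    (lintegral_mollify_le hg hg0 j))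
  rw [← lintegral_add_right _ ((hmj j).min hm)]
  refine lintegral_congr_ae ?_
  filter_upwards [ae_restrict_of_ae hg'] with x hx
  rw [hx]
  rcases le_total (ENNReal.ofReal (mollify g j x)) (ENNReal.ofReal (g' x)) with h | h
  · rw [tsub_eq_zero_of_le h, min_eq_left h, zero_add]
  · rw [min_eq_right h, tsub_add_cancel_of_le h]

end WeakDerivatives

/-! ### The upper gradient inequality along almost every curve. -/

section CurveInequality

open Filter Topology

variable {m : ℕ}

/-- Differentiation commutes with mollification up to the factor `mollScale j`, which is at most 1,
and the bound of D by g passes under the average. -/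
theorem norm_fderiv_mollify_le {h : Euc m → ℝ} {D : Euc m → Euc m →L[ℝ] ℝ}
    (H : HasWeakFDerivOn h D (Metric.ball 0 1)) {g : Euc m → ℝ} (hg : Integrable g) (hg0 : ∀ x, 0 ≤ g x)
    (hDg : ∀ᵐ x ∂(volume.restrict (Metric.ball (0 : Euc m) 1)), ∀ v, ‖D x v‖ ≤ g x * ‖v‖)
    {f : Euc m → ℝ} (hf : LocallyIntegrable f) {j : ℕ}
    (hfh : ∀ z ∈ Metric.closedBall (0 : Euc m) (1 - mollRadius j), f z = h z) {x : Euc m}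
    (hx : ‖x‖ ≤ 1) : ‖fderiv ℝ (mollify f j) x‖ ≤ mollify g j x := by
  have hDg' : ∀ᵐ x, x ∈ Metric.ball (0 : Euc m) 1 → ∀ v, ‖D x v‖ ≤ g x * ‖v‖ :=
    (ae_restrict_iff' Metric.isOpen_ball.measurableSet).1 hDg
  have hηc : Continuous fun z => (mollBump m j).normed volume (mollScale j • x - z) :=
    (mollTest_contDiff j _).continuous
  have hηs : HasCompactSupport fun z => (mollBump m j).normed volume (mollScale j • x - z) :=
    (isCompact_closedBall _ _).of_isClosed_subset (isClosed_tsupport _) (mollTest_tsupport j _)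
  have key : ∀ v, ‖mollify (fun z => D z v) j x‖ ≤ mollify g j x * ‖v‖ := fun v => by
    rw [mollify_eq, mollify_eq, ← integral_mul_const]
    refine norm_integral_le_of_norm_le ?_ ?_
    · have := hg.locallyIntegrable.integrable_smul_left_of_hasCompactSupport hηc hηs
      exact (this.mul_const ‖v‖)
    · filter_upwards [hDg'] with z hz
      rw [norm_mul, Real.norm_of_nonneg ((mollBump m j).nonneg_normed _), mul_assoc]
      by_cases h0 : (mollBump m j).normed volume (mollScale j • x - z) = 0
      · simp [h0]
      · refine mul_le_mul_of_nonneg_left (hz ?_ v) ((mollBump m j).nonneg_normed _)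
        exact mollRadius_closedBall_subset j (mollScale_closedBall_subset j hx
          (Metric.ball_subset_closedBall (mollBump_ne_zero h0)))
  have h0 := mollify_nonneg hg0 j x
  refine ContinuousLinearMap.opNorm_le_bound _ h0 fun v => ?_
  rw [fderiv_mollify H hf hfh hx, norm_mul, Real.norm_of_nonneg (mollScale_pos j).le]
  calc mollScale j * ‖mollify (fun z => D z v) j x‖ ≤ 1 * ‖mollify (fun z => D z v) j x‖ := by
        gcongr
        unfold mollScale; linarith [mollRadius_pos j]
    _ ≤ mollify g j x * ‖v‖ := by rw [one_mul]; exact key v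

/-- The function h is only locally integrable on the open ball, so it is truncated to a ball growing
with j. Near a fixed x the truncations eventually agree with a fixed one, to which the convergence
theorem applies. -/
theorem ae_tendsto_mollify_of_locallyIntegrableOn {h : Euc m → ℝ}
    (hh : LocallyIntegrableOn h (Metric.ball 0 1)) :
    ∀ᵐ x, x ∈ Metric.ball (0 : Euc m) 1 →
      Tendsto (fun j => mollify ((Metric.closedBall (0 : Euc m) (1 - mollRadius j)).indicator h) j x)
        atTop (𝓝 (h x)) := by
  have hint : ∀ i, LocallyIntegrable
      ((Metric.closedBall (0 : Euc m) (1 - mollRadius i)).indicator h) := fun i =>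
    ((integrable_indicator_iff Metric.isClosed_closedBall.measurableSet).2
      (hh.integrableOn_compact_subset (mollRadius_closedBall_subset i)
        (isCompact_closedBall _ _))).locallyIntegrable
  filter_upwards [ae_all_iff.2 fun i => ae_tendsto_mollify (hint i)] with x hx hxB
  have hx1 : ‖x‖ < 1 := by simpa using hxB
  obtain ⟨i, hi⟩ : ∃ i, mollRadius i < (1 - ‖x‖) / 2 :=
    (tendsto_mollRadius.eventually_lt_const (by linarith)).exists
  have h1 := hx i hx1.le
  rw [indicator_of_mem (by rw [mem_closedBall_zero_iff]; linarith [norm_nonneg x])] at h1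
  refine h1.congr' ?_
  have hev : ∀ᶠ j in atTop, mollRadius j < mollRadius i / 3 :=
    tendsto_mollRadius.eventually_lt_const (by linarith [mollRadius_pos i])
  filter_upwards [hev] with j hj
  refine mollify_congr fun z hz => ?_
  have hz1 : ‖z‖ ≤ 1 - mollRadius i := by
    have h2 : ‖z‖ ≤ ‖z - mollScale j • x‖ + ‖mollScale j • x‖ := norm_le_norm_sub_add _ _
    rw [Metric.mem_ball, dist_eq_norm] at hz
    have h3 : ‖mollScale j • x‖ ≤ ‖x‖ := by
      rw [norm_smul, Real.norm_of_nonneg (mollScale_pos j).le, mollScale]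
      nlinarith [mollRadius_pos j, norm_nonneg x]
    linarith [mollRadius_pos i]
  rw [indicator_of_mem (mem_closedBall_zero_iff.2 hz1),
    indicator_of_mem (mem_closedBall_zero_iff.2 (hz1.trans (by linarith [mollRadius_pos i])))]

/-- A weakly differentiable function on the unit ball satisfies the upper gradient inequality along
almost every curve of a family which does not charge negligible sets too much. -/
theorem HasWeakFDerivOn.enorm_sub_le_lintegral_curve {h : Euc m → ℝ}
    {D : Euc m → Euc m →L[ℝ] ℝ} (H : HasWeakFDerivOn h D (Metric.ball 0 1)) {g : Euc m → ℝ≥0∞}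
    (hg : Measurable g) (hgI : ∫⁻ x in Metric.ball (0 : Euc m) 1, g x ≠ ⊤)
    (hDg : ∀ᵐ x ∂(volume.restrict (Metric.ball (0 : Euc m) 1)), ∀ v, ‖D x v‖ₑ ≤ g x * ‖v‖ₑ)
    {Z : Type*} [MeasurableSpace Z] {ζ : Measure Z} [SFinite ζ] {γ : Z → ℝ → Euc m}
    {l : Z → ℝ → ℝ} (hγm : Measurable (Function.uncurry γ)) (hlm : Measurable (Function.uncurry l))
    (hγ : ∀ z, Continuous (γ z)) (hl : ∀ z, Continuous (l z)) (hl0 : ∀ z τ, 0 ≤ l z τ) {L : ℝ}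
    (hlL : ∀ᵐ z ∂ζ, ∀ τ, l z τ ≤ L) (hγB : ∀ z τ, ‖γ z τ‖ ≤ 1)
    (hs : ∀ z τ, ∀ᶠ s in 𝓝[>] τ, ‖γ z s - γ z τ‖ ≤ l z τ * (s - τ)) {C : ℝ≥0∞} (hC : C ≠ ⊤)
    (hpush : ∀ τ, ∀ F : Euc m → ℝ≥0∞, Measurable F →
      ∫⁻ z, F (γ z τ) ∂ζ ≤ C * ∫⁻ x in Metric.ball (0 : Euc m) 1, F x) :
    ∀ᵐ z ∂ζ, ‖h (γ z 1) - h (γ z 0)‖ₑ ≤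
      ∫⁻ τ in Icc (0 : ℝ) 1, ENNReal.ofReal (l z τ) * g (γ z τ) := by
  set B := Metric.ball (0 : Euc m) 1 with hB
  have hBm : MeasurableSet B := Metric.isOpen_ball.measurableSet
  set gr : Euc m → ℝ := fun x => (B.indicator g x).toReal with hgr
  have hgim : Measurable (B.indicator g) := hg.indicator hBm
  have hgI' : ∫⁻ x, B.indicator g x ≠ ⊤ := by rwa [lintegral_indicator hBm]
  have hgrm : Measurable gr := hgim.ennreal_toReal
  have hgri : Integrable gr := integrable_toReal_of_lintegral_ne_top hgim.aemeasurable hgI'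
  have hgr0 : ∀ x, 0 ≤ gr x := fun x => ENNReal.toReal_nonneg
  have hgr1 : ∀ x ∉ B, gr x = 0 := fun x hx => by simp [hgr, hx]
  have hgrle : ∀ x, ENNReal.ofReal (gr x) ≤ g x := fun x => by
    refine ENNReal.ofReal_toReal_le.trans ?_
    exact indicator_le_self' (fun _ _ => zero_le) x
  have hDgr : ∀ᵐ x ∂(volume.restrict B), ∀ v, ‖D x v‖ ≤ gr x * ‖v‖ := by
    have hfin : ∀ᵐ x ∂(volume.restrict B), g x < ⊤ := ae_lt_top hg hgI
    filter_upwards [hDg, hfin, ae_restrict_mem hBm] with x hx hxt hxB v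
    have h1 := ENNReal.toReal_mono (ENNReal.mul_ne_top hxt.ne (by simp)) (hx v)
    simpa [hgr, hxB, ENNReal.toReal_mul] using h1
  set f : ℕ → Euc m → ℝ := fun j =>
    (Metric.closedBall (0 : Euc m) (1 - mollRadius j)).indicator h with hf
  have hfi : ∀ j, LocallyIntegrable (f j) := fun j =>
    ((integrable_indicator_iff Metric.isClosed_closedBall.measurableSet).2
      (H.locallyIntegrableOn.integrableOn_compact_subset (mollRadius_closedBall_subset j)
        (isCompact_closedBall _ _))).locallyIntegrable
  have hff : ∀ j, ∀ z ∈ Metric.closedBall (0 : Euc m) (1 - mollRadius j), f j z = h z :=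
    fun j z hz => indicator_of_mem hz _
  have hGc : ∀ j, Continuous (mollify gr j) := fun j => continuous_mollify hgri.locallyIntegrable j
  set Q : ℕ → Euc m → ℝ≥0∞ := fun j x =>
    ENNReal.ofReal (mollify gr j x) - ENNReal.ofReal (gr x) with hQ
  have hQm : ∀ j, Measurable (Q j) := fun j =>
    (hGc j).measurable.ennreal_ofReal.sub hgrm.ennreal_ofReal
  set R : ℕ → Z → ℝ≥0∞ := fun j z =>
    ∫⁻ τ in Icc (0 : ℝ) 1, ENNReal.ofReal (l z τ) * Q j (γ z τ) with hR
  have hlm' : Measurable fun q : Z × ℝ => l q.1 q.2 := hlm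
  have hγm' : Measurable fun q : Z × ℝ => γ q.1 q.2 := hγm
  have hRm : ∀ j, Measurable (R j) := fun j =>
    Measurable.lintegral_prod_right (hlm'.ennreal_ofReal.mul ((hQm j).comp hγm'))
  -- The mollified functions satisfy the inequality along every curve, with the mollification of g
  -- as an upper gradient; R j collects the excess of the latter over g.
  have hcurve : ∀ j z, ‖mollify (f j) j (γ z 1) - mollify (f j) j (γ z 0)‖ₑ ≤
      (∫⁻ τ in Icc (0 : ℝ) 1, ENNReal.ofReal (l z τ) * g (γ z τ)) + R j z := fun j z => by
    have h1 := enorm_sub_le_lintegral_of_fderiv_bound (h := mollify (f j) j) (hγ z) (hGc j) (hl z)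
      (fun x => mollify_nonneg hgr0 j x) (hl0 z)
      (fun τ _ => ⟨(hasFDerivAt_mollify (hfi j) j _).1,
        norm_fderiv_mollify_le H hgri hgr0 hDgr (hfi j) (hff j) (hγB z τ)⟩) (fun τ _ => hs z τ)
    refine h1.trans ?_
    have hm1 : Measurable fun τ => ENNReal.ofReal (l z τ) * Q j (γ z τ) :=
      (hl z).measurable.ennreal_ofReal.mul ((hQm j).comp (hγ z).measurable)
    rw [hR, ← lintegral_add_right _ hm1]
    refine lintegral_mono fun τ => ?_
    rw [← mul_add]
    gcongr
    refine le_trans ?_ (add_le_add (hgrle _) le_rfl)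
    exact le_add_tsub
  have hRle : ∀ j, ∫⁻ z, R j z ∂ζ ≤ ENNReal.ofReal L * (C * ∫⁻ x in B, Q j x) := fun j => by
    calc ∫⁻ z, R j z ∂ζ = ∫⁻ τ in Icc (0 : ℝ) 1, ∫⁻ z, ENNReal.ofReal (l z τ) * Q j (γ z τ) ∂ζ := by
          rw [hR]
          exact lintegral_lintegral_swap
            (hlm'.ennreal_ofReal.mul ((hQm j).comp hγm')).aemeasurable
      _ ≤ ∫⁻ τ in Icc (0 : ℝ) 1, ENNReal.ofReal L * (C * ∫⁻ x in B, Q j x) := by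
          refine lintegral_mono fun τ => ?_
          calc ∫⁻ z, ENNReal.ofReal (l z τ) * Q j (γ z τ) ∂ζ
              ≤ ∫⁻ z, ENNReal.ofReal L * Q j (γ z τ) ∂ζ := by
                refine lintegral_mono_ae ?_
                filter_upwards [hlL] with z hz
                gcongr
                exact hz τ
            _ = ENNReal.ofReal L * ∫⁻ z, Q j (γ z τ) ∂ζ :=
                lintegral_const_mul' _ _ ENNReal.ofReal_ne_top
            _ ≤ _ := by gcongr; exact hpush τ _ (hQm j)
      _ = _ := by simp
  have hR0 : Tendsto (fun j => ∫⁻ z, R j z ∂ζ) atTop (𝓝 0) := by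
    have h1 := tendsto_lintegral_mollify_sub hgri hgr0 hgr1
    have h2 := ENNReal.Tendsto.const_mul (a := ENNReal.ofReal L)
      (ENNReal.Tendsto.const_mul (a := C) h1 (Or.inr hC)) (Or.inr ENNReal.ofReal_ne_top)
    rw [mul_zero, mul_zero] at h2
    exact tendsto_of_tendsto_of_tendsto_of_le_of_le tendsto_const_nhds h2 (fun j => zero_le) hRle
  -- By Fatou's lemma the excess tends to zero along a subsequence depending on the curve, which is
  -- enough to pass to the limit in `hcurve`.
  have hlim : ∀ᵐ z ∂ζ, liminf (fun j => R j z) atTop = 0 := by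
    have h1 := lintegral_liminf_le (μ := ζ) (u := atTop) hRm
    rw [hR0.liminf_eq, nonpos_iff_eq_zero, lintegral_eq_zero_iff (.liminf hRm)] at h1
    exact h1
  -- By `hpush`, almost no curve is at time τ in the null set where the mollifications fail to
  -- converge. Only τ = 0 and τ = 1 are needed.
  have hend : ∀ τ, ∀ᵐ z ∂ζ, Tendsto (fun j => mollify (f j) j (γ z τ)) atTop (𝓝 (h (γ z τ))) := by
    intro τ
    have h1 : ∀ᵐ x ∂(volume.restrict B),
        Tendsto (fun j => mollify (f j) j x) atTop (𝓝 (h x)) :=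
      (ae_restrict_iff' hBm).2 (ae_tendsto_mollify_of_locallyIntegrableOn H.locallyIntegrableOn)
    set T := toMeasurable (volume.restrict B)
      {x | ¬ Tendsto (fun j => mollify (f j) j x) atTop (𝓝 (h x))} with hT
    have hTm : MeasurableSet T := measurableSet_toMeasurable _ _
    have hT0 : (volume.restrict B) T = 0 := by rw [hT, measure_toMeasurable]; exact h1
    have h2 := hpush τ (T.indicator 1) (measurable_one.indicator hTm)
    have hTγ : Measurable fun z => T.indicator (1 : Euc m → ℝ≥0∞) (γ z τ) :=
      (measurable_one.indicator hTm).comp (hγm'.comp (measurable_id.prodMk measurable_const))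
    rw [lintegral_indicator_one hTm, hT0, mul_zero, nonpos_iff_eq_zero,
      lintegral_eq_zero_iff hTγ] at h2
    filter_upwards [h2] with z hz
    by_contra hcon
    have : γ z τ ∈ T := subset_toMeasurable _ _ hcon
    simp [this] at hz
  filter_upwards [hlim, hend 0, hend 1] with z hz h0 h1
  refine ENNReal.le_of_forall_pos_le_add fun ε hε _ => ?_
  have h2 := ((h1.sub h0).enorm)
  refine le_of_tendsto_of_frequently h2 ?_
  have h3 : ∃ᶠ j in atTop, R j z < ε := by
    refine frequently_lt_of_liminf_lt (by isBoundedDefault) ?_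
    rw [hz]; exact_mod_cast hε
  exact h3.mono fun j hj => (hcurve j z).trans (by gcongr)

end CurveInequality

/-! ### Hausdorff measure of Lipschitz images. -/

section HausdorffMeasure

variable {X Y : Type*} [EMetricSpace X] [MeasurableSpace X] [BorelSpace X]
  [EMetricSpace Y] [MeasurableSpace Y] [BorelSpace Y]

theorem LipschitzOnWith.euclideanHausdorffMeasure_image_le {K : NNReal} {f : X → Y} {s : Set X}
    (h : LipschitzOnWith K f s) (m : ℕ) :
    (μHE[m] : Measure Y) (f '' s) ≤ (K : ℝ≥0∞) ^ m * (μHE[m] : Measure X) s := by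
  have := h.hausdorffMeasure_image_le (d := (m : ℝ)) (by positivity)
  rw [ENNReal.rpow_natCast] at this
  simp only [Measure.euclideanHausdorffMeasure_def, Measure.smul_apply]
  rw [ENNReal.smul_def, ENNReal.smul_def, smul_eq_mul, smul_eq_mul, mul_left_comm]
  gcongr

end HausdorffMeasure

/-! ### The opening maps: collapsing, translating and reflecting into the unit ball. -/

section OpeningMap

variable {m : ℕ}

/-- A Lipschitz map of `ℝ^m` which is the identity on a ball and vanishes outside a larger ball. -/
def collapse (z : Euc m) : Euc m := max 0 (min 1 (2 - 2 / 3 * ‖z‖)) • z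

theorem collapse_of_le {z : Euc m} (hz : ‖z‖ ≤ 3 / 2) : collapse z = z := by
  rw [collapse, min_eq_left (by linarith), max_eq_right zero_le_one, one_smul]

theorem collapse_of_ge {z : Euc m} (hz : 3 ≤ ‖z‖) : collapse z = 0 := by
  rw [collapse, max_eq_left ((min_le_right _ _).trans (by linarith)), zero_smul]

theorem norm_collapse_le (z : Euc m) : ‖collapse z‖ ≤ 3 := by
  rcases le_total 3 ‖z‖ with h | h
  · rw [collapse_of_ge h]; simp
  · rw [collapse, norm_smul, Real.norm_of_nonneg (le_max_left _ _)]
    have h1 : max 0 (min 1 (2 - 2 / 3 * ‖z‖)) ≤ 1 := max_le zero_le_one (min_le_left _ _)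
    nlinarith [norm_nonneg z]

theorem norm_collapse_sub_le (z w : Euc m) : ‖collapse z - collapse w‖ ≤ 3 * ‖z - w‖ := by
  wlog hw : ‖w‖ ≤ 3 generalizing z w
  · by_cases hz : ‖z‖ ≤ 3
    · rw [norm_sub_rev, norm_sub_rev z]
      exact this w z hz
    · rw [collapse_of_ge (le_of_not_ge hz), collapse_of_ge (le_of_not_ge hw)]
      simp
  have h1 : ∀ z : Euc m, |max 0 (min 1 (2 - 2 / 3 * ‖z‖))| ≤ 1 := fun z => by
    rw [abs_of_nonneg (le_max_left _ _)]; exact max_le zero_le_one (min_le_left _ _)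
  have h2 : |max 0 (min 1 (2 - 2 / 3 * ‖z‖)) - max 0 (min 1 (2 - 2 / 3 * ‖w‖))| ≤
      2 / 3 * ‖z - w‖ := by
    refine (abs_max_sub_max_le_max _ _ _ _).trans (max_le (by simp) ?_)
    refine (abs_min_sub_min_le_max _ _ _ _).trans (max_le (by simp) ?_)
    have := abs_norm_sub_norm_le z w
    rw [show 2 - 2 / 3 * ‖z‖ - (2 - 2 / 3 * ‖w‖) = -(2 / 3 * (‖z‖ - ‖w‖)) by ring, abs_neg, abs_mul,
      abs_of_pos (by norm_num : (0 : ℝ) < 2 / 3)]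
    gcongr
  have h3 : collapse z - collapse w = max 0 (min 1 (2 - 2 / 3 * ‖z‖)) • (z - w) +
      (max 0 (min 1 (2 - 2 / 3 * ‖z‖)) - max 0 (min 1 (2 - 2 / 3 * ‖w‖))) • w := by
    simp only [collapse, smul_sub, sub_smul]; abel
  rw [h3]
  refine (norm_add_le _ _).trans ?_
  rw [norm_smul, norm_smul, Real.norm_eq_abs, Real.norm_eq_abs]
  have h4 := mul_le_mul (h1 z) le_rfl (norm_nonneg (z - w)) zero_le_one
  have h5 := mul_le_mul h2 hw (norm_nonneg w) (by positivity)
  linarith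

theorem continuous_collapse : Continuous (collapse : Euc m → Euc m) := by
  unfold collapse; fun_prop

/-- The Lipschitz retraction onto the closed unit ball which is the inversion outside the ball. -/
def reflectBall (x : Euc m) : Euc m := if ‖x‖ ≤ 1 then x else (‖x‖ ^ 2)⁻¹ • x

theorem norm_reflectBall_le (x : Euc m) : ‖reflectBall x‖ ≤ 1 := by
  unfold reflectBall
  split_ifs with h
  · exact h
  · push Not at h
    rw [norm_smul, norm_inv, norm_pow, norm_norm, sq, mul_inv, mul_assoc,
      inv_mul_cancel₀ (by positivity), mul_one]
    exact inv_le_one_of_one_le₀ h.le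

theorem norm_inversion_sub {x y : Euc m} (hx : x ≠ 0) (hy : y ≠ 0) :
    ‖(‖x‖ ^ 2)⁻¹ • x - (‖y‖ ^ 2)⁻¹ • y‖ = ‖x - y‖ / (‖x‖ * ‖y‖) := by
  have := EuclideanGeometry.dist_inversion_inversion (c := (0 : Euc m)) hx hy 1
  simp only [EuclideanGeometry.inversion, vsub_eq_sub, sub_zero, vadd_eq_add,
    add_zero, one_div, one_pow, dist_eq_norm] at this
  rw [← inv_pow, ← inv_pow, this]
  ring

theorem norm_reflectBall_sub_le (x y : Euc m) : ‖reflectBall x - reflectBall y‖ ≤ 3 * ‖x - y‖ := by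
  have mixed : ∀ x y : Euc m, ‖x‖ ≤ 1 → ¬ ‖y‖ ≤ 1 →
      ‖reflectBall x - reflectBall y‖ ≤ 3 * ‖x - y‖ := fun x y hx hy => by
    rw [reflectBall, reflectBall, if_pos hx, if_neg hy]
    push Not at hy
    have hy0 : 0 < ‖y‖ := by linarith
    have h1 : y - (‖y‖ ^ 2)⁻¹ • y = (1 - (‖y‖ ^ 2)⁻¹) • y := by rw [sub_smul, one_smul]
    have h2 : ‖y - (‖y‖ ^ 2)⁻¹ • y‖ ≤ 2 * (‖y‖ - 1) := by
      have h3 : (‖y‖ ^ 2)⁻¹ ≤ 1 := inv_le_one_of_one_le₀ (by nlinarith)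
      rw [h1, norm_smul, Real.norm_of_nonneg (by linarith)]
      have h4 : (1 - (‖y‖ ^ 2)⁻¹) * ‖y‖ = ‖y‖ - ‖y‖⁻¹ := by field_simp
      rw [h4]
      have h5 : 2 - ‖y‖ ≤ ‖y‖⁻¹ := by
        rw [← one_div, le_div_iff₀ hy0]; nlinarith [sq_nonneg (‖y‖ - 1)]
      linarith
    have h6 : ‖y‖ - 1 ≤ ‖x - y‖ := by
      have := norm_sub_norm_le y x
      rw [norm_sub_rev] at this
      linarith
    calc ‖x - (‖y‖ ^ 2)⁻¹ • y‖ = ‖(x - y) + (y - (‖y‖ ^ 2)⁻¹ • y)‖ := by congr 1; abel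
      _ ≤ ‖x - y‖ + ‖y - (‖y‖ ^ 2)⁻¹ • y‖ := norm_add_le _ _
      _ ≤ 3 * ‖x - y‖ := by linarith
  by_cases hx : ‖x‖ ≤ 1 <;> by_cases hy : ‖y‖ ≤ 1
  · rw [reflectBall, reflectBall, if_pos hx, if_pos hy]; linarith [norm_nonneg (x - y)]
  · exact mixed x y hx hy
  · rw [norm_sub_rev, norm_sub_rev x]; exact mixed y x hy hx
  · rw [reflectBall, reflectBall, if_neg hx, if_neg hy]
    push Not at hx hy
    rw [norm_inversion_sub (by rintro rfl; simp at hx; linarith) (by rintro rfl; simp at hy; linarith),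
      div_le_iff₀ (by positivity)]
    nlinarith [norm_nonneg (x - y), mul_le_mul hx.le hy.le zero_le_one (by linarith)]

theorem continuous_reflectBall : Continuous (reflectBall : Euc m → Euc m) := by
  refine (LipschitzWith.of_dist_le_mul (K := 3) fun x y => ?_).continuous
  rw [dist_eq_norm, dist_eq_norm]
  exact norm_reflectBall_sub_le x y

/-- A bound on the distortion of volume by `reflectBall`. -/
def reflectConst (m : ℕ) : ℝ≥0∞ := 1 + 16 ^ m

/-- The inversion is an involution sending the shell 1 < ‖y‖ ≤ 4 into 1/4 ≤ ‖x‖ < 1, where it is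
16-Lipschitz. The radius 4 is large enough for all the points `collapse z - a`, whose norm is less
than 3 + 1/2. -/
theorem volume_reflectBall_preimage_le (T : Set (Euc m)) :
    volume (reflectBall ⁻¹' T ∩ (Metric.closedBall 0 4 \ Metric.closedBall 0 1)) ≤
      16 ^ m * volume (T ∩ Metric.ball 0 1) := by
  set I : Euc m → Euc m := fun x => (‖x‖ ^ 2)⁻¹ • x with hI
  set s : Set (Euc m) := {x | x ∈ T ∧ 1 / 4 ≤ ‖x‖ ∧ ‖x‖ < 1} with hs
  have hlip : LipschitzOnWith 16 I s := by
    refine LipschitzOnWith.of_dist_le_mul fun x hx y hy => ?_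
    have hx' := hx.2.1
    have hy' := hy.2.1
    rw [dist_eq_norm, dist_eq_norm, norm_inversion_sub (by rintro rfl; simp at hx'; linarith)
      (by rintro rfl; simp at hy'; linarith), div_le_iff₀ (by nlinarith)]
    have h1 := mul_le_mul hx' hy' (by norm_num) (by linarith)
    push_cast
    nlinarith [norm_nonneg (x - y)]
  have h1 := hlip.euclideanHausdorffMeasure_image_le m
  rw [EuclideanSpace.euclideanHausdorffMeasure_eq_volume] at h1
  refine (measure_mono ?_).trans (h1.trans ?_)
  · rintro y ⟨hyT, hy4, hy1⟩
    have hy1' : 1 < ‖y‖ := by simpa using hy1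
    have hy4' : ‖y‖ ≤ 4 := by simpa using hy4
    have hy0 : 0 < ‖y‖ := by linarith
    have hr : reflectBall y = I y := by rw [reflectBall, if_neg (not_le.2 hy1')]
    have hn : ‖I y‖ = ‖y‖⁻¹ := by
      rw [hI]; simp only
      rw [norm_smul, norm_inv, norm_pow, norm_norm]; field_simp
    refine ⟨I y, ⟨hr ▸ hyT, ?_, ?_⟩, ?_⟩
    · rw [hn, ← one_div]; exact one_div_le_one_div_of_le hy0 hy4'
    · rw [hn]; exact inv_lt_one_of_one_lt₀ hy1'
    · change (‖I y‖ ^ 2)⁻¹ • I y = y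
      rw [hn, hI]; simp only
      rw [smul_smul, inv_pow, inv_inv, mul_inv_cancel₀ (by positivity), one_smul]
  · push_cast
    gcongr
    exact fun x hx => ⟨hx.1, by simpa using hx.2.2⟩

theorem lintegral_reflectBall_le {F : Euc m → ℝ≥0∞} (hF : Measurable F) :
    ∫⁻ y in Metric.closedBall 0 4, F (reflectBall y) ≤
      reflectConst m * ∫⁻ x in Metric.ball (0 : Euc m) 1, F x := by
  have hm : Measurable (reflectBall : Euc m → Euc m) := continuous_reflectBall.measurable
  have hU : Metric.closedBall (0 : Euc m) 4 =
      Metric.closedBall 0 1 ∪ (Metric.closedBall 0 4 \ Metric.closedBall 0 1) :=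
    (union_sdiff_cancel (Metric.closedBall_subset_closedBall (by norm_num))).symm
  rw [hU, reflectConst, add_mul, one_mul]
  refine (lintegral_union_le _ _ _).trans (add_le_add (le_of_eq ?_) ?_)
  · rw [setLIntegral_congr_fun (g := F) Metric.isClosed_closedBall.measurableSet fun x hx => by
      rw [reflectBall, if_pos (by simpa using hx)]]
    refine setLIntegral_congr (ae_eq_of_subset_of_measure_ge Metric.ball_subset_closedBall
      (Measure.addHaar_unitClosedBall_eq_addHaar_unitBall volume).le
      Metric.isOpen_ball.measurableSet.nullMeasurableSet measure_closedBall_lt_top.ne).symm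
  · have hle : (volume.restrict (Metric.closedBall 0 4 \ Metric.closedBall 0 1)).map
        (reflectBall : Euc m → Euc m) ≤ (16 ^ m : ℝ≥0∞) • volume.restrict (Metric.ball 0 1) := by
      refine Measure.le_iff.2 fun T hT => ?_
      rw [Measure.map_apply hm hT, Measure.restrict_apply (hm hT), Measure.smul_apply,
        Measure.restrict_apply hT, smul_eq_mul]
      exact volume_reflectBall_preimage_le T
    rw [← lintegral_map hF hm, ← smul_eq_mul, ← lintegral_smul_measure]
    exact lintegral_mono' hle le_rfl

/-- The family of opening maps. -/
def openingMap (a z : Euc m) : Euc m := reflectBall (collapse z - a)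

theorem norm_openingMap_le (a z : Euc m) : ‖openingMap a z‖ ≤ 1 := norm_reflectBall_le _

theorem norm_openingMap_sub_le (a z w : Euc m) :
    ‖openingMap a z - openingMap a w‖ ≤ 9 * ‖z - w‖ := by
  have h1 := norm_reflectBall_sub_le (collapse z - a) (collapse w - a)
  rw [sub_sub_sub_cancel_right] at h1
  have := norm_collapse_sub_le z w
  unfold openingMap
  linarith

theorem openingMap_of_ge (a : Euc m) {z : Euc m} (hz : 3 ≤ ‖z‖) :
    openingMap a z = reflectBall (-a) := by
  rw [openingMap, collapse_of_ge hz, zero_sub]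

theorem openingMap_add_of_le {a x : Euc m} (ha : ‖a‖ ≤ 1 / 2) (hx : ‖x‖ ≤ 1) :
    openingMap a (x + a) = x := by
  rw [openingMap, collapse_of_le ((norm_add_le _ _).trans (by linarith)), add_sub_cancel_right,
    reflectBall, if_pos hx]

theorem continuous_openingMap : Continuous fun q : Euc m × Euc m => openingMap q.1 q.2 :=
  continuous_reflectBall.comp ((continuous_collapse.comp continuous_snd).sub continuous_fst)

/-- For fixed z the map a ↦ `collapse z - a` preserves the volume. Averaging over the parameter a
therefore forgets the degeneracy of z ↦ `openingMap a z`, which is constant on large sets. -/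
theorem lintegral_openingMap_le {F : Euc m → ℝ≥0∞} (hF : Measurable F) (z : Euc m) :
    ∫⁻ a in Metric.ball (0 : Euc m) (1 / 2), F (openingMap a z) ≤
      reflectConst m * ∫⁻ x in Metric.ball (0 : Euc m) 1, F x := by
  refine le_trans ?_ (lintegral_reflectBall_le hF)
  rw [← lintegral_indicator Metric.isOpen_ball.measurableSet,
    ← lintegral_indicator Metric.isClosed_closedBall.measurableSet,
    ← lintegral_sub_left_eq_self (μ := volume)
      ((Metric.closedBall 0 4).indicator fun y => F (reflectBall y)) (collapse z)]
  refine lintegral_mono fun a => ?_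
  by_cases ha : a ∈ Metric.ball (0 : Euc m) (1 / 2)
  · have h1 : ‖a‖ < 1 / 2 := by simpa using ha
    have h2 : collapse z - a ∈ Metric.closedBall (0 : Euc m) 4 := by
      rw [mem_closedBall_zero_iff]
      have := norm_sub_le (collapse z) a
      linarith [norm_collapse_le z]
    rw [indicator_of_mem ha, indicator_of_mem h2]
    rfl
  · rw [indicator_of_notMem ha]; exact zero_le

attribute [irreducible] openingMap

end OpeningMap

/-! ### Opening for fractional energies: local oscillations at a given scale. -/

section FractionalOpening

variable {m : ℕ} {N : Type*} [EMetricSpace N] [MeasurableSpace N] [SecondCountableTopology N]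
  [BorelSpace N] {s p : ℝ} {u : Euc m → N}

/-- The localised difference of a map at the scale `ρ`. -/
def localDiff (p : ℝ) (u : Euc m → N) (ρ : ℝ≥0∞) (ξ η : Euc m) : ℝ≥0∞ :=
  if edist ξ η ≤ 10 * ρ then edist (u ξ) (u η) ^ p else 0

theorem measurable_localDiff (hu : Measurable u) :
    Measurable fun q : ℝ≥0∞ × Euc m × Euc m => localDiff p u q.1 q.2.1 q.2.2 := by
  unfold localDiff
  refine Measurable.ite (measurableSet_le ?_ ?_) ?_ measurable_const
  · exact (measurable_fst.comp measurable_snd).edist (measurable_snd.comp measurable_snd)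
  · exact measurable_const.mul measurable_fst
  · exact ((hu.comp (measurable_fst.comp measurable_snd)).edist
      (hu.comp (measurable_snd.comp measurable_snd))).pow_const _

theorem localDiff_of_le {ρ : ℝ≥0∞} {ξ η : Euc m} (h : edist ξ η ≤ 10 * ρ) :
    localDiff p u ρ ξ η = edist (u ξ) (u η) ^ p := if_pos h

theorem localDiff_of_not_le {ρ : ℝ≥0∞} {ξ η : Euc m} (h : ¬ edist ξ η ≤ 10 * ρ) :
    localDiff p u ρ ξ η = 0 := if_neg h

attribute [irreducible] localDiff

/-- The average of the localised difference over the unit ball. -/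
def localOsc (p : ℝ) (u : Euc m → N) (ρ : ℝ≥0∞) (η : Euc m) : ℝ≥0∞ :=
  ∫⁻ ξ in Metric.ball (0 : Euc m) 1, localDiff p u ρ ξ η

theorem measurable_localOsc (hu : Measurable u) (ρ : ℝ≥0∞) : Measurable (localOsc p u ρ) := by
  unfold localOsc
  have h1 : Measurable fun q : Euc m × Euc m => (ρ, q.2, q.1) := by fun_prop
  have h : Measurable (Function.uncurry fun η ξ : Euc m => localDiff p u ρ ξ η) :=
    (measurable_localDiff (p := p) hu).comp h1
  exact h.lintegral_prod_right

/-- Both values are compared with u ξ, for ξ in a ball of radius r/2 contained in the unit ball and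
at distance at most r from η. The constant 10 in `localDiff` is this 1 plus the constant 9 of the
opening maps. -/
theorem edist_rpow_le_localOsc (hu : Measurable u) (hp : 1 ≤ p) {r : ℝ} (hr : 0 < r) (hr1 : r ≤ 1)
    {η η' : Euc m} (hη : ‖η‖ ≤ 1) (hηη' : edist η η' ≤ 9 * ENNReal.ofReal r) :
    ENNReal.ofReal (r / 2) ^ m * volume (Metric.ball (0 : Euc m) 1) * edist (u η) (u η') ^ p ≤
      2 ^ (p - 1) * (localOsc p u (ENNReal.ofReal r) η + localOsc p u (ENNReal.ofReal r) η') := by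
  -- The centre is moved inwards, so that the ball of radius r/2 fits in the unit ball even when η
  -- is on the sphere.
  set c : Euc m := (1 - r / 2) • η with hc
  have hcn : ‖c‖ ≤ 1 - r / 2 := by
    rw [hc, norm_smul, Real.norm_of_nonneg (by linarith)]
    nlinarith
  have hsub : Metric.ball c (r / 2) ⊆ Metric.ball (0 : Euc m) 1 := by
    refine Metric.ball_subset_ball' ?_
    rw [dist_zero_right]; linarith
  have hnear : ∀ ξ ∈ Metric.ball c (r / 2), edist ξ η ≤ ENNReal.ofReal r := fun ξ hξ => by
    rw [edist_dist]
    refine ENNReal.ofReal_le_ofReal ((dist_triangle _ c _).trans ?_)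
    have : dist c η ≤ r / 2 := by
      rw [hc, dist_eq_norm, sub_smul, one_smul, sub_sub_cancel_left, norm_neg, norm_smul,
        Real.norm_of_nonneg (by linarith)]
      nlinarith
    linarith [Metric.mem_ball.1 hξ]
  have hvol : volume (Metric.ball c (r / 2)) =
      ENNReal.ofReal (r / 2) ^ m * volume (Metric.ball (0 : Euc m) 1) := by
    rw [Measure.addHaar_ball_of_pos _ _ (half_pos hr), finrank_euclideanSpace_fin,
      ENNReal.ofReal_pow (half_pos hr).le]
  rw [← hvol, mul_comm, ← setLIntegral_const]
  have hm0 : Measurable fun ξ : Euc m => (ENNReal.ofReal r, ξ, η) := by fun_prop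
  have hm1 : Measurable fun ξ => localDiff p u (ENNReal.ofReal r) ξ η :=
    (measurable_localDiff (p := p) hu).comp hm0
  unfold localOsc
  rw [← lintegral_add_left hm1, ← lintegral_const_mul' _ _ (by
    exact ENNReal.rpow_ne_top_of_nonneg (by linarith) (by simp))]
  refine (lintegral_mono_set hsub).trans' ?_
  refine setLIntegral_mono' Metric.isOpen_ball.measurableSet fun ξ hξ => ?_
  have h1 := hnear ξ hξ
  have h2 : edist ξ η' ≤ 10 * ENNReal.ofReal r := by
    calc edist ξ η' ≤ edist ξ η + edist η η' := edist_triangle _ _ _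
      _ ≤ ENNReal.ofReal r + 9 * ENNReal.ofReal r := add_le_add h1 hηη'
      _ = 10 * ENNReal.ofReal r := by ring
  have h3 : edist ξ η ≤ 10 * ENNReal.ofReal r := by
    refine h1.trans ?_
    calc ENNReal.ofReal r = 1 * ENNReal.ofReal r := (one_mul _).symm
      _ ≤ 10 * ENNReal.ofReal r := by gcongr; norm_num
  rw [localDiff_of_le h2, localDiff_of_le h3]
  refine le_trans ?_ (ENNReal.rpow_add_le_mul_rpow_add_rpow _ _ hp)
  gcongr
  rw [edist_comm (u ξ) (u η)]
  exact edist_triangle _ _ _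

/-- The average over the parameter of the difference of the opened maps. -/
theorem lintegral_openingMap_edist_le (hu : Measurable u) (hp : 1 ≤ p) {r : ℝ} (hr : 0 < r)
    (hr1 : r ≤ 1) {z z' : Euc m} (hz : min ‖z - z'‖ 1 = r) :
    ENNReal.ofReal (r / 2) ^ m * volume (Metric.ball (0 : Euc m) 1) *
      ∫⁻ a in Metric.ball (0 : Euc m) (1 / 2),
        edist (u (openingMap a z)) (u (openingMap a z')) ^ p ≤
      2 ^ p * reflectConst m *
        ∫⁻ η in Metric.ball (0 : Euc m) 1, localOsc p u (ENNReal.ofReal r) η := by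
  have hom : Measurable fun a => localOsc p u (ENNReal.ofReal r) (openingMap a z) :=
    (measurable_localOsc (p := p) hu (ENNReal.ofReal r)).comp
      (continuous_openingMap.comp (continuous_id.prodMk continuous_const)).measurable
  -- At distance at most 1 the opening maps are 9-Lipschitz; beyond that, r = 1 and the diameter 2
  -- of the unit ball is a sufficient bound.
  have hnear : ∀ a, edist (openingMap a z) (openingMap a z') ≤ 9 * ENNReal.ofReal r := fun a => by
    rw [edist_dist, show (9 : ℝ≥0∞) = ENNReal.ofReal 9 by simp, ← ENNReal.ofReal_mul (by norm_num),
      dist_eq_norm]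
    refine ENNReal.ofReal_le_ofReal ?_
    rcases le_total ‖z - z'‖ 1 with h | h
    · rw [min_eq_left h] at hz
      rw [← hz]
      exact norm_openingMap_sub_le a z z'
    · rw [min_eq_right h] at hz
      have := norm_sub_le (openingMap a z) (openingMap a z')
      linarith [norm_openingMap_le a z, norm_openingMap_le a z']
  have hcne : ENNReal.ofReal (r / 2) ^ m * volume (Metric.ball (0 : Euc m) 1) ≠ ⊤ :=
    ENNReal.mul_ne_top (by simp) measure_ball_lt_top.ne
  rw [← lintegral_const_mul' _ _ hcne]
  calc _ ≤ ∫⁻ a in Metric.ball (0 : Euc m) (1 / 2),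
        2 ^ (p - 1) * (localOsc p u (ENNReal.ofReal r) (openingMap a z) +
          localOsc p u (ENNReal.ofReal r) (openingMap a z')) :=
        lintegral_mono fun a => edist_rpow_le_localOsc hu hp hr hr1 (norm_openingMap_le a z)
          (hnear a)
    _ = 2 ^ (p - 1) * ((∫⁻ a in Metric.ball (0 : Euc m) (1 / 2),
          localOsc p u (ENNReal.ofReal r) (openingMap a z)) +
          (∫⁻ a in Metric.ball (0 : Euc m) (1 / 2),
            localOsc p u (ENNReal.ofReal r) (openingMap a z'))) := by
        rw [lintegral_const_mul' _ _ (ENNReal.rpow_ne_top_of_nonneg (by linarith) (by simp))]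
        congr 1
        exact lintegral_add_left hom _
    _ ≤ 2 ^ (p - 1) * (reflectConst m * (∫⁻ η in Metric.ball (0 : Euc m) 1,
          localOsc p u (ENNReal.ofReal r) η) + reflectConst m *
          (∫⁻ η in Metric.ball (0 : Euc m) 1, localOsc p u (ENNReal.ofReal r) η)) := by
        gcongr
        · exact lintegral_openingMap_le (measurable_localOsc hu _) z
        · exact lintegral_openingMap_le (measurable_localOsc hu _) z'
    _ = _ := by
        rw [← two_mul, ← mul_assoc, ← mul_assoc]
        congr 2
        calc (2 : ℝ≥0∞) ^ (p - 1) * 2 = 2 ^ (p - 1) * 2 ^ (1 : ℝ) := by rw [ENNReal.rpow_one]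
          _ = 2 ^ p := by rw [← ENNReal.rpow_add _ _ (by simp) (by simp)]; congr 1; ring

end FractionalOpening

/-! ### Opening for fractional energies: the averaged estimate. -/

section FractionalOpening

variable {m : ℕ} {N : Type*} [EMetricSpace N] [MeasurableSpace N] [SecondCountableTopology N]
  [BorelSpace N] {s p : ℝ} {u : Euc m → N}

/-- The total localised oscillation of a map over the unit ball. -/
def totalOsc (p : ℝ) (u : Euc m → N) (ρ : ℝ≥0∞) : ℝ≥0∞ :=
  ∫⁻ η in Metric.ball (0 : Euc m) 1, localOsc p u ρ η

/-- The convolution kernel bounding the average energy of the opened maps. -/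
def openingKernel (α p : ℝ) (u : Euc m → N) (w : Euc m) : ℝ≥0∞ :=
  (min ‖w‖ₑ 1 ^ m)⁻¹ * (‖w‖ₑ ^ α)⁻¹ * totalOsc p u (min ‖w‖ₑ 1)

theorem measurable_openingKernel {α : ℝ} (hu : Measurable u) :
    Measurable (openingKernel α p u) := by
  have h1 : Measurable fun q : (Euc m × Euc m) × Euc m => (min ‖q.1.1‖ₑ 1, q.2, q.1.2) := by
    fun_prop
  have h2 : Measurable (Function.uncurry fun (q : Euc m × Euc m) (ξ : Euc m) =>
      localDiff p u (min ‖q.1‖ₑ 1) ξ q.2) := (measurable_localDiff (p := p) hu).comp h1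
  have h3 : Measurable (Function.uncurry fun w η : Euc m => localOsc p u (min ‖w‖ₑ 1) η) :=
    h2.lintegral_prod_right
  have h4 : Measurable fun w : Euc m => totalOsc p u (min ‖w‖ₑ 1) := h3.lintegral_prod_right
  have h5 : Measurable fun w : Euc m => (min ‖w‖ₑ 1 ^ m)⁻¹ * (‖w‖ₑ ^ α)⁻¹ := by fun_prop
  exact h5.mul h4

/-- The integral of `‖x‖ ^ (-a)` outside of the unit ball. -/
def tailConst (m : ℕ) (a : ℝ) : ℝ≥0∞ :=
  ∫⁻ x in (Metric.ball (0 : Euc m) 1)ᶜ, (‖x‖ₑ ^ a)⁻¹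

/-- With t the distance of ξ and η, the localisation forces ‖w‖ and 1 to be at least t/10. The
factor in min(‖w‖, 1) is then at most of the order of t^(-m), and the tail integral of ‖w‖^(-α) is
of the order of t^(m - α): the product restores the kernel t^(-α). -/
theorem lintegral_localDiff_kernel_le {α : ℝ} (hp : 0 < p) (ξ η : Euc m) :
    ∫⁻ w : Euc m, (min ‖w‖ₑ 1 ^ m)⁻¹ * (‖w‖ₑ ^ α)⁻¹ * localDiff p u (min ‖w‖ₑ 1) ξ η ≤
      10 ^ α * tailConst m α * (edist (u ξ) (u η) ^ p / edist ξ η ^ α) := by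
  rcases eq_or_ne ξ η with rfl | hne
  · have : ∀ ρ, localDiff p u ρ ξ ξ = 0 := fun ρ => by
      rw [localDiff_of_le (by simp), edist_self, ENNReal.zero_rpow_of_pos hp]
    simp [this]
  set t := dist ξ η with ht
  have ht0 : 0 < t := dist_pos.2 hne
  have ht10 : 0 < t / 10 := by positivity
  have h0 : ENNReal.ofReal (t / 10) ≠ 0 := by simpa using ht0
  have hed : edist ξ η = 10 * ENNReal.ofReal (t / 10) := by
    rw [edist_dist, show (10 : ℝ≥0∞) = ENNReal.ofReal 10 by simp, ← ENNReal.ofReal_mul (by norm_num)]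
    congr 1; ring
  calc _ ≤ ∫⁻ w in (Metric.ball (0 : Euc m) (t / 10))ᶜ,
        (ENNReal.ofReal (t / 10) ^ m)⁻¹ * edist (u ξ) (u η) ^ p * (‖w‖ₑ ^ α)⁻¹ := by
        rw [← lintegral_indicator Metric.isOpen_ball.measurableSet.compl]
        refine lintegral_mono fun w => ?_
        by_cases hle : edist ξ η ≤ 10 * min ‖w‖ₑ 1
        · have h2 : ENNReal.ofReal (t / 10) ≤ min ‖w‖ₑ 1 := by
            rw [hed] at hle
            exact (ENNReal.mul_le_mul_iff_right (by simp) (by simp)).1 hle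
          have h3 : w ∈ (Metric.ball (0 : Euc m) (t / 10))ᶜ := by
            have := h2.trans (min_le_left _ _)
            rw [← ofReal_norm, ENNReal.ofReal_le_ofReal_iff (norm_nonneg _)] at this
            simpa using this
          rw [indicator_of_mem h3, localDiff_of_le hle, mul_right_comm]
          gcongr
        · rw [localDiff_of_not_le hle, mul_zero]; exact zero_le
    _ = (ENNReal.ofReal (t / 10) ^ m)⁻¹ * edist (u ξ) (u η) ^ p *
          (ENNReal.ofReal (t / 10) ^ ((m : ℝ) - α) * tailConst m α) := by
        have h := setLIntegral_compl_ball_rpow (volume : Measure (Euc m)) (a := α) ht10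
        rw [finrank_euclideanSpace_fin] at h
        rw [tailConst, ← h]
        refine lintegral_const_mul'' _ ?_
        exact ((measurable_enorm.pow_const _).inv).aemeasurable
    _ = 10 ^ α * tailConst m α * (edist (u ξ) (u η) ^ p / edist ξ η ^ α) := by
        have h4 : (ENNReal.ofReal (t / 10) ^ m)⁻¹ * ENNReal.ofReal (t / 10) ^ ((m : ℝ) - α) =
            10 ^ α * (edist ξ η ^ α)⁻¹ := by
          rw [hed, ENNReal.mul_rpow_of_ne_top (by simp) (by simp), ENNReal.mul_inv
            (by left; exact (ENNReal.rpow_pos (by simp) (by simp)).ne')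
            (by left; exact ENNReal.rpow_ne_top_of_ne_zero (by simp) (by simp)), ← mul_assoc,
            ENNReal.mul_inv_cancel (ENNReal.rpow_pos (by simp) (by simp)).ne'
              (ENNReal.rpow_ne_top_of_ne_zero (by simp) (by simp)), one_mul,
            ← ENNReal.rpow_neg, ← ENNReal.rpow_natCast, ← ENNReal.rpow_neg,
            ← ENNReal.rpow_add _ _ h0 (by simp)]
          congr 1; ring
        calc _ = ((ENNReal.ofReal (t / 10) ^ m)⁻¹ * ENNReal.ofReal (t / 10) ^ ((m : ℝ) - α)) *
              (tailConst m α * edist (u ξ) (u η) ^ p) := by ring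
          _ = _ := by rw [h4, div_eq_mul_inv (edist (u ξ) (u η) ^ p)]; ring

/-- The Gagliardo energy of a map on the unit ball. -/
def ballEnergy (s p : ℝ) (u : Euc m → N) : ℝ≥0∞ :=
  ∫⁻ η in Metric.ball (0 : Euc m) 1, ∫⁻ ξ in Metric.ball (0 : Euc m) 1,
    edist (u ξ) (u η) ^ p / edist ξ η ^ ((m : ℝ) + s * p)

theorem lintegral_openingKernel_le {α : ℝ} (hu : Measurable u) (hp : 0 < p) :
    ∫⁻ w : Euc m, openingKernel α p u w ≤ 10 ^ α * tailConst m α *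
      ∫⁻ η in Metric.ball (0 : Euc m) 1, ∫⁻ ξ in Metric.ball (0 : Euc m) 1,
        edist (u ξ) (u η) ^ p / edist ξ η ^ α := by
  have h1 : Measurable fun q : (Euc m × Euc m) × Euc m => (min ‖q.1.1‖ₑ 1, q.2, q.1.2) := by
    fun_prop
  have h2 : Measurable fun q : (Euc m × Euc m) × Euc m =>
      localDiff p u (min ‖q.1.1‖ₑ 1) q.2 q.1.2 := (measurable_localDiff (p := p) hu).comp h1
  have h3 : Measurable fun q : (Euc m × Euc m) × Euc m =>
      (min ‖q.1.1‖ₑ 1 ^ m)⁻¹ * (‖q.1.1‖ₑ ^ α)⁻¹ * localDiff p u (min ‖q.1.1‖ₑ 1) q.2 q.1.2 :=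
    Measurable.mul (by fun_prop) h2
  have h4 : Measurable fun q : Euc m × Euc m => ∫⁻ ξ in Metric.ball (0 : Euc m) 1,
      (min ‖q.1‖ₑ 1 ^ m)⁻¹ * (‖q.1‖ₑ ^ α)⁻¹ * localDiff p u (min ‖q.1‖ₑ 1) ξ q.2 :=
    Measurable.lintegral_prod_right h3
  have h5 : ∀ w η : Euc m, Measurable fun ξ : Euc m => localDiff p u (min ‖w‖ₑ 1) ξ η :=
    fun w η => by
      have h6 : Measurable fun ξ : Euc m => (min ‖w‖ₑ 1, ξ, η) := by fun_prop
      exact (measurable_localDiff (p := p) hu).comp h6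
  have hc : (10 : ℝ≥0∞) ^ α ≠ 0 := (ENNReal.rpow_pos (by simp) (by simp)).ne'
  calc ∫⁻ w : Euc m, openingKernel α p u w
      = ∫⁻ w : Euc m, ∫⁻ η in Metric.ball (0 : Euc m) 1, ∫⁻ ξ in Metric.ball (0 : Euc m) 1,
        (min ‖w‖ₑ 1 ^ m)⁻¹ * (‖w‖ₑ ^ α)⁻¹ * localDiff p u (min ‖w‖ₑ 1) ξ η := by
        refine lintegral_congr fun w => ?_
        rw [openingKernel, totalOsc, ← lintegral_const_mul _ (measurable_localOsc hu _)]
        refine lintegral_congr fun η => ?_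
        rw [localOsc, ← lintegral_const_mul _ (h5 w η)]
    _ = ∫⁻ η in Metric.ball (0 : Euc m) 1, ∫⁻ w : Euc m, ∫⁻ ξ in Metric.ball (0 : Euc m) 1,
        (min ‖w‖ₑ 1 ^ m)⁻¹ * (‖w‖ₑ ^ α)⁻¹ * localDiff p u (min ‖w‖ₑ 1) ξ η :=
        lintegral_lintegral_swap h4.aemeasurable
    _ = ∫⁻ η in Metric.ball (0 : Euc m) 1, ∫⁻ ξ in Metric.ball (0 : Euc m) 1, ∫⁻ w : Euc m,
        (min ‖w‖ₑ 1 ^ m)⁻¹ * (‖w‖ₑ ^ α)⁻¹ * localDiff p u (min ‖w‖ₑ 1) ξ η := by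
        refine lintegral_congr fun η => lintegral_lintegral_swap ?_
        have h6 : Measurable fun q : Euc m × Euc m => ((q.1, η), q.2) := by fun_prop
        exact (h3.comp h6).aemeasurable
    _ ≤ ∫⁻ η in Metric.ball (0 : Euc m) 1, ∫⁻ ξ in Metric.ball (0 : Euc m) 1,
        10 ^ α * tailConst m α * (edist (u ξ) (u η) ^ p / edist ξ η ^ α) :=
        lintegral_mono fun η => lintegral_mono fun ξ => lintegral_localDiff_kernel_le hp ξ η
    _ = _ := by
        have h7 : Measurable fun q : Euc m × Euc m => edist (u q.2) (u q.1) ^ p / edist q.2 q.1 ^ α :=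
          (((hu.comp measurable_snd).edist (hu.comp measurable_fst)).pow_const _).div
            ((measurable_snd.edist measurable_fst).pow_const _)
        rw [← lintegral_const_mul _ (Measurable.lintegral_prod_right h7)]
        refine lintegral_congr fun η => ?_
        have h8 : Measurable fun ξ : Euc m => (η, ξ) := by fun_prop
        exact lintegral_const_mul _ (h7.comp h8)

/-- The constant in the opening estimate for fractional energies. -/
def openingConst (m : ℕ) (s p : ℝ) : ℝ≥0∞ :=
  2 * volume (Metric.ball (0 : Euc m) 3) *
    (2 ^ m * (volume (Metric.ball (0 : Euc m) 1))⁻¹ * (2 ^ p * reflectConst m)) *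
    (10 ^ ((m : ℝ) + s * p) * tailConst m ((m : ℝ) + s * p))

theorem openingConst_ne_top (hsp : 0 < s * p) (hp : 0 < p) : openingConst m s p ≠ ⊤ := by
  have h1 : tailConst m ((m : ℝ) + s * p) ≠ ⊤ :=
    (lintegral_compl_ball_rpow_lt_top _ (by rw [finrank_euclideanSpace_fin]; linarith)).ne
  have h2 : (volume (Metric.ball (0 : Euc m) 1))⁻¹ ≠ ⊤ :=
    ENNReal.inv_ne_top.2 (Metric.measure_ball_pos _ _ one_pos).ne'
  have h3 : reflectConst m ≠ ⊤ := by unfold reflectConst; simp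
  have h4 : volume (Metric.ball (0 : Euc m) 3) ≠ ⊤ := measure_ball_lt_top.ne
  have h5 : (2 : ℝ≥0∞) ^ p ≠ ⊤ := ENNReal.rpow_ne_top_of_nonneg hp.le (by simp)
  have h6 : (10 : ℝ≥0∞) ^ ((m : ℝ) + s * p) ≠ ⊤ :=
    ENNReal.rpow_ne_top_of_nonneg (by positivity) (by simp)
  unfold openingConst
  finiteness

theorem lintegral_openingMap_pair_le (hu : Measurable u) (hp : 1 ≤ p) {α : ℝ} (z z' : Euc m) :
    (∫⁻ a in Metric.ball (0 : Euc m) (1 / 2),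
        edist (u (openingMap a z)) (u (openingMap a z')) ^ p) * (edist z z' ^ α)⁻¹ ≤
      2 ^ m * (volume (Metric.ball (0 : Euc m) 1))⁻¹ * (2 ^ p * reflectConst m) *
        openingKernel α p u (z - z') := by
  have hp0 : 0 < p := by linarith
  rcases eq_or_ne z z' with rfl | hne
  · simp [ENNReal.zero_rpow_of_pos hp0]
  have hr : 0 < min ‖z - z'‖ 1 := lt_min (norm_pos_iff.2 (sub_ne_zero.2 hne)) one_pos
  have key := lintegral_openingMap_edist_le hu hp hr (min_le_right _ _) (z := z) (z' := z') rfl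
  have hρ : ENNReal.ofReal (min ‖z - z'‖ 1) = min ‖z - z'‖ₑ 1 := by
    rw [ENNReal.ofReal_min, ofReal_norm, ENNReal.ofReal_one]
  have hc : (ENNReal.ofReal (min ‖z - z'‖ 1 / 2) ^ m * volume (Metric.ball (0 : Euc m) 1))⁻¹ =
      2 ^ m * (volume (Metric.ball (0 : Euc m) 1))⁻¹ * (min ‖z - z'‖ₑ 1 ^ m)⁻¹ := by
    rw [ENNReal.mul_inv (by right; exact measure_ball_lt_top.ne)
      (by right; exact (Metric.measure_ball_pos _ _ one_pos).ne'),
      ENNReal.ofReal_div_of_pos (by norm_num), hρ, div_eq_mul_inv, mul_pow,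
      ENNReal.mul_inv (by right; simp) (by right; simp)]
    simp only [ENNReal.ofReal_ofNat, ← ENNReal.inv_pow, inv_inv]
    ring
  have hcne : ENNReal.ofReal (min ‖z - z'‖ 1 / 2) ^ m * volume (Metric.ball (0 : Euc m) 1) ≠ ⊤ :=
    ENNReal.mul_ne_top (by simp) measure_ball_lt_top.ne
  have hcn0 : ENNReal.ofReal (min ‖z - z'‖ 1 / 2) ^ m * volume (Metric.ball (0 : Euc m) 1) ≠ 0 :=
    mul_ne_zero (pow_ne_zero _ (by simpa using hr)) (Metric.measure_ball_pos _ _ one_pos).ne'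
  have key2 : ∫⁻ a in Metric.ball (0 : Euc m) (1 / 2),
      edist (u (openingMap a z)) (u (openingMap a z')) ^ p ≤
      (ENNReal.ofReal (min ‖z - z'‖ 1 / 2) ^ m * volume (Metric.ball (0 : Euc m) 1))⁻¹ *
      (2 ^ p * reflectConst m * totalOsc p u (min ‖z - z'‖ₑ 1)) := by
    rw [← ENNReal.div_eq_inv_mul, ENNReal.le_div_iff_mul_le (Or.inl hcn0) (Or.inl hcne), mul_comm,
      ← hρ]
    exact key
  rw [openingKernel, edist_eq_enorm_sub]
  calc _ ≤ _ := mul_le_mul_left key2 _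
    _ = _ := by rw [hc]; ring

theorem measurable_openingMap_pair {α : ℝ} (hu : Measurable u) :
    Measurable fun q : Euc m × (Euc m × Euc m) =>
      edist (u (openingMap q.1 q.2.1)) (u (openingMap q.1 q.2.2)) ^ p / edist q.2.1 q.2.2 ^ α := by
  have hm1 : Measurable fun q : Euc m × (Euc m × Euc m) =>
      edist (u (openingMap q.1 q.2.1)) (u (openingMap q.1 q.2.2)) ^ p := by
    have h1 : Measurable fun q : Euc m × (Euc m × Euc m) => openingMap q.1 q.2.1 :=
      (continuous_openingMap.comp
        (continuous_fst.prodMk (continuous_fst.comp continuous_snd))).measurable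
    have h2 : Measurable fun q : Euc m × (Euc m × Euc m) => openingMap q.1 q.2.2 :=
      (continuous_openingMap.comp
        (continuous_fst.prodMk (continuous_snd.comp continuous_snd))).measurable
    exact ((hu.comp h1).edist (hu.comp h2)).pow_const _
  exact hm1.div (Measurable.pow_const (by fun_prop) _)

/-- After averaging over a, the integrand at (z, z') is bounded by a function of z - z'. Translation
invariance then gives the integral of that function, times the volume of the set where one of the
two points has to be. -/
theorem lintegral_pairEnergy_openingMap_le (hu : Measurable u) (hp : 1 ≤ p) :
    ∫⁻ a in Metric.ball (0 : Euc m) (1 / 2), pairEnergy s p (fun z => u (openingMap a z)) ≤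
      openingConst m s p * ballEnergy s p u := by
  have hp0 : 0 < p := by linarith
  set α := (m : ℝ) + s * p with hα
  set K := 2 ^ m * (volume (Metric.ball (0 : Euc m) 1))⁻¹ * (2 ^ p * reflectConst m) with hK
  have hΦ := measurable_openingKernel (p := p) (α := α) hu
  have hm2 := measurable_openingMap_pair (p := p) (α := α) hu
  -- The opened maps are constant off the ball of radius 3, so a pair contributes only if one of its
  -- points is in that ball, that is, if b z + b z' ≥ 1.
  set b := (Metric.ball (0 : Euc m) 3).indicator (1 : Euc m → ℝ≥0∞) with hb
  have hbm : Measurable b := measurable_one.indicator Metric.isOpen_ball.measurableSet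
  have hpair : ∀ q : Euc m × Euc m, ∫⁻ a in Metric.ball (0 : Euc m) (1 / 2),
      edist (u (openingMap a q.1)) (u (openingMap a q.2)) ^ p / edist q.1 q.2 ^ α ≤
      (b q.1 + b q.2) * (K * openingKernel α p u (q.1 - q.2)) := fun q => by
    have hm3 : Measurable fun a => edist (u (openingMap a q.1)) (u (openingMap a q.2)) ^ p :=
by
      have h1 : ∀ z : Euc m, Measurable fun a : Euc m => openingMap a z := fun z =>
        (continuous_openingMap.comp (continuous_id.prodMk continuous_const)).measurable
      exact ((hu.comp (h1 q.1)).edist (hu.comp (h1 q.2))).pow_const _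
    simp only [div_eq_mul_inv]
    rw [lintegral_mul_const _ hm3]
    by_cases hq : q.1 ∈ Metric.ball (0 : Euc m) 3 ∨ q.2 ∈ Metric.ball (0 : Euc m) 3
    · refine (lintegral_openingMap_pair_le hu hp q.1 q.2).trans ?_
      have : 1 ≤ b q.1 + b q.2 := by
        rcases hq with h | h
        · rw [hb, indicator_of_mem h]; exact le_self_add
        · rw [hb, indicator_of_mem h]; exact le_add_self
      calc _ = 1 * (K * openingKernel α p u (q.1 - q.2)) := (one_mul _).symm
        _ ≤ _ := mul_le_mul_left this _
    · push Not at hq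
      have h1 : 3 ≤ ‖q.1‖ := by simpa using hq.1
      have h2 : 3 ≤ ‖q.2‖ := by simpa using hq.2
      simp [openingMap_of_ge _ h1, openingMap_of_ge _ h2, ENNReal.zero_rpow_of_pos hp0]
  have hsym : ∫⁻ q : Euc m × Euc m, (b q.1 + b q.2) * (K * openingKernel α p u (q.1 - q.2))
      ∂(volume.prod volume) =
      2 * volume (Metric.ball (0 : Euc m) 3) * K * ∫⁻ w, openingKernel α p u w := by
    have hm4 : Measurable fun q : Euc m × Euc m => K * openingKernel α p u (q.1 - q.2) :=
by
      have hs : Measurable fun q : Euc m × Euc m => q.1 - q.2 := by fun_prop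
      exact (hΦ.comp hs).const_mul _
    have hbi : ∫⁻ z, b z = volume (Metric.ball (0 : Euc m) 3) :=
      lintegral_indicator_one Metric.isOpen_ball.measurableSet
    simp only [add_mul]
    have hm5 : Measurable fun q : Euc m × Euc m =>
        b q.1 * (K * openingKernel α p u (q.1 - q.2)) := (hbm.comp measurable_fst).mul hm4
    have hm6 : Measurable fun q : Euc m × Euc m =>
        b q.2 * (K * openingKernel α p u (q.1 - q.2)) := (hbm.comp measurable_snd).mul hm4
    rw [lintegral_add_left hm5, lintegral_prod _ hm5.aemeasurable,
      lintegral_prod_symm _ hm6.aemeasurable]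
    have e1 : ∀ z, ∫⁻ z', b z * (K * openingKernel α p u (z - z')) =
        b z * (K * ∫⁻ w, openingKernel α p u w) := fun z => by
      have hs : Measurable fun z' : Euc m => openingKernel α p u (z - z') :=
        hΦ.comp (by fun_prop)
      rw [lintegral_const_mul _ (hs.const_mul _),
        lintegral_const_mul _ hs,
        lintegral_sub_left_eq_self (μ := volume) (openingKernel α p u) z]
    have e2 : ∀ z', ∫⁻ z, b z' * (K * openingKernel α p u (z - z')) =
        b z' * (K * ∫⁻ w, openingKernel α p u w) := fun z' => by
      have hs : Measurable fun z : Euc m => openingKernel α p u (z - z') :=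
        hΦ.comp (by fun_prop)
      rw [lintegral_const_mul _ (hs.const_mul _),
        lintegral_const_mul _ hs,
        lintegral_sub_right_eq_self (μ := volume) (openingKernel α p u) z']
    simp_rw [e1, e2]
    rw [lintegral_mul_const _ hbm, hbi]
    ring
  calc _ = ∫⁻ q : Euc m × Euc m, (∫⁻ a in Metric.ball (0 : Euc m) (1 / 2),
        edist (u (openingMap a q.1)) (u (openingMap a q.2)) ^ p / edist q.1 q.2 ^ α)
        ∂(volume.prod volume) := lintegral_lintegral_swap hm2.aemeasurable
    _ ≤ _ := lintegral_mono hpair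
    _ ≤ _ := by
      rw [hsym]
      refine (mul_le_mul_right (lintegral_openingKernel_le hu hp0) _).trans (le_of_eq ?_)
      rw [openingConst, ballEnergy, ← hK, ← hα]
      ring

end FractionalOpening

/-! ### Distances recovered from countably many distance functions. -/

section DistanceFunctions

variable {N : Type*} [EMetricSpace N]

theorem lipschitzWith_toReal_edist (hfin : ∀ x y : N, edist x y ≠ ⊤) (y : N) :
    LipschitzWith 1 fun x => (edist x y).toReal := fun a b => by
  rw [ENNReal.coe_one, one_mul, edist_dist, Real.dist_eq, ← ENNReal.ofReal_toReal (hfin a b)]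
  refine ENNReal.ofReal_le_ofReal (abs_sub_le_iff.2 ⟨?_, ?_⟩)
  · have := ENNReal.toReal_mono (ENNReal.add_ne_top.2 ⟨hfin a b, hfin b y⟩) (edist_triangle a b y)
    rw [ENNReal.toReal_add (hfin a b) (hfin b y)] at this
    linarith
  · have := ENNReal.toReal_mono (ENNReal.add_ne_top.2 ⟨hfin b a, hfin a y⟩) (edist_triangle b a y)
    rw [ENNReal.toReal_add (hfin b a) (hfin a y), edist_comm b a] at this
    linarith

/-- The distance functions to the points of a dense set embed N isometrically: a point y of the set
close to a gives the distance of a and b up to an error. Countably many scalar inequalities thus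
control a map into N. -/
theorem edist_le_of_forall_dense (hfin : ∀ x y : N, edist x y ≠ ⊤) {D : Set N} (hD : Dense D)
    {a b : N} {T : ℝ≥0∞} (h : ∀ y ∈ D, ‖(edist b y).toReal - (edist a y).toReal‖ₑ ≤ T) :
    edist a b ≤ T := by
  refine ENNReal.le_of_forall_pos_le_add fun ε hε _ => ?_
  obtain ⟨y, hyD, hy⟩ := EMetric.mem_closure_iff.1 (hD a) (ε / 2 : NNReal)
    (by exact_mod_cast half_pos hε)
  have h1 : edist b y ≤ edist a y + T := by
    refine le_trans ?_ (add_le_add le_rfl (h y hyD))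
    rw [← ENNReal.ofReal_toReal (hfin b y), ← ENNReal.ofReal_toReal (hfin a y), ← ofReal_norm,
      ← ENNReal.ofReal_add ENNReal.toReal_nonneg (norm_nonneg _)]
    refine ENNReal.ofReal_le_ofReal ?_
    have := le_abs_self ((edist b y).toReal - (edist a y).toReal)
    rw [← Real.norm_eq_abs] at this
    simp only [ENNReal.toReal_ofReal ENNReal.toReal_nonneg]
    linarith
  calc edist a b ≤ edist a y + edist y b := edist_triangle _ _ _
    _ ≤ edist a y + (edist a y + T) := by rw [edist_comm y b]; gcongr
    _ ≤ (ε / 2 : NNReal) + ((ε / 2 : NNReal) + T) := by gcongr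
    _ = T + ε := by
      rw [← add_assoc, ← ENNReal.coe_add, add_halves, add_comm]

end DistanceFunctions

/-! ### Opening for first order energies. -/

section DirichletOpening

open Filter Topology

variable {m : ℕ}

theorem HasWeakDifferentialOn.hasWeakFDerivOn {h : Euc m → ℝ}
    {dh : ∀ x : Euc m, TangentSpace (modelWithCornersSelf ℝ (Euc m)) x →L[ℝ] ℝ} {A : Set (Euc m)}
    (H : HasWeakDifferentialOn m h dh A) : HasWeakFDerivOn h dh A := by
  have h0 : OpenPartialHomeomorph.refl (Euc m) ∈ atlas (Euc m) (Euc m) := by simp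
  have hid : ∀ (y v : Euc m), (mfderiv (modelWithCornersSelf ℝ (Euc m))
      (modelWithCornersSelf ℝ (Euc m)) (OpenPartialHomeomorph.refl (Euc m)).symm y) v = v :=
    fun y v => by
      change (mfderiv (modelWithCornersSelf ℝ (Euc m)) (modelWithCornersSelf ℝ (Euc m)) id y) v = v
      rw [mfderiv_id]
      rfl
  have hset : ((OpenPartialHomeomorph.refl (Euc m)).target ∩
      (OpenPartialHomeomorph.refl (Euc m)).symm ⁻¹' A) = A := by simp
  refine ⟨?_, fun v => ?_, fun v ψ hψ hc hs => ?_⟩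
  · have := H.locallyIntegrableOn _ h0
    rw [hset] at this
    exact this
  · have := H.locallyIntegrableOn_differential _ h0 v
    simp only [hid] at this
    rw [hset] at this
    exact this
  · have := H.integral_eq _ h0 v ψ hψ hc (by rwa [hset])
    simp only [hid] at this
    exact this

theorem HasWeakFDerivOn.congr_ae {h h' : Euc m → ℝ} {D : Euc m → Euc m →L[ℝ] ℝ} {A : Set (Euc m)}
    (H : HasWeakFDerivOn h D A) (hA : MeasurableSet A) (hh : h =ᵐ[volume.restrict A] h') :
    HasWeakFDerivOn h' D A where
  locallyIntegrableOn := fun x hx => by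
    obtain ⟨U, hU, hi⟩ := H.locallyIntegrableOn x hx
    refine ⟨U ∩ A, inter_mem hU self_mem_nhdsWithin, ?_⟩
    refine (hi.mono_set inter_subset_left).congr ?_
    exact ae_mono (Measure.restrict_mono inter_subset_right le_rfl) hh
  locallyIntegrableOn_deriv := H.locallyIntegrableOn_deriv
  integral_eq v ψ hψ hc hs := by
    rw [← H.integral_eq v ψ hψ hc hs]
    refine integral_congr_ae ?_
    filter_upwards [(ae_restrict_iff' hA).1 hh] with x hx
    by_cases hxA : x ∈ A
    · rw [hx hxA]
    · have h5 : fderiv ℝ ψ x = 0 := by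
        by_contra h
        exact hxA (hs (support_fderiv_subset ℝ h))
      simp [h5]

/-- The cutoff accompanying the opening map. -/
def openingCutoff (x : Euc m) : ℝ := max 0 (min 1 (7 - 2 * ‖x‖))

theorem continuous_openingCutoff : Continuous (openingCutoff : Euc m → ℝ) := by
  unfold openingCutoff; fun_prop

theorem openingCutoff_nonneg (x : Euc m) : 0 ≤ openingCutoff x := le_max_left _ _

theorem openingCutoff_le_one (x : Euc m) : openingCutoff x ≤ 1 :=
  max_le zero_le_one (min_le_left _ _)

theorem openingCutoff_of_le {x : Euc m} (hx : ‖x‖ ≤ 3) : openingCutoff x = 1 := by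
  rw [openingCutoff, min_eq_left (by linarith), max_eq_right zero_le_one]

theorem openingCutoff_of_ge {x : Euc m} (hx : 7 / 2 ≤ ‖x‖) : openingCutoff x = 0 := by
  rw [openingCutoff, max_eq_left ((min_le_right _ _).trans (by linarith))]

/-- Outside the closed ball of radius 3 the opening map is locally constant, so the speed bound may
be multiplied by a cutoff. The cutoff is continuous, as the curve inequality demands, and makes the
final upper gradient vanish far away. -/
theorem openingMap_speed (a v z : Euc m) (τ : ℝ) : ∀ᶠ s in 𝓝[>] τ,
    ‖openingMap a (z + s • v) - openingMap a (z + τ • v)‖ ≤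
      9 * ‖v‖ * openingCutoff (z + τ • v) * (s - τ) := by
  by_cases hx : ‖z + τ • v‖ ≤ 3
  · filter_upwards [self_mem_nhdsWithin] with s hs
    have hs' : 0 < s - τ := sub_pos.2 hs
    rw [openingCutoff_of_le hx]
    refine (norm_openingMap_sub_le _ _ _).trans (le_of_eq ?_)
    rw [add_sub_add_left_eq_sub, ← sub_smul, norm_smul, Real.norm_of_nonneg hs'.le]
    ring
  · push Not at hx
    have h1 : ∀ᶠ s in 𝓝 τ, 3 < ‖z + s • v‖ := by
      have : Continuous fun s : ℝ => ‖z + s • v‖ := by fun_prop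
      exact this.continuousAt.eventually (lt_mem_nhds hx)
    filter_upwards [nhdsWithin_le_nhds h1, self_mem_nhdsWithin] with s h2 hs
    have hs' : 0 < s - τ := sub_pos.2 hs
    rw [openingMap_of_ge a h2.le, openingMap_of_ge a hx.le, sub_self, norm_zero]
    have := openingCutoff_nonneg (z + τ • v)
    positivity

/-- The bound of the variation of the opened map along segments. -/
def openedBound (g : Euc m → ℝ≥0∞) (a z : Euc m) : ℝ≥0∞ :=
  ENNReal.ofReal (9 * openingCutoff z) * g (openingMap a z)

theorem continuous_openingMap_right (a : Euc m) : Continuous (openingMap a) := by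
  have h : Continuous fun z : Euc m => (a, z) := by fun_prop
  exact continuous_openingMap.comp h

theorem continuous_openingCurve : Continuous fun q : (Euc m × (Euc m × Euc m)) × ℝ =>
    openingMap q.1.1 (q.1.2.2 + q.2 • q.1.2.1) := by
  have h : Continuous fun q : (Euc m × (Euc m × Euc m)) × ℝ =>
    (q.1.1, q.1.2.2 + q.2 • q.1.2.1) := by fun_prop
  exact continuous_openingMap.comp h

theorem continuous_openingCurve_left (τ : ℝ) : Continuous fun q : Euc m × (Euc m × Euc m) =>
    openingMap q.1 (q.2.2 + τ • q.2.1) := by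
  have h : Continuous fun q : Euc m × (Euc m × Euc m) => (q.1, q.2.2 + τ • q.2.1) := by fun_prop
  exact continuous_openingMap.comp h

theorem continuous_openingCurve_right (q : Euc m × (Euc m × Euc m)) : Continuous fun τ : ℝ =>
    openingMap q.1 (q.2.2 + τ • q.2.1) := by
  have h : Continuous fun τ : ℝ => (q.1, q.2.2 + τ • q.2.1) := by fun_prop
  exact continuous_openingMap.comp h

theorem continuous_openingSpeed : Continuous fun q : (Euc m × (Euc m × Euc m)) × ℝ =>
    9 * ‖q.1.2.1‖ * openingCutoff (q.1.2.2 + q.2 • q.1.2.1) := by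
  have h : Continuous fun q : (Euc m × (Euc m × Euc m)) × ℝ => q.1.2.2 + q.2 • q.1.2.1 := by
    fun_prop
  have h1 : Continuous fun q : (Euc m × (Euc m × Euc m)) × ℝ => 9 * ‖q.1.2.1‖ := by fun_prop
  exact h1.mul (continuous_openingCutoff.comp h)

theorem continuous_openingSpeed_right (q : Euc m × (Euc m × Euc m)) : Continuous fun τ : ℝ =>
    9 * ‖q.2.1‖ * openingCutoff (q.2.2 + τ • q.2.1) := by
  have h : Continuous fun τ : ℝ => q.2.2 + τ • q.2.1 := by fun_prop
  exact continuous_const.mul (continuous_openingCutoff.comp h)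

variable {N : Type*} [EMetricSpace N] [SecondCountableTopology N]

/-- The images of segments under the opening maps form a family of curves indexed by (a, (direction,
base point)). Averaging over a shows that at each time it does not charge small sets too much, so
the curve inequality holds for almost every index; it is used for the distance functions to a
countable dense set. -/
theorem ae_segmentBound_openingMap (hfin : ∀ x y : N, edist x y ≠ ⊤) {u : Euc m → N}
    {g : Euc m → ℝ≥0∞} (hg : Measurable g) (hgI : ∫⁻ x in Metric.ball (0 : Euc m) 1, g x ≠ ⊤)
    (hu : ∀ f : N → ℝ, LipschitzWith 1 f → ∃ D : Euc m → Euc m →L[ℝ] ℝ,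
      HasWeakFDerivOn (fun x => f (u x)) D (Metric.ball 0 1) ∧
        ∀ᵐ x ∂(volume.restrict (Metric.ball (0 : Euc m) 1)), ∀ v, ‖D x v‖ₑ ≤ g x * ‖v‖ₑ) :
    ∀ᵐ a ∂(volume.restrict (Metric.ball (0 : Euc m) (1 / 2))),
      SegmentBound (fun z => u (openingMap a z)) (openedBound g a) := by
  obtain ⟨D, hDc, hD⟩ := TopologicalSpace.exists_countable_dense N
  set A := Metric.ball (0 : Euc m) (1 / 2) with hA
  -- Segments are restricted to a bounded set of directions and base points, which makes both the
  -- speeds and the total mass of the family bounded.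
  have key : ∀ R : ℕ, ∀ᵐ a ∂(volume.restrict A),
      ∀ᵐ z : Euc m × Euc m ∂(volume.prod volume), z ∈ Metric.ball (0 : Euc m × Euc m) R →
        edist (u (openingMap a z.2)) (u (openingMap a (z.2 + z.1))) ≤
          ‖z.1‖ₑ * ∫⁻ τ in Icc (0 : ℝ) 1, openedBound g a (z.2 + τ • z.1) := by
    intro R
    have hBm : MeasurableSet (Metric.ball (0 : Euc m × Euc m) R) :=
      Metric.isOpen_ball.measurableSet
    set ν : Measure (Euc m × Euc m) :=
      ((volume : Measure (Euc m)).prod volume).restrict (Metric.ball 0 R) with hν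
    have hνt : ν univ ≠ ⊤ := by
      rw [hν, Measure.restrict_apply_univ]; exact measure_ball_lt_top.ne
    have h1 : ∀ y ∈ D, ∀ᵐ q ∂((volume.restrict A).prod ν),
        ‖(edist (u (openingMap q.1 (q.2.2 + (1 : ℝ) • q.2.1))) y).toReal -
          (edist (u (openingMap q.1 (q.2.2 + (0 : ℝ) • q.2.1))) y).toReal‖ₑ ≤
        ∫⁻ τ in Icc (0 : ℝ) 1,
          ENNReal.ofReal (9 * ‖q.2.1‖ * openingCutoff (q.2.2 + τ • q.2.1)) *
            g (openingMap q.1 (q.2.2 + τ • q.2.1)) := by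
      intro y _
      obtain ⟨Dy, hDy, hDyg⟩ := hu _ (lipschitzWith_toReal_edist hfin y)
      refine HasWeakFDerivOn.enorm_sub_le_lintegral_curve hDy hg hgI hDyg
        (Z := Euc m × (Euc m × Euc m)) (ζ := (volume.restrict A).prod ν)
        (γ := fun q τ => openingMap q.1 (q.2.2 + τ • q.2.1))
        (l := fun q τ => 9 * ‖q.2.1‖ * openingCutoff (q.2.2 + τ • q.2.1))
        continuous_openingCurve.measurable continuous_openingSpeed.measurable
        continuous_openingCurve_right continuous_openingSpeed_right
        (fun q τ => mul_nonneg (by positivity) (openingCutoff_nonneg _)) (L := 9 * R) ?_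
        (fun q τ => norm_openingMap_le _ _) (fun q τ => openingMap_speed _ _ _ _)
        (C := ν univ * reflectConst m)
        (ENNReal.mul_ne_top hνt (by unfold reflectConst; simp)) ?_
      · have h2 : ∀ᵐ q ∂((volume.restrict A).prod ν), q.2 ∈ Metric.ball (0 : Euc m × Euc m) R :=
          Measure.quasiMeasurePreserving_snd.ae (ae_restrict_mem hBm)
        filter_upwards [h2] with q hq τ
        have h3 : ‖q.2.1‖ ≤ R :=
          (norm_fst_le q.2).trans (by simpa using (mem_ball_zero_iff.1 hq).le)
        calc 9 * ‖q.2.1‖ * openingCutoff (q.2.2 + τ • q.2.1) ≤ 9 * R * 1 :=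
              mul_le_mul (by linarith) (openingCutoff_le_one _) (openingCutoff_nonneg _)
                (by positivity)
          _ = 9 * R := mul_one _
      · intro τ F hF
        have hFm : Measurable fun q : Euc m × (Euc m × Euc m) =>
            F (openingMap q.1 (q.2.2 + τ • q.2.1)) :=
          hF.comp (continuous_openingCurve_left τ).measurable
        rw [lintegral_prod_symm _ hFm.aemeasurable]
        refine (lintegral_mono fun q : Euc m × Euc m =>
          lintegral_openingMap_le hF (q.2 + τ • q.1)).trans (le_of_eq ?_)
        rw [lintegral_const, mul_comm, mul_assoc]
    have h2 := (ae_ball_iff hDc).2 h1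
    have h3 := Measure.ae_ae_of_ae_prod h2
    filter_upwards [h3] with a ha
    rw [hν, ae_restrict_iff' hBm] at ha
    filter_upwards [ha] with z hz hzR
    refine edist_le_of_forall_dense hfin hD fun y hy => ?_
    have h4 := hz hzR y hy
    rw [one_smul, zero_smul, add_zero] at h4
    refine h4.trans (le_of_eq ?_)
    rw [← lintegral_const_mul' _ _ (by simp)]
    refine lintegral_congr fun τ => ?_
    rw [openedBound, ← mul_assoc, ← ofReal_norm, ← ENNReal.ofReal_mul (norm_nonneg _)]
    congr 2; ring
  filter_upwards [ae_all_iff.2 key] with a ha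
  filter_upwards [ae_all_iff.2 ha] with z hz
  obtain ⟨R, hR⟩ := exists_nat_gt ‖z‖
  exact hz R (by simpa using hR)

theorem lintegral_openedBound_rpow_le {p : ℝ} (hp : 0 < p) {g : Euc m → ℝ≥0∞} (hg : Measurable g) :
    ∫⁻ a in Metric.ball (0 : Euc m) (1 / 2), ∫⁻ z, openedBound g a z ^ p ≤
      9 ^ p * volume (Metric.ball (0 : Euc m) 4) * reflectConst m *
        ∫⁻ x in Metric.ball (0 : Euc m) 1, g x ^ p := by
  have hm : Measurable fun q : Euc m × Euc m => 9 ^ p * g (openingMap q.1 q.2) ^ p :=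
    ((hg.comp continuous_openingMap.measurable).pow_const p).const_mul _
  calc _ ≤ ∫⁻ a in Metric.ball (0 : Euc m) (1 / 2), ∫⁻ z in Metric.ball (0 : Euc m) 4,
        9 ^ p * g (openingMap a z) ^ p := by
        refine lintegral_mono fun a => ?_
        rw [← lintegral_indicator Metric.isOpen_ball.measurableSet]
        refine lintegral_mono fun z => ?_
        by_cases hz : z ∈ Metric.ball (0 : Euc m) 4
        · rw [indicator_of_mem hz, openedBound, ENNReal.mul_rpow_of_nonneg _ _ hp.le]
          gcongr
          rw [show (9 : ℝ≥0∞) = ENNReal.ofReal 9 by simp]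
          exact ENNReal.ofReal_le_ofReal (by linarith [openingCutoff_le_one z])
        · have : 4 ≤ ‖z‖ := by simpa using hz
          rw [openedBound, openingCutoff_of_ge (by linarith)]
          simp [ENNReal.zero_rpow_of_pos hp]
    _ = ∫⁻ z in Metric.ball (0 : Euc m) 4, ∫⁻ a in Metric.ball (0 : Euc m) (1 / 2),
        9 ^ p * g (openingMap a z) ^ p := lintegral_lintegral_swap hm.aemeasurable
    _ ≤ ∫⁻ z in Metric.ball (0 : Euc m) 4,
        9 ^ p * (reflectConst m * ∫⁻ x in Metric.ball (0 : Euc m) 1, g x ^ p) := by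
        refine lintegral_mono fun z => ?_
        rw [lintegral_const_mul' _ _ (ENNReal.rpow_ne_top_of_nonneg hp.le (by simp))]
        gcongr
        exact lintegral_openingMap_le (hg.pow_const p) z
    _ = _ := by rw [setLIntegral_const]; ring

end DirichletOpening

/-! ### Choice of the parameter and extension of maps from the unit ball. -/

section Opening

open Filter Topology

/-- Chebyshev's argument, compatible with a property holding almost everywhere. The strict
inequality E < e and the constant K + 1 rather than K take care of K = 0 and of E = 0. -/
theorem exists_mem_le_of_setLIntegral_le {α : Type*} [MeasurableSpace α] {μ : Measure α}
    {A : Set α} (hA : MeasurableSet A) (h0 : μ A ≠ 0) (ht : μ A ≠ ⊤) {P : α → Prop}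
    (hP : ∀ᵐ a ∂(μ.restrict A), P a) {f : α → ℝ≥0∞} {K E e : ℝ≥0∞} (hK : K ≠ ⊤)
    (hf : ∫⁻ a in A, f a ∂μ ≤ K * E) (he : E < e) :
    ∃ a ∈ A, P a ∧ f a ≤ (K + 1) / μ A * e := by
  by_contra! hcon
  have h1 : ∫⁻ a in A, (K + 1) / μ A * e ∂μ ≤ ∫⁻ a in A, f a ∂μ := by
    refine lintegral_mono_ae ?_
    filter_upwards [hP, ae_restrict_mem hA] with a ha haA using (hcon a haA ha).le
  rw [setLIntegral_const, mul_right_comm, ENNReal.div_mul_cancel h0 ht] at h1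
  have h2 : (K + 1) * e ≤ (K + 1) * E := h1.trans (hf.trans (by gcongr; exact le_self_add))
  exact absurd ((ENNReal.mul_le_mul_iff_right (by simp) (by simp [hK])).1 h2) (not_le.2 he)

variable {m : ℕ} {N : Type*} [EMetricSpace N] [MeasurableSpace N]

theorem sobolevEnergy_of_ne {M : Type*} [EMetricSpace M] [MeasurableSpace M] [BorelSpace M]
    [ChartedSpace (EuclideanSpace ℝ (Fin m)) M]
    [RiemannianBundle (fun x : M => TangentSpace (𝓡 m) x)] {s p : ℝ} (hs : s ≠ 1) (u : M → N)
    (A : Set M) : sobolevEnergy m s p u A = gagliardoEnergy m s p u A := if_neg hs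

theorem gagliardoEnergy_congr_ae {M : Type*} [EMetricSpace M] [MeasurableSpace M] [BorelSpace M]
    {s p : ℝ} {u u' : M → N} {A : Set M} (h : u =ᵐ[(μHE[m] : Measure M).restrict A] u') :
    gagliardoEnergy m s p u A = gagliardoEnergy m s p u' A := by
  refine lintegral_congr_ae ?_
  filter_upwards [h] with y hy
  refine lintegral_congr_ae ?_
  filter_upwards [h] with x hx
  rw [hx, hy]

theorem exists_bound_of_dirichletEnergy_lt {p : ℝ} {u u' : Euc m → N} {A : Set (Euc m)}
    (hA : MeasurableSet A) (hu : u =ᵐ[volume.restrict A] u') {e : ℝ≥0∞}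
    (he : dirichletEnergy m p u A < e) : ∃ g : Euc m → ℝ≥0∞, Measurable g ∧
      ∫⁻ x in A, g x ^ p < e ∧ ∀ f : N → ℝ, LipschitzWith 1 f → ∃ D : Euc m → Euc m →L[ℝ] ℝ,
        HasWeakFDerivOn (fun x => f (u' x)) D A ∧
          ∀ᵐ x ∂(volume.restrict A), ∀ v, ‖D x v‖ₑ ≤ g x * ‖v‖ₑ := by
  rw [dirichletEnergy, EuclideanSpace.euclideanHausdorffMeasure_eq_volume] at he
  simp only [iInf_lt_iff] at he
  obtain ⟨g, hg, hgu, hge⟩ := he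
  refine ⟨hg.mk, hg.measurable_mk, lt_of_le_of_lt (le_of_eq (lintegral_congr_ae ?_)) hge,
    fun f hf => ?_⟩
  · filter_upwards [hg.ae_eq_mk] with x hx
    rw [hx]
  · obtain ⟨dh, hdh, hb⟩ := hgu f hf
    refine ⟨dh, hdh.hasWeakFDerivOn.congr_ae hA ?_, ?_⟩
    · filter_upwards [hu] with x hx
      rw [hx]
    · rw [EuclideanSpace.euclideanHausdorffMeasure_eq_volume] at hb
      filter_upwards [hb, hg.ae_eq_mk] with x hx hgx v
      rw [← hgx]
      exact (hx v).trans_eq (congrArg (g x * ·) (enorm_tangentSpace_vectorSpace (x := x)))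

variable [BorelSpace N] [SecondCountableTopology N]

/-- For a good parameter a, the map z ↦ u (`openingMap a (z + a)`) agrees with u on the unit ball.
It is constant once ‖z + a‖ ≥ 3, in particular for ‖z‖ ≥ 4; the energy bound lives in the ball of
radius 7/2 before translation, and 7/2 + 1/2 = 4. -/
theorem exists_opening {s p : ℝ} (hs : s ∈ Ioc (0 : ℝ) 1) (hp : 1 ≤ p)
    (hfin : ∀ x y : N, edist x y ≠ ⊤) : ∃ C : ℝ≥0∞, C ≠ ⊤ ∧ ∀ u : Euc m → N,
    AEMeasurable u ((μHE[m] : Measure (Euc m)).restrict (Metric.ball 0 1)) → ∀ e : ℝ≥0∞,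
      sobolevEnergy m s p u (Metric.ball 0 1) < e → ∃ (v : Euc m → N) (b : N),
        (∀ x ∈ Metric.ball 0 1, v x = u x) ∧ (∀ x ∉ Metric.ball 0 4, v x = b) ∧
          HasEnergyLE s p v (Metric.ball 0 4) (C * e) := by
  have hp0 : 0 < p := by linarith
  set A := Metric.ball (0 : Euc m) (1 / 2) with hA
  have hAm : MeasurableSet A := Metric.isOpen_ball.measurableSet
  have hA0 : (volume : Measure (Euc m)) A ≠ 0 := (Metric.measure_ball_pos _ _ (by norm_num)).ne'
  have hAt : (volume : Measure (Euc m)) A ≠ ⊤ := measure_ball_lt_top.ne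
  have hB4 : (volume : Measure (Euc m)) (Metric.ball 0 4) ≠ ⊤ := measure_ball_lt_top.ne
  have hBm : MeasurableSet (Metric.ball (0 : Euc m) 1) := Metric.isOpen_ball.measurableSet
  obtain ⟨K, hK, hopen⟩ : ∃ K : ℝ≥0∞, K ≠ ⊤ ∧ ∀ u u' : Euc m → N, Measurable u' →
      u =ᵐ[volume.restrict (Metric.ball 0 1)] u' → ∀ e : ℝ≥0∞,
      sobolevEnergy m s p u (Metric.ball 0 1) < e → ∃ a ∈ A,
        HasEnergyLE s p (fun z => u' (openingMap a z)) (Metric.ball 0 (7 / 2))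
          ((K + 1) / volume A * e) := by
    rcases eq_or_ne s 1 with h1 | h1
    · refine ⟨9 ^ p * volume (Metric.ball (0 : Euc m) 4) * reflectConst m,
        ENNReal.mul_ne_top (ENNReal.mul_ne_top (by simp [hp0.le]) hB4)
          (by unfold reflectConst; simp), fun u u' hu' huu e he => ?_⟩
      rw [h1, sobolevEnergy, if_pos rfl] at he
      obtain ⟨g, hg, hge, hgu⟩ := exists_bound_of_dirichletEnergy_lt hBm huu he
      -- Since p ≥ 1, g ≤ 1 + g^p.
      have hgI : ∫⁻ x in Metric.ball (0 : Euc m) 1, g x ≠ ⊤ := by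
        refine ne_top_of_le_ne_top (b := ∫⁻ x in Metric.ball (0 : Euc m) 1, (1 + g x ^ p)) ?_
          (lintegral_mono fun x => ?_)
        · rw [lintegral_add_left measurable_const]
          refine ENNReal.add_ne_top.2 ⟨?_, hge.ne_top⟩
          rw [setLIntegral_const]
          exact ENNReal.mul_ne_top (by simp) measure_ball_lt_top.ne
        · rcases le_total (g x) 1 with h | h
          · exact h.trans le_self_add
          · calc g x = g x ^ (1 : ℝ) := (ENNReal.rpow_one _).symm
              _ ≤ g x ^ p := ENNReal.rpow_le_rpow_of_exponent_le h hp
              _ ≤ _ := le_add_self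
      obtain ⟨a, haA, ha, hae⟩ := exists_mem_le_of_setLIntegral_le hAm hA0 hAt
        (ae_segmentBound_openingMap hfin hg hgI hgu) (by
          exact ENNReal.mul_ne_top (ENNReal.mul_ne_top (by simp [hp0.le]) hB4)
            (by unfold reflectConst; simp)) (lintegral_openedBound_rpow_le hp0 hg) hge
      refine ⟨a, haA, (hu'.comp (continuous_openingMap_right a).measurable).aemeasurable,
        fun _ => ⟨openedBound g a, ?_, fun x hx => ?_, ha, hae⟩, fun h => absurd h1 h⟩
      · refine Measurable.mul ?_ (hg.comp (continuous_openingMap_right a).measurable)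
        exact (continuous_openingCutoff.measurable.const_mul 9).ennreal_ofReal
      · have : 7 / 2 ≤ ‖x‖ := by simpa using hx
        rw [openedBound, openingCutoff_of_ge this]; simp
    · refine ⟨openingConst m s p, openingConst_ne_top (mul_pos hs.1 hp0) hp0,
        fun u u' hu' huu e he => ?_⟩
      have huu' : u =ᵐ[(μHE[m] : Measure (Euc m)).restrict (Metric.ball 0 1)] u' := by
        rwa [EuclideanSpace.euclideanHausdorffMeasure_eq_volume]
      rw [sobolevEnergy_of_ne h1, gagliardoEnergy_congr_ae huu', gagliardoEnergy, EuclideanSpace.euclideanHausdorffMeasure_eq_volume] at he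
      change ballEnergy s p u' < e at he
      obtain ⟨a, haA, _, hae⟩ := exists_mem_le_of_setLIntegral_le hAm hA0 hAt (P := fun _ => True)
        (by simp) (openingConst_ne_top (mul_pos hs.1 hp0) hp0)
        (lintegral_pairEnergy_openingMap_le (s := s) hu' hp) he
      exact ⟨a, haA, (hu'.comp (continuous_openingMap_right a).measurable).aemeasurable,
        fun h => absurd h h1, fun _ => hae⟩
  refine ⟨(K + 1) / volume A, ENNReal.div_ne_top (by simp [hK]) hA0, fun u hu e he => ?_⟩
  rw [EuclideanSpace.euclideanHausdorffMeasure_eq_volume] at hu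
  obtain ⟨a, haA, ha⟩ := hopen u (AEMeasurable.mk u hu) hu.measurable_mk hu.ae_eq_mk e he
  have ha2 : ‖a‖ < 1 / 2 := by simpa [hA] using haA
  classical
  have h2 := ha.comp_inv_smul_sub hp0 (-a) one_pos
  -- The opening uses a measurable representative of u. Liftings are constrained at every point, so
  -- u itself is restored on the unit ball; this only changes the map on a null set.
  refine ⟨fun x => if x ∈ Metric.ball (0 : Euc m) 1 then u x else AEMeasurable.mk u hu (openingMap a (x + a)),
    AEMeasurable.mk u hu (reflectBall (-a)), fun x hx => if_pos hx, fun x hx => ?_, ?_⟩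
  · have hx4 : 4 ≤ ‖x‖ := by simpa using hx
    have hx1 : x ∉ Metric.ball (0 : Euc m) 1 := by simp; linarith
    refine (if_neg hx1).trans ?_
    rw [openingMap_of_ge]
    have := norm_sub_le (x + a) a
    rw [add_sub_cancel_right] at this
    linarith
  · refine (h2.mono (S' := Metric.ball 0 4) (e' := (K + 1) / volume A * e) ?_ ?_).congr_ae ?_
    · intro x hx
      simp only [inv_one, one_smul, sub_neg_eq_add, mem_preimage, mem_ball_zero_iff] at hx ⊢
      have := norm_sub_le (x + a) a
      rw [add_sub_cancel_right] at this
      linarith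
    · simp
    · filter_upwards [(ae_restrict_iff' hBm).1 hu.ae_eq_mk] with x hx
      simp only [inv_one, one_smul, sub_neg_eq_add]
      split_ifs with h
      · rw [hx h, openingMap_add_of_le ha2.le (by simpa using (mem_ball_zero_iff.1 h).le)]
      · rfl

end Opening

/-! ### Charts are locally bi-Lipschitz for the geodesic distance. -/

section Charts
open Filter Topology Manifold
variable {m : ℕ} {M : Type*} [EMetricSpace M] 
    [ChartedSpace (EuclideanSpace ℝ (Fin m)) M] [IsManifold (𝓡 m) ∞ M]
    [RiemannianBundle (fun x : M => TangentSpace (𝓡 m) x)]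
    [IsContMDiffRiemannianBundle (𝓡 m) ∞ (EuclideanSpace ℝ (Fin m))
      (fun x : M => TangentSpace (𝓡 m) x)]
    [IsRiemannianManifold (𝓡 m) M]

/-- The differential of a map into the Euclidean space. -/
def eucDeriv (f : M → Euc m) (x : M) : TangentSpace (𝓡 m) x →L[ℝ] Euc m :=
  mfderiv (𝓡 m) (𝓡 m) f x

/-- The differential of a map from the Euclidean space. -/
def derivOfEuc (f : Euc m → M) (y : Euc m) : Euc m →L[ℝ] TangentSpace (𝓡 m) (f y) :=
  mfderiv (𝓡 m) (𝓡 m) f y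

theorem isContinuousRiemannianBundle_tangentSpace :
    IsContinuousRiemannianBundle (EuclideanSpace ℝ (Fin m))
      (fun x : M => TangentSpace (𝓡 m) x) := by
  obtain ⟨g, hg, hgi⟩ := IsContMDiffRiemannianBundle.exists_contMDiff (IB := 𝓡 m) (n := ∞)
    (F := Euc m) (E := fun x : M => TangentSpace (𝓡 m) x)
  exact ⟨⟨g, hg.continuous, hgi⟩⟩

theorem eventually_enorm_eucDeriv_chartAt_le (x : M) : ∃ C : NNReal, ∀ᶠ y in 𝓝 x,
    ∀ v : TangentSpace (𝓡 m) y, ‖eucDeriv (chartAt (Euc m) x) y v‖ₑ ≤ C * ‖v‖ₑ := by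
  have := isContinuousRiemannianBundle_tangentSpace (m := m) (M := M)
  obtain ⟨C, _, hC⟩ := eventually_enorm_mfderiv_extChartAt_lt (𝓡 m) x
  refine ⟨C, ?_⟩
  filter_upwards [hC] with y hy v
  have h : ‖eucDeriv (chartAt (Euc m) x) y‖ₑ ≤ C := hy.le
  exact (ContinuousLinearMap.le_opENorm _ v).trans (by gcongr)

theorem eventually_enorm_derivOfEuc_chartAt_symm_le (x : M) : ∃ C : NNReal,
    ∀ᶠ y in 𝓝 (chartAt (Euc m) x x), ∀ v : Euc m,
      ‖derivOfEuc (chartAt (Euc m) x).symm y v‖ₑ ≤ C * ‖v‖ₑ := by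
  have := isContinuousRiemannianBundle_tangentSpace (m := m) (M := M)
  obtain ⟨C, _, hC⟩ := eventually_enorm_mfderivWithin_symm_extChartAt_lt (𝓡 m) x
  refine ⟨C, ?_⟩
  have h1 : range (𝓡 m) = univ := by simp
  simp only [h1, nhdsWithin_univ, mfderivWithin_univ] at hC
  filter_upwards [hC] with y hy v
  have h : ‖derivOfEuc (chartAt (Euc m) x).symm y‖ₑ ≤ C := hy.le
  exact (ContinuousLinearMap.le_opENorm _ v).trans (by gcongr)

/-- A nearly minimal path between two points at distance less than δ/3 from x has length less than
2δ/3, so it stays in the ball of radius δ where the differential of the chart is bounded; its image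
in the chart is therefore not much longer. -/
theorem eventually_edist_chartAt_le (x : M) : ∃ C : NNReal, ∃ s ∈ 𝓝 x, ∀ y ∈ s, ∀ y' ∈ s,
    edist (chartAt (Euc m) x y) (chartAt (Euc m) x y') ≤ C * edist y y' := by
  obtain ⟨C, hC⟩ := eventually_enorm_eucDeriv_chartAt_le (m := m) x
  obtain ⟨δ, δ0, hδ⟩ := EMetric.mem_nhds_iff.1
    (Filter.inter_mem hC (chart_source_mem_nhds (Euc m) x))
  set e := chartAt (Euc m) x with he
  have h3 : δ / 3 ≠ 0 := (ENNReal.div_pos δ0.ne' (by simp)).ne'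
  refine ⟨C, Metric.eball x (δ / 3), Metric.eball_mem_nhds x (pos_iff_ne_zero.2 h3),
    fun y hy y' hy' => ?_⟩
  have hlt : edist y y' < 2 * (δ / 3) := by
    calc edist y y' ≤ edist y x + edist y' x := edist_triangle_right _ _ _
      _ < δ / 3 + δ / 3 := ENNReal.add_lt_add hy hy'
      _ = _ := (two_mul _).symm
  suffices h : ∀ r, edist y y' < r → r < 2 * (δ / 3) → edist (e y) (e y') ≤ C * r by
    have h1 : Tendsto (fun r => (C : ℝ≥0∞) * r) (𝓝[>] (edist y y')) (𝓝 (C * edist y y')) :=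
      (ENNReal.Tendsto.const_mul tendsto_id (Or.inr ENNReal.coe_ne_top)).mono_left
        nhdsWithin_le_nhds
    have : (𝓝[>] (edist y y')).NeBot := nhdsGT_neBot_of_exists_gt ⟨_, hlt⟩
    refine ge_of_tendsto h1 ?_
    filter_upwards [Ioo_mem_nhdsGT hlt] with r hr using h r hr.1 hr.2
  intro r hr hr2
  rw [IsRiemannianManifold.out (I := 𝓡 m)] at hr
  obtain ⟨γ, hγ0, hγ1, hγs, hγl, -⟩ := exists_lt_locally_constant_of_riemannianEDist_lt hr zero_lt_one
  have hmem : ∀ t ∈ Icc (0 : ℝ) 1, γ t ∈ Metric.eball x δ := fun t ht => by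
    have h1 : edist y (γ t) < 2 * (δ / 3) := by
      rw [IsRiemannianManifold.out (I := 𝓡 m) y (γ t)]
      refine lt_of_le_of_lt ?_ (hγl.trans hr2)
      refine (riemannianEDist_le_pathELength (γ := γ) hγs.contMDiffOn hγ0 rfl ht.1).trans ?_
      exact pathELength_mono le_rfl ht.2
    calc edist (γ t) x ≤ edist (γ t) y + edist y x := edist_triangle _ _ _
      _ < 2 * (δ / 3) + δ / 3 := ENNReal.add_lt_add (by rwa [edist_comm]) hy
      _ = δ := by
        rw [← add_one_mul, show (2 : ℝ≥0∞) + 1 = 3 by norm_num, ENNReal.mul_div_cancel (by simp) (by simp)]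
  set γ' : ℝ → Euc m := fun t => e (γ t) with hγ'
  have hsrc : ∀ t ∈ Icc (0 : ℝ) 1, γ t ∈ e.source := fun t ht => (hδ (hmem t ht)).2
  have hC1 : ContMDiffOn 𝓘(ℝ, ℝ) (𝓡 m) 1 γ' (Icc 0 1) :=
    (contMDiffOn_chart (n := 1) (I := 𝓡 m) (x := x)).comp hγs.contMDiffOn hsrc
  calc edist (e y) (e y') = ‖γ' 1 - γ' 0‖ₑ := by
        rw [hγ', edist_comm, edist_eq_enorm_sub]; simp [hγ0, hγ1]
    _ ≤ ∫⁻ t in Icc (0 : ℝ) 1, ‖derivWithin γ' (Icc 0 1) t‖ₑ := by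
      apply enorm_sub_le_lintegral_derivWithin_Icc_of_contDiffOn_Icc _ zero_le_one
      exact hC1.contDiffOn
    _ ≤ ∫⁻ t in Icc (0 : ℝ) 1, C * ‖mfderivWithin 𝓘(ℝ, ℝ) (𝓡 m) γ (Icc 0 1) t 1‖ₑ := by
      refine setLIntegral_mono' measurableSet_Icc fun t ht => ?_
      have h1 : mfderivWithin 𝓘(ℝ, ℝ) (𝓡 m) γ' (Icc 0 1) t =
          (mfderiv (𝓡 m) (𝓡 m) e (γ t)).comp (mfderivWithin 𝓘(ℝ, ℝ) (𝓡 m) γ (Icc 0 1) t) := by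
        apply mfderiv_comp_mfderivWithin
        · exact mdifferentiableAt_atlas (chart_mem_atlas _ _) (hsrc t ht)
        · exact (hγs.mdifferentiable one_ne_zero).mdifferentiableOn _ ht
        · rw [uniqueMDiffWithinAt_iff_uniqueDiffWithinAt]
          exact uniqueDiffOn_Icc zero_lt_one _ ht
      have h2 : derivWithin γ' (Icc 0 1) t = eucDeriv e (γ t)
          (mfderivWithin 𝓘(ℝ, ℝ) (𝓡 m) γ (Icc 0 1) t 1) := by
        rw [← fderivWithin_derivWithin, ← mfderivWithin_eq_fderivWithin, h1]
        rfl
      rw [h2]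
      exact (hδ (hmem t ht)).1 _
    _ = C * pathELength (𝓡 m) γ 0 1 := by
      rw [lintegral_const_mul' _ _ ENNReal.coe_ne_top, pathELength_eq_lintegral_mfderivWithin_Icc]
    _ ≤ C * r := by gcongr

/-- The straight segment in the chart is a competitor for the geodesic distance. -/
theorem eventually_edist_chartAt_symm_le (x : M) : ∃ C : NNReal, ∃ r > 0,
    Metric.ball (chartAt (Euc m) x x) r ⊆ (chartAt (Euc m) x).target ∧
    ∀ y ∈ Metric.ball (chartAt (Euc m) x x) r, ∀ y' ∈ Metric.ball (chartAt (Euc m) x x) r,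
    edist ((chartAt (Euc m) x).symm y) ((chartAt (Euc m) x).symm y') ≤ C * edist y y' := by
  obtain ⟨C, hC⟩ := eventually_enorm_derivOfEuc_chartAt_symm_le (m := m) x
  set e := chartAt (Euc m) x with he
  obtain ⟨r, r0, hr⟩ := Metric.mem_nhds_iff.1
    (Filter.inter_mem hC (chart_target_mem_nhds (Euc m) x))
  refine ⟨C, r, r0, fun y hy => (hr hy).2, fun y hy y' hy' => ?_⟩
  set η : ℝ → Euc m := fun t => y + t • (y' - y) with hη
  have hmem : ∀ t ∈ Icc (0 : ℝ) 1, η t ∈ Metric.ball (e x) r := fun t ht =>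
    (convex_ball _ _).add_smul_sub_mem hy hy' ht
  have hηs : ContMDiff 𝓘(ℝ, ℝ) (𝓡 m) 1 η := by
    rw [contMDiff_iff_contDiff]; fun_prop
  have hηd : ∀ t ∈ Icc (0 : ℝ) 1, derivWithin η (Icc 0 1) t = y' - y := fun t ht => by
    have h1 : HasDerivAt η (y' - y) t := by
      have := ((hasDerivAt_id t).smul_const (y' - y)).const_add y
      rwa [one_smul] at this
    exact h1.hasDerivWithinAt.derivWithin (uniqueDiffOn_Icc zero_lt_one t ht)
  set γ : ℝ → M := fun t => e.symm (η t) with hγ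
  have hγs : ContMDiffOn 𝓘(ℝ, ℝ) (𝓡 m) 1 γ (Icc 0 1) :=
    (contMDiffOn_chart_symm (n := 1) (I := 𝓡 m) (x := x)).comp hηs.contMDiffOn
      fun t ht => (hr (hmem t ht)).2
  rw [IsRiemannianManifold.out (I := 𝓡 m)]
  calc riemannianEDist (𝓡 m) (e.symm y) (e.symm y') ≤ pathELength (𝓡 m) γ 0 1 :=
        riemannianEDist_le_pathELength hγs (by simp [hγ, hη]) (by simp [hγ, hη]) zero_le_one
    _ = ∫⁻ t in Icc (0 : ℝ) 1, ‖mfderivWithin 𝓘(ℝ, ℝ) (𝓡 m) γ (Icc 0 1) t 1‖ₑ :=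
        pathELength_eq_lintegral_mfderivWithin_Icc
    _ ≤ ∫⁻ t in Icc (0 : ℝ) 1, C * edist y y' := by
      refine setLIntegral_mono' measurableSet_Icc fun t ht => ?_
      have h1 : mfderivWithin 𝓘(ℝ, ℝ) (𝓡 m) γ (Icc 0 1) t =
          (mfderiv (𝓡 m) (𝓡 m) e.symm (η t)).comp
            (mfderivWithin 𝓘(ℝ, ℝ) (𝓡 m) η (Icc 0 1) t) := by
        apply mfderiv_comp_mfderivWithin
        · exact mdifferentiableAt_atlas_symm (chart_mem_atlas _ _) (hr (hmem t ht)).2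
        · exact (hηs.mdifferentiable one_ne_zero).mdifferentiableOn _ ht
        · rw [uniqueMDiffWithinAt_iff_uniqueDiffWithinAt]
          exact uniqueDiffOn_Icc zero_lt_one _ ht
      have h2 : mfderivWithin 𝓘(ℝ, ℝ) (𝓡 m) γ (Icc 0 1) t 1 =
          derivOfEuc e.symm (η t) (y' - y) := by
        rw [h1, ← hηd t ht, ← fderivWithin_derivWithin, ← mfderivWithin_eq_fderivWithin]
        rfl
      rw [h2, edist_comm, edist_eq_enorm_sub]
      exact (hr (hmem t ht)).1 _
    _ = _ := by simp
end Charts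

/-! ### Comparison of the Riemannian volume with the Lebesgue measure in charts. -/

section ChartMeasures
open Filter Topology Manifold
variable {m : ℕ} {M : Type*} [EMetricSpace M] [MeasurableSpace M] [BorelSpace M]
    [ChartedSpace (EuclideanSpace ℝ (Fin m)) M] [IsManifold (𝓡 m) ∞ M]
    [RiemannianBundle (fun x : M => TangentSpace (𝓡 m) x)]
    [IsContMDiffRiemannianBundle (𝓡 m) ∞ (EuclideanSpace ℝ (Fin m))
      (fun x : M => TangentSpace (𝓡 m) x)]
    [IsRiemannianManifold (𝓡 m) M]

theorem exists_lipschitz_transition {e c : OpenPartialHomeomorph M (Euc m)}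
    (he : e ∈ atlas (Euc m) M) (hc : c ∈ atlas (Euc m) M) {y : Euc m} (hy : y ∈ e.target)
    (hyc : e.symm y ∈ c.source) : ∃ C : NNReal, ∃ U ∈ 𝓝 y, ∀ y₁ ∈ U, ∀ y₂ ∈ U,
      edist (c (e.symm y₁)) (c (e.symm y₂)) ≤ C * edist y₁ y₂ := by
  have he' := IsManifold.subset_maximalAtlas (I := 𝓡 m) (n := ∞) he
  have hc' := IsManifold.subset_maximalAtlas (I := 𝓡 m) (n := ∞) hc
  have h1 : ContMDiffAt (𝓡 m) (𝓡 m) ∞ (c ∘ e.symm) y :=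
    (contMDiffAt_of_mem_maximalAtlas hc' hyc).comp y (contMDiffAt_symm_of_mem_maximalAtlas he' hy)
  have h2 : ContDiffAt ℝ 1 (c ∘ e.symm) y := h1.contDiffAt.of_le (by simp)
  obtain ⟨C, U, hU, hC⟩ := h2.exists_lipschitzOnWith
  exact ⟨C, U, hU, fun y₁ h₁ y₂ h₂ => hC h₁ h₂⟩

/-- The metric estimates are known for the preferred chart at a point, near that point. An arbitrary
chart of the atlas is reached by a transition map, which is smooth and hence locally Lipschitz in
both directions. -/
theorem exists_biLipschitz_chart {e : OpenPartialHomeomorph M (Euc m)}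
    (he : e ∈ atlas (Euc m) M) {y : Euc m} (hy : y ∈ e.target) :
    ∃ C : NNReal, ∃ U ∈ 𝓝 y, U ⊆ e.target ∧ ∀ y₁ ∈ U, ∀ y₂ ∈ U,
      edist (e.symm y₁) (e.symm y₂) ≤ C * edist y₁ y₂ ∧
      edist y₁ y₂ ≤ C * edist (e.symm y₁) (e.symm y₂) := by
  set x := e.symm y with hx
  set c := chartAt (Euc m) x with hc
  have hxs : x ∈ e.source := e.map_target hy
  have hxc : x ∈ c.source := mem_chart_source _ x
  have hex : e x = y := e.right_inv hy
  have hcm : c ∈ atlas (Euc m) M := chart_mem_atlas _ x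
  obtain ⟨C₁, r, r0, hrt, h₁⟩ := eventually_edist_chartAt_symm_le (m := m) x
  obtain ⟨C₂, s, hs, h₂⟩ := eventually_edist_chartAt_le (m := m) x
  obtain ⟨C₃, U₃, hU₃, h₃⟩ := exists_lipschitz_transition he hcm hy hxc
  obtain ⟨C₄, U₄, hU₄, h₄⟩ := exists_lipschitz_transition hcm he (c.map_source hxc)
    (by rwa [c.left_inv hxc])
  have hces : ContinuousAt e.symm y := e.symm.continuousAt hy
  have hcc : ContinuousAt c x := c.continuousAt hxc
  have hcomp : Tendsto (fun z => c (e.symm z)) (𝓝 y) (𝓝 (c x)) := hcc.tendsto.comp hces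
  refine ⟨max (C₁ * C₃) (C₄ * C₂), e.target ∩ U₃ ∩ e.symm ⁻¹' s ∩ e.symm ⁻¹' c.source ∩
    (fun z => c (e.symm z)) ⁻¹' (Metric.ball (c x) r ∩ U₄), ?_, fun z hz => hz.1.1.1.1, ?_⟩
  · refine inter_mem (inter_mem (inter_mem (inter_mem (e.open_target.mem_nhds hy) hU₃) (hces hs))
      (hces (c.open_source.mem_nhds hxc))) (hcomp (inter_mem (Metric.ball_mem_nhds _ r0) hU₄))
  · rintro y₁ ⟨⟨⟨⟨ht₁, h31⟩, hs1⟩, hc1⟩, hb1, h41⟩ y₂ ⟨⟨⟨⟨ht₂, h32⟩, hs2⟩, hc2⟩, hb2, h42⟩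
    have e1 : c.symm (c (e.symm y₁)) = e.symm y₁ := c.left_inv hc1
    have e2 : c.symm (c (e.symm y₂)) = e.symm y₂ := c.left_inv hc2
    constructor
    · have := h₁ _ hb1 _ hb2
      rw [← hc, e1, e2] at this
      calc _ ≤ _ := this
        _ ≤ C₁ * (C₃ * edist y₁ y₂) := by gcongr; exact h₃ _ h31 _ h32
        _ = ((C₁ * C₃ : NNReal) : ℝ≥0∞) * edist y₁ y₂ := by push_cast; ring
        _ ≤ _ := by gcongr; exact le_max_left _ _
    · have := h₄ _ h41 _ h42
      rw [e1, e2, e.right_inv ht₁, e.right_inv ht₂] at this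
      calc _ ≤ _ := this
        _ ≤ C₄ * (C₂ * edist (e.symm y₁) (e.symm y₂)) := by gcongr; exact h₂ _ hs1 _ hs2
        _ = ((C₄ * C₂ : NNReal) : ℝ≥0∞) * edist (e.symm y₁) (e.symm y₂) := by push_cast; ring
        _ ≤ _ := by gcongr; exact le_max_right _ _

/-- A bi-Lipschitz map distorts the m-dimensional Hausdorff measure by a bounded factor, and
finitely many neighbourhoods cover the compact set K. -/
theorem exists_measure_chart_symm_le {e : OpenPartialHomeomorph M (Euc m)}
    (he : e ∈ atlas (Euc m) M) {K : Set (Euc m)} (hK : IsCompact K) (hKt : K ⊆ e.target) :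
    ∃ C : ℝ≥0∞, C ≠ ⊤ ∧ ∀ A : Set M, volume (e.symm ⁻¹' A ∩ K) ≤ C * μHE[m] A := by
  refine hK.induction_on (p := fun K => ∃ C : ℝ≥0∞, C ≠ ⊤ ∧ ∀ A : Set M,
    volume (e.symm ⁻¹' A ∩ K) ≤ C * μHE[m] A) ⟨0, by simp, by simp⟩ ?_ ?_ ?_
  · rintro s t hst ⟨C, hC, h⟩
    exact ⟨C, hC, fun A => (measure_mono (inter_subset_inter_right _ hst)).trans (h A)⟩
  · rintro s t ⟨C, hC, h⟩ ⟨C', hC', h'⟩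
    refine ⟨C + C', ENNReal.add_ne_top.2 ⟨hC, hC'⟩, fun A => ?_⟩
    rw [inter_union_distrib_left, add_mul]
    exact (measure_union_le _ _).trans (add_le_add (h A) (h' A))
  · intro y hy
    obtain ⟨C, U, hU, hUt, h⟩ := exists_biLipschitz_chart he (hKt hy)
    refine ⟨U, mem_nhdsWithin_of_mem_nhds hU, (C : ℝ≥0∞) ^ m, by simp, fun A => ?_⟩
    have hL : LipschitzOnWith C e (e.symm '' U) := by
      rintro _ ⟨y₁, h₁, rfl⟩ _ ⟨y₂, h₂, rfl⟩
      rw [e.right_inv (hUt h₁), e.right_inv (hUt h₂)]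
      exact (h _ h₁ _ h₂).2
    have h2 := (hL.mono (inter_subset_left (t := A))).euclideanHausdorffMeasure_image_le m
    rw [← EuclideanSpace.euclideanHausdorffMeasure_eq_volume]
    calc _ ≤ μHE[m] (e '' (e.symm '' U ∩ A)) := by
          refine measure_mono fun z hz => ⟨e.symm z, ⟨⟨z, hz.2, rfl⟩, hz.1⟩, e.right_inv (hUt hz.2)⟩
      _ ≤ _ := h2
      _ ≤ _ := by gcongr; exact inter_subset_right

theorem exists_measure_chart_le {e : OpenPartialHomeomorph M (Euc m)}
    (he : e ∈ atlas (Euc m) M) {K : Set (Euc m)} (hK : IsCompact K) (hKt : K ⊆ e.target) :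
    ∃ C : ℝ≥0∞, C ≠ ⊤ ∧ ∀ A : Set (Euc m),
      (μHE[m] : Measure M) (e ⁻¹' A ∩ e.symm '' K) ≤ C * volume A := by
  -- The induction runs over arbitrary sets, on which `e.symm` is an inverse of the chart only
  -- inside the target.
  suffices h : ∃ C : ℝ≥0∞, C ≠ ⊤ ∧ ∀ A : Set (Euc m),
      (μHE[m] : Measure M) (e ⁻¹' A ∩ e.symm '' (K ∩ e.target)) ≤ C * volume A by
    rwa [inter_eq_left.2 hKt] at h
  refine hK.induction_on (p := fun K => ∃ C : ℝ≥0∞, C ≠ ⊤ ∧ ∀ A : Set (Euc m),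
    (μHE[m] : Measure M) (e ⁻¹' A ∩ e.symm '' (K ∩ e.target)) ≤ C * volume A)
    ⟨0, by simp, by simp⟩ ?_ ?_ ?_
  · rintro s t hst ⟨C, hC, h⟩
    exact ⟨C, hC, fun A => (measure_mono (by gcongr)).trans (h A)⟩
  · rintro s t ⟨C, hC, h⟩ ⟨C', hC', h'⟩
    refine ⟨C + C', ENNReal.add_ne_top.2 ⟨hC, hC'⟩, fun A => ?_⟩
    rw [union_inter_distrib_right, image_union, inter_union_distrib_left, add_mul]
    exact (measure_union_le _ _).trans (add_le_add (h A) (h' A))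
  · intro y hy
    obtain ⟨C, U, hU, hUt, h⟩ := exists_biLipschitz_chart he (hKt hy)
    refine ⟨U, mem_nhdsWithin_of_mem_nhds hU, (C : ℝ≥0∞) ^ m, by simp, fun A => ?_⟩
    have hL : LipschitzOnWith C e.symm U := fun y₁ h₁ y₂ h₂ => (h _ h₁ _ h₂).1
    have h2 := (hL.mono (inter_subset_left (t := A))).euclideanHausdorffMeasure_image_le m
    rw [← EuclideanSpace.euclideanHausdorffMeasure_eq_volume]
    calc _ ≤ (μHE[m] : Measure M) (e.symm '' (U ∩ A)) := by
          refine measure_mono ?_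
          rintro _ ⟨hzA, z, hz, rfl⟩
          rw [mem_preimage, e.right_inv hz.2] at hzA
          exact ⟨z, ⟨hz.1, hzA⟩, rfl⟩
      _ ≤ _ := h2
      _ ≤ _ := by gcongr; exact inter_subset_right

theorem isFiniteMeasure_euclideanHausdorffMeasure [CompactSpace M] :
    IsFiniteMeasure (μHE[m] : Measure M) := by
  have h : IsFiniteMeasureOnCompacts (μHE[m] : Measure M) := by
    have : IsLocallyFiniteMeasure (μHE[m] : Measure M) := ⟨fun x => by
      set e := chartAt (Euc m) x
      obtain ⟨r, r0, hr⟩ := Metric.nhds_basis_closedBall.mem_iff.1 (chart_target_mem_nhds (Euc m) x)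
      obtain ⟨C, hC, hle⟩ := exists_measure_chart_le (chart_mem_atlas (Euc m) x)
        (isCompact_closedBall (e x) r) hr
      refine ⟨e.symm '' Metric.closedBall (e x) r, ?_, ?_⟩
      · have := e.symm.image_mem_nhds (x := e x) (mem_chart_target _ x)
          (Metric.closedBall_mem_nhds _ r0)
        rwa [e.left_inv (mem_chart_source _ x)] at this
      · have h1 := hle (Metric.closedBall (e x) r)
        rw [inter_eq_right.2] at h1
        · exact h1.trans_lt (ENNReal.mul_lt_top hC.lt_top measure_closedBall_lt_top)
        · rintro _ ⟨y, hy, rfl⟩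
          rwa [mem_preimage, e.right_inv (hr hy)]⟩
    infer_instance
  infer_instance

end ChartMeasures

/-! ### From segment bounds to weak derivatives: the distributional estimate. -/

section SegmentDerivative
open Filter Topology
variable {m : ℕ}

/-- Each point of the segment is translated back to its base point; the test function absorbs the
translation at the cost of L ‖w‖. -/
theorem lintegral_segment_mul_le {g : Euc m → ℝ≥0∞} (hg : Measurable g) {ψ : Euc m → ℝ}
    {L : NNReal} (hL : LipschitzWith L ψ) (w : Euc m) :
    ∫⁻ x, (∫⁻ τ in Icc (0 : ℝ) 1, g (x + τ • w)) * ‖ψ x‖ₑ ≤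
      ∫⁻ x, g x * (‖ψ x‖ₑ + L * ‖w‖ₑ) := by
  have hψm : Measurable ψ := hL.continuous.measurable
  have hm : Measurable fun q : Euc m × ℝ => g (q.1 + q.2 • w) * ‖ψ q.1‖ₑ := by
    have h1 : Measurable fun q : Euc m × ℝ => q.1 + q.2 • w := by fun_prop
    have h2 : Measurable fun q : Euc m × ℝ => ψ q.1 := hψm.comp measurable_fst
    exact (hg.comp h1).mul h2.enorm
  have hm1 : ∀ x : Euc m, Measurable fun τ : ℝ => g (x + τ • w) := fun x => by
    have h1 : Measurable fun τ : ℝ => x + τ • w := by fun_prop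
    exact hg.comp h1
  calc ∫⁻ x, (∫⁻ τ in Icc (0 : ℝ) 1, g (x + τ • w)) * ‖ψ x‖ₑ
      = ∫⁻ x, ∫⁻ τ in Icc (0 : ℝ) 1, g (x + τ • w) * ‖ψ x‖ₑ := by
        refine lintegral_congr fun x => ?_
        rw [lintegral_mul_const _ (hm1 x)]
    _ = ∫⁻ τ in Icc (0 : ℝ) 1, ∫⁻ x, g (x + τ • w) * ‖ψ x‖ₑ :=
        lintegral_lintegral_swap hm.aemeasurable
    _ ≤ ∫⁻ τ in Icc (0 : ℝ) 1, ∫⁻ x, g x * (‖ψ x‖ₑ + L * ‖w‖ₑ) := by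
        refine setLIntegral_mono' measurableSet_Icc fun τ hτ => ?_
        have h1 := lintegral_add_right_eq_self (μ := (volume : Measure (Euc m)))
          (fun x => g x * ‖ψ (x - τ • w)‖ₑ) (τ • w)
        simp only [add_sub_cancel_right] at h1
        rw [h1]
        refine lintegral_mono fun x => ?_
        refine mul_le_mul_right ?_ _
        have h2 := hL (x - τ • w) x
        have h3 : edist (x - τ • w) x ≤ ‖w‖ₑ := by
          rw [edist_eq_enorm_sub, sub_sub_cancel_left, enorm_neg, enorm_smul]
          calc ‖τ‖ₑ * ‖w‖ₑ ≤ 1 * ‖w‖ₑ := by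
                gcongr
                rw [Real.enorm_eq_ofReal hτ.1]
                simpa using hτ.2
            _ = _ := one_mul _
        calc ‖ψ (x - τ • w)‖ₑ = ‖ψ x + (ψ (x - τ • w) - ψ x)‖ₑ := by rw [add_sub_cancel]
          _ ≤ ‖ψ x‖ₑ + ‖ψ (x - τ • w) - ψ x‖ₑ := enorm_add_le _ _
          _ ≤ ‖ψ x‖ₑ + L * ‖w‖ₑ := by
            gcongr
            rw [← edist_eq_enorm_sub]
            exact h2.trans (by gcongr)
    _ = _ := by simp

/-- Discrete integration by parts: the translation is moved from ψ to h, where the segment bound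
applies. -/
theorem enorm_integral_mul_translate_le {h : Euc m → ℝ} {g : Euc m → ℝ≥0∞} (hg : Measurable g)
    (hint : Integrable h) {ψ : Euc m → ℝ} {L : NNReal} (hL : LipschitzWith L ψ) {B : ℝ}
    (hB : ∀ x, ‖ψ x‖ ≤ B) {w : Euc m}
    (hw : ∀ᵐ x, edist (h x) (h (x + w)) ≤ ‖w‖ₑ * ∫⁻ τ in Icc (0 : ℝ) 1, g (x + τ • w)) :
    ‖∫ x, h x * (ψ x - ψ (x - w))‖ₑ ≤ ‖w‖ₑ * ∫⁻ x, g x * (‖ψ x‖ₑ + L * ‖w‖ₑ) := by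
  have hψc : Continuous ψ := hL.continuous
  have hψc' : Continuous fun x => ψ (x - w) := by fun_prop
  have i1 : Integrable fun x => h x * ψ x :=
    hint.mul_bdd hψc.aestronglyMeasurable (ae_of_all _ hB)
  have i2 : Integrable fun x => h x * ψ (x - w) :=
    hint.mul_bdd hψc'.aestronglyMeasurable (ae_of_all _ fun x => hB _)
  have i3 : Integrable fun x => h (x + w) * ψ x :=
    (hint.comp_add_right w).mul_bdd hψc.aestronglyMeasurable (ae_of_all _ hB)
  have h1 : ∫ x, h x * ψ (x - w) = ∫ x, h (x + w) * ψ x := by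
    rw [← integral_add_right_eq_self (fun x => h x * ψ (x - w)) w]
    simp only [add_sub_cancel_right]
  have h2 : ∫ x, h x * (ψ x - ψ (x - w)) = ∫ x, (h x - h (x + w)) * ψ x := by
    simp only [mul_sub, sub_mul]
    rw [integral_sub i1 i2, integral_sub i1 i3, h1]
  rw [h2]
  refine (enorm_integral_le_lintegral_enorm _).trans ?_
  calc ∫⁻ x, ‖(h x - h (x + w)) * ψ x‖ₑ
      ≤ ∫⁻ x, ‖w‖ₑ * ((∫⁻ τ in Icc (0 : ℝ) 1, g (x + τ • w)) * ‖ψ x‖ₑ) := by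
        refine lintegral_mono_ae ?_
        filter_upwards [hw] with x hx
        rw [enorm_mul, ← mul_assoc, ← edist_eq_enorm_sub]
        gcongr
    _ ≤ _ := by
        rw [lintegral_const_mul' _ _ (by simp)]
        exact mul_le_mul_right (lintegral_segment_mul_le hg hL w) _

/-- The directional derivative of ψ is a limit of difference quotients with steps t k. The segment
bound is available for almost every direction only; good directions are dense and both sides are
continuous in w. -/
theorem SegmentBound.enorm_integral_mul_fderiv_le {h : Euc m → ℝ} {g : Euc m → ℝ≥0∞}
    (hseg : SegmentBound h g) (hg : Measurable g) (hgI : ∫⁻ x, g x ≠ ⊤) (hint : Integrable h)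
    {ψ : Euc m → ℝ} (hψ : ContDiff ℝ ∞ ψ) (hc : HasCompactSupport ψ) (w : Euc m) :
    ‖∫ x, h x * fderiv ℝ ψ x w‖ₑ ≤ ‖w‖ₑ * ∫⁻ x, ‖ψ x‖ₑ * g x := by
  obtain ⟨L, hL⟩ := hψ.lipschitzWith_of_hasCompactSupport hc (by simp)
  obtain ⟨B, hB⟩ := hc.exists_bound_of_continuous hψ.continuous
  have hψ1 : ContDiff ℝ 1 ψ := hψ.of_le (by simp)
  have hfc : Continuous (fderiv ℝ ψ) := hψ1.continuous_fderiv one_ne_zero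
  obtain ⟨B', hB'⟩ := (hc.fderiv ℝ).exists_bound_of_continuous hfc
  have hψg : ∫⁻ x, ‖ψ x‖ₑ * g x ≠ ⊤ := by
    refine ne_top_of_le_ne_top (ENNReal.mul_ne_top (ENNReal.ofReal_ne_top (r := B)) hgI) ?_
    rw [← lintegral_const_mul' _ _ ENNReal.ofReal_ne_top]
    refine lintegral_mono fun x => ?_
    gcongr
    rw [← ofReal_norm]
    exact ENNReal.ofReal_le_ofReal (hB x)
  have hi : Integrable fun x => h x • fderiv ℝ ψ x := by
    have h1 : Integrable fun x => B' * ‖h x‖ := hint.norm.const_mul B'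
    refine h1.mono' (hint.aestronglyMeasurable.smul hfc.aestronglyMeasurable) (ae_of_all _ fun x => ?_)
    rw [norm_smul, mul_comm]
    exact mul_le_mul_of_nonneg_right (hB' x) (norm_nonneg _)
  have hT : ∀ w, ∫ x, h x * fderiv ℝ ψ x w = (∫ x, h x • fderiv ℝ ψ x) w := fun w => by
    rw [ContinuousLinearMap.integral_apply hi]
    rfl
  -- almost every direction is good
  set t : ℕ → ℝ := fun k => ((k : ℝ) + 1)⁻¹ with ht
  have ht0 : ∀ k, 0 < t k := fun k => by simp only [ht]; positivity
  have htt : Tendsto t atTop (𝓝 0) := by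
    simpa [ht] using tendsto_one_div_add_atTop_nhds_zero_nat (𝕜 := ℝ)
  have hgood : ∀ᵐ w : Euc m, ∀ k, ∀ᵐ x, edist (h x) (h (x + t k • w)) ≤
      ‖t k • w‖ₑ * ∫⁻ τ in Icc (0 : ℝ) 1, g (x + τ • t k • w) := by
    refine ae_all_iff.2 fun k => ?_
    have h1 := Measure.ae_ae_of_ae_prod hseg
    have h2 := (quasiMeasurePreserving_inv_smul_sub (volume : Measure (Euc m)) 0
      (inv_pos.2 (ht0 k))).ae h1
    simpa using h2
  have hmain : ∀ w : Euc m, (∀ k, ∀ᵐ x, edist (h x) (h (x + t k • w)) ≤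
      ‖t k • w‖ₑ * ∫⁻ τ in Icc (0 : ℝ) 1, g (x + τ • t k • w)) →
      ‖∫ x, h x * fderiv ℝ ψ x w‖ₑ ≤ ‖w‖ₑ * ∫⁻ x, ‖ψ x‖ₑ * g x := by
    intro w hw
    have h1 : Tendsto (fun k => ∫ x, h x * ((t k)⁻¹ * (ψ x - ψ (x - t k • w)))) atTop
        (𝓝 (∫ x, h x * fderiv ℝ ψ x w)) := by
      refine tendsto_integral_of_dominated_convergence (fun x => ‖h x‖ * (L * ‖w‖)) (fun k => ?_)
        (hint.norm.mul_const _) (fun k => ae_of_all _ fun x => ?_) (ae_of_all _ fun x => ?_)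
      · have : Continuous fun x => (t k)⁻¹ * (ψ x - ψ (x - t k • w)) := by
          have := hψ.continuous
          fun_prop
        exact hint.aestronglyMeasurable.mul this.aestronglyMeasurable
      · rw [norm_mul]
        gcongr
        rw [norm_mul, norm_inv, Real.norm_of_nonneg (ht0 k).le, inv_mul_le_iff₀ (ht0 k)]
        refine (hL.norm_sub_le _ _).trans (le_of_eq ?_)
        rw [sub_sub_cancel, norm_smul, Real.norm_of_nonneg (ht0 k).le]
        ring
      · refine Tendsto.const_mul _ ?_
        have h2 : HasDerivAt (fun s : ℝ => ψ (x + s • w)) (fderiv ℝ ψ x w) 0 := by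
          have h3 : HasFDerivAt ψ (fderiv ℝ ψ x) (x + (0 : ℝ) • w) := by
            rw [zero_smul, add_zero]
            exact (hψ1.differentiable one_ne_zero x).hasFDerivAt
          have h4 : HasDerivAt (fun s : ℝ => x + s • w) w 0 := by
            have := ((hasDerivAt_id (0 : ℝ)).smul_const w).const_add x
            rwa [one_smul] at this
          exact h3.comp_hasDerivAt 0 h4
        have h5 := h2.tendsto_slope_zero
        have h6 : Tendsto (fun k => - t k) atTop (𝓝[≠] (0 : ℝ)) := by
          refine tendsto_nhdsWithin_iff.2 ⟨by simpa using htt.neg, Eventually.of_forall fun k => ?_⟩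
          simpa using (ht0 k).ne'
        refine (h5.comp h6).congr fun k => ?_
        have h7 : x - t k • w = x + (- t k) • w := by rw [neg_smul, sub_eq_add_neg]
        simp only [Function.comp, zero_add, zero_smul, add_zero, h7, smul_eq_mul, inv_neg]
        ring
    -- The error due to the Lipschitz constant of ψ is proportional to the step, so the sharp
    -- constant survives in the limit.
    have h2 : Tendsto (fun k => ‖w‖ₑ * ((∫⁻ x, ‖ψ x‖ₑ * g x) +
        L * (ENNReal.ofReal (t k) * ‖w‖ₑ) * ∫⁻ x, g x)) atTop
        (𝓝 (‖w‖ₑ * ((∫⁻ x, ‖ψ x‖ₑ * g x) + L * (ENNReal.ofReal 0 * ‖w‖ₑ) * ∫⁻ x, g x))) := by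
      have h3 : Tendsto (fun k => ENNReal.ofReal (t k)) atTop (𝓝 (ENNReal.ofReal 0)) :=
        ENNReal.tendsto_ofReal htt
      refine ENNReal.Tendsto.const_mul (Tendsto.add tendsto_const_nhds ?_) (Or.inr (by simp))
      refine ENNReal.Tendsto.mul_const ?_ (Or.inr hgI)
      refine ENNReal.Tendsto.const_mul ?_ (Or.inr (by simp))
      exact ENNReal.Tendsto.mul_const h3 (Or.inr (by simp))
    simp only [ENNReal.ofReal_zero, zero_mul, mul_zero, add_zero] at h2
    refine le_of_tendsto_of_tendsto' h1.enorm h2 fun k => ?_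
    have h3 := enorm_integral_mul_translate_le hg hint hL hB (hw k)
    have h4 : ∫ x, h x * ((t k)⁻¹ * (ψ x - ψ (x - t k • w))) =
        (t k)⁻¹ * ∫ x, h x * (ψ x - ψ (x - t k • w)) := by
      rw [← integral_const_mul]
      congr 1; funext x; ring
    have h5 : ‖t k • w‖ₑ = ENNReal.ofReal (t k) * ‖w‖ₑ := by
      rw [enorm_smul, Real.enorm_eq_ofReal (ht0 k).le]
    rw [h5] at h3
    have h6 : ∫⁻ x, g x * (‖ψ x‖ₑ + L * (ENNReal.ofReal (t k) * ‖w‖ₑ)) =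
        (∫⁻ x, ‖ψ x‖ₑ * g x) + L * (ENNReal.ofReal (t k) * ‖w‖ₑ) * ∫⁻ x, g x := by
      simp only [mul_add]
      rw [lintegral_add_right _ (hg.mul_const _), lintegral_mul_const _ hg, mul_comm (∫⁻ x, g x)]
      simp only [mul_comm (g _)]
    rw [h6] at h3
    rw [h4, enorm_mul, Real.enorm_eq_ofReal (inv_pos.2 (ht0 k)).le, ENNReal.ofReal_inv_of_pos (ht0 k)]
    rw [← ENNReal.div_eq_inv_mul]
    refine ENNReal.div_le_of_le_mul ?_
    rw [mul_comm, ← mul_assoc]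
    exact h3
  have hcl : IsClosed {w : Euc m | ‖∫ x, h x * fderiv ℝ ψ x w‖ₑ ≤ ‖w‖ₑ * ∫⁻ x, ‖ψ x‖ₑ * g x} := by
    refine isClosed_le ?_ ?_
    · simp only [hT]; fun_prop
    · exact ENNReal.continuous_mul_const hψg |>.comp continuous_enorm
  have hd := Measure.dense_of_ae (μ := (volume : Measure (Euc m))) (hgood.mono hmain)
  have := hcl.closure_subset_iff.2 (subset_refl _) (hd w)
  exact this

end SegmentDerivative

/-! ### Representation of functionals bounded through a map into a Hilbert space. -/

section Riesz

/-- The bound makes T vanish on the kernel of J, so T descends to a bounded functional on the range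
of J; it is extended by the Hahn–Banach theorem and represented by the Riesz theorem. -/
theorem exists_inner_eq_of_bound {V H : Type*} [AddCommGroup V] [Module ℝ V]
    [NormedAddCommGroup H] [InnerProductSpace ℝ H] [CompleteSpace H] (J : V →ₗ[ℝ] H)
    (T : V →ₗ[ℝ] ℝ) {C : ℝ} (hT : ∀ v, ‖T v‖ ≤ C * ‖J v‖) :
    ∃ y : H, ∀ v, T v = inner ℝ y (J v) := by
  have hker : LinearMap.ker J ≤ LinearMap.ker T := fun v hv => by
    have h1 := hT v
    rw [LinearMap.mem_ker.1 hv, norm_zero, mul_zero] at h1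
    exact norm_le_zero_iff.1 h1
  set T' : LinearMap.range J →ₗ[ℝ] ℝ :=
    ((LinearMap.ker J).liftQ T hker).comp J.quotKerEquivRange.symm.toLinearMap with hT'
  have hTJ : ∀ v, T' ⟨J v, v, rfl⟩ = T v := fun v => by
    have h1 : J.quotKerEquivRange.symm ⟨J v, v, rfl⟩ = (LinearMap.ker J).mkQ v := by
      rw [LinearEquiv.symm_apply_eq]
      rfl
    rw [hT', LinearMap.comp_apply, LinearEquiv.coe_coe, h1]
    simp
  have hb : ∀ x : LinearMap.range J, ‖T' x‖ ≤ C * ‖x‖ := by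
    rintro ⟨_, v, rfl⟩
    rw [hTJ]
    exact hT v
  obtain ⟨S, hS, -⟩ := exists_extension_norm_eq (LinearMap.range J) (T'.mkContinuous C hb)
  refine ⟨(InnerProductSpace.toDual ℝ H).symm S, fun v => ?_⟩
  rw [InnerProductSpace.toDual_symm_apply, ← hTJ v]
  exact (hS ⟨J v, v, rfl⟩).symm

end Riesz

/-! ### From segment bounds to weak derivatives: existence of the derivative. -/

section SegmentDerivative
open Filter Topology
open scoped Convolution
variable {m : ℕ}

variable (m) in
/-- The smooth functions with compact support. -/
def smoothCompact : Submodule ℝ (Euc m → ℝ) where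
  carrier := {ψ | ContDiff ℝ ∞ ψ ∧ HasCompactSupport ψ}
  add_mem' ha hb := ⟨ha.1.add hb.1, ha.2.add hb.2⟩
  zero_mem' := ⟨contDiff_const, HasCompactSupport.zero⟩
  smul_mem' c _ h := ⟨h.1.const_smul c, h.2.smul_left (f := fun _ => c)⟩

theorem memLp_smoothCompact (ψ : smoothCompact m) (μ : Measure (Euc m)) [IsFiniteMeasure μ] :
    MemLp (ψ : Euc m → ℝ) 2 μ := by
  obtain ⟨B, hB⟩ := ψ.2.2.exists_bound_of_continuous ψ.2.1.continuous
  exact MemLp.of_bound ψ.2.1.continuous.aestronglyMeasurable B (ae_of_all _ hB)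

/-- The functional is bounded in L¹ for the measure g dx. This measure is finite, so the functional
is also bounded in L², where it is represented by some y; the density for the Lebesgue measure is g
y. -/
theorem exists_density_of_bound {g : Euc m → ℝ≥0∞} (hg : Measurable g) (hgI : ∫⁻ x, g x ≠ ⊤)
    (T : smoothCompact m →ₗ[ℝ] ℝ) {C : NNReal}
    (hT : ∀ ψ : smoothCompact m, ‖T ψ‖ₑ ≤ C * ∫⁻ x, ‖(ψ : Euc m → ℝ) x‖ₑ * g x) :
    ∃ d : Euc m → ℝ, Integrable d ∧ ∀ ψ : smoothCompact m, T ψ = ∫ x, (ψ : Euc m → ℝ) x * d x := by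
  set μ : Measure (Euc m) := volume.withDensity g with hμ
  have hfin : IsFiniteMeasure μ := isFiniteMeasure_withDensity hgI
  have hgt : ∀ᵐ x, g x < ⊤ := ae_lt_top hg hgI
  set J : smoothCompact m →ₗ[ℝ] Lp ℝ 2 μ :=
    { toFun := fun ψ => (memLp_smoothCompact ψ μ).toLp _
      map_add' := fun a b => MemLp.toLp_add (memLp_smoothCompact a μ) (memLp_smoothCompact b μ)
      map_smul' := fun c a => MemLp.toLp_const_smul c (memLp_smoothCompact a μ) } with hJ
  have hJT : ∀ ψ, ‖T ψ‖ ≤ (C * μ.real univ ^ (1 / (2 : ℝ))) * ‖J ψ‖ := fun ψ => by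
    have hm := (memLp_smoothCompact ψ μ).aestronglyMeasurable
    have h1 : eLpNorm (ψ : Euc m → ℝ) 1 μ ≤
        eLpNorm (ψ : Euc m → ℝ) 2 μ * μ univ ^ (1 / (2 : ℝ)) := by
      have := eLpNorm_le_eLpNorm_mul_rpow_measure_univ (p := 1) (q := 2) (by norm_num) hm
      simp only [ENNReal.toReal_one, ENNReal.toReal_ofNat] at this
      rwa [show (1 : ℝ) / 1 - 1 / 2 = 1 / 2 by norm_num] at this
    have h2 : ∫⁻ x, ‖(ψ : Euc m → ℝ) x‖ₑ * g x = eLpNorm (ψ : Euc m → ℝ) 1 μ := by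
      rw [eLpNorm_one_eq_lintegral_enorm, hμ,
        lintegral_withDensity_eq_lintegral_mul _ hg ψ.2.1.continuous.measurable.enorm]
      simp only [Pi.mul_apply, mul_comm]
    have h3 := hT ψ
    rw [h2] at h3
    have h4 : ‖T ψ‖ₑ ≤ C * (eLpNorm (ψ : Euc m → ℝ) 2 μ * μ univ ^ (1 / (2 : ℝ))) :=
      h3.trans (by gcongr)
    have h5 := ENNReal.toReal_mono (ENNReal.mul_ne_top (by simp) (ENNReal.mul_ne_top
      (memLp_smoothCompact ψ μ).eLpNorm_ne_top (by simp))) h4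
    rw [toReal_enorm] at h5
    refine h5.trans (le_of_eq ?_)
    rw [ENNReal.toReal_mul, ENNReal.toReal_mul, ← ENNReal.toReal_rpow]
    change _ = _ * ‖(memLp_smoothCompact ψ μ).toLp _‖
    rw [Lp.norm_toLp, Measure.real, ENNReal.coe_toReal]
    ring
  obtain ⟨y, hy⟩ := exists_inner_eq_of_bound J T hJT
  have hyi : Integrable (y : Euc m → ℝ) μ := (Lp.memLp y).integrable (by norm_num)
  refine ⟨fun x => (g x).toReal • (y : Euc m → ℝ) x,
    (integrable_withDensity_iff_integrable_smul' hg hgt).1 hyi, fun ψ => ?_⟩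
  rw [hy, L2.inner_def]
  have h1 : ∫ x, inner ℝ ((y : Euc m → ℝ) x) ((J ψ : Euc m → ℝ) x) ∂μ =
      ∫ x, (ψ : Euc m → ℝ) x * (y : Euc m → ℝ) x ∂μ := by
    refine integral_congr_ae ?_
    filter_upwards [(memLp_smoothCompact ψ μ).coeFn_toLp] with x hx
    change inner ℝ ((y : Euc m → ℝ) x) (((memLp_smoothCompact ψ μ).toLp _ : Euc m → ℝ) x) = _
    rw [hx]
    simp
  refine h1.trans ((integral_withDensity_eq_integral_toReal_smul hg hgt _).trans ?_)
  congr 1; funext x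
  simp only [smul_eq_mul]; ring

/-- The convolution with the normalised bump function. -/
def smoothing (f : Euc m → ℝ) (j : ℕ) : Euc m → ℝ :=
  (mollBump m j).normed volume ⋆[ContinuousLinearMap.mul ℝ ℝ, volume] f

theorem smoothing_eq (f : Euc m → ℝ) (j : ℕ) (x : Euc m) :
    smoothing f j x = ∫ z, (mollBump m j).normed volume (x - z) * f z := by
  unfold smoothing
  rw [convolution_eq_swap]
  rfl

theorem ae_tendsto_smoothing {f : Euc m → ℝ} (hf : LocallyIntegrable f) :
    ∀ᵐ x, Tendsto (fun j => smoothing f j x) atTop (𝓝 (f x)) :=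
  ContDiffBump.ae_convolution_tendsto_right_of_locallyIntegrable (K := 2) (φ := mollBump m)
    tendsto_mollRadius (Eventually.of_forall fun j =>
      le_of_eq (by simp only [mollBump]; ring)) hf

theorem mollTest_mem (j : ℕ) (x : Euc m) :
    (fun z => (mollBump m j).normed volume (x - z)) ∈ smoothCompact m :=
  ⟨mollTest_contDiff j x, (isCompact_closedBall _ _).of_isClosed_subset (isClosed_tsupport _)
    (mollTest_tsupport j x)⟩

/-- Testing against mollifiers centred at x gives the pointwise inequality at Lebesgue points of
both f and g. -/
theorem ae_enorm_le_of_integral_bound {f : Euc m → ℝ} (hf : Integrable f) {g : Euc m → ℝ≥0∞}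
    (hg : Measurable g) (hgI : ∫⁻ x, g x ≠ ⊤) {C : NNReal}
    (h : ∀ ψ : smoothCompact m, ‖∫ x, (ψ : Euc m → ℝ) x * f x‖ₑ ≤
      C * ∫⁻ x, ‖(ψ : Euc m → ℝ) x‖ₑ * g x) : ∀ᵐ x, ‖f x‖ₑ ≤ C * g x := by
  have hgi : Integrable fun x => (g x).toReal :=
    integrable_toReal_of_lintegral_ne_top hg.aemeasurable hgI
  filter_upwards [ae_tendsto_smoothing hf.locallyIntegrable,
    ae_tendsto_smoothing hgi.locallyIntegrable, ae_lt_top hg hgI] with x h1 h2 h3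
  have h4 : ‖f x‖ ≤ C * (g x).toReal := by
    refine le_of_tendsto_of_tendsto' h1.norm (h2.const_mul (C : ℝ)) fun j => ?_
    rw [smoothing_eq, smoothing_eq]
    set ψ : smoothCompact m := ⟨_, mollTest_mem j x⟩ with hψ
    have hψ0 : ∀ z, 0 ≤ (ψ : Euc m → ℝ) z := fun z => (mollBump m j).nonneg_normed _
    obtain ⟨B, hB⟩ := ψ.2.2.exists_bound_of_continuous ψ.2.1.continuous
    have hi : Integrable fun z => (ψ : Euc m → ℝ) z * (g z).toReal :=
      hgi.bdd_mul ψ.2.1.continuous.aestronglyMeasurable (ae_of_all _ hB)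
    have h5 : ∫⁻ z, ‖(ψ : Euc m → ℝ) z‖ₑ * g z =
        ENNReal.ofReal (∫ z, (ψ : Euc m → ℝ) z * (g z).toReal) := by
      rw [ofReal_integral_eq_lintegral_ofReal hi
        (ae_of_all _ fun z => mul_nonneg (hψ0 z) ENNReal.toReal_nonneg)]
      refine lintegral_congr_ae ?_
      filter_upwards [ae_lt_top hg hgI] with z hz
      rw [ENNReal.ofReal_mul (hψ0 z), ENNReal.ofReal_toReal hz.ne, Real.enorm_eq_ofReal (hψ0 z)]
    have h6 := h ψ
    rw [h5, ← ofReal_norm, ← ENNReal.ofReal_coe_nnreal, ← ENNReal.ofReal_mul C.coe_nonneg,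
      ENNReal.ofReal_le_ofReal_iff (mul_nonneg C.coe_nonneg
        (integral_nonneg fun z => mul_nonneg (hψ0 z) ENNReal.toReal_nonneg))] at h6
    exact h6
  rw [← ENNReal.ofReal_toReal h3.ne, ← ofReal_norm, ← ENNReal.ofReal_coe_nnreal,
    ← ENNReal.ofReal_mul C.coe_nonneg]
  exact ENNReal.ofReal_le_ofReal h4

/-- The densities of the partial derivatives assemble into a covector field. Its operator norm is
bounded by g itself, without a dimensional constant, since the distributional estimate is sharp in
every direction and not only in those of the basis. -/
theorem SegmentBound.exists_hasWeakFDerivOn {h : Euc m → ℝ} {g : Euc m → ℝ≥0∞}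
    (hseg : SegmentBound h g) (hg : Measurable g) (hgI : ∫⁻ x, g x ≠ ⊤) (hint : Integrable h) :
    ∃ D : Euc m → Euc m →L[ℝ] ℝ, HasWeakFDerivOn h D univ ∧ (∀ v, Integrable fun x => D x v) ∧
      ∀ᵐ x, ∀ v, ‖D x v‖ₑ ≤ g x * ‖v‖ₑ := by
  have hiψ : ∀ (ψ : smoothCompact m) (v : Euc m),
      Integrable fun x => h x * fderiv ℝ (ψ : Euc m → ℝ) x v := fun ψ v => by
    have hψ1 : ContDiff ℝ 1 (ψ : Euc m → ℝ) := ψ.2.1.of_le (by simp)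
    have hfc : Continuous (fderiv ℝ (ψ : Euc m → ℝ)) := hψ1.continuous_fderiv one_ne_zero
    obtain ⟨B', hB'⟩ := (ψ.2.2.fderiv ℝ).exists_bound_of_continuous hfc
    refine hint.mul_bdd (c := B' * ‖v‖) (by fun_prop : Continuous fun x =>
      fderiv ℝ (ψ : Euc m → ℝ) x v).aestronglyMeasurable (ae_of_all _ fun x => ?_)
    exact ((fderiv ℝ (ψ : Euc m → ℝ) x).le_opNorm v).trans (by gcongr; exact hB' x)
  have hdiff : ∀ ψ : smoothCompact m, Differentiable ℝ (ψ : Euc m → ℝ) := fun ψ =>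
    ψ.2.1.differentiable (by simp)
  have hex : ∀ v : Euc m, ∃ d : Euc m → ℝ, Integrable d ∧ ∀ ψ : smoothCompact m,
      - ∫ x, h x * fderiv ℝ (ψ : Euc m → ℝ) x v = ∫ x, (ψ : Euc m → ℝ) x * d x := fun v => by
    set T : smoothCompact m →ₗ[ℝ] ℝ :=
      { toFun := fun ψ => - ∫ x, h x * fderiv ℝ (ψ : Euc m → ℝ) x v
        map_add' := fun a b => by
          rw [← neg_add, ← integral_add (hiψ a v) (hiψ b v)]
          congr 2; funext x
          rw [Submodule.coe_add, fderiv_add (hdiff a x) (hdiff b x)]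
          simp [mul_add]
        map_smul' := fun c a => by
          rw [RingHom.id_apply, smul_eq_mul, mul_neg, ← integral_const_mul]
          congr 2; funext x
          rw [Submodule.coe_smul, fderiv_const_smul (hdiff a x)]
          simp [mul_left_comm] } with hT
    exact exists_density_of_bound hg hgI T (C := ‖v‖₊) fun ψ => by
      change ‖- _‖ₑ ≤ _
      rw [enorm_neg]
      exact hseg.enorm_integral_mul_fderiv_le hg hgI hint ψ.2.1 ψ.2.2 v
  set b := EuclideanSpace.basisFun (Fin m) ℝ with hb
  choose d hdi hd using fun i => hex (b i)
  set D : Euc m → Euc m →L[ℝ] ℝ := fun x => ∑ i, d i x • EuclideanSpace.proj i with hD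
  have hDv : ∀ x v, D x v = ∑ i, d i x * v i := fun x v => by
    simp [hD, sum_apply]
  have hDi : ∀ v, Integrable fun x => D x v := fun v => by
    simp only [hDv]
    exact integrable_finsetSum _ fun i _ => (hdi i).mul_const _
  have hkey : ∀ (ψ : smoothCompact m) v,
      - ∫ x, h x * fderiv ℝ (ψ : Euc m → ℝ) x v = ∫ x, (ψ : Euc m → ℝ) x * D x v := fun ψ v => by
    obtain ⟨B, hB⟩ := ψ.2.2.exists_bound_of_continuous ψ.2.1.continuous
    have hvb : v = ∑ i, v i • b i := by
      have := b.sum_repr v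
      simpa [hb] using this.symm
    have h1 : ∀ x, h x * fderiv ℝ (ψ : Euc m → ℝ) x v =
        ∑ i, v i * (h x * fderiv ℝ (ψ : Euc m → ℝ) x (b i)) := fun x => by
      conv_lhs => rw [hvb]
      rw [_root_.map_sum, Finset.mul_sum]
      refine Finset.sum_congr rfl fun i _ => ?_
      rw [map_smul, smul_eq_mul]; ring
    have h2 : ∀ x, (ψ : Euc m → ℝ) x * D x v = ∑ i, v i * ((ψ : Euc m → ℝ) x * d i x) := fun x => by
      rw [hDv, Finset.mul_sum]
      refine Finset.sum_congr rfl fun i _ => ?_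
      ring
    simp only [h1, h2]
    rw [integral_finsetSum _ fun i _ => (hiψ ψ (b i)).const_mul _,
      integral_finsetSum _ fun i _ => ((hdi i).bdd_mul
        ψ.2.1.continuous.aestronglyMeasurable (ae_of_all _ hB)).const_mul _, ← Finset.sum_neg_distrib]
    refine Finset.sum_congr rfl fun i _ => ?_
    rw [integral_const_mul, integral_const_mul, ← hd, mul_neg]
  refine ⟨D, ⟨hint.locallyIntegrable.locallyIntegrableOn _,
    fun v => (hDi v).locallyIntegrable.locallyIntegrableOn _, fun v ψ hψ hc _ => ?_⟩, hDi, ?_⟩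
  · rw [← hkey ⟨ψ, hψ, hc⟩ v, neg_neg]
  -- A countable dense set of directions leaves a single null set; the other directions follow by
  -- continuity.
  · obtain ⟨S, hSc, hS⟩ := TopologicalSpace.exists_countable_dense (Euc m)
    have h1 : ∀ v ∈ S, ∀ᵐ x, ‖D x v‖ₑ ≤ ‖v‖₊ * g x := fun v _ =>
      ae_enorm_le_of_integral_bound (hDi v) hg hgI fun ψ => by
        rw [← hkey, enorm_neg]
        exact hseg.enorm_integral_mul_fderiv_le hg hgI hint ψ.2.1 ψ.2.2 v
    filter_upwards [(ae_ball_iff hSc).2 h1, ae_lt_top hg hgI] with x hx hgx v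
    have hcl : IsClosed {v : Euc m | ‖D x v‖ₑ ≤ g x * ‖v‖ₑ} :=
      isClosed_le (by fun_prop) ((ENNReal.continuous_const_mul hgx.ne).comp continuous_enorm)
    have := hcl.closure_subset_iff.2 (fun v hv => by
      have := hx v hv
      rwa [mul_comm] at this) (hS v)
    exact this

end SegmentDerivative

/-! ### Convergence of smoothings in L¹. -/

section Smoothing
open Filter Topology
open scoped Convolution
variable {m : ℕ}

theorem integrable_smoothing {f : Euc m → ℝ} (hf : Integrable f) (j : ℕ) :
    Integrable (smoothing f j) :=
  ((mollBump m j).integrable_normed (μ := volume)).integrable_convolution _ hf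

theorem integral_smoothing {f : Euc m → ℝ} (hf : Integrable f) (j : ℕ) :
    ∫ x, smoothing f j x = ∫ x, f x := by
  unfold smoothing
  rw [integral_convolution _ ((mollBump m j).integrable_normed (μ := volume)) hf,
    ContDiffBump.integral_normed]
  simp

/-- Scheffé's argument: |F - f| is twice the positive part of f - F minus f - F. The latter has
integral zero, and the positive part is dominated by f. -/
theorem tendsto_integral_norm_of_nonneg {X : Type*} [MeasurableSpace X] {μ : Measure X}
    {F : ℕ → X → ℝ} {f : X → ℝ} (hF : ∀ j, Integrable (F j) μ) (hf : Integrable f μ)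
    (hF0 : ∀ j x, 0 ≤ F j x) (hf0 : ∀ x, 0 ≤ f x)
    (hlim : ∀ᵐ x ∂μ, Tendsto (fun j => F j x) atTop (𝓝 (f x)))
    (hint : ∀ j, ∫ x, F j x ∂μ = ∫ x, f x ∂μ) :
    Tendsto (fun j => ∫ x, ‖F j x - f x‖ ∂μ) atTop (𝓝 0) := by
  have h1 : Tendsto (fun j => ∫ x, max (f x - F j x) 0 ∂μ) atTop (𝓝 (∫ x, (0 : ℝ) ∂μ)) := by
    refine tendsto_integral_of_dominated_convergence f
      (fun j => (hf.sub (hF j)).pos_part.aestronglyMeasurable) hf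
      (fun j => ae_of_all _ fun x => ?_) ?_
    · rw [Real.norm_of_nonneg (le_max_right _ _)]
      exact max_le (by linarith [hF0 j x]) (hf0 x)
    · filter_upwards [hlim] with x hx
      simpa using (hx.const_sub (f x)).max (tendsto_const_nhds (x := (0 : ℝ)))
  rw [integral_zero] at h1
  have h2 : ∀ j, ∫ x, ‖F j x - f x‖ ∂μ = 2 * ∫ x, max (f x - F j x) 0 ∂μ := fun j => by
    have h3 : ∀ x, ‖F j x - f x‖ = 2 * max (f x - F j x) 0 - (f x - F j x) := fun x => by
      rw [Real.norm_eq_abs]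
      rcases le_total (f x) (F j x) with h | h
      · rw [abs_of_nonneg (by linarith), max_eq_right (by linarith)]; ring
      · rw [abs_of_nonpos (by linarith), max_eq_left (by linarith)]; ring
    have i1 : Integrable (fun x => f x - F j x) μ := hf.sub (hF j)
    have i2 : Integrable (fun x => 2 * max (f x - F j x) 0) μ := i1.pos_part.const_mul 2
    simp only [h3]
    rw [integral_sub i2 i1, integral_sub hf (hF j), hint, sub_self, sub_zero, integral_const_mul]
  simp only [h2]
  simpa using h1.const_mul 2

theorem tendsto_integral_norm_smoothing_sub {f : Euc m → ℝ} (hf : Integrable f) :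
    Tendsto (fun j => ∫ x, ‖smoothing f j x - f x‖) atTop (𝓝 0) := by
  have hpos : ∀ g : Euc m → ℝ, Integrable g → (∀ x, 0 ≤ g x) →
      Tendsto (fun j => ∫ x, ‖smoothing g j x - g x‖) atTop (𝓝 0) := fun g hg hg0 =>
    tendsto_integral_norm_of_nonneg (integrable_smoothing hg) hg (fun j x => by
      rw [smoothing_eq]
      exact integral_nonneg fun z => mul_nonneg ((mollBump m j).nonneg_normed _) (hg0 z)) hg0
      (ae_tendsto_smoothing hg.locallyIntegrable) (integral_smoothing hg)
  have hp : Integrable fun x => max (f x) 0 := hf.pos_part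
  have hn : Integrable fun x => max (-f x) 0 := hf.neg_part
  have hsplit : ∀ j x, smoothing f j x =
      smoothing (fun x => max (f x) 0) j x - smoothing (fun x => max (-f x) 0) j x := fun j x => by
    have hi : ∀ g : Euc m → ℝ, Integrable g →
        Integrable fun z => (mollBump m j).normed volume (x - z) * g z := fun g hg => by
      obtain ⟨B, hB⟩ := (mollTest_mem j x).2.exists_bound_of_continuous
        (mollTest_mem j x).1.continuous
      exact hg.bdd_mul (mollTest_mem j x).1.continuous.aestronglyMeasurable (ae_of_all _ hB)
    rw [smoothing_eq, smoothing_eq, smoothing_eq, ← integral_sub (hi _ hp) (hi _ hn)]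
    congr 1; funext z
    rw [← mul_sub]
    congr 1
    rcases le_total (f z) 0 with h | h
    · rw [max_eq_right h, max_eq_left (by linarith)]; ring
    · rw [max_eq_left h, max_eq_right (by linarith)]; ring
  have h1 := (hpos _ hp fun x => le_max_right _ _).add (hpos _ hn fun x => le_max_right _ _)
  rw [add_zero] at h1
  refine squeeze_zero (fun j => integral_nonneg fun x => norm_nonneg _) (fun j => ?_) h1
  have ip : Integrable fun x => ‖smoothing (fun x => max (f x) 0) j x - max (f x) 0‖ :=
    ((integrable_smoothing hp j).sub hp).norm
  have im : Integrable fun x => ‖smoothing (fun x => max (-f x) 0) j x - max (-f x) 0‖ :=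
    ((integrable_smoothing hn j).sub hn).norm
  rw [← integral_add ip im]
  refine integral_mono ((integrable_smoothing hf j).sub hf).norm (ip.add im) fun x => ?_
  have h3 : f x = max (f x) 0 - max (-f x) 0 := by
    rcases le_total (f x) 0 with h | h
    · rw [max_eq_right h, max_eq_left (by linarith)]; ring
    · rw [max_eq_left h, max_eq_right (by linarith)]; ring
  simp only
  rw [hsplit]
  conv_lhs => rw [h3]
  refine le_trans (le_of_eq ?_) (norm_sub_le _ _)
  congr 1; ring

theorem contDiff_smoothing {f : Euc m → ℝ} (hf : LocallyIntegrable f) (j : ℕ) :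
    ContDiff ℝ ∞ (smoothing f j) :=
  (mollBump m j).hasCompactSupport_normed.contDiff_convolution_left _
    (mollBump m j).contDiff_normed hf

theorem smoothing_eq_zero {f : Euc m → ℝ} {c : Euc m} {r : ℝ}
    (hf : ∀ x ∉ Metric.closedBall c r, f x = 0) (j : ℕ) {x : Euc m}
    (hx : x ∉ Metric.closedBall c (r + mollRadius j)) : smoothing f j x = 0 := by
  rw [smoothing_eq]
  refine integral_eq_zero_of_ae (ae_of_all _ fun z => ?_)
  change _ * f z = 0
  by_cases hz : z ∈ Metric.closedBall c r
  · have h1 : (mollBump m j).normed volume (x - z) = 0 := by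
      by_contra h
      have h2 := mollTest_tsupport j x (subset_tsupport _ h)
      refine hx ?_
      rw [Metric.mem_closedBall] at hz h2 ⊢
      linarith [dist_triangle x z c, dist_comm x z]
    rw [h1, zero_mul]
  · rw [hf z hz, mul_zero]

theorem fderiv_smoothing {h : Euc m → ℝ} {D : Euc m → Euc m →L[ℝ] ℝ}
    (H : HasWeakFDerivOn h D univ) (hf : LocallyIntegrable h) (j : ℕ) (x v : Euc m) :
    fderiv ℝ (smoothing h j) x v = smoothing (fun z => D z v) j x := by
  set η := (mollBump m j).normed (volume : Measure (Euc m)) with hη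
  have hs : HasCompactSupport η := (mollBump m j).hasCompactSupport_normed
  have hc : ContDiff ℝ 1 η := (mollBump m j).contDiff_normed
  have h1 : HasFDerivAt (smoothing h j) _ x :=
    hs.hasFDerivAt_convolution_left (ContinuousLinearMap.mul ℝ ℝ) hc hf x
  have hex := (hs.fderiv ℝ).convolutionExists_left
    ((ContinuousLinearMap.mul ℝ ℝ).precompL (Euc m)) (hc.continuous_fderiv one_ne_zero) hf x
  have h2 : fderiv ℝ (smoothing h j) x v = ∫ z, fderiv ℝ η (x - z) v * h z := by
    rw [h1.fderiv, convolution_eq_swap, ContinuousLinearMap.integral_apply]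
    · rfl
    · exact (convolutionExistsAt_iff_integrable_swap).1 hex
  rw [h2, smoothing_eq]
  have h3 := H.integral_eq v _ (mollTest_mem j x).1 (mollTest_mem j x).2 (subset_univ _)
  rw [← neg_eq_iff_eq_neg, ← integral_neg] at h3
  rw [← h3]
  congr 1; funext z
  have hd : HasFDerivAt η _ (x - z) := (hc.differentiable one_ne_zero _).hasFDerivAt
  have h4 := hd.comp z ((hasFDerivAt_id z).const_sub x)
  have h5 : fderiv ℝ (fun z => η (x - z)) z = _ := h4.fderiv
  rw [h5]
  simp only [ContinuousLinearMap.comp_apply, neg_apply, ContinuousLinearMap.id_apply, map_neg]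
  ring

end Smoothing

/-! ### Changes of variables: the smooth case and integrability. -/

section Pullback
open Filter Topology
variable {m : ℕ}

/-- A change of variables between open subsets of the Euclidean space, defined on `O ⊆ O'`, such
that the preimage of the closed ball `closedBall c R` is relatively closed in `O'`. -/
structure IsChange (T : Euc m → Euc m) (O O' : Set (Euc m)) (c : Euc m) (R : ℝ) : Prop where
  isOpen : IsOpen O
  isOpen' : IsOpen O'
  subset : O ⊆ O'
  contDiffOn : ContDiffOn ℝ ∞ T O
  isCompact : ∀ K ⊆ O', IsCompact K → IsCompact (K ∩ (O ∩ T ⁻¹' Metric.closedBall c R))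
  measure_le : ∀ K ⊆ O', IsCompact K → ∃ C : ℝ≥0∞, C ≠ ⊤ ∧ ∀ A : Set (Euc m),
    volume (T ⁻¹' A ∩ (K ∩ (O ∩ T ⁻¹' Metric.closedBall c R))) ≤ C * volume A

variable {T : Euc m → Euc m} {O O' : Set (Euc m)} {c : Euc m} {R : ℝ}

/-- The derivative of the pullback of a function with derivative `D`. -/
def pullDeriv (T : Euc m → Euc m) (O : Set (Euc m)) (D : Euc m → Euc m →L[ℝ] ℝ) (y : Euc m) :
    Euc m →L[ℝ] ℝ :=
  O.indicator (fun y => (D (T y)).comp (fderiv ℝ T y)) y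

theorem pullDeriv_of_mem {D : Euc m → Euc m →L[ℝ] ℝ} {y : Euc m} (hy : y ∈ O) (v : Euc m) :
    pullDeriv T O D y v = D (T y) (fderiv ℝ T y v) := by
  rw [pullDeriv, indicator_of_mem hy]; rfl

theorem pullDeriv_of_notMem {D : Euc m → Euc m →L[ℝ] ℝ} {y : Euc m} (hy : y ∉ O) :
    pullDeriv T O D y = 0 := by
  rw [pullDeriv, indicator_of_notMem hy]

/-- At a point of O' outside O, relative closedness of the preimage of the ball shows that the
pullback vanishes in a neighbourhood. Extension by zero is therefore harmless. -/
theorem IsChange.pull_contDiffAt (hT : IsChange T O O' c R) {k : Euc m → ℝ} (hk : ContDiff ℝ 1 k)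
    (hk0 : ∀ x ∉ Metric.closedBall c R, k x = 0) {y : Euc m} (hy : y ∈ O') :
    ContDiffAt ℝ 1 (O.indicator (fun y => k (T y))) y ∧
      fderiv ℝ (O.indicator (fun y => k (T y))) y = pullDeriv T O (fderiv ℝ k) y := by
  by_cases hyO : y ∈ O
  · have he : O.indicator (fun y => k (T y)) =ᶠ[𝓝 y] fun y => k (T y) := by
      filter_upwards [hT.isOpen.mem_nhds hyO] with z hz using indicator_of_mem hz _
    have hTy : ContDiffAt ℝ 1 T y :=
      (hT.contDiffOn.contDiffAt (hT.isOpen.mem_nhds hyO)).of_le (by simp)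
    refine ⟨(hk.contDiffAt.comp y hTy).congr_of_eventuallyEq he, ?_⟩
    rw [he.fderiv_eq, pullDeriv, indicator_of_mem hyO]
    exact fderiv_comp y (hk.differentiable one_ne_zero _) (hTy.differentiableAt one_ne_zero)
  · have he : O.indicator (fun y => k (T y)) =ᶠ[𝓝 y] fun _ => 0 := by
      obtain ⟨ρ, hρ, hρO⟩ := Metric.nhds_basis_closedBall.mem_iff.1 (hT.isOpen'.mem_nhds hy)
      have h1 := hT.isCompact _ hρO (isCompact_closedBall y ρ)
      have h2 : (Metric.closedBall y ρ ∩ (O ∩ T ⁻¹' Metric.closedBall c R))ᶜ ∈ 𝓝 y :=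
        h1.isClosed.isOpen_compl.mem_nhds fun h => hyO h.2.1
      filter_upwards [h2, Metric.closedBall_mem_nhds y hρ] with z hz hzρ
      by_cases hzO : z ∈ O
      · rw [indicator_of_mem hzO]
        exact hk0 _ fun h => hz ⟨hzρ, hzO, h⟩
      · exact indicator_of_notMem hzO _
    refine ⟨contDiffAt_const.congr_of_eventuallyEq he, ?_⟩
    rw [he.fderiv_eq, pullDeriv_of_notMem hyO]
    simp

/-- The product of ψ with the pullback is C¹ with compact support, so the integral of its derivative
vanishes. -/
theorem IsChange.integral_pull_smooth (hT : IsChange T O O' c R) {k : Euc m → ℝ}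
    (hk : ContDiff ℝ 1 k) (hk0 : ∀ x ∉ Metric.closedBall c R, k x = 0) {ψ : Euc m → ℝ}
    (hψ : ContDiff ℝ ∞ ψ) (hc : HasCompactSupport ψ) (hs : tsupport ψ ⊆ O') (v : Euc m) :
    ∫ y, O.indicator (fun y => k (T y)) y * fderiv ℝ ψ y v =
      - ∫ y, ψ y * pullDeriv T O (fderiv ℝ k) y v := by
  set κ := O.indicator (fun y => k (T y)) with hκ
  have hψ1 : ContDiff ℝ 1 ψ := hψ.of_le (by simp)
  have hf : ContDiff ℝ 1 fun y => ψ y * κ y := by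
    refine contDiff_iff_contDiffAt.2 fun y => ?_
    by_cases hy : y ∈ tsupport ψ
    · exact hψ1.contDiffAt.mul (hT.pull_contDiffAt hk hk0 (hs hy)).1
    · refine contDiffAt_const (c := (0 : ℝ)) |>.congr_of_eventuallyEq ?_
      filter_upwards [notMem_tsupport_iff_eventuallyEq.1 hy] with z hz
      simp only [hz, Pi.zero_apply, zero_mul]
  have hfc : HasCompactSupport fun y => ψ y * κ y := hc.mul_right
  have hd : ∀ y, fderiv ℝ (fun y => ψ y * κ y) y v =
      κ y * fderiv ℝ ψ y v + ψ y * pullDeriv T O (fderiv ℝ k) y v := fun y => by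
    by_cases hy : y ∈ tsupport ψ
    · obtain ⟨h1, h2⟩ := hT.pull_contDiffAt hk hk0 (hs hy)
      rw [fderiv_fun_mul (hψ1.differentiable one_ne_zero y) (h1.differentiableAt one_ne_zero), ← h2]
      simp only [add_apply, smul_apply, smul_eq_mul]
      ring
    · have h1 := notMem_tsupport_iff_eventuallyEq.1 hy
      have h2 : (fun y => ψ y * κ y) =ᶠ[𝓝 y] fun _ => 0 := by
        filter_upwards [h1] with z hz
        simp only [hz, Pi.zero_apply, zero_mul]
      rw [h2.fderiv_eq, h1.fderiv_eq, h1.eq_of_nhds]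
      simp
  have hfd : Continuous fun y => fderiv ℝ (fun y => ψ y * κ y) y v := by
    have := hf.continuous_fderiv one_ne_zero
    fun_prop
  have hint : Integrable fun y => fderiv ℝ (fun y => ψ y * κ y) y v :=
    hfd.integrable_of_hasCompactSupport (hfc.fderiv_apply ℝ v)
  have h0 : ∫ y, fderiv ℝ (fun y => ψ y * κ y) y v = 0 := by
    have := integral_mul_fderiv_eq_neg_fderiv_mul_of_integrable (μ := (volume : Measure (Euc m)))
      (𝕜 := ℝ) (f := fun _ => (1 : ℝ)) (g := fun y => ψ y * κ y) (v := v) (by simp)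
      (by simpa using hint) (by simpa using hf.continuous.integrable_of_hasCompactSupport hfc)
      (fun _ _ => by fun_prop) (fun y _ => hf.differentiable one_ne_zero y)
    simpa using this
  have h1 : Integrable fun y => κ y * fderiv ℝ ψ y v := by
    have hcont : Continuous fun y => κ y * fderiv ℝ ψ y v := by
      refine continuous_iff_continuousAt.2 fun y => ?_
      have hψd : Continuous fun y => fderiv ℝ ψ y v := by
        have := hψ1.continuous_fderiv one_ne_zero
        fun_prop
      by_cases hy : y ∈ tsupport ψ
      · exact (hT.pull_contDiffAt hk hk0 (hs hy)).1.continuousAt.mul hψd.continuousAt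
      · refine continuousAt_const (y := (0 : ℝ)) |>.congr ?_
        have h1 := (notMem_tsupport_iff_eventuallyEq.1 hy).fderiv (𝕜 := ℝ)
        filter_upwards [h1] with z hz
        rw [hz]
        simp
    exact hcont.integrable_of_hasCompactSupport (hc.fderiv_apply ℝ v).mul_left
  have h2 : ∀ y, ψ y * pullDeriv T O (fderiv ℝ k) y v =
      fderiv ℝ (fun y => ψ y * κ y) y v - κ y * fderiv ℝ ψ y v := fun y => by rw [hd]; ring
  simp only [h2]
  rw [integral_sub hint h1, h0, zero_sub, neg_neg]

theorem IsChange.integrableOn_comp (hT : IsChange T O O' c R) {K : Set (Euc m)} (hKO : K ⊆ O')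
    (hK : IsCompact K) : ∃ C : ℝ≥0∞, C ≠ ⊤ ∧
      AEMeasurable T (volume.restrict (K ∩ (O ∩ T ⁻¹' Metric.closedBall c R))) ∧
      (volume.restrict (K ∩ (O ∩ T ⁻¹' Metric.closedBall c R))).map T ≤ C • volume := by
  obtain ⟨C, hC, h⟩ := hT.measure_le K hKO hK
  have hKm := (hT.isCompact K hKO hK).measurableSet
  have hm : AEMeasurable T (volume.restrict (K ∩ (O ∩ T ⁻¹' Metric.closedBall c R))) :=
    (hT.contDiffOn.continuousOn.mono fun y hy => hy.2.1).aemeasurable hKm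
  refine ⟨C, hC, hm, Measure.le_iff.2 fun A hA => ?_⟩
  rw [Measure.map_apply_of_aemeasurable hm hA, Measure.restrict_apply' hKm]
  exact h A

theorem lintegral_comp_le_of_map_le {X Y : Type*} [MeasurableSpace X] [MeasurableSpace Y]
    {μ : Measure X} {ν : Measure Y} {T : X → Y} (hT : AEMeasurable T μ) {C : ℝ≥0∞}
    (hle : μ.map T ≤ C • ν) {f : Y → ℝ≥0∞} (hf : AEMeasurable f ν) :
    ∫⁻ x, f (T x) ∂μ ≤ C * ∫⁻ y, f y ∂ν := by
  have hac : μ.map T ≪ ν := Measure.absolutelyContinuous_of_le_smul hle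
  rw [← lintegral_map' (hf.mono_ac hac) hT, ← smul_eq_mul, ← lintegral_smul_measure]
  exact lintegral_mono' hle le_rfl

theorem integrable_comp_of_map_le {X Y E : Type*} [MeasurableSpace X] [MeasurableSpace Y]
    [NormedAddCommGroup E] {μ : Measure X} {ν : Measure Y} {T : X → Y} (hT : AEMeasurable T μ)
    {C : ℝ≥0∞} (hC : C ≠ ⊤) (hle : μ.map T ≤ C • ν) {f : Y → E} (hf : Integrable f ν) :
    Integrable (fun x => f (T x)) μ :=
  ((hf.smul_measure hC).mono_measure hle).comp_aemeasurable hT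

end Pullback

/-! ### Changes of variables: the chain rule for weak derivatives. -/

section Pullback
open Filter Topology
variable {m : ℕ} {T : Euc m → Euc m} {O O' : Set (Euc m)} {c : Euc m} {R : ℝ}

theorem indicator_comp_eq {k : Euc m → ℝ} (hk0 : ∀ x ∉ Metric.closedBall c R, k x = 0)
    (K : Set (Euc m)) {y : Euc m} (hy : y ∈ K) :
    O.indicator (fun y => k (T y)) y =
      (K ∩ (O ∩ T ⁻¹' Metric.closedBall c R)).indicator (fun y => k (T y)) y := by
  by_cases h1 : y ∈ O
  · rw [indicator_of_mem h1]
    by_cases h2 : T y ∈ Metric.closedBall c R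
    · rw [indicator_of_mem (show y ∈ K ∩ (O ∩ T ⁻¹' Metric.closedBall c R) from ⟨hy, h1, h2⟩)]
    · rw [indicator_of_notMem fun h => h2 h.2.2, hk0 _ h2]
  · rw [indicator_of_notMem h1, indicator_of_notMem fun h => h1 h.2.1]

theorem pullDeriv_eq_indicator {D : Euc m → Euc m →L[ℝ] ℝ}
    (hD0 : ∀ x ∉ Metric.closedBall c R, D x = 0) (K : Set (Euc m)) {y : Euc m} (hy : y ∈ K)
    (v : Euc m) : pullDeriv T O D y v = (K ∩ (O ∩ T ⁻¹' Metric.closedBall c R)).indicator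
      (fun y => ∑ i, fderiv ℝ T y v i * D (T y) (EuclideanSpace.basisFun (Fin m) ℝ i)) y := by
  have hsum : ∀ L : Euc m →L[ℝ] ℝ, ∀ w : Euc m,
      L w = ∑ i, w i * L (EuclideanSpace.basisFun (Fin m) ℝ i) := fun L w => by
    have h1 : w = ∑ i, w i • EuclideanSpace.basisFun (Fin m) ℝ i := by
      simpa using ((EuclideanSpace.basisFun (Fin m) ℝ).sum_repr w).symm
    conv_lhs => rw [h1]
    simp only [_root_.map_sum, map_smul, smul_eq_mul]
  by_cases h1 : y ∈ O
  · rw [pullDeriv_of_mem h1]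
    by_cases h2 : T y ∈ Metric.closedBall c R
    · rw [indicator_of_mem (show y ∈ K ∩ (O ∩ T ⁻¹' Metric.closedBall c R) from ⟨hy, h1, h2⟩),
        hsum]
    · rw [indicator_of_notMem fun h => h2 h.2.2, hD0 _ h2]; simp
  · rw [indicator_of_notMem fun h => h1 h.2.1, pullDeriv_of_notMem h1]; simp

theorem IsChange.exists_bound (hT : IsChange T O O' c R) {K : Set (Euc m)} (hKO : K ⊆ O')
    (hK : IsCompact K) (v : Euc m) : ∃ B : ℝ, ∀ i,
      AEStronglyMeasurable (fun y => fderiv ℝ T y v i)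
        (volume.restrict (K ∩ (O ∩ T ⁻¹' Metric.closedBall c R))) ∧
      ∀ y ∈ K ∩ (O ∩ T ⁻¹' Metric.closedBall c R), ‖fderiv ℝ T y v i‖ ≤ B := by
  have hKc := hT.isCompact K hKO hK
  have h1 : ContinuousOn (fun y => fderiv ℝ T y v)
      (K ∩ (O ∩ T ⁻¹' Metric.closedBall c R)) := by
    have h2 : ContinuousOn (fderiv ℝ T) O := hT.contDiffOn.continuousOn_fderiv_of_isOpen hT.isOpen
      (by simp)
    exact (h2.mono fun y hy => hy.2.1).clm_apply continuousOn_const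
  obtain ⟨B, hB⟩ := hKc.exists_bound_of_continuousOn h1
  refine ⟨B, fun i => ⟨?_, fun y hy => (PiLp.norm_apply_le _ i).trans (hB y hy)⟩⟩
  have h3 : ContinuousOn (fun y => fderiv ℝ T y v i)
      (K ∩ (O ∩ T ⁻¹' Metric.closedBall c R)) :=
    (EuclideanSpace.proj (𝕜 := ℝ) i).continuous.comp_continuousOn h1
  exact h3.aestronglyMeasurable hKc.measurableSet

theorem IsChange.integrableOn_pull (hT : IsChange T O O' c R) {k : Euc m → ℝ} (hk : Integrable k)
    (hk0 : ∀ x ∉ Metric.closedBall c R, k x = 0) {K : Set (Euc m)} (hKO : K ⊆ O')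
    (hK : IsCompact K) : IntegrableOn (O.indicator fun y => k (T y)) K := by
  obtain ⟨C, hC, hm, hle⟩ := hT.integrableOn_comp hKO hK
  have hKc := hT.isCompact K hKO hK
  have h1 := integrable_comp_of_map_le hm hC hle hk
  have h2 := (integrable_indicator_iff hKc.measurableSet).2 h1
  refine h2.integrableOn.congr_fun (fun y hy => ?_) hK.measurableSet
  exact (indicator_comp_eq hk0 K hy).symm

theorem IsChange.integrableOn_pullDeriv (hT : IsChange T O O' c R) {D : Euc m → Euc m →L[ℝ] ℝ}
    (hD : ∀ v, Integrable fun x => D x v) (hD0 : ∀ x ∉ Metric.closedBall c R, D x = 0)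
    {K : Set (Euc m)} (hKO : K ⊆ O') (hK : IsCompact K) (v : Euc m) :
    IntegrableOn (fun y => pullDeriv T O D y v) K := by
  obtain ⟨C, hC, hm, hle⟩ := hT.integrableOn_comp hKO hK
  have hKc := hT.isCompact K hKO hK
  obtain ⟨B, hB⟩ := hT.exists_bound hKO hK v
  have h1 : Integrable (fun y => ∑ i, fderiv ℝ T y v i *
      D (T y) (EuclideanSpace.basisFun (Fin m) ℝ i))
      (volume.restrict (K ∩ (O ∩ T ⁻¹' Metric.closedBall c R))) :=
    integrable_finsetSum _ fun i _ => (integrable_comp_of_map_le hm hC hle (hD _)).bdd_mul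
      (hB i).1 ((ae_restrict_mem hKc.measurableSet).mono fun y hy => (hB i).2 y hy)
  have h2 := (integrable_indicator_iff hKc.measurableSet).2 h1
  refine h2.integrableOn.congr_fun (fun y hy => ?_) hK.measurableSet
  exact (pullDeriv_eq_indicator hD0 K hy v).symm

theorem tendsto_lintegral_enorm_comp {X Y : Type*} [MeasurableSpace X] [MeasurableSpace Y]
    {μ : Measure X} {ν : Measure Y} {T : X → Y} (hT : AEMeasurable T μ) {C : ℝ≥0∞} (hC : C ≠ ⊤)
    (hle : μ.map T ≤ C • ν) {F : ℕ → Y → ℝ} {f : Y → ℝ} (hF : ∀ j, Integrable (F j) ν)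
    (hf : Integrable f ν) (h : Tendsto (fun j => ∫ y, ‖F j y - f y‖ ∂ν) atTop (𝓝 0)) :
    Tendsto (fun j => ∫⁻ x, ‖F j (T x) - f (T x)‖ₑ ∂μ) atTop (𝓝 0) := by
  have h1 : Tendsto (fun j => C * ENNReal.ofReal (∫ y, ‖F j y - f y‖ ∂ν)) atTop (𝓝 0) := by
    simpa using ENNReal.Tendsto.const_mul (ENNReal.tendsto_ofReal h) (Or.inr hC)
  refine tendsto_of_tendsto_of_tendsto_of_le_of_le tendsto_const_nhds h1 (fun j => zero_le)
    fun j => ?_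
  have h2 : Integrable (fun y => F j y - f y) ν := (hF j).sub hf
  simp only
  rw [ofReal_integral_norm_eq_lintegral_enorm h2]
  exact lintegral_comp_le_of_map_le hT hle h2.aestronglyMeasurable.enorm

theorem tendsto_integral_mul_of_tendsto {X : Type*} [MeasurableSpace X] {μ : Measure X}
    {F : ℕ → X → ℝ} {f a : X → ℝ} {B : ℝ} (hF : ∀ᶠ j in atTop, Integrable (F j) μ)
    (hf : Integrable f μ) (ha : AEStronglyMeasurable a μ) (hB : ∀ᵐ x ∂μ, ‖a x‖ ≤ B)
    (h : Tendsto (fun j => ∫⁻ x, ‖F j x - f x‖ₑ ∂μ) atTop (𝓝 0)) :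
    Tendsto (fun j => ∫ x, a x * F j x ∂μ) atTop (𝓝 (∫ x, a x * f x ∂μ)) := by
  refine tendsto_integral_of_L1 _ (hf.bdd_mul ha hB).aestronglyMeasurable
    (hF.mono fun j hj => hj.bdd_mul ha hB) ?_
  have h1 : Tendsto (fun j => ENNReal.ofReal B * ∫⁻ x, ‖F j x - f x‖ₑ ∂μ) atTop (𝓝 0) := by
    simpa using ENNReal.Tendsto.const_mul h (Or.inr ENNReal.ofReal_ne_top)
  refine tendsto_of_tendsto_of_tendsto_of_le_of_le tendsto_const_nhds h1 (fun j => zero_le)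
    fun j => ?_
  simp only
  rw [← lintegral_const_mul' _ _ ENNReal.ofReal_ne_top]
  refine lintegral_mono_ae ?_
  filter_upwards [hB] with x hx
  rw [← mul_sub, enorm_mul]
  gcongr
  rw [← ofReal_norm]
  exact ENNReal.ofReal_le_ofReal hx

/-- The chain rule holds for the smoothings of h. These converge in L¹ together with their
derivatives, and the bounded distortion of volume transfers the convergence to the pullbacks on
compact sets. The gap r < R leaves room for the spreading of the supports. -/
theorem IsChange.hasWeakFDerivOn (hT : IsChange T O O' c R) {h : Euc m → ℝ}
    {D : Euc m → Euc m →L[ℝ] ℝ} {r : ℝ} (hr : r < R) (H : HasWeakFDerivOn h D univ)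
    (hh : Integrable h) (hD : ∀ v, Integrable fun x => D x v)
    (hh0 : ∀ x ∉ Metric.closedBall c r, h x = 0) (hD0 : ∀ x ∉ Metric.closedBall c r, D x = 0) :
    HasWeakFDerivOn (O.indicator fun y => h (T y)) (pullDeriv T O D) O' := by
  have hsub : Metric.closedBall c r ⊆ Metric.closedBall c R := Metric.closedBall_subset_closedBall hr.le
  have hh0' : ∀ x ∉ Metric.closedBall c R, h x = 0 := fun x hx => hh0 x fun h => hx (hsub h)
  have hD0' : ∀ x ∉ Metric.closedBall c R, D x = 0 := fun x hx => hD0 x fun h => hx (hsub h)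
  refine ⟨(locallyIntegrableOn_iff hT.isOpen'.isLocallyClosed).2 fun K hKO hK =>
    hT.integrableOn_pull hh hh0' hKO hK, fun v =>
    (locallyIntegrableOn_iff hT.isOpen'.isLocallyClosed).2 fun K hKO hK =>
    hT.integrableOn_pullDeriv hD hD0' hKO hK v, fun v ψ hψ hc hs => ?_⟩
  set K := tsupport ψ with hK
  have hKc : IsCompact K := hc
  set P := K ∩ (O ∩ T ⁻¹' Metric.closedBall c R) with hP
  have hPc : IsCompact P := hT.isCompact K hs hKc
  obtain ⟨C, hC, hm, hle⟩ := hT.integrableOn_comp hs hKc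
  have hψ1 : ContDiff ℝ 1 ψ := hψ.of_le (by simp)
  have hψd : Continuous fun y => fderiv ℝ ψ y v := by
    have := hψ1.continuous_fderiv one_ne_zero
    fun_prop
  obtain ⟨B₁, hB₁⟩ := (hc.fderiv_apply ℝ v).exists_bound_of_continuous hψd
  obtain ⟨B₂, hB₂⟩ := hc.exists_bound_of_continuous hψ.continuous
  obtain ⟨B₃, hB₃⟩ := hT.exists_bound hs hKc v
  have ha : ∀ i, AEStronglyMeasurable (fun y => ψ y * fderiv ℝ T y v i) (volume.restrict P) :=
    fun i => AEStronglyMeasurable.mul hψ.continuous.aestronglyMeasurable (hB₃ i).1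
  have hab : ∀ i, ∀ᵐ y ∂(volume.restrict P), ‖ψ y * fderiv ℝ T y v i‖ ≤ B₂ * B₃ := fun i => by
    filter_upwards [ae_restrict_mem hPc.measurableSet] with y hy
    rw [norm_mul]
    exact mul_le_mul (hB₂ y) ((hB₃ i).2 y hy) (norm_nonneg _) ((norm_nonneg _).trans (hB₂ y))
  have hcomp : ∀ f : Euc m → ℝ, Integrable f → Integrable (fun y => f (T y)) (volume.restrict P) :=
    fun f hf => integrable_comp_of_map_le hm hC hle hf
  have hlim : ∀ (a f : Euc m → ℝ) (B : ℝ), AEStronglyMeasurable a (volume.restrict P) →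
      (∀ᵐ y ∂(volume.restrict P), ‖a y‖ ≤ B) → Integrable f →
      Tendsto (fun j => ∫ y in P, a y * smoothing f j (T y)) atTop
        (𝓝 (∫ y in P, a y * f (T y))) := fun a f B ha hB hf =>
    tendsto_integral_mul_of_tendsto (F := fun j y => smoothing f j (T y)) (f := fun y => f (T y))
      (Eventually.of_forall fun j => hcomp _ (integrable_smoothing hf j)) (hcomp _ hf) ha hB
      (tendsto_lintegral_enorm_comp hm hC hle (integrable_smoothing hf) hf
        (tendsto_integral_norm_smoothing_sub hf))
  have hL : ∀ k : Euc m → ℝ, (∀ x ∉ Metric.closedBall c R, k x = 0) →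
      ∫ y, O.indicator (fun y => k (T y)) y * fderiv ℝ ψ y v =
        ∫ y in P, fderiv ℝ ψ y v * k (T y) := fun k hk => by
    rw [← integral_indicator hPc.measurableSet]
    congr 1; funext y
    by_cases hy : y ∈ K
    · rw [indicator_comp_eq hk K hy, ← hP]
      by_cases hyP : y ∈ P
      · rw [indicator_of_mem hyP, indicator_of_mem hyP, mul_comm]
      · rw [indicator_of_notMem hyP, indicator_of_notMem hyP, zero_mul]
    · rw [(notMem_tsupport_iff_eventuallyEq.1 hy).fderiv_eq,
        indicator_of_notMem (show y ∉ P from fun h => hy h.1)]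
      simp
  have hRs : ∀ D : Euc m → Euc m →L[ℝ] ℝ, (∀ x ∉ Metric.closedBall c R, D x = 0) →
      (∀ v, Integrable fun x => D x v) →
      ∫ y, ψ y * pullDeriv T O D y v = ∑ i, ∫ y in P, (ψ y * fderiv ℝ T y v i) *
        D (T y) (EuclideanSpace.basisFun (Fin m) ℝ i) := fun D hD hDi => by
    rw [← integral_finsetSum, ← integral_indicator hPc.measurableSet]
    · congr 1; funext y
      by_cases hy : y ∈ K
      · rw [pullDeriv_eq_indicator hD K hy, ← hP]
        by_cases hyP : y ∈ P
        · rw [indicator_of_mem hyP, indicator_of_mem hyP, Finset.mul_sum]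
          refine Finset.sum_congr rfl fun i _ => ?_
          ring
        · rw [indicator_of_notMem hyP, indicator_of_notMem hyP, mul_zero]
      · rw [indicator_of_notMem (show y ∉ P from fun h => hy h.1),
          image_eq_zero_of_notMem_tsupport hy, zero_mul]
    · intro i _
      exact (hcomp _ (hDi _)).bdd_mul (ha i) (hab i)
  have hsm0 : ∀ᶠ j in atTop, ∀ x ∉ Metric.closedBall c R, smoothing h j x = 0 := by
    filter_upwards [tendsto_mollRadius.eventually (gt_mem_nhds (sub_pos.2 hr))] with j hj x hx
    exact smoothing_eq_zero hh0 j fun h => hx (Metric.closedBall_subset_closedBall (by linarith) h)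
  have hsmd0 : ∀ᶠ j in atTop, ∀ x ∉ Metric.closedBall c R, fderiv ℝ (smoothing h j) x = 0 := by
    filter_upwards [tendsto_mollRadius.eventually (gt_mem_nhds (sub_pos.2 hr))] with j hj x hx
    ext v
    rw [fderiv_smoothing H hh.locallyIntegrable]
    exact smoothing_eq_zero (fun z hz => by rw [hD0 z hz]; rfl) j
      fun h => hx (Metric.closedBall_subset_closedBall (by linarith) h)
  have hlim1 := hlim _ h B₁ hψd.aestronglyMeasurable (ae_of_all _ hB₁) hh
  have hlim2 : Tendsto (fun j => ∑ i, ∫ y in P, (ψ y * fderiv ℝ T y v i) *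
        smoothing (fun z => D z (EuclideanSpace.basisFun (Fin m) ℝ i)) j (T y)) atTop
      (𝓝 (∑ i, ∫ y in P, (ψ y * fderiv ℝ T y v i) *
        D (T y) (EuclideanSpace.basisFun (Fin m) ℝ i))) :=
    tendsto_finsetSum _ fun i _ => hlim _ _ _ (ha i) (hab i) (hD _)
  rw [hL h hh0', hRs D hD0' hD]
  refine tendsto_nhds_unique hlim1 ((hlim2.neg).congr' ?_)
  filter_upwards [hsm0, hsmd0] with j h0 hd0
  have hsmooth : ContDiff ℝ 1 (smoothing h j) :=
    (contDiff_smoothing hh.locallyIntegrable j).of_le (by simp)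
  have h1 := hT.integral_pull_smooth hsmooth h0 hψ hc hs v
  rw [hL _ h0, hRs _ hd0] at h1
  · rw [h1]
    simp only [fderiv_smoothing H hh.locallyIntegrable]
  · intro w
    simp only [fderiv_smoothing H hh.locallyIntegrable]
    exact integrable_smoothing (hD w) j

end Pullback

/-! ### Transplanting a function from a chart to the manifold. -/

section Transplant
open Filter Topology Manifold
variable {m : ℕ} {M : Type*} [EMetricSpace M] [MeasurableSpace M] [BorelSpace M]
    [ChartedSpace (EuclideanSpace ℝ (Fin m)) M] [IsManifold (𝓡 m) ∞ M]
    [RiemannianBundle (fun x : M => TangentSpace (𝓡 m) x)]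

/-- The chart `e` is bi-Lipschitz with constant `L` on the closed ball `closedBall c R`. -/
structure ChartBall (e : OpenPartialHomeomorph M (Euc m)) (c : Euc m) (R : ℝ) (L : NNReal) :
    Prop where
  mem : e ∈ atlas (Euc m) M
  pos : 0 < R
  subset : Metric.closedBall c R ⊆ e.target
  edist_le : ∀ y ∈ Metric.closedBall c R, ∀ y' ∈ Metric.closedBall c R,
    edist y y' ≤ L * edist (e.symm y) (e.symm y')
  edist_symm_le : ∀ y ∈ Metric.closedBall c R, ∀ y' ∈ Metric.closedBall c R,
    edist (e.symm y) (e.symm y') ≤ L * edist y y'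
  deriv_le : ∀ y ∈ Metric.closedBall c R, ∀ v, ‖eucDeriv e (e.symm y) v‖ₑ ≤ L * ‖v‖ₑ
  deriv_symm_le : ∀ y ∈ Metric.closedBall c R, ∀ v, ‖derivOfEuc e.symm y v‖ₑ ≤ L * ‖v‖ₑ
  exists_measure_chart_le : ∀ K ⊆ e.target, IsCompact K → ∃ C : ℝ≥0∞, C ≠ ⊤ ∧
    ∀ A : Set (Euc m), (μHE[m] : Measure M) (e ⁻¹' A ∩ e.symm '' K) ≤ C * volume A
  exists_measure_chart_symm_le : ∀ e' ∈ atlas (Euc m) M, ∀ K ⊆ e'.target, IsCompact K →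
    ∃ C : ℝ≥0∞, C ≠ ⊤ ∧ ∀ A : Set M, volume (e'.symm ⁻¹' A ∩ K) ≤ C * μHE[m] A

theorem exists_chartBall [IsContMDiffRiemannianBundle (𝓡 m) ∞ (EuclideanSpace ℝ (Fin m))
      (fun x : M => TangentSpace (𝓡 m) x)] [IsRiemannianManifold (𝓡 m) M] (x : M) :
    ∃ (e : OpenPartialHomeomorph M (Euc m)) (c : Euc m) (R : ℝ) (L : NNReal),
      ChartBall e c R L := by
  set e := chartAt (Euc m) x with he
  have hex : e.symm (e x) = x := e.left_inv (mem_chart_source _ x)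
  have hea : e ∈ atlas (Euc m) M := chart_mem_atlas _ x
  have hc : ContinuousAt e.symm (e x) := e.symm.continuousAt (mem_chart_target _ x)
  obtain ⟨C₁, U, hU, hUt, h₁⟩ := exists_biLipschitz_chart hea (mem_chart_target (Euc m) x)
  obtain ⟨C₂, h₂⟩ := eventually_enorm_eucDeriv_chartAt_le (m := m) x
  obtain ⟨C₃, h₃⟩ := eventually_enorm_derivOfEuc_chartAt_symm_le (m := m) x
  have h₂' := hc.eventually (by rwa [hex])
  obtain ⟨R, hR, hRs⟩ := Metric.nhds_basis_closedBall.mem_iff.1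
    (inter_mem hU (inter_mem h₂' h₃))
  refine ⟨e, e x, R, max C₁ (max C₂ C₃), hea, hR, fun y hy => hUt (hRs hy).1,
    fun y hy y' hy' => ?_, fun y hy y' hy' => ?_, fun y hy v => ?_, fun y hy v => ?_,
    fun K hK hKc => exists_measure_chart_le hea hKc hK,
    fun e' he' K hK hKc => exists_measure_chart_symm_le he' hKc hK⟩
  · refine ((h₁ _ (hRs hy).1 _ (hRs hy').1).2).trans ?_
    gcongr; exact le_max_left _ _
  · refine ((h₁ _ (hRs hy).1 _ (hRs hy').1).1).trans ?_
    gcongr; exact le_max_left _ _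
  · refine ((hRs hy).2.1 v).trans ?_
    gcongr; exact (le_max_left _ _).trans (le_max_right _ _)
  · refine ((hRs hy).2.2 v).trans ?_
    gcongr; exact (le_max_right _ _).trans (le_max_right _ _)

variable {e : OpenPartialHomeomorph M (Euc m)} {c : Euc m} {R : ℝ} {L : NNReal}

theorem ChartBall.isCompact_image (h : ChartBall e c R L) {r : ℝ} (hr : r ≤ R) :
    IsCompact (e.symm '' Metric.closedBall c r) :=
  (isCompact_closedBall c r).image_of_continuousOn
    (e.continuousOn_symm.mono ((Metric.closedBall_subset_closedBall hr).trans h.subset))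

theorem mem_image_symm_iff {s : Set (Euc m)} (hs : s ⊆ e.target) {x : M} :
    x ∈ e.symm '' s ↔ x ∈ e.source ∧ e x ∈ s := by
  constructor
  · rintro ⟨y, hy, rfl⟩
    exact ⟨e.map_target (hs hy), by rwa [e.right_inv (hs hy)]⟩
  · rintro ⟨h1, h2⟩
    exact ⟨e x, h2, e.left_inv h1⟩

theorem ChartBall.map_le (h : ChartBall e c R L) : ∃ C : ℝ≥0∞, C ≠ ⊤ ∧
    AEMeasurable e ((μHE[m] : Measure M).restrict (e.symm '' Metric.closedBall c R)) ∧
    ((μHE[m] : Measure M).restrict (e.symm '' Metric.closedBall c R)).map e ≤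
      C • (volume : Measure (Euc m)) := by
  obtain ⟨C, hC, hle⟩ := h.exists_measure_chart_le _ h.subset (isCompact_closedBall c R)
  have hm : MeasurableSet (e.symm '' Metric.closedBall c R) :=
    (h.isCompact_image le_rfl).isClosed.measurableSet
  have hme : AEMeasurable e ((μHE[m] : Measure M).restrict (e.symm '' Metric.closedBall c R)) :=
    (e.continuousOn.mono fun x hx => ((mem_image_symm_iff h.subset).1 hx).1).aemeasurable hm
  refine ⟨C, hC, hme, Measure.le_iff.2 fun A hA => ?_⟩
  rw [Measure.map_apply_of_aemeasurable hme hA, Measure.restrict_apply' hm]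
  exact hle A

theorem ChartBall.map_symm_le (h : ChartBall e c R L) : ∃ C : ℝ≥0∞, C ≠ ⊤ ∧
    AEMeasurable e.symm (volume.restrict (Metric.closedBall c R)) ∧
    (volume.restrict (Metric.closedBall c R)).map e.symm ≤ C • (μHE[m] : Measure M) := by
  obtain ⟨C, hC, hle⟩ := h.exists_measure_chart_symm_le e h.mem _ h.subset (isCompact_closedBall c R)
  have hm : MeasurableSet (Metric.closedBall c R) := Metric.isClosed_closedBall.measurableSet
  have hme : AEMeasurable e.symm (volume.restrict (Metric.closedBall c R)) :=
    (e.continuousOn_symm.mono h.subset).aemeasurable hm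
  refine ⟨C, hC, hme, Measure.le_iff.2 fun A hA => ?_⟩
  rw [Measure.map_apply_of_aemeasurable hme hA, Measure.restrict_apply' hm]
  exact hle A

theorem contDiffAt_transition {e' : OpenPartialHomeomorph M (Euc m)} (he : e ∈ atlas (Euc m) M)
    (he' : e' ∈ atlas (Euc m) M) {y : Euc m} (hy : y ∈ e'.target) (hye : e'.symm y ∈ e.source) :
    ContDiffAt ℝ ∞ (fun y => e (e'.symm y)) y := by
  have h1 := IsManifold.subset_maximalAtlas (I := 𝓡 m) (n := ∞) he
  have h2 := IsManifold.subset_maximalAtlas (I := 𝓡 m) (n := ∞) he'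
  have h3 : ContMDiffAt (𝓡 m) (𝓡 m) ∞ (e ∘ e'.symm) y :=
    (contMDiffAt_of_mem_maximalAtlas h1 hye).comp y (contMDiffAt_symm_of_mem_maximalAtlas h2 hy)
  exact h3.contDiffAt

theorem ChartBall.isChange (h : ChartBall e c R L) {e' : OpenPartialHomeomorph M (Euc m)}
    (he' : e' ∈ atlas (Euc m) M) :
    IsChange (fun y => e (e'.symm y)) (e'.target ∩ e'.symm ⁻¹' e.source) e'.target c R := by
  have key : ∀ K ⊆ e'.target, K ∩ ((e'.target ∩ e'.symm ⁻¹' e.source) ∩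
      (fun y => e (e'.symm y)) ⁻¹' Metric.closedBall c R) =
        K ∩ e'.symm ⁻¹' (e.symm '' Metric.closedBall c R) := fun K hK => by
    ext y
    simp only [mem_inter_iff, mem_preimage, mem_image_symm_iff h.subset]
    exact ⟨fun ⟨h1, ⟨h2, h3⟩, h4⟩ => ⟨h1, h3, h4⟩, fun ⟨h1, h3, h4⟩ => ⟨h1, ⟨hK h1, h3⟩, h4⟩⟩
  refine ⟨e'.symm.isOpen_inter_preimage e.open_source, e'.open_target, inter_subset_left,
    fun y hy => (contDiffAt_transition h.mem he' hy.1 hy.2).contDiffWithinAt, fun K hK hKc => ?_,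
    fun K hK hKc => ?_⟩
  · rw [key K hK]
    refine hKc.of_isClosed_subset ?_ inter_subset_left
    exact (e'.continuousOn_symm.mono hK).preimage_isClosed_of_isClosed hKc.isClosed
      (h.isCompact_image le_rfl).isClosed
  · obtain ⟨C₁, hC₁, h₁⟩ := h.exists_measure_chart_symm_le e' he' K hK hKc
    obtain ⟨C₂, hC₂, h₂⟩ := h.exists_measure_chart_le _ h.subset (isCompact_closedBall c R)
    refine ⟨C₁ * C₂, ENNReal.mul_ne_top hC₁ hC₂, fun A => ?_⟩
    rw [key K hK]
    calc _ ≤ volume (e'.symm ⁻¹' (e ⁻¹' A ∩ e.symm '' Metric.closedBall c R) ∩ K) :=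
          measure_mono fun y hy => ⟨⟨hy.1, hy.2.2⟩, hy.2.1⟩
      _ ≤ C₁ * μHE[m] (e ⁻¹' A ∩ e.symm '' Metric.closedBall c R) := h₁ _
      _ ≤ C₁ * (C₂ * volume A) := by gcongr; exact h₂ A
      _ = _ := by ring

theorem HasWeakFDerivOn.add_const {h : Euc m → ℝ} {D : Euc m → Euc m →L[ℝ] ℝ} {A : Set (Euc m)}
    (H : HasWeakFDerivOn h D A) (b : ℝ) : HasWeakFDerivOn (fun x => h x + b) D A where
  locallyIntegrableOn := H.locallyIntegrableOn.add ((locallyIntegrable_const b).locallyIntegrableOn _)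
  locallyIntegrableOn_deriv := H.locallyIntegrableOn_deriv
  integral_eq v ψ hψ hc hs := by
    have hψ1 : ContDiff ℝ 1 ψ := hψ.of_le (by simp)
    have hψd : Continuous fun y => fderiv ℝ ψ y v := by
      have := hψ1.continuous_fderiv one_ne_zero
      fun_prop
    have hi : Integrable fun y => fderiv ℝ ψ y v :=
      hψd.integrable_of_hasCompactSupport (hc.fderiv_apply ℝ v)
    have h0 : ∫ y, fderiv ℝ ψ y v = 0 := by
      have := integral_mul_fderiv_eq_neg_fderiv_mul_of_integrable (μ := (volume : Measure (Euc m)))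
        (𝕜 := ℝ) (f := fun _ => (1 : ℝ)) (g := ψ) (v := v) (by simp)
        (by simpa using hi) (by simpa using hψ.continuous.integrable_of_hasCompactSupport hc)
        (fun _ _ => by fun_prop) (fun y _ => hψ1.differentiable one_ne_zero y)
      simpa using this
    obtain ⟨B, hB⟩ := (hc.fderiv_apply ℝ v).exists_bound_of_continuous hψd
    have h1 : Integrable fun y => h y * fderiv ℝ ψ y v := by
      have h2 := H.locallyIntegrableOn.integrableOn_compact_subset hs hc
      have h3 : IntegrableOn (fun y => h y * fderiv ℝ ψ y v) (tsupport ψ) :=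
        h2.mul_bdd hψd.aestronglyMeasurable (ae_of_all _ hB)
      refine (integrableOn_iff_integrable_of_support_subset fun y hy => ?_).1 h3
      by_contra hys
      exact hy (by simp [(notMem_tsupport_iff_eventuallyEq.1 hys).fderiv_eq])
    rw [← H.integral_eq v ψ hψ hc hs]
    simp only [add_mul]
    rw [integral_add h1 (hi.const_mul b), integral_const_mul, h0, mul_zero, add_zero]

open Classical in
/-- The transplantation of a map from the Euclidean space to the manifold. -/
def transplant {N : Type*} (e : OpenPartialHomeomorph M (Euc m)) (v : Euc m → N) (b : N) (x : M) :
    N :=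
  if x ∈ e.source then v (e x) else b

open Classical in
/-- The differential of the transplantation of a function. -/
def transplantDeriv (e : OpenPartialHomeomorph M (Euc m)) (D : Euc m → Euc m →L[ℝ] ℝ) (x : M) :
    TangentSpace (𝓡 m) x →L[ℝ] ℝ :=
  if x ∈ e.source then (D (e x)).comp (eucDeriv e x) else 0

/-- Read in any chart of the atlas, the transplanted function minus b is the pullback of h - b by a
transition map, extended by zero. Subtracting b is what makes the function integrable and compactly
supported. -/
theorem ChartBall.hasWeakDifferentialOn (hB : ChartBall e c R L) {h : Euc m → ℝ} {b : ℝ}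
    {D : Euc m → Euc m →L[ℝ] ℝ} {r : ℝ} (hr : r < R)
    (H : HasWeakFDerivOn (fun x => h x - b) D univ)
    (hh : Integrable fun x => h x - b) (hD : ∀ v, Integrable fun x => D x v)
    (hh0 : ∀ x ∉ Metric.closedBall c r, h x = b) (hD0 : ∀ x ∉ Metric.closedBall c r, D x = 0) :
    HasWeakDifferentialOn m (transplant e h b) (transplantDeriv e D) univ := by
  have key : ∀ e' ∈ atlas (Euc m) M,
      HasWeakFDerivOn (fun y => (e'.target ∩ e'.symm ⁻¹' e.source).indicator
        (fun y => h (e (e'.symm y)) - b) y + b)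
        (pullDeriv (fun y => e (e'.symm y)) (e'.target ∩ e'.symm ⁻¹' e.source) D) e'.target :=
    fun e' he' => ((hB.isChange he').hasWeakFDerivOn hr H hh hD
      (fun x hx => by rw [hh0 x hx, sub_self]) hD0).add_const b
  have k1 : ∀ e' : OpenPartialHomeomorph M (Euc m), ∀ y ∈ e'.target,
      (e'.target ∩ e'.symm ⁻¹' e.source).indicator (fun y => h (e (e'.symm y)) - b) y + b =
        transplant e h b (e'.symm y) := fun e' y hy => by
    by_cases hye : e'.symm y ∈ e.source
    · rw [indicator_of_mem (show y ∈ e'.target ∩ e'.symm ⁻¹' e.source from ⟨hy, hye⟩), transplant,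
        if_pos hye, sub_add_cancel]
    · rw [indicator_of_notMem (fun h => hye h.2), transplant, if_neg hye, zero_add]
  have k2 : ∀ e' ∈ atlas (Euc m) M, ∀ y ∈ e'.target, ∀ v,
      pullDeriv (fun y => e (e'.symm y)) (e'.target ∩ e'.symm ⁻¹' e.source) D y v =
        transplantDeriv e D (e'.symm y) (mfderiv (𝓡 m) (𝓡 m) e'.symm y v) :=
    fun e' he' y hy v => by
    by_cases hye : e'.symm y ∈ e.source
    · rw [pullDeriv_of_mem (show y ∈ e'.target ∩ e'.symm ⁻¹' e.source from ⟨hy, hye⟩),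
        transplantDeriv, if_pos hye, ContinuousLinearMap.comp_apply]
      congr 1
      have h1 : mfderiv (𝓡 m) (𝓡 m) (e ∘ e'.symm) y =
          (mfderiv (𝓡 m) (𝓡 m) e (e'.symm y)).comp (mfderiv (𝓡 m) (𝓡 m) e'.symm y) :=
        mfderiv_comp y (mdifferentiableAt_atlas hB.mem hye) (mdifferentiableAt_atlas_symm he' hy)
      rw [mfderiv_eq_fderiv] at h1
      exact congrArg (fun A : Euc m →L[ℝ] Euc m => A v) h1
    · rw [pullDeriv_of_notMem (fun h => hye h.2), transplantDeriv, if_neg hye]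
      rfl
  refine ⟨fun e' he' => ?_, fun e' he' v => ?_, fun e' he' v ψ hψ hc hs => ?_⟩
  · rw [preimage_univ, inter_univ, locallyIntegrableOn_iff e'.open_target.isLocallyClosed]
    intro K hK hKc
    refine ((key e' he').locallyIntegrableOn.integrableOn_compact_subset hK hKc).congr_fun
      (fun y hy => k1 e' y (hK hy)) hKc.measurableSet
  · rw [preimage_univ, inter_univ, locallyIntegrableOn_iff e'.open_target.isLocallyClosed]
    intro K hK hKc
    refine (((key e' he').locallyIntegrableOn_deriv v).integrableOn_compact_subset hK hKc).congr_fun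
      (fun y hy => k2 e' he' y (hK hy) v) hKc.measurableSet
  · rw [preimage_univ, inter_univ] at hs
    have h1 := (key e' he').integral_eq v ψ hψ hc hs
    have h2 : ∀ y, transplant e h b (e'.symm y) * fderiv ℝ ψ y v =
        ((e'.target ∩ e'.symm ⁻¹' e.source).indicator (fun y => h (e (e'.symm y)) - b) y + b) *
          fderiv ℝ ψ y v := fun y => by
      by_cases hy : y ∈ tsupport ψ
      · rw [k1 e' y (hs hy)]
      · rw [(notMem_tsupport_iff_eventuallyEq.1 hy).fderiv_eq]
        simp
    have h3 : ∀ y, ψ y * transplantDeriv e D (e'.symm y) (mfderiv (𝓡 m) (𝓡 m) e'.symm y v) =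
        ψ y * pullDeriv (fun y => e (e'.symm y)) (e'.target ∩ e'.symm ⁻¹' e.source) D y v :=
      fun y => by
      by_cases hy : y ∈ tsupport ψ
      · rw [k2 e' he' y (hs hy)]
      · rw [image_eq_zero_of_notMem_tsupport hy, zero_mul, zero_mul]
    simp only [h2, h3]
    exact h1

end Transplant

/-! ### First order energy of transplanted maps. -/

section TransplantEnergy
open Filter Topology Manifold
variable {m : ℕ} {N : Type*} [EMetricSpace N] [MeasurableSpace N] [BorelSpace N]

/-- A translation by w with ‖w‖ > 2r moves the ball off itself, where v = b; the segment bound then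
controls the distance of v to b by integrals of g. An admissible w exists since almost every
direction is good. -/
theorem SegmentBound.integrable_sub {v : Euc m → N} {g : Euc m → ℝ≥0∞} (hseg : SegmentBound v g)
    (hm : 1 ≤ m) (hg : Measurable g) (hgI : ∫⁻ x, g x ≠ ⊤) (hv : AEMeasurable v volume) {c : Euc m}
    {r : ℝ} {b : N} (hvb : ∀ x ∉ Metric.closedBall c r, v x = b) {f : N → ℝ}
    (hf : LipschitzWith 1 f) : Integrable fun x => f (v x) - f b := by
  have hmeas : AEStronglyMeasurable (fun x => f (v x) - f b) volume :=
    ((hf.continuous.measurable.comp_aemeasurable hv).sub_const _).aestronglyMeasurable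
  refine ⟨hmeas, ?_⟩
  have : Nontrivial (Euc m) := by
    have : Nonempty (Fin m) := ⟨⟨0, hm⟩⟩
    infer_instance
  obtain ⟨w₀, hw₀⟩ := NormedSpace.exists_lt_norm ℝ (Euc m) (2 * r)
  have hopen : IsOpen {w : Euc m | 2 * r < ‖w‖} := isOpen_lt continuous_const continuous_norm
  have hpos : volume {w : Euc m | 2 * r < ‖w‖} ≠ 0 := (hopen.measure_pos _ ⟨w₀, hw₀⟩).ne'
  have h1 := Measure.ae_ae_of_ae_prod hseg
  obtain ⟨w, hwr, hw⟩ : ∃ w, 2 * r < ‖w‖ ∧ ∀ᵐ x, edist (v x) (v (x + w)) ≤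
      ‖w‖ₑ * ∫⁻ τ in Icc (0 : ℝ) 1, g (x + τ • w) := by
    by_contra hcon
    exact hpos (measure_mono_null (fun w hw h => hcon ⟨w, hw, h⟩) h1)
  have hmg : Measurable fun q : Euc m × ℝ => g (q.1 + q.2 • w) := by
    have h1 : Measurable fun q : Euc m × ℝ => q.1 + q.2 • w := by fun_prop
    exact hg.comp h1
  have h2 : ∫⁻ x, ‖f (v x) - f b‖ₑ ≤ ‖w‖ₑ * ∫⁻ x, g x := by
    calc ∫⁻ x, ‖f (v x) - f b‖ₑ ≤ ∫⁻ x, ‖w‖ₑ * ∫⁻ τ in Icc (0 : ℝ) 1, g (x + τ • w) := by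
          refine lintegral_mono_ae ?_
          filter_upwards [hw] with x hx
          by_cases hxc : x ∈ Metric.closedBall c r
          · have h3 : x + w ∉ Metric.closedBall c r := fun h => by
              rw [Metric.mem_closedBall, dist_eq_norm] at h hxc
              have := norm_sub_le (x + w - c) (x - c)
              rw [show x + w - c - (x - c) = w by abel] at this
              linarith
            rw [hvb _ h3] at hx
            refine le_trans ?_ hx
            rw [← edist_eq_enorm_sub]
            simpa using hf (v x) b
          · rw [hvb x hxc]; simp
      _ = ‖w‖ₑ * ∫⁻ τ in Icc (0 : ℝ) 1, ∫⁻ x, g (x + τ • w) := by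
          rw [lintegral_const_mul' _ _ (by simp), lintegral_lintegral_swap hmg.aemeasurable]
      _ = _ := by
          simp only [lintegral_add_right_eq_self g]
          simp
  exact h2.trans_lt (ENNReal.mul_lt_top (by simp) hgI.lt_top)

theorem lintegral_ne_top_of_rpow {g : Euc m → ℝ≥0∞} {p : ℝ} (hp : 1 ≤ p) {c : Euc m} {r : ℝ}
    (hg0 : ∀ x ∉ Metric.closedBall c r, g x = 0) (hgp : ∫⁻ x, g x ^ p ≠ ⊤) : ∫⁻ x, g x ≠ ⊤ := by
  have h1 : ∫⁻ x, ((Metric.closedBall c r).indicator 1 x + g x ^ p) ≠ ⊤ := by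
    rw [lintegral_add_left (measurable_one.indicator Metric.isClosed_closedBall.measurableSet),
      lintegral_indicator_one Metric.isClosed_closedBall.measurableSet]
    exact ENNReal.add_ne_top.2 ⟨measure_closedBall_lt_top.ne, hgp⟩
  refine ne_top_of_le_ne_top h1 (lintegral_mono fun x => ?_)
  by_cases hx : x ∈ Metric.closedBall c r
  · simp only [indicator_of_mem hx, Pi.one_apply]
    rcases le_total (g x) 1 with h | h
    · exact h.trans le_self_add
    · calc g x = g x ^ (1 : ℝ) := (ENNReal.rpow_one _).symm
        _ ≤ g x ^ p := ENNReal.rpow_le_rpow_of_exponent_le h hp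
        _ ≤ _ := le_add_self
  · simp [hg0 x hx]

variable {M : Type*} [EMetricSpace M] [MeasurableSpace M] [BorelSpace M]
    [ChartedSpace (EuclideanSpace ℝ (Fin m)) M] [IsManifold (𝓡 m) ∞ M]
    [RiemannianBundle (fun x : M => TangentSpace (𝓡 m) x)]
    {e : OpenPartialHomeomorph M (Euc m)} {c : Euc m} {R : ℝ} {L : NNReal}

theorem ChartBall.aemeasurable_transplant {X : Type*} [MeasurableSpace X]
    (hB : ChartBall e c R L) {v : Euc m → X} {b : X} (hv : AEMeasurable v volume)
    (hvb : ∀ x ∉ Metric.closedBall c R, v x = b) :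
    AEMeasurable (transplant e v b) (μHE[m] : Measure M) := by
  obtain ⟨C, hC, hm, hle⟩ := hB.map_le
  have hQ : MeasurableSet (e.symm '' Metric.closedBall c R) :=
    (hB.isCompact_image le_rfl).isClosed.measurableSet
  have h1 : AEMeasurable (transplant e v b)
      ((μHE[m] : Measure M).restrict (e.symm '' Metric.closedBall c R)) := by
    have h2 : AEMeasurable (fun x => v (e x))
        ((μHE[m] : Measure M).restrict (e.symm '' Metric.closedBall c R)) :=
      (hv.mono_ac (Measure.absolutelyContinuous_of_le_smul hle)).comp_aemeasurable hm
    refine h2.congr ?_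
    filter_upwards [ae_restrict_mem hQ] with x hx
    rw [transplant, if_pos ((mem_image_symm_iff hB.subset).1 hx).1]
  have h2 : AEMeasurable (transplant e v b)
      ((μHE[m] : Measure M).restrict (e.symm '' Metric.closedBall c R)ᶜ) := by
    refine (aemeasurable_const (b := b)).congr ?_
    filter_upwards [ae_restrict_mem hQ.compl] with x hx
    by_cases hxe : x ∈ e.source
    · rw [transplant, if_pos hxe, hvb]
      exact fun h => hx ((mem_image_symm_iff hB.subset).2 ⟨hxe, h⟩)
    · rw [transplant, if_neg hxe]
  rw [← Measure.restrict_univ (μ := (μHE[m] : Measure M)),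
    ← union_compl_self (e.symm '' Metric.closedBall c R)]
  exact aemeasurable_union_iff.2 ⟨h1, h2⟩

theorem ChartBall.lintegral_transplant_le (hB : ChartBall e c R L) : ∃ C : ℝ≥0∞, C ≠ ⊤ ∧
    ∀ f : Euc m → ℝ≥0∞, AEMeasurable f volume → (∀ x ∉ Metric.closedBall c R, f x = 0) →
      ∫⁻ x, transplant e f 0 x ∂(μHE[m] : Measure M) ≤ C * ∫⁻ y, f y := by
  obtain ⟨C, hC, hm, hle⟩ := hB.map_le
  have hQ : MeasurableSet (e.symm '' Metric.closedBall c R) :=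
    (hB.isCompact_image le_rfl).isClosed.measurableSet
  refine ⟨C, hC, fun f hf hf0 => le_trans (le_of_eq ?_) (lintegral_comp_le_of_map_le hm hle hf)⟩
  rw [← lintegral_indicator hQ]
  refine lintegral_congr fun x => ?_
  by_cases hx : x ∈ e.symm '' Metric.closedBall c R
  · rw [indicator_of_mem hx, transplant, if_pos ((mem_image_symm_iff hB.subset).1 hx).1]
  · rw [indicator_of_notMem hx, transplant]
    split_ifs with hxe
    · exact hf0 _ fun h => hx ((mem_image_symm_iff hB.subset).2 ⟨hxe, h⟩)
    · rfl

theorem ChartBall.dirichletEnergy_transplant_lt_top (hB : ChartBall e c R L) (hm : 1 ≤ m) {p : ℝ}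
    (hp : 1 ≤ p) {v : Euc m → N} {b : N} {r : ℝ} (hr : r < R) {en : ℝ≥0∞} (hen : en ≠ ⊤)
    (hv : HasEnergyLE 1 p v (Metric.closedBall c r) en)
    (hvb : ∀ x ∉ Metric.closedBall c r, v x = b) :
    dirichletEnergy m p (transplant (M := M) e v b) univ < ⊤ := by
  have hp0 : 0 < p := by linarith
  have hsub : Metric.closedBall c r ⊆ Metric.closedBall c R :=
    Metric.closedBall_subset_closedBall hr.le
  obtain ⟨g, hg, hg0, hseg, hge⟩ := hv.exists_segmentBound rfl
  have hgp : ∫⁻ x, g x ^ p ≠ ⊤ := ne_top_of_le_ne_top hen hge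
  have hgI := lintegral_ne_top_of_rpow hp hg0 hgp
  obtain ⟨C, hC, hle⟩ := hB.lintegral_transplant_le
  have hg0' : ∀ x ∉ Metric.closedBall c R, g x = 0 := fun x hx => hg0 x fun h => hx (hsub h)
  have hGm : AEMeasurable (transplant (M := M) e (fun y => L * g y) 0) (μHE[m] : Measure M) :=
    hB.aemeasurable_transplant (hg.const_mul _).aemeasurable fun x hx => by simp [hg0' x hx]
  have hW : WeakDerivBoundOn m (transplant (M := M) e v b)
      (transplant (M := M) e (fun y => L * g y) 0) univ := by
    intro f hf
    have hh := hseg.integrable_sub hm hg hgI hv.aemeasurable hvb hf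
    have hseg' : SegmentBound (fun x => f (v x) - f b) g := by
      filter_upwards [hseg] with z hz
      refine le_trans ?_ hz
      have h1 := hf (v z.2) (v (z.2 + z.1))
      rw [ENNReal.coe_one, one_mul] at h1
      rw [edist_sub_right]
      exact h1
    obtain ⟨D, hD, hDi, hDg⟩ := hseg'.exists_hasWeakFDerivOn hg hgI hh
    classical
    -- The derivative is set to zero on the null set where the bound fails. The bound then holds
    -- everywhere, so D' vanishes wherever g does.
    set D' : Euc m → Euc m →L[ℝ] ℝ := fun x =>
      if ∀ w, ‖D x w‖ₑ ≤ g x * ‖w‖ₑ then D x else 0 with hD'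
    have hDD : D' =ᵐ[volume] D := by
      filter_upwards [hDg] with x hx
      exact if_pos hx
    have hD'g : ∀ x w, ‖D' x w‖ₑ ≤ g x * ‖w‖ₑ := fun x w => by
      by_cases h : ∀ w, ‖D x w‖ₑ ≤ g x * ‖w‖ₑ
      · rw [hD']; simp only [if_pos h]; exact h w
      · rw [hD']; simp only [if_neg h]; simp
    have hD'0 : ∀ x ∉ Metric.closedBall c r, D' x = 0 := fun x hx => by
      ext w
      have := hD'g x w
      rw [hg0 x hx, zero_mul] at this
      simpa using this
    have hD'i : ∀ w, Integrable fun x => D' x w := fun w => (hDi w).congr (by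
      filter_upwards [hDD] with x hx
      rw [hx])
    have hD'w : HasWeakFDerivOn (fun x => f (v x) - f b) D' univ :=
      ⟨hD.locallyIntegrableOn, fun w => (hD'i w).locallyIntegrable.locallyIntegrableOn _,
        fun w ψ hψ hc hs => by
          rw [hD.integral_eq w ψ hψ hc hs]
          congr 1
          refine integral_congr_ae ?_
          filter_upwards [hDD] with x hx
          rw [hx]⟩
    refine ⟨transplantDeriv e D', ?_, ae_of_all _ fun x w => ?_⟩
    · have h1 := hB.hasWeakDifferentialOn (h := fun x => f (v x)) hr hD'w hh hD'i
        (fun x hx => by rw [hvb x hx]) hD'0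
      convert h1 using 2
      rename_i x
      simp only [transplant]
      split_ifs <;> rfl
    · by_cases hx : x ∈ e.source
      · rw [transplantDeriv, transplant, if_pos hx, if_pos hx, ContinuousLinearMap.comp_apply]
        by_cases hxc : e x ∈ Metric.closedBall c R
        · have h1 := hB.deriv_le (e x) hxc
          rw [e.left_inv hx] at h1
          calc _ ≤ g (e x) * ‖eucDeriv e x w‖ₑ := hD'g _ _
            _ ≤ g (e x) * (L * ‖w‖ₑ) := by gcongr; exact h1 w
            _ = _ := by ring
        · rw [hD'0 _ fun h => hxc (hsub h)]; simp
      · rw [transplantDeriv, if_neg hx]; simp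
  have hlt : ∫⁻ y, (L * g y) ^ p ≠ ⊤ := by
    simp_rw [ENNReal.mul_rpow_of_nonneg _ _ hp0.le]
    rw [lintegral_const_mul' _ _ (by simp [hp0.le])]
    exact ENNReal.mul_ne_top (by simp [hp0.le]) hgp
  have hint : ∫⁻ x in univ, transplant (M := M) e (fun y => L * g y) 0 x ^ p ∂μHE[m] ≤
      C * ∫⁻ y, (L * g y) ^ p := by
    rw [Measure.restrict_univ]
    refine le_trans (le_of_eq ?_) (hle (fun y => (L * g y) ^ p)
      ((hg.const_mul _).pow_const _).aemeasurable fun x hx => ?_)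
    · refine lintegral_congr fun x => ?_
      simp only [transplant]
      split_ifs
      · rfl
      · simp [hp0]
    · simp [hg0' x hx, hp0]
  rw [dirichletEnergy]
  refine lt_of_le_of_lt (iInf_le_of_le _ (iInf_le_of_le hGm.restrict (iInf_le_of_le hW hint))) ?_
  exact ENNReal.mul_lt_top hC.lt_top hlt.lt_top

end TransplantEnergy

/-! ### Fractional energy of transplanted maps. -/

section TransplantGagliardo
open Filter Topology Manifold
variable {m : ℕ} {N : Type*} [EMetricSpace N] [MeasurableSpace N] [BorelSpace N]
  [SecondCountableTopology N]

/-- A Poincaré inequality: v = b on a shell S of positive measure, and all points of S are at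
distance at most 2R from those of the smaller ball. Pairs with one point in S thus already
contribute a fixed multiple of the integral of d(v, b)^p. -/
theorem lintegral_edist_rpow_lt_top {s p α : ℝ} (hα : α = (m : ℝ) + s * p) (hα0 : 0 ≤ α)
    (hm : 1 ≤ m) {v : Euc m → N} {b : N} {c : Euc m} {r R : ℝ} (hr : r < R) (hR : 0 < R) (hp : 0 < p)
    (hv : AEMeasurable v volume) (hvb : ∀ x ∉ Metric.closedBall c r, v x = b)
    (hen : pairEnergy s p v ≠ ⊤) : ∫⁻ y, edist (v y) b ^ p < ⊤ := by
  have : Nontrivial (Euc m) := by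
    have : Nonempty (Fin m) := ⟨⟨0, hm⟩⟩
    infer_instance
  set S : Set (Euc m) := Metric.ball c R \ Metric.closedBall c r with hS
  have hSo : IsOpen S := Metric.isOpen_ball.sdiff Metric.isClosed_closedBall
  have hSne : S.Nonempty := by
    obtain ⟨w, hw⟩ := _root_.exists_norm_eq (Euc m) (c := (max r 0 + R) / 2)
      (by positivity)
    have h1 : max r 0 < R := max_lt hr hR
    refine ⟨c + w, ?_, ?_⟩
    · simp only [Metric.mem_ball, dist_self_add_left, hw]; linarith
    · simp only [Metric.mem_closedBall, dist_self_add_left, hw, not_le]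
      have := le_max_left r 0
      linarith
  have hS0 : volume S ≠ 0 := (hSo.measure_pos _ hSne).ne'
  have hSt : volume S ≠ ⊤ := ((measure_mono sdiff_subset).trans_lt measure_ball_lt_top).ne
  set κ : ℝ≥0∞ := (ENNReal.ofReal (2 * R) ^ α)⁻¹ with hκ
  have hR0 : ENNReal.ofReal (2 * R) ≠ 0 := by simpa using hR
  have hκ0 : κ ≠ 0 := ENNReal.inv_ne_zero.2 (ENNReal.rpow_ne_top_of_nonneg hα0 ENNReal.ofReal_ne_top)
  have hκt : κ ≠ ⊤ := ENNReal.inv_ne_top.2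
    (ENNReal.rpow_pos (pos_iff_ne_zero.2 hR0) ENNReal.ofReal_ne_top).ne'
  have h1 : (κ * volume S) * ∫⁻ y, edist (v y) b ^ p ≤ pairEnergy s p v := by
    rw [pairEnergy, lintegral_prod _ (aemeasurable_pairEnergy hv),
      ← lintegral_const_mul' _ _ (ENNReal.mul_ne_top hκt hSt)]
    refine lintegral_mono fun x => ?_
    by_cases hx : x ∈ Metric.closedBall c r
    · calc κ * volume S * edist (v x) b ^ p = ∫⁻ y in S, κ * edist (v x) b ^ p := by
            rw [setLIntegral_const]; ring
        _ ≤ ∫⁻ y in S, edist (v x) (v y) ^ p / edist x y ^ ((m : ℝ) + s * p) := by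
            refine setLIntegral_mono_ae' hSo.measurableSet (ae_of_all _ fun y hy => ?_)
            rw [hvb y hy.2, ENNReal.div_eq_inv_mul, ← hα, hκ]
            refine mul_le_mul_left (ENNReal.inv_le_inv.2 (ENNReal.rpow_le_rpow ?_ hα0)) _
            rw [edist_dist]
            refine ENNReal.ofReal_le_ofReal ?_
            have h2 := dist_triangle_right x y c
            have h3 := Metric.mem_closedBall.1 hx
            have h4 := Metric.mem_ball.1 hy.1
            linarith
        _ ≤ _ := setLIntegral_le_lintegral _ _
    · rw [hvb x hx]; simp [hp]
  exact (ENNReal.lt_top_of_mul_ne_top_right (ne_top_of_le_ne_top hen h1) (mul_ne_zero hκ0 hS0))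

variable {M : Type*} [EMetricSpace M] [MeasurableSpace M] [BorelSpace M]

variable (m M) in
/-- The tail integrals of `d(x, ·)^(-α)` are finite, uniformly in `x`. -/
def HasTailBound (α : ℝ) : Prop :=
  ∀ δ : ℝ, 0 < δ → ∃ T : ℝ≥0∞, T ≠ ⊤ ∧ ∀ x : M,
    ∫⁻ y in {y | ENNReal.ofReal δ ≤ edist x y}, (edist x y ^ α)⁻¹ ∂(μHE[m] : Measure M) ≤ T

theorem hasTailBound_of_isFiniteMeasure [IsFiniteMeasure (μHE[m] : Measure M)] {α : ℝ} (hα : 0 ≤ α) :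
    HasTailBound m M α := fun δ hδ => by
  have h0 : ENNReal.ofReal δ ≠ 0 := by simpa using hδ
  refine ⟨(ENNReal.ofReal δ ^ α)⁻¹ * μHE[m] (univ : Set M), ENNReal.mul_ne_top
    (ENNReal.inv_ne_top.2 (by simp [h0])) (measure_ne_top _ _), fun x => ?_⟩
  calc _ ≤ ∫⁻ y in {y | ENNReal.ofReal δ ≤ edist x y}, (ENNReal.ofReal δ ^ α)⁻¹ ∂(μHE[m] : Measure M) := by
        refine setLIntegral_mono_ae' (measurableSet_le measurable_const (by fun_prop))
          (ae_of_all _ fun y hy => ?_)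
        exact ENNReal.inv_le_inv.2 (ENNReal.rpow_le_rpow hy hα)
    _ ≤ _ := by
        rw [setLIntegral_const]
        gcongr
        exact subset_univ _

theorem hasTailBound_euclidean {α : ℝ} (hα : (m : ℝ) < α) : HasTailBound m (Euc m) α := fun δ hδ => by
  refine ⟨ENNReal.ofReal δ ^ ((Module.finrank ℝ (Euc m) : ℝ) - α) *
    ∫⁻ x in (Metric.ball (0 : Euc m) 1)ᶜ, (‖x‖ₑ ^ α)⁻¹, ?_, fun x => ?_⟩
  · refine ENNReal.mul_ne_top (ENNReal.rpow_ne_top_of_ne_zero (by simpa using hδ) (by simp)) ?_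
    exact (lintegral_compl_ball_rpow_lt_top volume (by simpa using hα)).ne
  · rw [← setLIntegral_compl_ball_rpow volume hδ, EuclideanSpace.euclideanHausdorffMeasure_eq_volume]
    have hm1 : MeasurableSet {y : Euc m | ENNReal.ofReal δ ≤ edist x y} :=
      measurableSet_le measurable_const (by fun_prop)
    rw [← lintegral_indicator hm1, ← lintegral_indicator Metric.isOpen_ball.measurableSet.compl,
      ← lintegral_sub_right_eq_self ((Metric.ball (0 : Euc m) δ)ᶜ.indicator _) x]
    refine le_of_eq (lintegral_congr fun y => ?_)
    have h1 : edist x y = ‖y - x‖ₑ := by rw [edist_comm, edist_eq_enorm_sub]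
    have h2 : y - x ∈ (Metric.ball (0 : Euc m) δ)ᶜ ↔ y ∈ {y : Euc m | ENNReal.ofReal δ ≤ edist x y} := by
      rw [mem_ofPred_eq, h1, mem_compl_iff, mem_ball_zero_iff, not_lt, ← ofReal_norm,
        ENNReal.ofReal_le_ofReal_iff (norm_nonneg _)]
    by_cases h : y ∈ {y : Euc m | ENNReal.ofReal δ ≤ edist x y}
    · rw [indicator_of_mem h, indicator_of_mem (h2.2 h), h1]
    · rw [indicator_of_notMem h, indicator_of_notMem fun h' => h (h2.1 h')]

variable [SecondCountableTopology M] [SFinite (μHE[m] : Measure M)]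
    [ChartedSpace (EuclideanSpace ℝ (Fin m)) M] [IsManifold (𝓡 m) ∞ M]
    [RiemannianBundle (fun x : M => TangentSpace (𝓡 m) x)]
    {e : OpenPartialHomeomorph M (Euc m)} {c : Euc m} {R : ℝ} {L : NNReal}

/-- Pairs of points of the chart ball Q are compared with the Euclidean energy by the bi-Lipschitz
property. For the other pairs, one point is off Q, where the map equals b; if they contribute, the
other point lies in the image of the smaller ball, hence at distance at least δ, and the tail of the
kernel is integrable. -/
theorem ChartBall.gagliardoEnergy_transplant_lt_top (hB : ChartBall e c R L) (hm : 1 ≤ m) {s p : ℝ}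
    (hs : 0 < s) (hp : 0 < p) (hT : HasTailBound m M ((m : ℝ) + s * p)) {v : Euc m → N} {b : N}
    {r : ℝ} (hr : r < R) (hv : AEMeasurable v volume) (hen : pairEnergy s p v ≠ ⊤)
    (hvb : ∀ x ∉ Metric.closedBall c r, v x = b) :
    gagliardoEnergy m s p (transplant (M := M) e v b) univ < ⊤ := by
  set α : ℝ := (m : ℝ) + s * p with hα
  have hα0 : 0 ≤ α := by positivity
  set w := transplant (M := M) e v b with hw
  set Q := e.symm '' Metric.closedBall c R with hQ
  have hQm : MeasurableSet Q := (hB.isCompact_image le_rfl).isClosed.measurableSet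
  have hrQ : e.symm '' Metric.closedBall c r ⊆ Q :=
    image_mono (Metric.closedBall_subset_closedBall hr.le)
  have hball : Metric.ball c R ⊆ e.target := Metric.ball_subset_closedBall.trans hB.subset
  have hU : IsOpen (e.symm '' Metric.ball c R) := by
    exact e.symm.isOpen_image_of_subset_source Metric.isOpen_ball hball
  obtain ⟨δ, hδ, hthick⟩ := (hB.isCompact_image hr.le).exists_thickening_subset_open hU
    (image_mono (Metric.closedBall_subset_ball hr))
  have hUQ : e.symm '' Metric.ball c R ⊆ Q := image_mono Metric.ball_subset_closedBall
  have hfar : ∀ x ∈ e.symm '' Metric.closedBall c r, ∀ y ∉ Q, ENNReal.ofReal δ ≤ edist x y := by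
    intro x hx y hy
    by_contra hcon
    refine hy (hUQ (hthick ?_))
    rw [Metric.thickening, mem_ofPred_eq]
    refine lt_of_le_of_lt (Metric.infEDist_le_edist_of_mem hx) ?_
    rw [edist_comm]
    exact not_le.1 hcon
  have hwb : ∀ x ∉ e.symm '' Metric.closedBall c r, w x = b := by
    intro x hx
    rw [hw, transplant]
    split_ifs with hxe
    · exact hvb _ fun h => hx ⟨e x, h, e.left_inv hxe⟩
    · rfl
  have hwQ : ∀ x ∈ Q, w x = v (e x) := fun x hx => by
    rw [hw, transplant, if_pos ((mem_image_symm_iff hB.subset).1 hx).1]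
  have hwm : AEMeasurable w (μHE[m] : Measure M) := hB.aemeasurable_transplant hv
    fun x hx => hvb x fun h => hx (Metric.closedBall_subset_closedBall hr.le h)
  obtain ⟨T, hT, hTle⟩ := hT δ hδ
  set φ : M → ℝ≥0∞ := fun x => edist (w x) b ^ p with hφ
  have hφm : AEMeasurable φ (μHE[m] : Measure M) := (hwm.edist aemeasurable_const).pow_const _
  have hφt : ∫⁻ x, φ x ∂(μHE[m] : Measure M) < ⊤ := by
    obtain ⟨C, hC, hle⟩ := hB.lintegral_transplant_le
    have h1 := hle (fun y => edist (v y) b ^ p) ((hv.edist aemeasurable_const).pow_const _)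
      fun x hx => by
        rw [hvb x fun h => hx (Metric.closedBall_subset_closedBall hr.le h)]
        simp [hp]
    refine lt_of_le_of_lt (le_of_eq_of_le (lintegral_congr fun x => ?_) h1) (ENNReal.mul_lt_top hC.lt_top
      (lintegral_edist_rpow_lt_top hα hα0 hm hr hB.pos hp hv hvb hen))
    rw [hφ, hw]
    simp only [transplant]
    split_ifs <;> simp [hp]
  set k : M → M → ℝ≥0∞ := fun x y =>
    {y | ENNReal.ofReal δ ≤ edist x y}.indicator (fun y => (edist x y ^ α)⁻¹) y with hk
  have hkm : Measurable (fun z : M × M => k z.1 z.2) := by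
    have h1 : MeasurableSet {z : M × M | ENNReal.ofReal δ ≤ edist z.1 z.2} :=
      measurableSet_le measurable_const (by fun_prop)
    have h2 : Measurable fun z : M × M => (edist z.1 z.2 ^ α)⁻¹ := by fun_prop
    exact h2.indicator h1
  have hkc : ∀ x y, k x y = k y x := fun x y => by
    simp only [hk, indicator, mem_ofPred_eq, edist_comm]
  have hk1 : ∀ x, ∫⁻ y, k x y ∂(μHE[m] : Measure M) ≤ T := fun x => by
    rw [hk, lintegral_indicator (measurableSet_le measurable_const (by fun_prop))]
    exact hTle x
  set G : M → M → ℝ≥0∞ := fun x y => edist (w x) (w y) ^ p / edist x y ^ α with hG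
  -- The last two terms treat the pairs with exactly one point in Q, according to which of the two
  -- points it is.
  have hpt : ∀ y x, G x y ≤ Q.indicator (fun y => Q.indicator (fun x => G x y) x) y +
      (k x y * φ x + k y x * φ y) := by
    intro y x
    by_cases hy : y ∈ Q
    · by_cases hx : x ∈ Q
      · rw [indicator_of_mem hy, indicator_of_mem hx]; exact le_self_add
      · have h1 : w x = b := hwb x fun h => hx (hrQ h)
        by_cases hy' : y ∈ e.symm '' Metric.closedBall c r
        · refine le_trans ?_ (le_add_self.trans le_add_self)
          have h2 : k y x = (edist y x ^ α)⁻¹ :=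
            indicator_of_mem (show x ∈ {x | ENNReal.ofReal δ ≤ edist y x} from hfar y hy' x hx) _
          rw [hG, h2, hφ]
          simp only [h1]
          rw [ENNReal.div_eq_inv_mul, edist_comm x y, edist_comm b]
        · rw [hG]; simp [h1, hwb y hy', hp]
    · have h1 : w y = b := hwb y fun h => hy (hrQ h)
      by_cases hx' : x ∈ e.symm '' Metric.closedBall c r
      · refine le_trans ?_ (le_self_add.trans le_add_self)
        have h2 : k x y = (edist x y ^ α)⁻¹ :=
          indicator_of_mem (show y ∈ {y | ENNReal.ofReal δ ≤ edist x y} from hfar x hx' y hy) _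
        rw [hG, h2, hφ]
        simp only [h1]
        rw [ENNReal.div_eq_inv_mul]
      · rw [hG]; simp [h1, hwb x hx', hp]
  obtain ⟨C, hC, hme, hle⟩ := hB.map_le
  have hcore : ∫⁻ y in Q, ∫⁻ x in Q, G x y ∂μHE[m] ∂(μHE[m] : Measure M) < ⊤ := by
    set H : Euc m → Euc m → ℝ≥0∞ := fun x y => edist (v x) (v y) ^ p / edist x y ^ α with hH
    have hHm : AEMeasurable (fun z : Euc m × Euc m => H z.1 z.2) (volume.prod volume) :=
      aemeasurable_pairEnergy hv
    have h1 : ∀ y ∈ Q, ∀ x ∈ Q, G x y ≤ (L : ℝ≥0∞) ^ α * H (e x) (e y) := fun y hy x hx => by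
      rcases eq_or_ne x y with rfl | hxy
      · simp [hG, hp]
      have h2 := (mem_image_symm_iff hB.subset).1 hx
      have h3 := (mem_image_symm_iff hB.subset).1 hy
      have h4 := hB.edist_le _ h2.2 _ h3.2
      rw [e.left_inv h2.1, e.left_inv h3.1] at h4
      simp only [hG, hH, hwQ x hx, hwQ y hy, ENNReal.div_eq_inv_mul]
      rw [← mul_assoc]
      refine mul_le_mul_left ?_ _
      have h5 := ENNReal.rpow_le_rpow h4 hα0
      rw [ENNReal.mul_rpow_of_nonneg _ _ hα0] at h5
      have h6 := ENNReal.inv_le_inv.2 h5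
      refine le_trans ?_ (mul_le_mul_right h6 _)
      have hL0 : (L : ℝ≥0∞) ^ α ≠ ⊤ := by simp [hα0]
      -- The value L = 0 would force the two distinct points to coincide.
      by_cases hL : (L : ℝ≥0∞) ^ α = 0
      · exfalso
        have hL' : (L : ℝ≥0∞) = 0 := by
          rcases ENNReal.rpow_eq_zero_iff.1 hL with h | h
          · exact h.1
          · simp at h
        rw [hL', zero_mul, nonpos_iff_eq_zero, edist_eq_zero] at h4
        exact hxy (e.injOn h2.1 h3.1 h4)
      · rw [ENNReal.mul_inv (Or.inl hL) (Or.inl hL0), ← mul_assoc, ENNReal.mul_inv_cancel hL hL0, one_mul]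
    calc _ ≤ ∫⁻ y in Q, ∫⁻ x in Q, (L : ℝ≥0∞) ^ α * H (e x) (e y) ∂μHE[m] ∂(μHE[m] : Measure M) := by
          refine setLIntegral_mono_ae' hQm (ae_of_all _ fun y hy => ?_)
          exact setLIntegral_mono_ae' hQm (ae_of_all _ fun x hx => h1 y hy x hx)
      _ = (L : ℝ≥0∞) ^ α * ∫⁻ y in Q, ∫⁻ x in Q, H (e x) (e y) ∂μHE[m] ∂(μHE[m] : Measure M) := by
          have hL0 : (L : ℝ≥0∞) ^ α ≠ ⊤ := by simp [hα0]
          simp_rw [lintegral_const_mul' _ _ hL0]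
      _ ≤ (L : ℝ≥0∞) ^ α * ∫⁻ y in Q, (C * ∫⁻ x, H x (e y)) ∂(μHE[m] : Measure M) := by
          refine mul_le_mul_right (lintegral_mono fun y => ?_) _
          refine lintegral_comp_le_of_map_le (f := fun x => H x (e y)) hme hle ?_
          have h7 : Measurable fun x : Euc m => edist x (e y) := by fun_prop
          exact ((hv.edist aemeasurable_const).pow_const _).div (h7.pow_const _).aemeasurable
      _ ≤ (L : ℝ≥0∞) ^ α * (C * (C * ∫⁻ y, ∫⁻ x, H x y)) := by
          refine mul_le_mul_right ?_ _
          rw [lintegral_const_mul' _ _ hC]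
          refine mul_le_mul_right ?_ _
          exact lintegral_comp_le_of_map_le (f := fun y => ∫⁻ x, H x y) hme hle hHm.lintegral_prod_left'
      _ < ⊤ := by
          rw [← lintegral_prod_symm _ hHm]
          exact ENNReal.mul_lt_top (ENNReal.rpow_lt_top_of_nonneg hα0 ENNReal.coe_ne_top) (ENNReal.mul_lt_top hC.lt_top
            (ENNReal.mul_lt_top hC.lt_top hen.lt_top))
  have hkφ : AEMeasurable (fun z : M × M => k z.2 z.1 * φ z.2)
      ((μHE[m] : Measure M).prod (μHE[m] : Measure M)) :=
    (hkm.comp measurable_swap).aemeasurable.mul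
      (hφm.comp_quasiMeasurePreserving Measure.quasiMeasurePreserving_snd)
  have hkφ' : AEMeasurable (fun z : M × M => k z.1 z.2 * φ z.1)
      ((μHE[m] : Measure M).prod (μHE[m] : Measure M)) :=
    hkm.aemeasurable.mul
      (hφm.comp_quasiMeasurePreserving Measure.quasiMeasurePreserving_fst)
  have htail : ∫⁻ y, ∫⁻ x, k y x * φ y ∂μHE[m] ∂(μHE[m] : Measure M) ≤
      T * ∫⁻ y, φ y ∂(μHE[m] : Measure M) := by
    rw [← lintegral_const_mul'' _ hφm]
    refine lintegral_mono fun y => ?_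
    have : Measurable (k y) := hkm.comp measurable_prodMk_left
    rw [lintegral_mul_const _ this]
    exact mul_le_mul_left (hk1 y) _
  have htail' : ∫⁻ y, ∫⁻ x, k x y * φ x ∂μHE[m] ∂(μHE[m] : Measure M) ≤
      T * ∫⁻ y, φ y ∂(μHE[m] : Measure M) := by
    rw [lintegral_lintegral_swap hkφ]
    exact htail
  rw [gagliardoEnergy, Measure.restrict_univ]
  have hI1 : AEMeasurable (fun y => ∫⁻ x, k y x * φ y ∂(μHE[m] : Measure M)) (μHE[m] : Measure M) :=
    hkφ'.lintegral_prod_right'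
  have hI2 : AEMeasurable (fun y => ∫⁻ x, k x y * φ x ∂(μHE[m] : Measure M)) (μHE[m] : Measure M) :=
    hkφ.lintegral_prod_right'
  calc _ ≤ ∫⁻ y, ((Q.indicator (fun y => ∫⁻ x in Q, G x y ∂μHE[m]) y) +
        ((∫⁻ x, k x y * φ x ∂μHE[m]) + (∫⁻ x, k y x * φ y ∂μHE[m]))) ∂(μHE[m] : Measure M) := by
        refine lintegral_mono fun y => (lintegral_mono (hpt y)).trans ?_
        have h1 : AEMeasurable (fun x => k x y * φ x) (μHE[m] : Measure M) := by
          have : Measurable fun x => k x y := hkm.comp measurable_prodMk_right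
          exact this.aemeasurable.mul hφm
        have h2 : Measurable (fun x => k y x * φ y) := by
          have : Measurable (k y) := hkm.comp measurable_prodMk_left
          exact this.mul_const _
        rw [lintegral_add_right' _ (show AEMeasurable (fun x => k x y * φ x + k y x * φ y) _ from
          h1.add h2.aemeasurable), lintegral_add_right _ h2]
        refine add_le_add_left ?_ _
        by_cases hy : y ∈ Q
        · simp only [indicator_of_mem hy]
          rw [lintegral_indicator hQm]
        · simp [indicator_of_notMem hy]
    _ = (∫⁻ y in Q, ∫⁻ x in Q, G x y ∂μHE[m] ∂(μHE[m] : Measure M)) +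
        ((∫⁻ y, ∫⁻ x, k x y * φ x ∂μHE[m] ∂(μHE[m] : Measure M)) +
          (∫⁻ y, ∫⁻ x, k y x * φ y ∂μHE[m] ∂(μHE[m] : Measure M))) := by
        rw [lintegral_add_right' _ (show AEMeasurable (fun y => (∫⁻ x, k x y * φ x ∂μHE[m]) +
          (∫⁻ x, k y x * φ y ∂μHE[m])) _ from hI2.add hI1), lintegral_add_right' _ hI1, lintegral_indicator hQm]
    _ < ⊤ := by
        have : T * ∫⁻ y, φ y ∂(μHE[m] : Measure M) < ⊤ := ENNReal.mul_lt_top hT.lt_top hφt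
        exact ENNReal.add_lt_top.2 ⟨hcore, ENNReal.add_lt_top.2
          ⟨htail'.trans_lt this, htail.trans_lt this⟩⟩

theorem ChartBall.memSobolev_transplant (hB : ChartBall e c R L) (hm : 1 ≤ m) {s p : ℝ}
    (hs : 0 < s) (hp : 1 ≤ p) (hT : HasTailBound m M ((m : ℝ) + s * p)) {v : Euc m → N} {b : N}
    {r : ℝ} (hr : r < R) {en : ℝ≥0∞} (hen : en ≠ ⊤)
    (hv : HasEnergyLE s p v (Metric.closedBall c r) en)
    (hvb : ∀ x ∉ Metric.closedBall c r, v x = b) :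
    MemSobolev m s p (transplant (M := M) e v b) := by
  refine ⟨hB.aemeasurable_transplant hv.aemeasurable fun x hx =>
    hvb x fun h => hx (Metric.closedBall_subset_closedBall hr.le h), ?_⟩
  by_cases h1 : s = 1
  · subst h1
    rw [sobolevEnergy, if_pos rfl]
    exact hB.dirichletEnergy_transplant_lt_top hm hp hr hen hv hvb
  · rw [sobolevEnergy, if_neg h1]
    exact hB.gagliardoEnergy_transplant_lt_top hm hs (by linarith) hT hr hv.aemeasurable
      (ne_top_of_le_ne_top hen (hv.pairEnergy_le h1)) hvb

end TransplantGagliardo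

/-! ### Weak derivatives and integrals under affine dilations. -/

section AffineChange
open Filter Topology Manifold
variable {m : ℕ}

theorem measurableEmbedding_add_smul (z : Euc m) {ρ : ℝ} (hρ : 0 < ρ) :
    MeasurableEmbedding fun x : Euc m => z + ρ • x :=
  ((Homeomorph.smulOfNeZero (α := Euc m) ρ hρ.ne').trans
    (Homeomorph.addLeft z)).measurableEmbedding

theorem exists_map_add_smul (z : Euc m) {ρ : ℝ} (hρ : 0 < ρ) : ∃ κ : ℝ≥0∞, κ ≠ ⊤ ∧
    (volume : Measure (Euc m)).map (fun x => z + ρ • x) = κ • volume := by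
  refine ⟨ENNReal.ofReal |(ρ ^ Module.finrank ℝ (Euc m))⁻¹|, ENNReal.ofReal_ne_top, ?_⟩
  have h : (volume : Measure (Euc m)).map (fun x => z + ρ • x) =
      ((volume : Measure (Euc m)).map (fun x => ρ • x)).map (fun x => z + x) :=
    (Measure.map_map (by fun_prop) (by fun_prop)).symm
  rw [h, Measure.map_addHaar_smul volume hρ.ne', Measure.map_smul, map_add_left_eq_self]

theorem integral_comp_add_smul_eq (z : Euc m) {ρ : ℝ} (hρ : 0 < ρ) : ∃ κ : ℝ, ∀ f : Euc m → ℝ,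
    ∫ x, f (z + ρ • x) = κ * ∫ y, f y := by
  obtain ⟨κ, -, hmap⟩ := exists_map_add_smul z hρ
  refine ⟨κ.toReal, fun f => ?_⟩
  rw [← (measurableEmbedding_add_smul z hρ).integral_map f, hmap, integral_smul_measure, smul_eq_mul]

theorem locallyIntegrableOn_comp_add_smul {f : Euc m → ℝ} {A : Set (Euc m)}
    (hf : LocallyIntegrableOn f A volume) (z : Euc m) {ρ : ℝ} (hρ : 0 < ρ) :
    LocallyIntegrableOn (fun x => f (z + ρ • x)) ((fun x => z + ρ • x) ⁻¹' A) volume := by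
  intro x hx
  obtain ⟨U, hU, hi⟩ := hf (z + ρ • x) hx
  obtain ⟨κ, hκ, hmap⟩ := exists_map_add_smul z hρ
  have hc : Continuous fun x : Euc m => z + ρ • x := by fun_prop
  refine ⟨(fun x => z + ρ • x) ⁻¹' U,
    (hc.continuousWithinAt.tendsto_nhdsWithin (mapsTo_preimage _ A)) hU, ?_⟩
  have h1 : IntegrableOn f U ((volume : Measure (Euc m)).map fun x => z + ρ • x) := by
    rw [hmap, IntegrableOn, Measure.restrict_smul]
    exact Integrable.smul_measure hi hκ
  exact (measurableEmbedding_add_smul z hρ).integrableOn_map_iff.1 h1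

theorem HasWeakFDerivOn.mono {h : Euc m → ℝ} {D : Euc m → Euc m →L[ℝ] ℝ} {A A' : Set (Euc m)}
    (H : HasWeakFDerivOn h D A) (hA : A' ⊆ A) : HasWeakFDerivOn h D A' :=
  ⟨H.locallyIntegrableOn.mono_set hA, fun v => (H.locallyIntegrableOn_deriv v).mono_set hA,
    fun v ψ hψ hc hs => H.integral_eq v ψ hψ hc (hs.trans hA)⟩

theorem HasWeakFDerivOn.comp_add_smul {h : Euc m → ℝ} {D : Euc m → Euc m →L[ℝ] ℝ} {A : Set (Euc m)}
    (H : HasWeakFDerivOn h D A) (z : Euc m) {ρ : ℝ} (hρ : 0 < ρ) :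
    HasWeakFDerivOn (fun x => h (z + ρ • x)) (fun x => ρ • D (z + ρ • x))
      ((fun x => z + ρ • x) ⁻¹' A) := by
  refine ⟨locallyIntegrableOn_comp_add_smul H.locallyIntegrableOn z hρ, fun v => ?_, fun v ψ hψ hc hs => ?_⟩
  · have h1 : LocallyIntegrableOn (fun x => ρ * D x v) A volume := fun x hx => by
      obtain ⟨U, hU, hi⟩ := H.locallyIntegrableOn_deriv v x hx
      exact ⟨U, hU, Integrable.const_mul hi ρ⟩
    exact locallyIntegrableOn_comp_add_smul h1 z hρ
  · obtain ⟨κ, hκ⟩ := integral_comp_add_smul_eq z hρ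
    set S : Euc m → Euc m := fun y => ρ⁻¹ • (y - z) with hS
    have hST : ∀ x, S (z + ρ • x) = x := fun x => by simp [hS, smul_smul, hρ.ne']
    have hTS : ∀ y, z + ρ • S y = y := fun y => by simp [hS, smul_smul, hρ.ne']
    have hSd : ∀ y, HasFDerivAt S (ρ⁻¹ • ContinuousLinearMap.id ℝ (Euc m)) y := fun y =>
      ((hasFDerivAt_id y).sub_const z).const_smul ρ⁻¹
    have hψ' : ContDiff ℝ ∞ (ψ ∘ S) := hψ.comp (by fun_prop)
    have hd : ∀ y, fderiv ℝ (ψ ∘ S) y v = ρ⁻¹ * fderiv ℝ ψ (S y) v := fun y => by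
      have h1 := ((hψ.differentiable (by simp)) (S y)).hasFDerivAt.comp y (hSd y)
      rw [h1.fderiv]
      simp
    have hhomeo : S = ((Homeomorph.subRight z).trans
      (Homeomorph.smulOfNeZero (α := Euc m) ρ⁻¹ (inv_ne_zero hρ.ne'))) := rfl
    have hc' : HasCompactSupport (ψ ∘ S) := by
      rw [hhomeo]
      exact hc.comp_homeomorph _
    have hs' : tsupport (ψ ∘ S) ⊆ A := by
      have h1 : tsupport (ψ ∘ S) ⊆ S ⁻¹' tsupport ψ :=
        closure_minimal (fun y hy => subset_tsupport ψ hy)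
          ((isClosed_tsupport ψ).preimage (by fun_prop))
      intro y hy
      have := hs (h1 hy)
      rwa [mem_preimage, hTS] at this
    have h2 := H.integral_eq v _ hψ' hc' hs'
    have h3 : ∀ x, h (z + ρ • x) * fderiv ℝ ψ x v =
        (fun y => ρ * (h y * fderiv ℝ (ψ ∘ S) y v)) (z + ρ • x) := fun x => by
      simp only [hd, hST]
      field_simp
    have h4 : ∀ x, ψ x * (ρ • D (z + ρ • x)) v =
        (fun y => ρ * ((ψ ∘ S) y * D y v)) (z + ρ • x) := fun x => by
      simp only [Function.comp, hST, _root_.smul_apply, smul_eq_mul]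
      ring
    simp only [h3, h4]
    rw [hκ (fun y => ρ * (h y * fderiv ℝ (ψ ∘ S) y v)), hκ (fun y => ρ * ((ψ ∘ S) y * D y v)),
      integral_const_mul, integral_const_mul, h2]
    ring

theorem HasWeakFDerivOn.hasWeakDifferentialOn {h : Euc m → ℝ}
    {dh : ∀ x : Euc m, TangentSpace (modelWithCornersSelf ℝ (Euc m)) x →L[ℝ] ℝ} {A : Set (Euc m)}
    (H : HasWeakFDerivOn h dh A) : HasWeakDifferentialOn m h dh A := by
  have hid : ∀ (y v : Euc m), (mfderiv (modelWithCornersSelf ℝ (Euc m))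
      (modelWithCornersSelf ℝ (Euc m)) (OpenPartialHomeomorph.refl (Euc m)).symm y) v = v :=
    fun y v => by
      change (mfderiv (modelWithCornersSelf ℝ (Euc m)) (modelWithCornersSelf ℝ (Euc m)) id y) v = v
      rw [mfderiv_id]
      rfl
  have hset : ((OpenPartialHomeomorph.refl (Euc m)).target ∩
      (OpenPartialHomeomorph.refl (Euc m)).symm ⁻¹' A) = A := by simp
  refine ⟨fun e he => ?_, fun e he v => ?_, fun e he v ψ hψ hc hs => ?_⟩
  all_goals
    rw [chartedSpaceSelf_atlas] at he
    subst he
  · rw [hset]; exact H.locallyIntegrableOn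
  · rw [hset]; simp only [hid]; exact H.locallyIntegrableOn_deriv v
  · rw [hset] at hs; simp only [hid]; exact H.integral_eq v ψ hψ hc hs

theorem setLIntegral_ball_comp_add_smul (f : Euc m → ℝ≥0∞) (z : Euc m) {ρ : ℝ} (hρ : 0 < ρ) :
    ENNReal.ofReal ρ ^ (m : ℝ) * ∫⁻ x in Metric.ball 0 1, f (z + ρ • x) =
      ∫⁻ y in Metric.ball z ρ, f y := by
  rw [← lintegral_indicator Metric.isOpen_ball.measurableSet,
    ← lintegral_indicator Metric.isOpen_ball.measurableSet,
    ← lintegral_comp_add_smul volume ((Metric.ball z ρ).indicator f) z hρ, finrank_euclideanSpace_fin,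
    ENNReal.rpow_natCast]
  congr 1
  refine lintegral_congr fun x => ?_
  have h1 : x ∈ Metric.ball (0 : Euc m) 1 ↔ z + ρ • x ∈ Metric.ball z ρ := by
    rw [mem_ball_zero_iff, Metric.mem_ball, dist_self_add_left, norm_smul, Real.norm_of_nonneg hρ.le,
      mul_lt_iff_lt_one_right hρ]
  by_cases h : x ∈ Metric.ball (0 : Euc m) 1
  · rw [indicator_of_mem h, indicator_of_mem (h1.1 h)]
  · rw [indicator_of_notMem h, indicator_of_notMem fun h' => h (h1.2 h')]

end AffineChange

/-! ### Superadditivity of the energies over disjoint balls of a chart. -/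

section LocalEnergies
open Filter Topology Manifold
variable {m : ℕ} {F : Type*} [EMetricSpace F] [MeasurableSpace F]

theorem gagliardoEnergy_comp_add_smul {r q : ℝ} (φ : Euc m → F) (z : Euc m) {ρ : ℝ} (hρ : 0 < ρ) :
    ENNReal.ofReal ρ ^ ((m : ℝ) - r * q) *
        gagliardoEnergy m r q (fun x => φ (z + ρ • x)) (Metric.ball 0 1) =
      ∫⁻ y in Metric.ball z ρ, ∫⁻ x in Metric.ball z ρ,
        edist (φ x) (φ y) ^ q / edist x y ^ ((m : ℝ) + r * q) := by
  have hK0 : ENNReal.ofReal ρ ≠ 0 := by simpa using hρ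
  have hKt : ENNReal.ofReal ρ ≠ ⊤ := ENNReal.ofReal_ne_top
  rw [gagliardoEnergy, EuclideanSpace.euclideanHausdorffMeasure_eq_volume,
    ← setLIntegral_ball_comp_add_smul _ z hρ,
    show (m : ℝ) - r * q = (m : ℝ) + ((m : ℝ) + -((m : ℝ) + r * q)) by ring,
    ENNReal.rpow_add _ _ hK0 hKt, mul_assoc]
  congr 1
  rw [← lintegral_const_mul' _ _ (ENNReal.rpow_ne_top_of_ne_zero hK0 hKt)]
  refine lintegral_congr fun y => ?_
  rw [← setLIntegral_ball_comp_add_smul (fun x => edist (φ x) (φ (z + ρ • y)) ^ q /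
      edist x (z + ρ • y) ^ ((m : ℝ) + r * q)) z hρ, ENNReal.rpow_add _ _ hK0 hKt, mul_assoc]
  congr 1
  rw [← lintegral_const_mul' _ _ (ENNReal.rpow_ne_top_of_ne_zero hK0 hKt)]
  refine lintegral_congr fun x => ?_
  have h1 : edist (z + ρ • x) (z + ρ • y) = ENNReal.ofReal ρ * edist x y := by
    rw [edist_add_left, edist_smul₀, Real.nnnorm_of_nonneg hρ.le, ENNReal.ofReal, ENNReal.smul_def,
      smul_eq_mul]
    congr 2
    exact (Real.toNNReal_of_nonneg hρ.le).symm
  rw [h1, ENNReal.rpow_neg, ENNReal.div_eq_inv_mul, ENNReal.div_eq_inv_mul, ← mul_assoc]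
  congr 1
  rw [ENNReal.mul_rpow_of_ne_top hKt (edist_ne_top _ _), ENNReal.mul_inv
    (Or.inl (ENNReal.rpow_pos (pos_iff_ne_zero.2 hK0) hKt).ne') (Or.inl (ENNReal.rpow_ne_top_of_ne_zero hK0 hKt))]

variable [SecondCountableTopology F] [BorelSpace F]
variable {M : Type*} [EMetricSpace M] [MeasurableSpace M] [BorelSpace M]
    [ChartedSpace (EuclideanSpace ℝ (Fin m)) M] [IsManifold (𝓡 m) ∞ M]
    [RiemannianBundle (fun x : M => TangentSpace (𝓡 m) x)]
    {e : OpenPartialHomeomorph M (Euc m)} {c : Euc m} {R : ℝ} {L : NNReal}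

/-- The scaling factor turns each term into the energy of the lifting over pairs of points in the
same ball. These sets of pairs are disjoint, and the energy in the chart is at most a multiple of
the one on M. -/
theorem ChartBall.tsum_gagliardoEnergy_lt_top [SecondCountableTopology M]
    [SFinite (μHE[m] : Measure M)] (hB : ChartBall e c R L) {r q : ℝ} (hr : 0 < r) (hq : 0 < q)
    {Φ : M → F} (hΦ : AEMeasurable Φ (μHE[m] : Measure M))
    (hE : gagliardoEnergy m r q Φ univ < ⊤) {ι : Type*} [Countable ι] {z : ι → Euc m} {ρ : ι → ℝ}
    (hρ : ∀ i, 0 < ρ i) (hsub : ∀ i, Metric.ball (z i) (ρ i) ⊆ Metric.ball c R)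
    (hdisj : Pairwise fun i j => Disjoint (Metric.ball (z i) (ρ i)) (Metric.ball (z j) (ρ j))) :
    ∑' i, ENNReal.ofReal (ρ i) ^ ((m : ℝ) - r * q) *
      gagliardoEnergy m r q (fun x => Φ (e.symm (z i + ρ i • x))) (Metric.ball 0 1) < ⊤ := by
  set α : ℝ := (m : ℝ) + r * q with hα
  have hα0 : 0 ≤ α := by positivity
  set H : Euc m → Euc m → ℝ≥0∞ := fun x y =>
    edist (Φ (e.symm x)) (Φ (e.symm y)) ^ q / edist x y ^ α with hH
  set G : M → M → ℝ≥0∞ := fun x y => edist (Φ x) (Φ y) ^ q / edist x y ^ α with hG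
  set Q : Set (Euc m) := Metric.closedBall c R with hQ
  have hQm : MeasurableSet Q := Metric.isClosed_closedBall.measurableSet
  obtain ⟨C, hC, hme, hle⟩ := hB.map_symm_le
  have hL0 : (L : ℝ≥0∞) ^ α ≠ ⊤ := ENNReal.rpow_ne_top_of_nonneg hα0 ENNReal.coe_ne_top
  have hGm : AEMeasurable (fun z : M × M => G z.1 z.2)
      ((μHE[m] : Measure M).prod (μHE[m] : Measure M)) := by
    have h1 : AEMeasurable (fun z : M × M => Φ z.1)
        ((μHE[m] : Measure M).prod (μHE[m] : Measure M)) :=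
      hΦ.comp_quasiMeasurePreserving Measure.quasiMeasurePreserving_fst
    have h2 : AEMeasurable (fun z : M × M => Φ z.2)
        ((μHE[m] : Measure M).prod (μHE[m] : Measure M)) :=
      hΦ.comp_quasiMeasurePreserving Measure.quasiMeasurePreserving_snd
    have h3 : Measurable (fun z : M × M => edist z.1 z.2) := by fun_prop
    exact ((h1.edist h2).pow_const _).div (h3.pow_const _).aemeasurable
  have h1 : ∀ y ∈ Q, ∀ x ∈ Q, H x y ≤ (L : ℝ≥0∞) ^ α * G (e.symm x) (e.symm y) :=
      fun y hy x hx => by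
    rcases eq_or_ne x y with rfl | hxy
    · simp [hH, hq]
    have h4 := hB.edist_symm_le _ hx _ hy
    simp only [hG, hH, ENNReal.div_eq_inv_mul]
    rw [← mul_assoc]
    refine mul_le_mul_left ?_ _
    have h5 := ENNReal.rpow_le_rpow h4 hα0
    rw [ENNReal.mul_rpow_of_nonneg _ _ hα0] at h5
    refine le_trans ?_ (mul_le_mul_right (ENNReal.inv_le_inv.2 h5) _)
    by_cases hL : (L : ℝ≥0∞) ^ α = 0
    · exfalso
      have hL' : (L : ℝ≥0∞) = 0 := by
        rcases ENNReal.rpow_eq_zero_iff.1 hL with h | h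
        · exact h.1
        · simp at h
      rw [hL', zero_mul, nonpos_iff_eq_zero, edist_eq_zero] at h4
      exact hxy (e.symm.injOn (hB.subset hx) (hB.subset hy) h4)
    · rw [ENNReal.mul_inv (Or.inl hL) (Or.inl hL0), ← mul_assoc, ENNReal.mul_inv_cancel hL hL0, one_mul]
  have hcore : ∫⁻ y in Q, ∫⁻ x in Q, H x y < ⊤ := by
    calc _ ≤ ∫⁻ y in Q, ∫⁻ x in Q, (L : ℝ≥0∞) ^ α * G (e.symm x) (e.symm y) := by
          refine setLIntegral_mono_ae' hQm (ae_of_all _ fun y hy => ?_)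
          exact setLIntegral_mono_ae' hQm (ae_of_all _ fun x hx => h1 y hy x hx)
      _ = (L : ℝ≥0∞) ^ α * ∫⁻ y in Q, ∫⁻ x in Q, G (e.symm x) (e.symm y) := by
          simp_rw [lintegral_const_mul' _ _ hL0]
      _ ≤ (L : ℝ≥0∞) ^ α * ∫⁻ y in Q, C * ∫⁻ x, G x (e.symm y) ∂(μHE[m] : Measure M) := by
          refine mul_le_mul_right (lintegral_mono fun y => ?_) _
          refine lintegral_comp_le_of_map_le (f := fun x => G x (e.symm y)) hme hle ?_
          have h7 : Measurable fun x : M => edist x (e.symm y) := by fun_prop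
          exact ((hΦ.edist aemeasurable_const).pow_const _).div (h7.pow_const _).aemeasurable
      _ ≤ (L : ℝ≥0∞) ^ α * (C * (C * ∫⁻ y, ∫⁻ x, G x y ∂μHE[m] ∂(μHE[m] : Measure M))) := by
          refine mul_le_mul_right ?_ _
          rw [lintegral_const_mul' _ _ hC]
          refine mul_le_mul_right ?_ _
          exact lintegral_comp_le_of_map_le (f := fun y => ∫⁻ x, G x y ∂(μHE[m] : Measure M)) hme hle
            hGm.lintegral_prod_left'
      _ < ⊤ := by
          rw [gagliardoEnergy, Measure.restrict_univ] at hE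
          exact ENNReal.mul_lt_top hL0.lt_top (ENNReal.mul_lt_top hC.lt_top
            (ENNReal.mul_lt_top hC.lt_top hE))
  refine lt_of_le_of_lt ?_ hcore
  have hsub' : ∀ i, Metric.ball (z i) (ρ i) ⊆ Q := fun i => (hsub i).trans Metric.ball_subset_closedBall
  calc _ = ∑' i, ∫⁻ y in Metric.ball (z i) (ρ i), ∫⁻ x in Metric.ball (z i) (ρ i), H x y :=
        tsum_congr fun i => gagliardoEnergy_comp_add_smul (fun x => Φ (e.symm x)) (z i) (hρ i)
    _ ≤ ∑' i, ∫⁻ y in Metric.ball (z i) (ρ i), ∫⁻ x in Q, H x y :=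
        ENNReal.tsum_le_tsum fun i => lintegral_mono fun y => lintegral_mono_set (hsub' i)
    _ = ∫⁻ y in ⋃ i, Metric.ball (z i) (ρ i), ∫⁻ x in Q, H x y :=
        (lintegral_iUnion (fun i => Metric.isOpen_ball.measurableSet) hdisj _).symm
    _ ≤ _ := lintegral_mono_set (iUnion_subset hsub')

/-- A bound g on M becomes ρ i L g on the i-th rescaled ball. The factor ρ i ^ q cancels in ρ i ^ (m
- q), leaving the Jacobian, and the integrals over disjoint balls add up. -/
theorem ChartBall.tsum_dirichletEnergy_lt_top (hB : ChartBall e c R L) {q : ℝ} (hq : 0 < q)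
    {Φ : M → F} (hE : dirichletEnergy m q Φ univ < ⊤) {ι : Type*} [Countable ι] {z : ι → Euc m}
    {ρ : ι → ℝ} (hρ : ∀ i, 0 < ρ i) (hsub : ∀ i, Metric.ball (z i) (ρ i) ⊆ Metric.ball c R)
    (hdisj : Pairwise fun i j => Disjoint (Metric.ball (z i) (ρ i)) (Metric.ball (z j) (ρ j))) :
    ∑' i, ENNReal.ofReal (ρ i) ^ ((m : ℝ) - q) *
      dirichletEnergy m q (fun x => Φ (e.symm (z i + ρ i • x))) (Metric.ball 0 1) < ⊤ := by
  rw [dirichletEnergy] at hE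
  simp only [iInf_lt_iff] at hE
  obtain ⟨g, hg, hgΦ, hgq⟩ := hE
  rw [Measure.restrict_univ] at hg hgq
  set Q : Set (Euc m) := Metric.closedBall c R with hQ
  have hQm : MeasurableSet Q := Metric.isClosed_closedBall.measurableSet
  obtain ⟨C, hC, hme, hle⟩ := hB.map_symm_le
  have hac := Measure.absolutelyContinuous_of_le_smul hle
  have hsub' : ∀ i, Metric.ball (z i) (ρ i) ⊆ Q := fun i => (hsub i).trans Metric.ball_subset_closedBall
  have hcore : ∫⁻ y in Q, (L * g (e.symm y)) ^ q < ⊤ := by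
    have h1 := lintegral_comp_le_of_map_le (f := fun x => g x ^ q) hme hle (hg.pow_const _)
    have hL : (L : ℝ≥0∞) ^ q ≠ ⊤ := ENNReal.rpow_ne_top_of_nonneg hq.le ENNReal.coe_ne_top
    simp_rw [ENNReal.mul_rpow_of_nonneg _ _ hq.le]
    rw [lintegral_const_mul' _ _ hL]
    exact ENNReal.mul_lt_top hL.lt_top (h1.trans_lt (ENNReal.mul_lt_top hC.lt_top hgq))
  have hmem : ∀ i, ∀ x ∈ Metric.ball (0 : Euc m) 1, z i + ρ i • x ∈ Q := fun i x hx => by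
    refine hsub' i ?_
    rw [Metric.mem_ball, dist_self_add_left, norm_smul, Real.norm_of_nonneg (hρ i).le]
    have := mem_ball_zero_iff.1 hx
    nlinarith [hρ i]
  have hpull : ∀ i, ∀ P : Euc m → Prop, (∀ᵐ y ∂(volume.restrict Q), P y) →
      ∀ᵐ x ∂(volume.restrict (Metric.ball (0 : Euc m) 1)), P (z i + ρ i • x) := fun i P hP => by
    rw [ae_restrict_iff' hQm] at hP
    rw [ae_restrict_iff' Metric.isOpen_ball.measurableSet]
    filter_upwards [(quasiMeasurePreserving_add_smul volume (z i) (hρ i)).ae hP] with x hx hxb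
    exact hx (hmem i x hxb)
  have hball : ∀ i, ENNReal.ofReal (ρ i) ^ ((m : ℝ) - q) *
      dirichletEnergy m q (fun x => Φ (e.symm (z i + ρ i • x))) (Metric.ball 0 1) ≤
        ∫⁻ y in Metric.ball (z i) (ρ i), (L * g (e.symm y)) ^ q := fun i => by
    have hK0 : ENNReal.ofReal (ρ i) ≠ 0 := by simpa using hρ i
    have hKt : ENNReal.ofReal (ρ i) ≠ ⊤ := ENNReal.ofReal_ne_top
    have hgm : AEMeasurable (fun x => ENNReal.ofReal (ρ i) * (L * g (e.symm (z i + ρ i • x))))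
        ((μHE[m] : Measure (Euc m)).restrict (Metric.ball 0 1)) := by
      rw [EuclideanSpace.euclideanHausdorffMeasure_eq_volume]
      obtain ⟨g', hg', hgg'⟩ := (hg.mono_ac hac).comp_aemeasurable hme
      refine ⟨fun x => ENNReal.ofReal (ρ i) * (L * g' (z i + ρ i • x)), ?_, ?_⟩
      · have : Measurable fun x : Euc m => z i + ρ i • x := by fun_prop
        exact ((hg'.comp this).const_mul _).const_mul _
      · filter_upwards [hpull i _ hgg'] with x hx
        simp only [Function.comp] at hx
        rw [hx]
    have hW : WeakDerivBoundOn m (fun x => Φ (e.symm (z i + ρ i • x)))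
        (fun x => ENNReal.ofReal (ρ i) * (L * g (e.symm (z i + ρ i • x)))) (Metric.ball 0 1) := by
      intro f hf
      obtain ⟨dh, hdh, hb⟩ := hgΦ f hf
      have h1 : HasWeakFDerivOn (fun y => f (Φ (e.symm y)))
          (fun y => (dh (e.symm y)).comp (derivOfEuc e.symm y)) e.target := by
        have hset : e.target ∩ e.symm ⁻¹' univ = e.target := by simp
        refine ⟨?_, fun v => ?_, fun v ψ hψ hc hs => ?_⟩
        · have := hdh.locallyIntegrableOn e hB.mem
          rwa [hset] at this
        · have := hdh.locallyIntegrableOn_differential e hB.mem v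
          rwa [hset] at this
        · exact hdh.integral_eq e hB.mem v ψ hψ hc (by rwa [hset])
      have h2 := (h1.comp_add_smul (z i) (hρ i)).mono (A' := Metric.ball 0 1)
        fun x hx => hB.subset (hmem i x hx)
      refine ⟨_, h2.hasWeakDifferentialOn, ?_⟩
      rw [EuclideanSpace.euclideanHausdorffMeasure_eq_volume]
      rw [Measure.restrict_univ] at hb
      have h3 : ∀ᵐ y ∂(volume.restrict Q), ∀ w : TangentSpace (𝓡 m) (e.symm y),
          ‖dh (e.symm y) w‖ₑ ≤ g (e.symm y) * ‖w‖ₑ := ae_of_ae_map hme (hac.ae_le hb)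
      filter_upwards [hpull i _ h3, ae_restrict_mem Metric.isOpen_ball.measurableSet] with x hx hxb v
      have h5 : ∀ v : Euc m, ‖(ρ i • (dh (e.symm (z i + ρ i • x))).comp (derivOfEuc e.symm (z i + ρ i • x))) v‖ₑ ≤
          ENNReal.ofReal (ρ i) * (g (e.symm (z i + ρ i • x)) * (L * ‖v‖ₑ)) := fun v => by
        have h4 := hB.deriv_symm_le _ (hmem i x hxb) v
        rw [_root_.smul_apply, enorm_smul, Real.enorm_of_nonneg (hρ i).le]
        refine mul_le_mul_right ((hx _).trans ?_) _
        exact mul_le_mul_right h4 _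
      refine (h5 v).trans (le_of_eq ?_)
      rw [enorm_tangentSpace_vectorSpace]
      ring
    have hle' : dirichletEnergy m q (fun x => Φ (e.symm (z i + ρ i • x))) (Metric.ball 0 1) ≤
        ENNReal.ofReal (ρ i) ^ q * ∫⁻ x in Metric.ball 0 1, (L * g (e.symm (z i + ρ i • x))) ^ q := by
      rw [dirichletEnergy]
      refine iInf_le_of_le _ (iInf_le_of_le hgm (iInf_le_of_le hW (le_of_eq ?_)))
      rw [EuclideanSpace.euclideanHausdorffMeasure_eq_volume,
        ← lintegral_const_mul' _ _ (ENNReal.rpow_ne_top_of_ne_zero hK0 hKt)]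
      refine lintegral_congr fun x => ENNReal.mul_rpow_of_nonneg _ _ hq.le
    refine (mul_le_mul_right hle' _).trans (le_of_eq ?_)
    rw [← mul_assoc, ← ENNReal.rpow_add _ _ hK0 hKt, sub_add_cancel,
      ← setLIntegral_ball_comp_add_smul _ (z i) (hρ i)]
  refine lt_of_le_of_lt ?_ hcore
  calc _ ≤ ∑' i, ∫⁻ y in Metric.ball (z i) (ρ i), (L * g (e.symm y)) ^ q := ENNReal.tsum_le_tsum hball
    _ = ∫⁻ y in ⋃ i, Metric.ball (z i) (ρ i), (L * g (e.symm y)) ^ q :=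
        (lintegral_iUnion (fun i => Metric.isOpen_ball.measurableSet) hdisj _).symm
    _ ≤ _ := lintegral_mono_set (iUnion_subset hsub')

end LocalEnergies

/-! ### From the lifting hypothesis on the domain to local liftings in a Euclidean ball. -/

section LocalLifting
open Filter Topology Manifold

variable (m : ℕ) {N F : Type*} [EMetricSpace N] [MeasurableSpace N] [EMetricSpace F]
    [MeasurableSpace F] in
/-- Maps of finite energy which are constant outside some fixed ball have local liftings of
finite energy. -/
def LiftsLocally (proj : F → N) (s p r q : ℝ) : Prop :=
  ∃ (c : Euc m) (R : ℝ), 0 < R ∧ ∀ (v : Euc m → N) (b : N) (en : ℝ≥0∞), en ≠ ⊤ →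
    HasEnergyLE s p v (Metric.closedBall c R) en → (∀ x ∉ Metric.closedBall c R, v x = b) →
      ∀ (ι : Type) [Countable ι] (z : ι → Euc m) (ρ : ι → ℝ), (∀ i, 0 < ρ i) →
        (∀ i, Metric.ball (z i) (ρ i) ⊆ Metric.ball c R) →
        (Pairwise fun i j => Disjoint (Metric.ball (z i) (ρ i)) (Metric.ball (z j) (ρ j))) →
          ∑' i, ENNReal.ofReal (ρ i) ^ ((m : ℝ) - s * p) *
            liftingEnergy m proj r q (fun x => v (z i + ρ i • x)) (Metric.ball 0 1) < ⊤

variable {m : ℕ} {N F : Type*} [EMetricSpace N] [MeasurableSpace N] [BorelSpace N]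
  [SecondCountableTopology N] [EMetricSpace F]
  [MeasurableSpace F] [SecondCountableTopology F] [BorelSpace F]
  {M : Type*} [EMetricSpace M] [MeasurableSpace M] [BorelSpace M] [Nonempty M]
    [SecondCountableTopology M] [SFinite (μHE[m] : Measure M)]
    [ChartedSpace (EuclideanSpace ℝ (Fin m)) M] [IsManifold (𝓡 m) ∞ M]
    [RiemannianBundle (fun x : M => TangentSpace (𝓡 m) x)]
    [IsContMDiffRiemannianBundle (𝓡 m) ∞ (EuclideanSpace ℝ (Fin m))
      (fun x : M => TangentSpace (𝓡 m) x)]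
    [IsRiemannianManifold (𝓡 m) M]

/-- This is where the global hypothesis enters: the map is transplanted to M, lifted there, and the
lifting is read in the chart on each of the balls. The relation rq = sp makes the scaling exponents
of map and lifting agree. Henceforth M plays no role. -/
theorem EverySobolevMapLifts.liftsLocally {proj : F → N} {s p r q : ℝ} (hm : 1 ≤ m)
    (hs : 0 < s) (hp : 1 ≤ p) (hr : 0 < r) (hq : 1 ≤ q) (hrq : r * q = s * p)
    (hT : HasTailBound m M ((m : ℝ) + s * p)) (H : EverySobolevMapLifts m M proj s p r q) :
    LiftsLocally m proj s p r q := by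
  obtain ⟨e, c, R, L, hB⟩ := exists_chartBall (m := m) (Classical.arbitrary M)
  -- Half of the radius is kept as the margin required for transplanting.
  refine ⟨c, R / 2, half_pos hB.pos, fun v b en hen hv hvb ι _ z ρ hρ hsub hdisj => ?_⟩
  have hR2 : R / 2 < R := half_lt_self hB.pos
  obtain ⟨Φ, ⟨hΦm, hΦE⟩, hΦ⟩ := H _ (hB.memSobolev_transplant hm hs hp hT hR2 hen hv hvb)
  have hsubR : ∀ i, Metric.ball (z i) (ρ i) ⊆ Metric.ball c R := fun i =>
    (hsub i).trans (Metric.ball_subset_ball hR2.le)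
  obtain ⟨C, hC, hme, hle⟩ := hB.map_symm_le
  have hac := Measure.absolutelyContinuous_of_le_smul hle
  have hmem : ∀ i, ∀ x ∈ Metric.ball (0 : Euc m) 1, z i + ρ i • x ∈ Metric.closedBall c R :=
    fun i x hx => by
    refine Metric.ball_subset_closedBall (hsubR i ?_)
    rw [Metric.mem_ball, dist_self_add_left, norm_smul, Real.norm_of_nonneg (hρ i).le]
    have := mem_ball_zero_iff.1 hx
    nlinarith [hρ i]
  have hlift : ∀ i, liftingEnergy m proj r q (fun x => v (z i + ρ i • x)) (Metric.ball 0 1) ≤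
      sobolevEnergy m r q (fun x => Φ (e.symm (z i + ρ i • x))) (Metric.ball 0 1) := fun i => by
    rw [liftingEnergy]
    refine iInf_le_of_le _ (iInf_le_of_le ?_ (iInf_le_of_le (fun x hx => ?_) le_rfl))
    · rw [EuclideanSpace.euclideanHausdorffMeasure_eq_volume]
      obtain ⟨g', hg', hgg'⟩ := (hΦm.mono_ac hac).comp_aemeasurable hme
      refine ⟨fun x => g' (z i + ρ i • x), ?_, ?_⟩
      · have : Measurable fun x : Euc m => z i + ρ i • x := by fun_prop
        exact hg'.comp this
      · rw [EventuallyEq, ae_restrict_iff' Metric.isClosed_closedBall.measurableSet] at hgg'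
        rw [EventuallyEq, ae_restrict_iff' Metric.isOpen_ball.measurableSet]
        filter_upwards [(quasiMeasurePreserving_add_smul volume (z i) (hρ i)).ae hgg'] with x hx hxb
        exact hx (hmem i x hxb)
    · have h1 := hB.subset (hmem i x hx)
      rw [hΦ, transplant, if_pos (e.map_target h1), e.right_inv h1]
  refine lt_of_le_of_lt (ENNReal.tsum_le_tsum fun i => mul_le_mul_right (hlift i) _) ?_
  by_cases h1 : r = 1
  · subst h1
    simp only [sobolevEnergy, if_true] at hΦE ⊢
    rw [← hrq, one_mul]
    exact hB.tsum_dirichletEnergy_lt_top (by linarith) hΦE hρ hsubR hdisj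
  · simp only [sobolevEnergy, if_neg h1] at hΦE ⊢
    rw [← hrq]
    exact hB.tsum_gagliardoEnergy_lt_top hr (by linarith) hΦm hΦE hρ hsubR hdisj

end LocalLifting

/-! ### Averaging a function with a concentrated rescaling decreases its norm. -/

section HalfSum
open Filter Topology

variable {V : Type*} [NormedAddCommGroup V] [NormedSpace ℝ V] [FiniteDimensional ℝ V]
  [MeasurableSpace V] [BorelSpace V] (μ : Measure V) [μ.IsAddHaarMeasure]

theorem exists_setLIntegral_ball_le [Nontrivial V] {f : V → ℝ≥0∞}
    (hfi : ∫⁻ x, f x ∂μ ≠ ⊤) {ε : ℝ≥0∞} (hε : ε ≠ 0) :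
    ∃ δ > 0, ∫⁻ x in Metric.ball 0 δ, f x ∂μ ≤ ε := by
  have h1 : Tendsto (fun n : ℕ => μ (Metric.ball (0 : V) (1 / ((n : ℝ) + 1)))) atTop (𝓝 0) := by
    have h2 : ⋂ n : ℕ, Metric.ball (0 : V) (1 / ((n : ℝ) + 1)) = {0} := by
      ext x
      simp only [mem_iInter, mem_ball_zero_iff, mem_singleton_iff]
      refine ⟨fun h => ?_, fun h n => by rw [h, norm_zero]; positivity⟩
      by_contra hx
      obtain ⟨n, hn⟩ := exists_nat_one_div_lt (norm_pos_iff.2 hx)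
      exact lt_irrefl _ ((h n).trans hn)
    have h3 := tendsto_measure_iInter_atTop (μ := μ)
      (s := fun n : ℕ => Metric.ball (0 : V) (1 / ((n : ℝ) + 1)))
      (fun n => Metric.isOpen_ball.measurableSet.nullMeasurableSet)
      (fun i j hij => Metric.ball_subset_ball (one_div_le_one_div_of_le (by positivity) (by gcongr)))
      ⟨0, measure_ball_lt_top.ne⟩
    rwa [h2, measure_singleton] at h3
  have h4 := (tendsto_setLIntegral_zero hfi h1).eventually (Iio_mem_nhds (pos_iff_ne_zero.2 hε))
  obtain ⟨n, hn⟩ := h4.exists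
  exact ⟨_, by positivity, le_of_lt hn⟩

theorem exists_setLIntegral_compl_ball_le {f : V → ℝ≥0∞} (hfi : ∫⁻ x, f x ∂μ ≠ ⊤) {ε : ℝ≥0∞}
    (hε : ε ≠ 0) : ∃ n : ℕ, ∫⁻ x in (Metric.ball 0 (n : ℝ))ᶜ, f x ∂μ ≤ ε := by
  have hfin : IsFiniteMeasure (μ.withDensity f) := isFiniteMeasure_withDensity hfi
  have h2 : ⋂ n : ℕ, (Metric.ball (0 : V) (n : ℝ))ᶜ = ∅ := by
    ext x
    simp only [mem_iInter, mem_compl_iff, mem_ball_zero_iff, mem_empty_iff_false, iff_false, not_forall,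
      not_not]
    exact exists_nat_gt _
  have h3 := tendsto_measure_iInter_atTop (μ := μ.withDensity f)
    (s := fun n : ℕ => (Metric.ball (0 : V) (n : ℝ))ᶜ)
    (fun n => Metric.isOpen_ball.measurableSet.compl.nullMeasurableSet)
    (fun i j hij => compl_subset_compl.2 (Metric.ball_subset_ball (by exact_mod_cast hij)))
    ⟨0, measure_ne_top _ _⟩
  rw [h2, measure_empty] at h3
  obtain ⟨n, hn⟩ := (h3.eventually (Iio_mem_nhds (pos_iff_ne_zero.2 hε))).exists
  refine ⟨n, le_of_lt ?_⟩
  rwa [← withDensity_apply _ Metric.isOpen_ball.measurableSet.compl]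

/-- The factor by which the energy decreases when a function is averaged with a rescaling. -/
def halfSumFactor (p : ℝ) : ℝ≥0∞ := ENNReal.ofReal ((2 ^ (1 / p - 1) + 1) / 2) ^ p

theorem halfSumFactor_lt_one {p : ℝ} (hp : 1 < p) : halfSumFactor p < 1 := by
  have h1 : (2 : ℝ) ^ (1 / p - 1) < 1 := by
    refine Real.rpow_lt_one_of_one_lt_of_neg (by norm_num) ?_
    have : 1 / p < 1 := (div_lt_one (by linarith)).2 hp
    linarith
  refine ENNReal.rpow_lt_one ?_ (by linarith)
  rw [← ENNReal.ofReal_one]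
  exact (ENNReal.ofReal_lt_ofReal_iff one_pos).2 (by linarith)

/-- The rescaling F of f has the same L^p norm, but for large l it is concentrated near the origin,
where f has little mass. Were the supports disjoint, the norm of f + F would be at most (2E)^(1/p),
a factor b = 2^(1/p - 1) < 1 better than the triangle inequality; the small overlaps are absorbed by
the gap between b and (b + 1)/2. -/
theorem exists_lintegral_half_add_le [Nontrivial V] {f : V → ℝ≥0∞} (hf : Measurable f) {p : ℝ}
    (hp : 1 < p) {E : ℝ≥0∞} (hE0 : E ≠ 0) (hE : E ≠ ⊤) (hfE : ∫⁻ x, f x ^ p ∂μ ≤ E) :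
    ∃ l : ℝ, 1 ≤ l ∧ ∫⁻ x, ((f x + ENNReal.ofReal l ^ ((Module.finrank ℝ V : ℝ) / p) * f (l • x)) / 2) ^ p ∂μ ≤
      halfSumFactor p * E := by
  have hp0 : 0 < p := by linarith
  set b : ℝ := 2 ^ (1 / p - 1) with hb
  have hb0 : 0 < b := by positivity
  have hb1 : b < 1 := by
    refine Real.rpow_lt_one_of_one_lt_of_neg (by norm_num) ?_
    have : 1 / p < 1 := (div_lt_one (by linarith)).2 hp
    linarith
  -- Each of the two overlap terms has norm at most θ E^(1/p), and 2b + 2θ = 1 + b is twice the base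
  -- in `halfSumFactor`.
  set θ : ℝ := (1 - b) / 2 with hθ
  have hθ0 : 0 < θ := by linarith
  have hfi : ∫⁻ x, f x ^ p ∂μ ≠ ⊤ := ne_top_of_le_ne_top hE hfE
  set ε : ℝ≥0∞ := ENNReal.ofReal θ ^ p * E with hε
  have hε0 : ε ≠ 0 := mul_ne_zero (ENNReal.rpow_pos (by simpa using hθ0) ENNReal.ofReal_ne_top).ne' hE0
  obtain ⟨δ, hδ, hδε⟩ := exists_setLIntegral_ball_le μ hfi hε0
  obtain ⟨n, hn⟩ := exists_setLIntegral_compl_ball_le μ hfi hε0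
  obtain ⟨k, hk⟩ := exists_nat_gt ((n : ℝ) / δ)
  set l : ℝ := (k : ℝ) + 1 with hl
  have hl0 : 0 < l := by positivity
  -- Dilation by l sends the complement of the ball of radius δ into the complement of the ball of
  -- radius n, where f has little mass.
  have hln : (n : ℝ) ≤ l * δ := by
    rw [div_lt_iff₀ hδ] at hk
    nlinarith
  refine ⟨l, by simp [hl], ?_⟩
  set d : ℝ := (Module.finrank ℝ V : ℝ) with hd
  set F : V → ℝ≥0∞ := fun x => ENNReal.ofReal l ^ (d / p) * f (l • x) with hF
  have hFm : Measurable F := by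
    have : Measurable fun x : V => l • x := by fun_prop
    exact (hf.comp this).const_mul _
  have hFp : ∀ x, F x ^ p = ENNReal.ofReal l ^ Module.finrank ℝ V * f (l • x) ^ p := fun x => by
    rw [hF]
    simp only
    rw [ENNReal.mul_rpow_of_nonneg _ _ hp0.le, ← ENNReal.rpow_mul, div_mul_cancel₀ _ hp0.ne', hd,
      ENNReal.rpow_natCast]
  have hpt : ENNReal.ofReal l ^ Module.finrank ℝ V ≠ ⊤ := ENNReal.pow_ne_top ENNReal.ofReal_ne_top
  have hscale : ∀ G : V → ℝ≥0∞, ∫⁻ x, ENNReal.ofReal l ^ Module.finrank ℝ V * G (l • x) ∂μ = ∫⁻ x, G x ∂μ :=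
    fun G => by
      rw [lintegral_const_mul' _ _ hpt, ← lintegral_comp_add_smul μ G 0 hl0]
      simp
  set S : Set V := Metric.ball 0 δ with hS
  have hSm : MeasurableSet S := Metric.isOpen_ball.measurableSet
  -- The main parts of f and of F have disjoint supports, so the p-th powers of their norms add; u₂
  -- and u₃ are the overlaps.
  set u₁ : V → ℝ≥0∞ := fun x => Sᶜ.indicator f x + S.indicator F x with hu₁
  set u₂ : V → ℝ≥0∞ := S.indicator f with hu₂
  set u₃ : V → ℝ≥0∞ := Sᶜ.indicator F with hu₃
  have m₁ : Measurable u₁ := (hf.indicator hSm.compl).add (hFm.indicator hSm)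
  have m₂ : Measurable u₂ := hf.indicator hSm
  have m₃ : Measurable u₃ := hFm.indicator hSm.compl
  have hsum : ∀ x, f x + F x = (u₁ + u₂ + u₃) x := fun x => by
    simp only [Pi.add_apply, hu₁, hu₂, hu₃]
    by_cases hx : x ∈ S
    · simp [hx]; ring
    · simp [hx]
  have i₁ : ∫⁻ x, u₁ x ^ p ∂μ ≤ 2 * E := by
    calc _ ≤ ∫⁻ x, (f x ^ p + F x ^ p) ∂μ := by
          refine lintegral_mono fun x => ?_
          simp only [hu₁]
          by_cases hx : x ∈ S
          · simp [hx]
          · simp [hx]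
      _ = ∫⁻ x, f x ^ p ∂μ + ∫⁻ x, f x ^ p ∂μ := by
          rw [lintegral_add_left (hf.pow_const _)]
          simp only [hFp]
          rw [hscale fun x => f x ^ p]
      _ ≤ E + E := add_le_add hfE hfE
      _ = _ := (two_mul E).symm
  have i₂ : ∫⁻ x, u₂ x ^ p ∂μ ≤ ε := by
    refine le_trans (le_of_eq ?_) hδε
    rw [← lintegral_indicator hSm]
    refine lintegral_congr fun x => ?_
    by_cases hx : x ∈ S
    · simp [hu₂, hx]
    · simp [hu₂, hx, hp0]
  have i₃ : ∫⁻ x, u₃ x ^ p ∂μ ≤ ε := by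
    refine le_trans ?_ hn
    rw [← lintegral_indicator Metric.isOpen_ball.measurableSet.compl,
      ← hscale ((Metric.ball (0 : V) (n : ℝ))ᶜ.indicator fun x => f x ^ p)]
    refine lintegral_mono fun x => ?_
    by_cases hx : x ∈ S
    · simp [hu₃, hx, hp0]
    · have h1 : l • x ∈ (Metric.ball (0 : V) (n : ℝ))ᶜ := by
        rw [hS, mem_ball_zero_iff, not_lt] at hx
        rw [mem_compl_iff, mem_ball_zero_iff, not_lt, norm_smul, Real.norm_of_nonneg hl0.le]
        exact hln.trans (by gcongr)
      rw [indicator_of_mem h1, ← hFp, hu₃, indicator_of_mem hx]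
  have hmain : (∫⁻ x, (f x + F x) ^ p ∂μ) ^ (1 / p) ≤ 2 * (ENNReal.ofReal ((b + 1) / 2) * E ^ (1 / p)) := by
    simp_rw [hsum]
    have hp' : 0 ≤ 1 / p := by positivity
    have hεp : ε ^ (1 / p) = ENNReal.ofReal θ * E ^ (1 / p) := by
      rw [hε, ENNReal.mul_rpow_of_nonneg _ _ hp', ← ENNReal.rpow_mul, mul_one_div_cancel hp0.ne',
        ENNReal.rpow_one]
    calc _ ≤ (∫⁻ x, (u₁ + u₂) x ^ p ∂μ) ^ (1 / p) + (∫⁻ x, u₃ x ^ p ∂μ) ^ (1 / p) :=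
          ENNReal.lintegral_Lp_add_le (m₁.add m₂).aemeasurable m₃.aemeasurable hp.le
      _ ≤ (∫⁻ x, u₁ x ^ p ∂μ) ^ (1 / p) + (∫⁻ x, u₂ x ^ p ∂μ) ^ (1 / p) +
          (∫⁻ x, u₃ x ^ p ∂μ) ^ (1 / p) := by
          gcongr
          exact ENNReal.lintegral_Lp_add_le m₁.aemeasurable m₂.aemeasurable hp.le
      _ ≤ (2 * E) ^ (1 / p) + ε ^ (1 / p) + ε ^ (1 / p) :=
          add_le_add (add_le_add (ENNReal.rpow_le_rpow i₁ hp') (ENNReal.rpow_le_rpow i₂ hp'))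
            (ENNReal.rpow_le_rpow i₃ hp')
      _ = (ENNReal.ofReal (2 * b) + ENNReal.ofReal θ + ENNReal.ofReal θ) * E ^ (1 / p) := by
          rw [hεp, ENNReal.mul_rpow_of_nonneg _ _ hp', add_mul, add_mul]
          congr 3
          rw [show (2 : ℝ≥0∞) = ENNReal.ofReal 2 by simp, ENNReal.ofReal_rpow_of_pos two_pos, hb,
            Real.rpow_sub two_pos, Real.rpow_one]
          congr 1
          ring
      _ = _ := by
          rw [← ENNReal.ofReal_add (by positivity) hθ0.le, ← ENNReal.ofReal_add (by positivity) hθ0.le,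
            ← mul_assoc, show (2 : ℝ≥0∞) = ENNReal.ofReal 2 by simp, ← ENNReal.ofReal_mul two_pos.le]
          congr 2
          rw [hθ]; ring
  have h6 := ENNReal.rpow_le_rpow hmain hp0.le
  rw [← ENNReal.rpow_mul, one_div_mul_cancel hp0.ne', ENNReal.rpow_one,
    ENNReal.mul_rpow_of_nonneg _ _ hp0.le, ENNReal.mul_rpow_of_nonneg _ _ hp0.le, ← ENNReal.rpow_mul,
    one_div_mul_cancel hp0.ne', ENNReal.rpow_one] at h6
  have h2p : (2 : ℝ≥0∞) ^ p ≠ 0 := (ENNReal.rpow_pos (by norm_num) (by norm_num)).ne'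
  have h2t : (2 : ℝ≥0∞) ^ p ≠ ⊤ := ENNReal.rpow_ne_top_of_nonneg hp0.le (by norm_num)
  simp_rw [ENNReal.div_rpow_of_nonneg _ _ hp0.le, ENNReal.div_eq_inv_mul]
  rw [lintegral_const_mul' _ _ (ENNReal.inv_ne_top.2 h2p), halfSumFactor]
  calc _ ≤ ((2 : ℝ≥0∞) ^ p)⁻¹ * (2 ^ p * (ENNReal.ofReal ((b + 1) / 2) ^ p * E)) :=
        mul_le_mul_right h6 _
    _ = _ := by rw [← mul_assoc, ENNReal.inv_mul_cancel h2p h2t, one_mul]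

end HalfSum

/-! ### Cutoff functions of small energy. -/

section Cutoff
open Filter Topology
variable {m : ℕ}

/-- There is a cutoff function of energy at most `e`, equal to `1` near the origin and to `0`
outside a fixed ball. -/
def HasCutoff (m : ℕ) (s p : ℝ) (e : ℝ≥0∞) : Prop :=
  ∃ (δ : ℝ) (η : Euc m → ℝ), 0 < δ ∧ δ < 2 ∧ Continuous η ∧ (∀ x ∈ Metric.ball 0 δ, η x = 1) ∧
    (∀ x ∉ Metric.ball 0 2, η x = 0) ∧ HasEnergyLE s p η (Metric.closedBall 0 2) e

theorem segmentBound_of_contDiff {η : Euc m → ℝ} (hη : ContDiff ℝ ∞ η) :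
    SegmentBound η fun x => ‖fderiv ℝ η x‖ₑ := by
  refine ae_of_all _ fun z => ?_
  have hd : Continuous fun x => ‖fderiv ℝ η x‖ := (hη.continuous_fderiv (by simp)).norm
  have h := enorm_sub_le_lintegral_of_fderiv_bound (h := η) (γ := fun τ => z.2 + τ • z.1)
    (G := fun x => ‖fderiv ℝ η x‖) (l := fun _ => ‖z.1‖) (by fun_prop) hd continuous_const
    (fun x => norm_nonneg _) (fun _ => norm_nonneg _)
    (fun τ _ => ⟨hη.differentiable (by simp) _, le_rfl⟩)
    (fun τ _ => by
      filter_upwards [self_mem_nhdsWithin] with t ht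
      rw [add_sub_add_left_eq_sub, ← sub_smul, norm_smul, Real.norm_of_nonneg (sub_nonneg.2 (le_of_lt ht)),
        mul_comm])
  simp only [one_smul, zero_smul, add_zero, ofReal_norm] at h
  rw [lintegral_const_mul' _ _ (by simp)] at h
  rwa [edist_comm, edist_eq_enorm_sub]

/-- Differences of η are at most min(1, K ‖w‖). The resulting kernel is integrable near the origin
because s < 1, and at infinity because s > 0. -/
theorem pairEnergy_lt_top_of_contDiff (hm : 1 ≤ m) {s p : ℝ} (hs : s ∈ Ioo (0 : ℝ) 1) (hp : 1 ≤ p)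
    {η : Euc m → ℝ} (hη : ContDiff ℝ ∞ η) (hη0 : ∀ x ∉ Metric.ball (0 : Euc m) 2, η x = 0)
    (hη1 : ∀ x, η x ∈ Icc (0 : ℝ) 1) : pairEnergy s p η < ⊤ := by
  have hp0 : 0 < p := by linarith
  have : Nontrivial (Euc m) := by
    have : Nonempty (Fin m) := ⟨⟨0, hm⟩⟩
    infer_instance
  have hsupp : HasCompactSupport η := HasCompactSupport.intro (isCompact_closedBall (0 : Euc m) 2)
    fun x hx => hη0 x fun h => hx (Metric.ball_subset_closedBall h)
  obtain ⟨K, hK⟩ := hη.lipschitzWith_of_hasCompactSupport hsupp (by simp)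
  set α : ℝ := (m : ℝ) + s * p with hα
  have hsp : s * p < p := by nlinarith [hs.2]
  set k : Euc m → ℝ≥0∞ := fun w => min 1 (K * ‖w‖ₑ) ^ p / ‖w‖ₑ ^ α with hk
  have hkm : Measurable k := by fun_prop
  have hkt : ∫⁻ w, k w < ⊤ := by
    rw [← lintegral_add_compl _ (Metric.isOpen_ball (x := (0 : Euc m)) (ε := 1)).measurableSet]
    refine ENNReal.add_lt_top.2 ⟨?_, ?_⟩
    · calc _ ≤ ∫⁻ w in Metric.ball (0 : Euc m) 1, (K : ℝ≥0∞) ^ p * (‖w‖ₑ ^ (α - p))⁻¹ := by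
            refine lintegral_mono_ae ?_
            have h0 : ∀ᵐ w : Euc m ∂(volume.restrict (Metric.ball 0 1)), w ≠ 0 :=
              ae_restrict_of_ae (Measure.ae_ne volume 0)
            filter_upwards [h0] with w hw
            have hw0 : ‖w‖ₑ ≠ 0 := enorm_ne_zero.2 hw
            calc k w ≤ (K * ‖w‖ₑ) ^ p / ‖w‖ₑ ^ α :=
                  ENNReal.div_le_div_right (ENNReal.rpow_le_rpow (min_le_right _ _) hp0.le) _
              _ = _ := by
                  rw [ENNReal.mul_rpow_of_nonneg _ _ hp0.le, mul_div_assoc, ← ENNReal.rpow_sub _ _ hw0 enorm_ne_top,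
                    ← ENNReal.rpow_neg, neg_sub]
        _ < ⊤ := by
            rw [lintegral_const_mul' _ _ (ENNReal.rpow_ne_top_of_nonneg hp0.le ENNReal.coe_ne_top)]
            refine ENNReal.mul_lt_top (ENNReal.rpow_lt_top_of_nonneg hp0.le ENNReal.coe_ne_top) (lintegral_ball_rpow_lt_top volume ?_)
            rw [finrank_euclideanSpace_fin]
            linarith
    · refine lt_of_le_of_lt (lintegral_mono fun w => ?_) (lintegral_compl_ball_rpow_lt_top volume (a := α) ?_)
      · rw [hk]
        simp only
        rw [ENNReal.div_eq_inv_mul]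
        calc _ ≤ (‖w‖ₑ ^ α)⁻¹ * 1 ^ p :=
              mul_le_mul_right (ENNReal.rpow_le_rpow (min_le_left _ _) hp0.le) _
          _ = _ := by simp
      · rw [finrank_euclideanSpace_fin]
        have := mul_pos hs.1 hp0
        linarith
  set B : Set (Euc m) := Metric.ball 0 2 with hB
  have hBm : MeasurableSet B := Metric.isOpen_ball.measurableSet
  have hpt : ∀ z : Euc m × Euc m, edist (η z.1) (η z.2) ^ p / edist z.1 z.2 ^ α ≤
      B.indicator (fun _ => k (z.2 - z.1)) z.1 + B.indicator (fun _ => k (z.1 - z.2)) z.2 := fun z => by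
    have h1 : edist (η z.1) (η z.2) ≤ min 1 (K * ‖z.2 - z.1‖ₑ) := by
      refine le_min ?_ ?_
      · rw [edist_dist, ← ENNReal.ofReal_one]
        exact ENNReal.ofReal_le_ofReal (Real.dist_le_of_mem_Icc_01 (hη1 _) (hη1 _))
      · have := hK z.1 z.2
        rwa [edist_comm z.1, edist_eq_enorm_sub z.2] at this
    have h2 : edist (η z.1) (η z.2) ^ p / edist z.1 z.2 ^ α ≤ k (z.2 - z.1) := by
      rw [hk, edist_comm z.1, edist_eq_enorm_sub z.2]
      exact ENNReal.div_le_div_right (ENNReal.rpow_le_rpow h1 hp0.le) _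
    have h3 : k (z.1 - z.2) = k (z.2 - z.1) := by
      rw [hk]; simp only; rw [← neg_sub, enorm_neg]
    by_cases hz1 : z.1 ∈ B
    · rw [indicator_of_mem hz1]; exact h2.trans le_self_add
    · by_cases hz2 : z.2 ∈ B
      · rw [indicator_of_mem hz2, h3]; exact h2.trans le_add_self
      · rw [hη0 _ hz1, hη0 _ hz2]; simp [hp0]
  have hm1 : Measurable fun z : Euc m × Euc m => B.indicator (fun _ => k (z.2 - z.1)) z.1 := by
    have h1 : Measurable fun z : Euc m × Euc m => k (z.2 - z.1) := by fun_prop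
    exact h1.indicator (hBm.preimage measurable_fst)
  have hm2 : Measurable fun z : Euc m × Euc m => B.indicator (fun _ => k (z.1 - z.2)) z.2 := by
    have h1 : Measurable fun z : Euc m × Euc m => k (z.1 - z.2) := by fun_prop
    exact h1.indicator (hBm.preimage measurable_snd)
  have hval : ∫⁻ x, ∫⁻ y, B.indicator (fun _ => k (y - x)) x < ⊤ := by
    have h1 : ∀ x, ∫⁻ y, B.indicator (fun _ => k (y - x)) x = B.indicator (fun _ => ∫⁻ w, k w) x :=
      fun x => by
        by_cases hx : x ∈ B
        · simp only [indicator_of_mem hx]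
          exact lintegral_sub_right_eq_self k x
        · simp [indicator_of_notMem hx]
    simp_rw [h1]
    rw [lintegral_indicator hBm, setLIntegral_const]
    exact ENNReal.mul_lt_top hkt measure_ball_lt_top
  calc pairEnergy s p η ≤ ∫⁻ z : Euc m × Euc m, (B.indicator (fun _ => k (z.2 - z.1)) z.1 +
        B.indicator (fun _ => k (z.1 - z.2)) z.2) ∂(volume.prod volume) := lintegral_mono hpt
    _ = (∫⁻ x, ∫⁻ y, B.indicator (fun _ => k (y - x)) x) +
        (∫⁻ x, ∫⁻ y, B.indicator (fun _ => k (y - x)) x) := by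
        rw [lintegral_add_left hm1, lintegral_prod _ hm1.aemeasurable, lintegral_prod_symm _ hm2.aemeasurable]
    _ < ⊤ := ENNReal.add_lt_top.2 ⟨hval, hval⟩

theorem exists_hasCutoff (hm : 1 ≤ m) {s p : ℝ} (hs : s ∈ Ioc (0 : ℝ) 1) (hp : 1 ≤ p) :
    ∃ e : ℝ≥0∞, e ≠ ⊤ ∧ HasCutoff m s p e := by
  have hp0 : 0 < p := by linarith
  let f : ContDiffBump (0 : Euc m) := ⟨1, 2, one_pos, one_lt_two⟩
  have hf : ContDiff ℝ ∞ f := f.contDiff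
  have hfc : HasCompactSupport f := f.hasCompactSupport
  have hf0 : ∀ x ∉ Metric.ball (0 : Euc m) 2, f x = 0 := fun x hx =>
    f.zero_of_le_dist (by simpa using hx)
  have hf1 : ∀ x ∈ Metric.ball (0 : Euc m) 1, f x = 1 := fun x hx =>
    f.one_of_mem_closedBall (Metric.ball_subset_closedBall hx)
  have hd : Continuous fun x => ‖fderiv ℝ f x‖ₑ := (hf.continuous_fderiv (by simp)).enorm
  have hsupp : ∀ x ∉ Metric.closedBall (0 : Euc m) 2, ‖fderiv ℝ f x‖ₑ = 0 := fun x hx => by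
    have h0 : fderiv ℝ f x = 0 := by
      refine (notMem_tsupport_iff_eventuallyEq.1 fun h => hx ?_).fderiv_eq.trans (by simp)
      rw [f.tsupport_eq] at h
      exact h
    rw [h0, ← ofReal_norm, norm_zero, ENNReal.ofReal_zero]
  obtain ⟨K, hK⟩ := (hfc.fderiv ℝ).exists_bound_of_continuous (hf.continuous_fderiv (by simp))
  have h1 : ∫⁻ x, ‖fderiv ℝ f x‖ₑ ^ p < ⊤ := by
    calc _ ≤ ∫⁻ x, (Metric.closedBall (0 : Euc m) 2).indicator (fun _ => ENNReal.ofReal K ^ p) x := by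
          refine lintegral_mono fun x => ?_
          by_cases hx : x ∈ Metric.closedBall (0 : Euc m) 2
          · rw [indicator_of_mem hx, ← ofReal_norm]
            exact ENNReal.rpow_le_rpow (ENNReal.ofReal_le_ofReal (hK x)) hp0.le
          · rw [indicator_of_notMem hx, hsupp x hx]; simp [hp0]
      _ < ⊤ := by
          rw [lintegral_indicator Metric.isClosed_closedBall.measurableSet, setLIntegral_const]
          exact ENNReal.mul_lt_top (ENNReal.rpow_lt_top_of_nonneg hp0.le ENNReal.ofReal_ne_top) measure_closedBall_lt_top
  by_cases hs1 : s = 1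
  · exact ⟨_, h1.ne, 1, f, one_pos, one_lt_two, hf.continuous, hf1, hf0,
      hf.continuous.measurable.aemeasurable,
      fun _ => ⟨_, hd.measurable, hsupp, segmentBound_of_contDiff hf, le_rfl⟩, fun h => absurd hs1 h⟩
  · exact ⟨_, (pairEnergy_lt_top_of_contDiff hm ⟨hs.1, lt_of_le_of_ne hs.2 hs1⟩ hp hf hf0
      fun x => ⟨f.nonneg, f.le_one⟩).ne, 1, f, one_pos, one_lt_two, hf.continuous, hf1, hf0,
      hf.continuous.measurable.aemeasurable, fun h => absurd h hs1, fun _ => le_rfl⟩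

theorem edist_half_add_le (a b a' b' : ℝ) :
    edist ((a + b) / 2) ((a' + b') / 2) ≤ (edist a a' + edist b b') / 2 := by
  rw [edist_eq_enorm_sub, edist_eq_enorm_sub, edist_eq_enorm_sub,
    show (a + b) / 2 - (a' + b') / 2 = ((a - a') + (b - b')) / 2 by ring, div_eq_mul_inv, enorm_mul,
    ENNReal.div_eq_inv_mul, mul_comm]
  have h : ‖(2 : ℝ)⁻¹‖ₑ = 2⁻¹ := by
    rw [Real.enorm_of_nonneg (by norm_num), ENNReal.ofReal_inv_of_pos two_pos]; simp
  rw [h]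
  exact mul_le_mul_right (enorm_add_le _ _) _

/-- For sp = m the energy is invariant under dilations, so the average of η with x ↦ η(l x) is again
a cutoff and has a smaller energy by the half sum estimate. That estimate is applied to the segment
bound on ℝ^m when s = 1, and to the difference quotient on ℝ^m × ℝ^m otherwise. -/
theorem HasCutoff.half {s p : ℝ} (hm : 1 ≤ m) (hp : 1 < p) (hsp : s * p = m) {e : ℝ≥0∞}
    (he : e ≠ ⊤) (h : HasCutoff m s p e) : HasCutoff m s p (halfSumFactor p * e) := by
  have hp0 : 0 < p := by linarith
  have : Nontrivial (Euc m) := by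
    have : Nonempty (Fin m) := ⟨⟨0, hm⟩⟩
    infer_instance
  rcases eq_or_ne e 0 with rfl | he0
  · rwa [mul_zero]
  obtain ⟨δ, η, hδ, hδ2, hηc, hη1, hη0, hη⟩ := h
  have key : ∃ l : ℝ, 1 ≤ l ∧ HasEnergyLE s p (fun x => (η x + η (l • x)) / 2) (Metric.closedBall 0 2)
      (halfSumFactor p * e) := by
    by_cases hs1 : s = 1
    · obtain ⟨g, hg, hg0, hseg, hge⟩ := hη.exists_segmentBound hs1
      obtain ⟨l, hl, hle⟩ := exists_lintegral_half_add_le volume hg hp he0 he hge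
      have hl0 : 0 < l := by linarith
      -- Since sp = m and s = 1, the amplitude of the rescaling is l itself, which is the factor
      -- given by the chain rule.
      have hd : (Module.finrank ℝ (Euc m) : ℝ) / p = 1 := by
        rw [finrank_euclideanSpace_fin, ← hsp, hs1, one_mul, div_self hp0.ne']
      rw [hd] at hle
      simp only [ENNReal.rpow_one] at hle
      have hgl : Measurable fun x : Euc m => g (l • x) := by
        have : Measurable fun x : Euc m => l • x := by fun_prop
        exact hg.comp this
      refine ⟨l, hl, ⟨by fun_prop, fun _ => ⟨fun x => (g x + ENNReal.ofReal l * g (l • x)) / 2,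
        (hg.add (hgl.const_mul _)).div_const 2, fun x hx => ?_,
        ?_, hle⟩, fun h => absurd hs1 h⟩⟩
      · have h2 : l • x ∉ Metric.closedBall (0 : Euc m) 2 := by
          rw [mem_closedBall_zero_iff, not_le] at hx ⊢
          rw [norm_smul, Real.norm_of_nonneg hl0.le]
          nlinarith
        simp [hg0 x hx, hg0 _ h2]
      · have h2 := (quasiMeasurePreserving_add_smul
          ((volume : Measure (Euc m)).prod (volume : Measure (Euc m))) (0, 0) hl0).ae hseg
        filter_upwards [hseg, h2] with z hz hz2
        have h3 : (((0, 0) : Euc m × Euc m) + l • z) = (l • z.1, l • z.2) := by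
          ext <;> simp
        rw [h3] at hz2
        have hmg : Measurable fun τ : ℝ => g (z.2 + τ • z.1) := by
          have : Measurable fun τ : ℝ => z.2 + τ • z.1 := by fun_prop
          exact hg.comp this
        have h4 : edist (η (l • z.2)) (η (l • (z.2 + z.1))) ≤ ‖z.1‖ₑ *
            ∫⁻ τ in Icc (0 : ℝ) 1, ENNReal.ofReal l * g (l • (z.2 + τ • z.1)) := by
          rw [lintegral_const_mul' _ _ ENNReal.ofReal_ne_top, ← mul_assoc, mul_comm ‖z.1‖ₑ]
          refine le_trans (by simpa only [smul_add] using hz2) (le_of_eq ?_)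
          simp only [enorm_smul, Real.enorm_of_nonneg hl0.le, smul_add, smul_comm l]
        refine (edist_half_add_le _ _ _ _).trans ?_
        simp only [ENNReal.div_eq_inv_mul]
        rw [lintegral_const_mul' _ _ (by simp), lintegral_add_left hmg, mul_left_comm, mul_add ‖z.1‖ₑ]
        exact mul_le_mul_right (add_le_add hz h4) _
    -- The exponent 2m/p is (m + sp)/p as well as the dimension of the product divided by p, so that
    -- rescaling f amounts to dilating η.
    · set f : Euc m × Euc m → ℝ≥0∞ := fun z => edist (η z.1) (η z.2) / edist z.1 z.2 ^ ((2 * m : ℝ) / p)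
        with hf
      have hfm : Measurable f := by
        have h1 : Measurable fun z : Euc m × Euc m => edist (η z.1) (η z.2) := by
          have : Continuous fun z : Euc m × Euc m => edist (η z.1) (η z.2) := by fun_prop
          exact this.measurable
        have h2 : Measurable fun z : Euc m × Euc m => edist z.1 z.2 ^ ((2 * m : ℝ) / p) := by fun_prop
        exact h1.div h2
      have hfp : ∀ z, f z ^ p = edist (η z.1) (η z.2) ^ p / edist z.1 z.2 ^ ((m : ℝ) + s * p) := fun z => by
        rw [hf]
        simp only
        rw [ENNReal.div_rpow_of_nonneg _ _ hp0.le, ← ENNReal.rpow_mul, div_mul_cancel₀ _ hp0.ne', hsp,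
          two_mul]
      have hfe : ∫⁻ z, f z ^ p ∂(volume.prod volume) ≤ e := by
        simp_rw [hfp]
        exact hη.pairEnergy_le hs1
      obtain ⟨l, hl, hle⟩ := exists_lintegral_half_add_le (volume.prod volume) hfm hp he0 he hfe
      have hl0 : 0 < l := by linarith
      refine ⟨l, hl, ⟨by fun_prop, fun h => absurd h hs1, fun _ => le_trans (lintegral_mono fun z => ?_) hle⟩⟩
      have hfin : (Module.finrank ℝ (Euc m × Euc m) : ℝ) = 2 * m := by
        rw [Module.finrank_prod, finrank_euclideanSpace_fin]; push_cast; ring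
      have hK0 : ENNReal.ofReal l ≠ 0 := by simpa using hl0
      have h5 : ENNReal.ofReal l ^ ((2 * m : ℝ) / p) * f (l • z) =
          edist (η (l • z.1)) (η (l • z.2)) / edist z.1 z.2 ^ ((2 * m : ℝ) / p) := by
        have h1 : edist (l • z.1) (l • z.2) = ENNReal.ofReal l * edist z.1 z.2 := by
          rw [edist_smul₀, Real.nnnorm_of_nonneg hl0.le, ENNReal.ofReal, ENNReal.smul_def, smul_eq_mul]
          congr 2
          exact (Real.toNNReal_of_nonneg hl0.le).symm
        have hne := (ENNReal.rpow_pos (p := (2 * m : ℝ) / p) (pos_iff_ne_zero.2 hK0) ENNReal.ofReal_ne_top).ne'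
        have hnt := ENNReal.rpow_ne_top_of_ne_zero (y := (2 * m : ℝ) / p) hK0 ENNReal.ofReal_ne_top
        rw [hf]
        simp only [Prod.smul_fst, Prod.smul_snd]
        rw [h1, ENNReal.mul_rpow_of_ne_top ENNReal.ofReal_ne_top (edist_ne_top _ _), ENNReal.div_eq_inv_mul,
          ENNReal.mul_inv (Or.inl hne) (Or.inl hnt), ← mul_assoc, ← mul_assoc, ENNReal.mul_inv_cancel hne hnt,
          one_mul, ENNReal.div_eq_inv_mul]
      rw [hfin, h5, hf]
      simp only
      rw [← ENNReal.add_div, ENNReal.div_right_comm, ENNReal.div_rpow_of_nonneg _ _ hp0.le,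
        ← ENNReal.rpow_mul, div_mul_cancel₀ _ hp0.ne', hsp, two_mul]
      exact ENNReal.div_le_div_right (ENNReal.rpow_le_rpow (edist_half_add_le _ _ _ _) hp0.le) _
  obtain ⟨l, hl, hE⟩ := key
  have hl0 : 0 < l := by linarith
  refine ⟨δ / l, _, by positivity, ?_, by fun_prop, fun x hx => ?_, fun x hx => ?_, hE⟩
  · exact (div_le_self hδ.le hl).trans_lt hδ2
  · rw [mem_ball_zero_iff, lt_div_iff₀ hl0] at hx
    rw [hη1 x, hη1 (l • x)]
    · norm_num
    · rw [mem_ball_zero_iff, norm_smul, Real.norm_of_nonneg hl0.le]; linarith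
    · rw [mem_ball_zero_iff]; nlinarith [norm_nonneg x]
  · rw [hη0 x hx, hη0 (l • x)]
    · norm_num
    · rw [mem_ball_zero_iff, not_lt] at hx ⊢
      rw [norm_smul, Real.norm_of_nonneg hl0.le]
      nlinarith

theorem HasCutoff.mono {s p : ℝ} {e e' : ℝ≥0∞} (h : HasCutoff m s p e) (he : e ≤ e') :
    HasCutoff m s p e' := by
  obtain ⟨δ, η, hδ, hδ2, hηc, hη1, hη0, hη⟩ := h
  exact ⟨δ, η, hδ, hδ2, hηc, hη1, hη0, hη.mono Subset.rfl he⟩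

theorem hasCutoff_of_eq (hm : 1 ≤ m) {s p : ℝ} (hs : s ∈ Ioc (0 : ℝ) 1) (hp : 1 < p)
    (hsp : s * p = m) {ε : ℝ≥0∞} (hε : ε ≠ 0) : HasCutoff m s p ε := by
  obtain ⟨e, he, h⟩ := exists_hasCutoff hm hs hp.le
  have hk : ∀ n : ℕ, HasCutoff m s p (halfSumFactor p ^ n * e) := fun n => by
    induction n with
    | zero => simpa using h
    | succ n ih =>
      rw [pow_succ', mul_assoc]
      refine HasCutoff.half hm hp hsp (ENNReal.mul_ne_top (ENNReal.pow_ne_top ?_) he) ih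
      exact ((halfSumFactor_lt_one hp).trans ENNReal.one_lt_top).ne
  have h1 : Tendsto (fun n : ℕ => halfSumFactor p ^ n * e) atTop (𝓝 (0 * e)) :=
    ENNReal.Tendsto.mul_const (ENNReal.tendsto_pow_atTop_nhds_zero_of_lt_one (halfSumFactor_lt_one hp))
      (Or.inr he)
  rw [zero_mul] at h1
  obtain ⟨n, hn⟩ := (h1.eventually (Iio_mem_nhds (pos_iff_ne_zero.2 hε))).exists
  exact (hk n).mono (le_of_lt hn)

end Cutoff

/-! ### Short Lipschitz paths in the target. -/

section TargetPaths
open Filter Topology Manifold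

theorem edist_ne_top_of_connectedSpace {N : Type*} [EMetricSpace N] [ConnectedSpace N] (x y : N) :
    edist x y ≠ ⊤ := by
  have h : Metric.eball x ⊤ = univ := IsClopen.eq_univ
    ⟨Metric.isClosed_eball_top, Metric.isOpen_eball⟩ ⟨x, Metric.mem_eball_self (by simp)⟩
  have h1 : y ∈ Metric.eball x ⊤ := by rw [h]; trivial
  rw [edist_comm]
  exact (Metric.mem_eball.1 h1).ne

variable {n : ℕ} {N : Type*} [EMetricSpace N]
    [ChartedSpace (EuclideanSpace ℝ (Fin n)) N] [IsManifold (𝓡 n) ∞ N]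
    [RiemannianBundle (fun x : N => TangentSpace (𝓡 n) x)]
    [IsContMDiffRiemannianBundle (𝓡 n) ∞ (EuclideanSpace ℝ (Fin n))
      (fun x : N => TangentSpace (𝓡 n) x)]
    [IsRiemannianManifold (𝓡 n) N]

-- The path is a segment in a chart, with the parameter clamped to [0, 1]. Its Lipschitz constant is
-- at most C ‖e b - e a‖, which tends to zero as b tends to a.
include n in
theorem eventually_exists_lipschitz_path (a : N) {ε : NNReal} (hε : 0 < ε) : ∀ᶠ b in 𝓝 a,
    ∃ γ : ℝ → N, LipschitzWith ε γ ∧ γ 0 = a ∧ γ 1 = b := by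
  obtain ⟨C, r, hr, hsub, hC⟩ := eventually_edist_chartAt_symm_le (m := n) a
  set e := chartAt (Euc n) a with he
  have hea : ContinuousAt e a := e.continuousAt (mem_chart_source _ a)
  have h1 : ∀ᶠ b in 𝓝 a, e b ∈ Metric.ball (e a) r := hea (Metric.ball_mem_nhds _ hr)
  have h2 : ∀ᶠ b in 𝓝 a, C * ‖e b - e a‖₊ < ε := by
    have h3 : ContinuousAt (fun b => C * ‖e b - e a‖₊) a :=
      continuousAt_const.mul ((hea.sub continuousAt_const).nnnorm)
    have h4 : (fun b => C * ‖e b - e a‖₊) a < ε := by simpa using hε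
    exact h3.eventually (Iio_mem_nhds h4)
  filter_upwards [h1, h2, e.open_source.mem_nhds (mem_chart_source _ a)] with b hb hbε hbs
  set κ : ℝ → ℝ := fun t => max 0 (min 1 t) with hκ
  have hκl : LipschitzWith 1 κ := ((LipschitzWith.id).const_min 1).const_max 0
  have hκ01 : ∀ t, κ t ∈ Icc (0 : ℝ) 1 := fun t =>
    ⟨le_max_left _ _, max_le zero_le_one (min_le_left _ _)⟩
  have hmem : ∀ t, e a + κ t • (e b - e a) ∈ Metric.ball (e a) r := fun t => by
    rw [Metric.mem_ball, dist_self_add_left, norm_smul, Real.norm_of_nonneg (hκ01 t).1]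
    rw [Metric.mem_ball, dist_eq_norm] at hb
    have := (hκ01 t).2
    nlinarith [norm_nonneg (e b - e a), (hκ01 t).1]
  refine ⟨fun t => e.symm (e a + κ t • (e b - e a)), fun t t' => ?_, ?_, ?_⟩
  · refine (hC _ (hmem t) _ (hmem t')).trans ?_
    rw [edist_add_left, edist_eq_enorm_sub, ← sub_smul, enorm_smul, ← edist_eq_enorm_sub]
    have h5 := hκl t t'
    rw [ENNReal.coe_one, one_mul] at h5
    calc (C : ℝ≥0∞) * (edist (κ t) (κ t') * ‖e b - e a‖ₑ)
        = ((C * ‖e b - e a‖₊ : NNReal) : ℝ≥0∞) * edist (κ t) (κ t') := by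
          rw [ENNReal.coe_mul, enorm_eq_nnnorm]; ring
      _ ≤ ε * edist t t' := by gcongr
  · simp [hκ, he]
  · simp only [hκ]
    rw [min_self, max_eq_right zero_le_one, one_smul, add_sub_cancel, e.left_inv hbs]

end TargetPaths

/-! ### Transitions between two values. -/

section Transitions
open Filter Topology Manifold
variable {m : ℕ} {N : Type*} [EMetricSpace N] [MeasurableSpace N] [BorelSpace N]
  [SecondCountableTopology N] {s p : ℝ}

/-- The map `w` takes the value `b` on `ball 0 ρ'` and the value `a` off `ball 0 ρ`, and its energy
is at most `ε`. -/
structure IsTransition (s p : ℝ) (a b : N) (ρ' ρ : ℝ) (w : Euc m → N) (ε : ℝ≥0∞) : Prop where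
  pos : 0 < ρ'
  lt : ρ' < ρ
  inner : ∀ x ∈ Metric.ball 0 ρ', w x = b
  outer : ∀ x ∉ Metric.ball 0 ρ, w x = a
  energy : HasEnergyLE s p w (Metric.closedBall 0 ρ) ε

/-- The transition is a path composed with a rescaled cutoff. The ratio of the inner to the outer
radius comes from the cutoff alone, and is independent of the values and of the path. -/
theorem exists_isTransition_of_cutoff (hp : 0 < p) {e : ℝ≥0∞} (h : HasCutoff m s p e) :
    ∃ δ : ℝ, 0 < δ ∧ δ < 2 ∧ ∀ (a b : N) (γ : ℝ → N) (L : NNReal), LipschitzWith L γ →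
      γ 0 = a → γ 1 = b → ∀ l : ℝ, 0 < l → ∃ w : Euc m → N, IsTransition s p a b (l * δ) (l * 2) w
        ((L : ℝ≥0∞) ^ p * (ENNReal.ofReal l ^ ((m : ℝ) - s * p) * e)) := by
  obtain ⟨δ, η, hδ, hδ2, hηc, hη1, hη0, hη⟩ := h
  refine ⟨δ, hδ, hδ2, fun a b γ L hγ h0 h1 l hl => ⟨fun x => γ (η (l⁻¹ • (x - 0))), by positivity,
    by gcongr, fun x hx => ?_, fun x hx => ?_, ?_⟩⟩
  · rw [hη1, h1]
    rw [mem_ball_zero_iff] at hx ⊢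
    rw [sub_zero, norm_smul, norm_inv, Real.norm_of_nonneg hl.le]
    rwa [inv_mul_lt_iff₀ hl]
  · rw [hη0, h0]
    rw [mem_ball_zero_iff, not_lt] at hx ⊢
    rw [sub_zero, norm_smul, norm_inv, Real.norm_of_nonneg hl.le]
    rwa [le_inv_mul_iff₀ hl]
  · refine ((hη.comp_inv_smul_sub hp 0 hl).lipschitz_comp hp hγ).mono (fun x hx => ?_) le_rfl
    rw [mem_preimage, mem_closedBall_zero_iff, sub_zero, norm_smul, norm_inv,
      Real.norm_of_nonneg hl.le, inv_mul_le_iff₀ hl] at hx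
    rwa [mem_closedBall_zero_iff]

variable (m) in
/-- One can pass from the value `a` to the value `b` in any ball, with an arbitrarily small energy. -/
def HasSmallTransitions (s p : ℝ) (a b : N) : Prop :=
  ∀ ρ : ℝ, 0 < ρ → ∀ ε : ℝ≥0∞, ε ≠ 0 → ∃ (ρ' : ℝ) (w : Euc m → N), IsTransition s p a b ρ' ρ w ε

theorem IsTransition.mono {a b : N} {ρ' ρ : ℝ} {w : Euc m → N} {ε : ℝ≥0∞}
    (h : IsTransition s p a b ρ' ρ w ε) {ρ₁ : ℝ} (hρ : ρ ≤ ρ₁) {ε₁ : ℝ≥0∞} (hε : ε ≤ ε₁) :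
    IsTransition s p a b ρ' ρ₁ w ε₁ :=
  ⟨h.pos, h.lt.trans_le hρ, h.inner, fun x hx => h.outer x fun h => hx (Metric.ball_subset_ball hρ h),
    h.energy.mono (Metric.closedBall_subset_closedBall hρ) hε⟩

/-- For sp < m the scale l is sent to zero. For sp = m the energy does not depend on the scale, and
a cutoff of small energy is used instead. -/
theorem hasSmallTransitions_of_path (hm : 1 ≤ m) (hs : s ∈ Ioc (0 : ℝ) 1) (hp : 1 ≤ p)
    (hsp : s * p < m ∨ (s * p = m ∧ 1 < p)) {a b : N} {γ : ℝ → N} {L : NNReal}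
    (hγ : LipschitzWith L γ) (h0 : γ 0 = a) (h1 : γ 1 = b) : HasSmallTransitions m s p a b := by
  have hp0 : 0 < p := by linarith
  intro ρ hρ ε hε
  have hLt : (L : ℝ≥0∞) ^ p ≠ ⊤ := ENNReal.rpow_ne_top_of_nonneg hp0.le ENNReal.coe_ne_top
  rcases hsp with hsp | ⟨hsp, hp1⟩
  · obtain ⟨e, he, hc⟩ := exists_hasCutoff hm hs hp
    obtain ⟨δ, hδ, hδ2, hw⟩ := exists_isTransition_of_cutoff (N := N) hp0 hc
    have hlim : Tendsto (fun l : ℝ => (L : ℝ≥0∞) ^ p * (ENNReal.ofReal l ^ ((m : ℝ) - s * p) * e))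
        (𝓝[>] 0) (𝓝 0) := by
      have h2 : Tendsto (fun l : ℝ => ENNReal.ofReal l ^ ((m : ℝ) - s * p)) (𝓝[>] 0) (𝓝 0) := by
        have h3 : Continuous fun l : ℝ => ENNReal.ofReal l ^ ((m : ℝ) - s * p) :=
          ENNReal.continuous_rpow_const.comp ENNReal.continuous_ofReal
        have h4 := h3.tendsto 0
        rw [ENNReal.ofReal_zero, ENNReal.zero_rpow_of_pos (by linarith)] at h4
        exact h4.mono_left nhdsWithin_le_nhds
      have h5 := ENNReal.Tendsto.const_mul (ENNReal.Tendsto.mul_const h2 (Or.inr he)) (Or.inr hLt)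
      simpa using h5
    obtain ⟨l, hl, hlρ⟩ := ((hlim.eventually (Iio_mem_nhds (pos_iff_ne_zero.2 hε))).and
      (Ioo_mem_nhdsGT (half_pos hρ))).exists
    obtain ⟨w, hw⟩ := hw a b γ L hγ h0 h1 l hlρ.1
    exact ⟨_, w, hw.mono (by linarith [hlρ.2]) (le_of_lt hl)⟩
  -- The denominator L^p + 1 rather than L^p avoids a division by zero for constant paths.
  · obtain ⟨δ, hδ, hδ2, hw⟩ := exists_isTransition_of_cutoff (N := N) hp0
      (hasCutoff_of_eq hm hs hp1 hsp (ε := ε / (L ^ p + 1)) (ENNReal.div_pos hε (by simp [hLt])).ne')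
    obtain ⟨w, hw⟩ := hw a b γ L hγ h0 h1 (ρ / 2) (half_pos hρ)
    refine ⟨_, w, hw.mono (by linarith) ?_⟩
    rw [hsp, sub_self, ENNReal.rpow_zero, one_mul, ← mul_div_assoc]
    refine ENNReal.div_le_of_le_mul ?_
    rw [mul_comm]
    exact mul_le_mul_right le_self_add _

/-- The second transition is nested in the inner ball of the first. -/
theorem HasSmallTransitions.trans (hp : 0 < p) {a b c : N} (hab : HasSmallTransitions m s p a b)
    (hbc : HasSmallTransitions m s p b c) : HasSmallTransitions m s p a c := by
  classical
  intro ρ hρ ε hε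
  have h3 : (3 : ℝ≥0∞) ^ p * 2 ≠ ⊤ :=
    ENNReal.mul_ne_top (ENNReal.rpow_ne_top_of_nonneg hp.le (by norm_num)) (by norm_num)
  have h30 : (3 : ℝ≥0∞) ^ p * 2 ≠ 0 :=
    mul_ne_zero (ENNReal.rpow_pos (by norm_num) (by norm_num)).ne' (by norm_num)
  set ε' := ε / (3 ^ p * 2) with hε'
  have hε0 : ε' ≠ 0 := (ENNReal.div_pos hε h3).ne'
  obtain ⟨ρ₁, w₁, h₁⟩ := hab ρ hρ ε' hε0
  obtain ⟨ρ₂, w₂, h₂⟩ := hbc ρ₁ h₁.pos ε' hε0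
  refine ⟨ρ₂, fun x => if x ∈ Metric.ball 0 ρ₁ then w₂ x else w₁ x, h₂.pos, h₂.lt.trans h₁.lt,
    fun x hx => ?_, fun x hx => ?_, ?_⟩
  · rw [if_pos (Metric.ball_subset_ball h₂.lt.le hx), h₂.inner x hx]
  · rw [if_neg fun h => hx (Metric.ball_subset_ball h₁.lt.le h), h₁.outer x hx]
  · have h := HasEnergyLE.patch (ι := Unit) (w := w₁) (v := fun _ => w₂) (c := fun _ => b)
      (u := fun x => if x ∈ Metric.ball 0 ρ₁ then w₂ x else w₁ x)
      (U := fun _ => Metric.ball 0 ρ₁) hp h₁.energy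
      (fun _ => h₂.energy) (fun _ => Metric.isOpen_ball.measurableSet)
      (fun i j hij => absurd (Subsingleton.elim i j) hij) (fun _ x hx => h₂.outer x hx)
      (fun _ x hx => h₁.inner x hx) (fun _ x hx => if_pos hx) (fun x hx => if_neg (hx ()))
    refine h.mono (union_subset Subset.rfl (iUnion_subset fun _ =>
      Metric.closedBall_subset_closedBall h₁.lt.le)) (le_of_eq ?_)
    rw [tsum_fintype, Finset.univ_unique, Finset.sum_singleton, ← two_mul, ← mul_assoc, hε',
      ENNReal.mul_div_cancel h30 h3]

end Transitions

/-! ### Transitions in a connected or compact target. -/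

section ConnectedTransitions
open Filter Topology Manifold
variable {m : ℕ} {s p : ℝ} {n : ℕ} {N : Type*} [EMetricSpace N] [MeasurableSpace N] [BorelSpace N]
    [SecondCountableTopology N]
    [ChartedSpace (EuclideanSpace ℝ (Fin n)) N] [IsManifold (𝓡 n) ∞ N]
    [RiemannianBundle (fun x : N => TangentSpace (𝓡 n) x)]
    [IsContMDiffRiemannianBundle (𝓡 n) ∞ (EuclideanSpace ℝ (Fin n))
      (fun x : N => TangentSpace (𝓡 n) x)]
    [IsRiemannianManifold (𝓡 n) N]

-- The set of values reachable from a is open, and it is closed because paths can be reversed;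
-- connectedness concludes.
include n in
theorem hasSmallTransitions [ConnectedSpace N] (hm : 1 ≤ m) (hs : s ∈ Ioc (0 : ℝ) 1) (hp : 1 ≤ p)
    (hsp : s * p < m ∨ (s * p = m ∧ 1 < p)) (a b : N) : HasSmallTransitions m s p a b := by
  have hp0 : 0 < p := by linarith
  have hloc : ∀ a : N, ∀ᶠ b in 𝓝 a, HasSmallTransitions m s p a b ∧ HasSmallTransitions m s p b a :=
    fun a => by
      filter_upwards [eventually_exists_lipschitz_path (n := n) a one_pos] with b ⟨γ, hγ, h0, h1⟩
      refine ⟨hasSmallTransitions_of_path hm hs hp hsp hγ h0 h1,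
        hasSmallTransitions_of_path (γ := fun t => γ (1 - t)) hm hs hp hsp (L := 1) (fun t t' => ?_)
          (by simpa using h1) (by simpa using h0)⟩
      refine (hγ _ _).trans (le_of_eq ?_)
      rw [edist_sub_left]
  have h : {b | HasSmallTransitions m s p a b} = univ := by
    refine IsClopen.eq_univ ⟨⟨isOpen_iff_mem_nhds.2 fun b hb => ?_⟩, isOpen_iff_mem_nhds.2 fun b hb => ?_⟩
      ⟨a, (hloc a).self_of_nhds.1⟩
    · filter_upwards [hloc b] with b' hb' h
      exact hb (HasSmallTransitions.trans hp0 h hb'.2)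
    · filter_upwards [hloc b] with b' hb'
      exact HasSmallTransitions.trans hp0 hb hb'.1
  have h1 : b ∈ {b | HasSmallTransitions m s p a b} := by rw [h]; trivial
  exact h1

-- No capacity argument is available in the range where this is used: the energy is small because
-- the path is short. The inner radius ρ' is fixed before b, since the size of the copies placed
-- inside, and hence the required Λ, depends on it.
include n in
theorem exists_isTransition_near (hm : 1 ≤ m) (hs : s ∈ Ioc (0 : ℝ) 1) (hp : 1 ≤ p) (a : N) {ρ : ℝ}
    (hρ : 0 < ρ) {ε : ℝ≥0∞} (hε : ε ≠ 0) : ∃ ρ' : ℝ, 0 < ρ' ∧ ρ' < ρ ∧ ∀ᶠ b in 𝓝 a,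
      ∃ w : Euc m → N, IsTransition s p a b ρ' ρ w ε := by
  have hp0 : 0 < p := by linarith
  obtain ⟨e, he, hc⟩ := exists_hasCutoff hm hs hp
  obtain ⟨δ, hδ, hδ2, hw⟩ := exists_isTransition_of_cutoff (N := N) hp0 hc
  set E : ℝ≥0∞ := ENNReal.ofReal (ρ / 2) ^ ((m : ℝ) - s * p) * e with hE
  have hEt : E ≠ ⊤ := ENNReal.mul_ne_top
    (ENNReal.rpow_ne_top_of_ne_zero (by simpa using hρ) ENNReal.ofReal_ne_top) he
  obtain ⟨L, hL0, hL⟩ : ∃ L : NNReal, 0 < L ∧ (L : ℝ≥0∞) ^ p * E ≤ ε := by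
    have h1 : Tendsto (fun L : NNReal => (L : ℝ≥0∞) ^ p * E) (𝓝[>] 0) (𝓝 0) := by
      have h3 : Continuous fun L : NNReal => (L : ℝ≥0∞) ^ p :=
        ENNReal.continuous_rpow_const.comp ENNReal.continuous_coe
      have h4 := h3.tendsto 0
      rw [ENNReal.coe_zero, ENNReal.zero_rpow_of_pos hp0] at h4
      have h5 := ENNReal.Tendsto.mul_const
        (h4.mono_left (nhdsWithin_le_nhds (s := Ioi 0))) (Or.inr hEt)
      rwa [zero_mul] at h5
    obtain ⟨L, hL, hL0⟩ := ((h1.eventually (Iio_mem_nhds (pos_iff_ne_zero.2 hε))).and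
      self_mem_nhdsWithin).exists
    exact ⟨L, hL0, le_of_lt hL⟩
  refine ⟨ρ / 2 * δ, by positivity, by nlinarith, ?_⟩
  filter_upwards [eventually_exists_lipschitz_path (n := n) a hL0] with b ⟨γ, hγ, h0, h1⟩
  obtain ⟨w, hw⟩ := hw a b γ L hγ h0 h1 (ρ / 2) (half_pos hρ)
  exact ⟨w, hw.mono (by linarith) hL⟩

end ConnectedTransitions

/-! ### Number and size of the copies; cubic grids. -/

section Scales
open Filter Topology

/-- Used with α = m - sp: k^m copies at the scale σ multiply energies by k^m σ^α, which should be
comparable to t while the grid fits in a ball of radius ρ. For α > 0 any t is reached by many tiny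
copies. For α = 0 the scale is free but the multiplier is an integer, so t must not be small, and
rounding costs 2^m. For α < 0 one small copy is enough, provided that t is large depending on the
radius, which is therefore fixed in advance. -/
theorem exists_scale {m : ℕ} (hm : 1 ≤ m) {α : ℝ} (hα : α < m) {ρ₀ : ℝ} (hρ₀ : 0 < ρ₀) :
    ∃ T : ℝ, 1 ≤ T ∧ ∀ t : ℝ, 0 < t → (0 < α ∨ T ≤ t) → ∀ ρ : ℝ, 0 < ρ → (0 ≤ α ∨ ρ = ρ₀) →
      ∃ (k : ℕ) (σ : ℝ), 1 ≤ k ∧ 0 < σ ∧ 8 * m * k * σ ≤ ρ ∧ t / 2 ^ m ≤ (k : ℝ) ^ m * σ ^ α ∧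
        (k : ℝ) ^ m * σ ^ α ≤ t := by
  have hm0 : (0 : ℝ) < m := by exact_mod_cast hm
  have h2m : (1 : ℝ) ≤ 2 ^ m := one_le_pow₀ (by norm_num)
  rcases lt_trichotomy α 0 with h | h | h
  -- With k = 1 the scale is t^(1/α), decreasing in t, and it is at most c as soon as t ≥ c^α.
  · set c : ℝ := ρ₀ / (8 * m) with hc
    have hc0 : 0 < c := by positivity
    refine ⟨max 1 (c ^ α), le_max_left _ _, fun t ht htT ρ hρ hρρ => ?_⟩
    rcases htT with htT | htT
    · exact absurd htT (not_lt.2 h.le)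
    rcases hρρ with hρρ | rfl
    · exact absurd h (not_lt.2 hρρ)
    have h1 : (t ^ α⁻¹) ^ α = t := Real.rpow_inv_rpow ht.le h.ne
    refine ⟨1, t ^ α⁻¹, le_rfl, by positivity, ?_, ?_, ?_⟩
    · have h2 : t ^ α⁻¹ ≤ c := by
        calc t ^ α⁻¹ ≤ (c ^ α) ^ α⁻¹ := Real.rpow_le_rpow_of_nonpos (by positivity)
              ((le_max_right _ _).trans htT) (inv_nonpos.2 h.le)
          _ = c := Real.rpow_rpow_inv hc0.le h.ne
      rw [hc, le_div_iff₀ (by positivity)] at h2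
      push_cast
      linarith
    · rw [h1]; simp only [Nat.cast_one, one_pow, one_mul]; exact div_le_self ht.le h2m
    · rw [h1]; simp
  · subst h
    refine ⟨1, le_rfl, fun t ht htT ρ hρ _ => ?_⟩
    rcases htT with htT | htT
    · exact absurd htT (lt_irrefl _)
    set x : ℝ := t ^ (m : ℝ)⁻¹ with hx
    have hx1 : 1 ≤ x := Real.one_le_rpow htT (by positivity)
    have hxm : x ^ m = t := Real.rpow_inv_natCast_pow ht.le (by omega)
    set k := ⌊x⌋₊ with hk
    have hk1 : 1 ≤ k := Nat.le_floor (by simpa using hx1)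
    have hk1' : (1 : ℝ) ≤ k := by exact_mod_cast hk1
    have hkx : (k : ℝ) ≤ x := Nat.floor_le (by linarith)
    have hxk : x ≤ 2 * k := by
      have := Nat.lt_floor_add_one x
      rw [← hk] at this
      linarith
    refine ⟨k, ρ / (8 * m * k), hk1, by positivity, ?_, ?_, ?_⟩
    · rw [mul_div_cancel₀ _ (by positivity)]
    · rw [Real.rpow_zero, mul_one, div_le_iff₀ (by positivity), ← hxm, mul_comm, ← mul_pow]
      exact pow_le_pow_left₀ (by linarith) hxk m
    · rw [Real.rpow_zero, mul_one, ← hxm]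
      exact pow_le_pow_left₀ (by linarith) hkx m
  · refine ⟨1, le_rfl, fun t ht _ ρ hρ _ => ?_⟩
    -- With σ = (t / k^m)^(1/α), the size k σ of the grid is t^(1/α) k^(1 - m/α), which tends to
    -- zero since α < m.
    have hlim : Tendsto (fun k : ℕ => 8 * m * t ^ α⁻¹ * (k : ℝ) ^ (-(m / α - 1))) atTop
        (𝓝 (8 * m * t ^ α⁻¹ * 0)) := by
      refine Tendsto.const_mul _ ((tendsto_rpow_neg_atTop ?_).comp tendsto_natCast_atTop_atTop)
      rw [sub_pos, lt_div_iff₀ h, one_mul]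
      exact hα
    rw [mul_zero] at hlim
    obtain ⟨k, hk, hk1⟩ := ((hlim.eventually (Iio_mem_nhds hρ)).and (eventually_ge_atTop 1)).exists
    have hk0 : (0 : ℝ) < k := by exact_mod_cast hk1
    have hσ : ((t / (k : ℝ) ^ m) ^ α⁻¹) ^ α = t / (k : ℝ) ^ m := Real.rpow_inv_rpow (by positivity) h.ne'
    refine ⟨k, (t / (k : ℝ) ^ m) ^ α⁻¹, hk1, by positivity, ?_, ?_, ?_⟩
    · refine le_trans (le_of_eq ?_) (le_of_lt hk)
      rw [Real.div_rpow ht.le (by positivity), ← Real.rpow_natCast, ← Real.rpow_mul hk0.le, neg_sub,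
        Real.rpow_sub hk0, Real.rpow_one, div_eq_mul_inv (m : ℝ) α]
      ring
    · rw [hσ, mul_div_cancel₀ _ (by positivity)]
      exact div_le_self ht.le h2m
    · rw [hσ, mul_div_cancel₀ _ (by positivity)]

variable {m : ℕ}

/-- The points of a cubic grid with step `h`. -/
def gridPoint (h : ℝ) {k : ℕ} (i : Fin m → Fin k) : Euc m := WithLp.toLp 2 fun l => h * (i l : ℝ)

theorem le_dist_gridPoint {h : ℝ} (hh : 0 < h) {k : ℕ} {i j : Fin m → Fin k} (hij : i ≠ j) :
    h ≤ dist (gridPoint h i) (gridPoint h j) := by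
  obtain ⟨l, hl⟩ := Function.ne_iff.1 hij
  rw [dist_eq_norm]
  refine le_trans ?_ (PiLp.norm_apply_le (gridPoint h i - gridPoint h j) l)
  have h1 : (gridPoint h i - gridPoint h j) l = h * ((i l : ℝ) - (j l : ℝ)) := by
    simp [gridPoint, mul_sub]
  rw [h1, norm_mul, Real.norm_of_nonneg hh.le, Real.norm_eq_abs]
  have h2 : (1 : ℝ) ≤ |((i l : ℕ) : ℝ) - ((j l : ℕ) : ℝ)| := by
    have h3 : ((i l : ℕ) : ℤ) - ((j l : ℕ) : ℤ) ≠ 0 := by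
      intro h4
      exact hl (Fin.ext (by omega))
    have h4 := Int.one_le_abs h3
    exact_mod_cast h4
  nlinarith

theorem norm_gridPoint_le {h : ℝ} (hh : 0 < h) {k : ℕ} (i : Fin m → Fin k) :
    ‖gridPoint h i‖ ≤ m * (h * (k - 1)) := by
  rw [EuclideanSpace.norm_eq]
  have hi : ∀ l, 0 ≤ h * (i l : ℝ) ∧ h * (i l : ℝ) ≤ h * (k - 1) := fun l => by
    refine ⟨by positivity, ?_⟩
    have h1 : ((i l : ℕ) : ℝ) + 1 ≤ k := by exact_mod_cast (i l).isLt
    nlinarith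
  rcases Nat.eq_zero_or_pos m with rfl | hm
  · simp
  have hD : 0 ≤ h * ((k : ℝ) - 1) := (hi ⟨0, hm⟩).1.trans (hi ⟨0, hm⟩).2
  have hm1 : (1 : ℝ) ≤ m := by exact_mod_cast hm
  refine Real.sqrt_le_iff.2 ⟨by positivity, ?_⟩
  calc ∑ l, ‖gridPoint h i l‖ ^ 2 ≤ ∑ _l : Fin m, (h * ((k : ℝ) - 1)) ^ 2 := by
        refine Finset.sum_le_sum fun l _ => ?_
        change ‖h * (i l : ℝ)‖ ^ 2 ≤ _
        rw [Real.norm_of_nonneg (hi l).1]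
        exact pow_le_pow_left₀ (hi l).1 (hi l).2 2
    _ = m * (h * ((k : ℝ) - 1)) ^ 2 := by simp
    _ ≤ (m * (h * ((k : ℝ) - 1))) ^ 2 := by
        rw [mul_pow (m : ℝ)]
        have h1 : (m : ℝ) ≤ m ^ 2 := by nlinarith
        exact mul_le_mul_of_nonneg_right h1 (sq_nonneg _)

end Scales

/-! ### Patching maps on disjoint sets. -/

section PatchMap
variable {m : ℕ} {N : Type*} {ι : Type*}

open Classical in
/-- The map equal to `v i` on `U i`, and to `w` off the union of the sets `U i`. -/
def patchMap (U : ι → Set (Euc m)) (v : ι → Euc m → N) (w : Euc m → N) (x : Euc m) : N :=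
  if h : ∃ i, x ∈ U i then v h.choose x else w x

theorem patchMap_of_mem {U : ι → Set (Euc m)} (hU : Pairwise fun i j => Disjoint (U i) (U j))
    (v : ι → Euc m → N) (w : Euc m → N) (i : ι) (x : Euc m) (hx : x ∈ U i) :
    patchMap U v w x = v i x := by
  have h : ∃ i, x ∈ U i := ⟨i, hx⟩
  rw [patchMap, dif_pos h]
  by_contra hne
  have hij : h.choose ≠ i := fun h1 => hne (by rw [h1])
  exact disjoint_left.1 (hU hij) h.choose_spec hx

theorem patchMap_of_notMem {U : ι → Set (Euc m)} (v : ι → Euc m → N) (w : Euc m → N) (x : Euc m)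
    (hx : ∀ i, x ∉ U i) : patchMap U v w x = w x :=
  dif_neg (not_exists.2 hx)

end PatchMap

/-! ### Cells: many copies of a map that is hard to lift. -/

section Cells
open Filter Topology

variable {m : ℕ} {N F : Type*} [EMetricSpace N] [MeasurableSpace N] [EMetricSpace F]
    [MeasurableSpace F]

theorem liftingEnergy_congr {M : Type*} [EMetricSpace M] [MeasurableSpace M] [BorelSpace M]
    [ChartedSpace (EuclideanSpace ℝ (Fin m)) M]
    [RiemannianBundle (fun x : M => TangentSpace (𝓡 m) x)] (proj : F → N) (r q : ℝ) {u u' : M → N}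
    {A : Set M} (h : ∀ x ∈ A, u x = u' x) :
    liftingEnergy m proj r q u A = liftingEnergy m proj r q u' A := by
  rw [liftingEnergy, liftingEnergy]
  congr 1; ext φ
  congr 1; ext hφ
  have : (∀ x ∈ A, proj (φ x) = u x) ↔ (∀ x ∈ A, proj (φ x) = u' x) :=
    forall₂_congr fun x hx => by rw [h x hx]
  simp only [this]

variable (m) in
/-- A map of energy at most `C * E`, constant equal to `b` off a ball, with a lifting energy on the
unit ball which is at least `Λ * E`. -/
structure IsHardToLift (proj : F → N) (s p r q C Λ : ℝ) (v : Euc m → N) (b : N) (E : ℝ) : Prop where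
  pos : 0 < E
  outer : ∀ x ∉ Metric.ball 0 4, v x = b
  energy : HasEnergyLE s p v (Metric.ball 0 4) (ENNReal.ofReal (C * E))
  le_lifting : ENNReal.ofReal (Λ * E) ≤ liftingEnergy m proj r q v (Metric.ball 0 1)
  small : s * p < m ∨ Λ * E ≤ 2

variable (m) in
/-- There is a map of energy at most `ε`, constant equal to `a` outside a ball of radius `ρ`, and
disjoint balls of that ball on which the lifting energies sum up to at least `1`. -/
def HasCell (proj : F → N) (s p r q : ℝ) (a : N) (ρ : ℝ) (ε : ℝ≥0∞) : Prop :=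
  ∃ Z : Euc m → N, (∀ x ∉ Metric.ball 0 ρ, Z x = a) ∧ HasEnergyLE s p Z (Metric.closedBall 0 ρ) ε ∧
    ∃ (ι : Type) (_ : Countable ι) (z : ι → Euc m) (σ : ℝ), 0 < σ ∧
      (∀ i, Metric.ball (z i) σ ⊆ Metric.ball 0 ρ) ∧
      (Pairwise fun i j => Disjoint (Metric.ball (z i) σ) (Metric.ball (z j) σ)) ∧
      1 ≤ ∑' i, ENNReal.ofReal σ ^ ((m : ℝ) - s * p) *
        liftingEnergy m proj r q (fun x => Z (z i + σ • x)) (Metric.ball 0 1)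

variable [BorelSpace N] [SecondCountableTopology N]

/-- The negated bound, with the constant Λ, gives a map on the ball, which is then opened. The
number E lies strictly above the energy, so that it is positive even if the energy vanishes, and
strictly below the lifting energy divided by Λ. -/
theorem exists_isHardToLift {proj : F → N} {s p r q : ℝ} (hs : s ∈ Ioc (0 : ℝ) 1) (hp : 1 ≤ p)
    (hfin : ∀ x y : N, edist x y ≠ ⊤) (H : ¬ LinearLiftingBound m proj s p r q) :
    ∃ C : ℝ, 0 < C ∧ ∀ Λ : ℝ, 0 < Λ → ∃ v b E, IsHardToLift m proj s p r q C Λ v b E := by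
  obtain ⟨C, hC, hopen⟩ := exists_opening (m := m) hs hp hfin
  refine ⟨C.toReal + 1, by positivity, fun Λ hΛ => ?_⟩
  rw [LinearLiftingBound] at H
  push Not at H
  obtain ⟨u, hu, hsmall, hG⟩ := H Λ hΛ
  set En := sobolevEnergy m s p u (Metric.ball 0 1) with hEn
  set G := liftingEnergy m proj r q u (Metric.ball 0 1) with hGdef
  have hΛ0 : ENNReal.ofReal Λ ≠ 0 := by simpa using hΛ
  have hlt : En < G / ENNReal.ofReal Λ := by
    rw [ENNReal.lt_div_iff_mul_lt (Or.inl hΛ0) (Or.inl ENNReal.ofReal_ne_top), mul_comm]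
    exact hG
  -- If sp ≥ m the energy is at most 1/Λ, which leaves room for E' < 2/Λ.
  obtain ⟨E', hE', hE'G, hE's⟩ : ∃ E' : ℝ≥0∞, En < E' ∧ E' < G / ENNReal.ofReal Λ ∧
      (s * p < m ∨ E' < ENNReal.ofReal (2 / Λ)) := by
    rcases hsmall with h | h
    · obtain ⟨E', h1, h2⟩ := exists_between hlt
      exact ⟨E', h1, h2, Or.inl h⟩
    · have h3 : En < ENNReal.ofReal (2 / Λ) := by
        refine h.trans_lt ((ENNReal.ofReal_lt_ofReal_iff (by positivity)).2 ?_)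
        gcongr
        norm_num
      obtain ⟨E', h1, h2⟩ := exists_between (lt_min hlt h3)
      exact ⟨E', h1, h2.trans_le (min_le_left _ _), Or.inr (h2.trans_le (min_le_right _ _))⟩
  have hE't : E' ≠ ⊤ := (hE'G.trans_le le_top).ne
  have hE'0 : E' ≠ 0 := (lt_of_le_of_lt zero_le hE').ne'
  obtain ⟨v, b, hvu, hvb, hv⟩ := hopen u hu E' hE'
  refine ⟨v, b, E'.toReal, ENNReal.toReal_pos hE'0 hE't, hvb, hv.mono Subset.rfl ?_, ?_, ?_⟩
  · rw [ENNReal.ofReal_mul (by positivity), ENNReal.ofReal_toReal hE't]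
    gcongr
    calc C = ENNReal.ofReal C.toReal := (ENNReal.ofReal_toReal hC).symm
      _ ≤ _ := ENNReal.ofReal_le_ofReal (by linarith)
  · rw [ENNReal.ofReal_mul hΛ.le, ENNReal.ofReal_toReal hE't, liftingEnergy_congr proj r q hvu, mul_comm]
    exact ((ENNReal.lt_div_iff_mul_lt (Or.inl hΛ0) (Or.inl ENNReal.ofReal_ne_top)).1 hE'G).le
  · refine hE's.imp_right fun h => ?_
    have h1 := (ENNReal.toReal_le_of_le_ofReal (by positivity) h.le)
    rw [le_div_iff₀ hΛ] at h1
    linarith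

theorem exists_forall_hasCell {proj : F → N} {s p r q C : ℝ} (hm : 1 ≤ m) (hs : 0 < s) (hp : 0 < p)
    (hC : 0 < C) {ε : ℝ} (hε : 0 < ε) {ρ₀ : ℝ} (hρ₀ : 0 < ρ₀) : ∃ Λ₀ : ℝ, ∀ Λ : ℝ, Λ₀ ≤ Λ →
      ∀ v b E, IsHardToLift m proj s p r q C Λ v b E → ∀ (a : N) (ρ' ρ : ℝ) (w : Euc m → N),
        IsTransition s p a b ρ' ρ w (ENNReal.ofReal ε) → (s * p ≤ m ∨ ρ' = ρ₀) →
          HasCell m proj s p r q a ρ (3 ^ p * (ENNReal.ofReal ε + ENNReal.ofReal ε)) := by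
  have hsp : 0 < s * p := mul_pos hs hp
  obtain ⟨T, hT1, hT⟩ := exists_scale (m := m) hm (α := (m : ℝ) - s * p) (by linarith) hρ₀
  -- The first bound makes the lifting energies sum up to at least ε Λ / (2^m C) ≥ 1. The second,
  -- with Λ E ≤ 2, gives t = ε / (C E) ≥ T.
  refine ⟨max (2 ^ m * C / ε) (2 * C * T / ε), fun Λ hΛ v b E hv a ρ' ρ w hw hρ => ?_⟩
  have hΛ1 : 2 ^ m * C / ε ≤ Λ := (le_max_left _ _).trans hΛ
  have hΛ2 : 2 * C * T / ε ≤ Λ := (le_max_right _ _).trans hΛ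
  have hE := hv.pos
  have hΛ0 : 0 < Λ := lt_of_lt_of_le (by positivity) hΛ1
  set t : ℝ := ε / (C * E) with ht
  have ht0 : 0 < t := by positivity
  obtain ⟨k, σ, hk, hσ, hkσ, hlow, hup⟩ := hT t ht0 (hv.small.imp (fun h => by linarith) fun h => by
    rw [ht, le_div_iff₀ (by positivity)]
    rw [div_le_iff₀ hε] at hΛ2
    nlinarith) ρ' hw.pos (hρ.imp_left fun h => by linarith)
  have hm1 : (1 : ℝ) ≤ m := by exact_mod_cast hm
  have hk1 : (1 : ℝ) ≤ k := by exact_mod_cast hk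
  -- A rescaled copy is constant off a ball of radius 4σ, so a step of 8σ keeps the copies disjoint.
  set z : (Fin m → Fin k) → Euc m := gridPoint (8 * σ) with hz
  set U : (Fin m → Fin k) → Set (Euc m) := fun i => Metric.ball (z i) (4 * σ) with hU
  have hUd : Pairwise fun i j => Disjoint (U i) (U j) := fun i j hij =>
    Metric.ball_disjoint_ball (by
      have := le_dist_gridPoint (h := 8 * σ) (by positivity) hij
      linarith)
  have hUρ' : ∀ i, U i ⊆ Metric.ball 0 ρ' := fun i => by
    refine Metric.ball_subset_ball' ?_
    rw [dist_zero_right]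
    have := norm_gridPoint_le (h := 8 * σ) (by positivity) i
    have h1 : 4 * σ ≤ 8 * σ * m := by nlinarith
    nlinarith
  have hUρ : ∀ i, U i ⊆ Metric.ball 0 ρ := fun i => (hUρ' i).trans (Metric.ball_subset_ball hw.lt.le)
  have hσU : ∀ i, Metric.ball (z i) σ ⊆ U i := fun i => Metric.ball_subset_ball (by linarith)
  set V : (Fin m → Fin k) → Euc m → N := fun i x => v (σ⁻¹ • (x - z i)) with hV
  have hVU : ∀ i, ∀ x ∉ U i, V i x = b := fun i x hx => by
    refine hv.outer _ fun h => hx ?_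
    rw [mem_ball_zero_iff, norm_smul, norm_inv, Real.norm_of_nonneg hσ.le, inv_mul_lt_iff₀ hσ] at h
    rw [hU, Metric.mem_ball, dist_eq_norm]
    linarith
  have hσ0 : ENNReal.ofReal σ ^ ((m : ℝ) - s * p) = ENNReal.ofReal (σ ^ ((m : ℝ) - s * p)) :=
    ENNReal.ofReal_rpow_of_pos hσ
  have hcard : ∀ x : ℝ, 0 ≤ x → ∑' _ : Fin m → Fin k, ENNReal.ofReal x =
      ENNReal.ofReal ((k : ℝ) ^ m * x) := fun x hx => by
    rw [tsum_fintype, Finset.sum_const, Finset.card_univ, Fintype.card_fun, Fintype.card_fin,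
      Fintype.card_fin, nsmul_eq_mul, ENNReal.ofReal_mul (by positivity)]
    congr 1
    rw [ENNReal.ofReal_pow (by positivity), ENNReal.ofReal_natCast, Nat.cast_pow]
  refine ⟨patchMap U V w, fun x hx => ?_, ?_, (Fin m → Fin k), inferInstance, z, σ, hσ,
    fun i => (hσU i).trans (hUρ i), fun i j hij => (hUd hij).mono (hσU i) (hσU j), ?_⟩
  · rw [patchMap_of_notMem V w x fun i hi => hx (hUρ i hi), hw.outer x hx]
  · refine (HasEnergyLE.patch hp hw.energy (fun i => hv.energy.comp_inv_smul_sub hp (z i) hσ)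
      (fun i => Metric.isOpen_ball.measurableSet) hUd hVU (fun i x hx => hw.inner x (hUρ' i hx))
      (fun i x hx => patchMap_of_mem hUd V w i x hx) (patchMap_of_notMem V w)).mono ?_ ?_
    · refine union_subset Subset.rfl (iUnion_subset fun i x hx => ?_)
      refine Metric.ball_subset_closedBall (hUρ i ?_)
      rw [mem_preimage, mem_ball_zero_iff, norm_smul, norm_inv, Real.norm_of_nonneg hσ.le,
        inv_mul_lt_iff₀ hσ] at hx
      rw [hU, Metric.mem_ball, dist_eq_norm]
      linarith
    · refine mul_le_mul_right (add_le_add_right ?_ _) _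
      rw [hσ0, ← ENNReal.ofReal_mul (by positivity), hcard _ (by positivity)]
      refine ENNReal.ofReal_le_ofReal ?_
      have h1 : t * (C * E) = ε := div_mul_cancel₀ _ (by positivity)
      rw [← h1, ← mul_assoc]
      exact mul_le_mul_of_nonneg_right hup (by positivity)
  · have hval : ∀ i, liftingEnergy m proj r q (fun x => patchMap U V w (z i + σ • x)) (Metric.ball 0 1) =
        liftingEnergy m proj r q v (Metric.ball 0 1) := fun i =>
      liftingEnergy_congr proj r q fun x hx => by
        rw [patchMap_of_mem hUd V w i]
        · simp [hV, smul_smul, hσ.ne']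
        · refine hσU i ?_
          rw [Metric.mem_ball, dist_self_add_left, norm_smul, Real.norm_of_nonneg hσ.le]
          have := mem_ball_zero_iff.1 hx
          nlinarith
    simp_rw [hval]
    calc (1 : ℝ≥0∞) = ENNReal.ofReal 1 := ENNReal.ofReal_one.symm
      _ ≤ ENNReal.ofReal ((k : ℝ) ^ m * (σ ^ ((m : ℝ) - s * p) * (Λ * E))) := by
          refine ENNReal.ofReal_le_ofReal ?_
          rw [← mul_assoc]
          refine le_trans ?_ (mul_le_mul_of_nonneg_right hlow (by positivity))
          rw [ht, div_div, div_mul_eq_mul_div, le_div_iff₀ (by positivity), one_mul]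
          rw [div_le_iff₀ hε] at hΛ1
          nlinarith
      _ = ∑' _ : Fin m → Fin k, ENNReal.ofReal (σ ^ ((m : ℝ) - s * p) * (Λ * E)) :=
          (hcard _ (by positivity)).symm
      _ ≤ _ := by
          refine ENNReal.tsum_le_tsum fun i => ?_
          rw [ENNReal.ofReal_mul (by positivity), ← hσ0]
          exact mul_le_mul_right hv.le_lifting _

end Cells

/-! ### Accumulation of cells and the contradiction. -/

section Contradiction
open Filter Topology Manifold

theorem hasEnergyLE_const {m : ℕ} {N : Type*} [EMetricSpace N] [MeasurableSpace N] {s p : ℝ}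
    (hp : 0 < p) (a : N) (S : Set (Euc m)) : HasEnergyLE s p (fun _ => a) S 0 where
  aemeasurable := aemeasurable_const
  exists_segmentBound _ := ⟨fun _ => 0, measurable_const, fun _ _ => rfl,
    ae_of_all _ fun z => by simp, by simp [hp]⟩
  pairEnergy_le _ := by simp [pairEnergy, hp]

variable {m : ℕ} {N F : Type*} [EMetricSpace N] [MeasurableSpace N] [BorelSpace N]
  [SecondCountableTopology N] [EMetricSpace F] [MeasurableSpace F] {proj : F → N} {s p r q : ℝ}

/-- Infinitely many cells with summable energies cannot be placed in a ball. -/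
theorem not_liftsLocally_of_hasCell (hm : 1 ≤ m) (hp : 0 < p) {a : N}
    (hcell : ∀ ρ : ℝ, 0 < ρ → ∀ ε : ℝ, 0 < ε → HasCell m proj s p r q a ρ (ENNReal.ofReal ε)) :
    ¬ LiftsLocally m proj s p r q := by
  rintro ⟨c, R, hR, H⟩
  have : Nontrivial (Euc m) := by
    have : Nonempty (Fin m) := ⟨⟨0, hm⟩⟩
    infer_instance
  obtain ⟨e₁, he₁⟩ := _root_.exists_norm_eq (Euc m) (c := 1) zero_le_one
  -- The numbers τ k are both the energies of the cells, which are summable, and the scales of the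
  -- balls. The k-th centre is at distance R τ k from c + R e₁, and two centres with indices k < l
  -- are at distance at least R τ k / 2, which exceeds the sum of the radii R τ k / 4 and R τ l / 4.
  set τ : ℕ → ℝ := fun k => (1 / 2) ^ k with hτ
  have hτ0 : ∀ k, 0 < τ k := fun k => by positivity
  have hτ1 : ∀ k, τ k ≤ 1 := fun k => pow_le_one₀ (by norm_num) (by norm_num)
  have hτlt : ∀ k l, k < l → τ l ≤ τ k / 2 := fun k l h => by
    calc τ l ≤ τ (k + 1) := pow_le_pow_of_le_one (by norm_num) (by norm_num) h
      _ = τ k / 2 := by simp only [hτ, pow_succ]; ring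
  set ρ : ℕ → ℝ := fun k => R * τ k / 4 with hρ
  have hρ0 : ∀ k, 0 < ρ k := fun k => by have := hτ0 k; positivity
  set y : ℕ → Euc m := fun k => c + (R * (1 - τ k)) • e₁ with hy
  have hydist : ∀ k l, dist (y k) (y l) = R * |τ k - τ l| := fun k l => by
    rw [hy, dist_add_left, dist_eq_norm, ← sub_smul, norm_smul, he₁, mul_one, Real.norm_eq_abs,
      ← mul_sub, abs_mul, abs_of_pos hR, abs_sub_comm]
    congr 2; ring
  have hyd : ∀ k l, k < l → ρ k + ρ l ≤ dist (y k) (y l) := fun k l h => by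
    have h1 := hτlt k l h
    have h2 := hτ0 k
    rw [hydist, abs_of_nonneg (by linarith)]
    simp only [hρ]
    nlinarith
  have hyd' : Pairwise fun k l => Disjoint (Metric.ball (y k) (ρ k)) (Metric.ball (y l) (ρ l)) := by
    intro k l h
    refine Metric.ball_disjoint_ball ?_
    rcases lt_or_gt_of_ne h with h | h
    · exact hyd k l h
    · rw [dist_comm, add_comm]; exact hyd l k h
  have hysub : ∀ k, Metric.ball (y k) (ρ k) ⊆ Metric.ball c R := fun k => by
    refine Metric.ball_subset_ball' ?_
    have h1 := hτ0 k
    have h2 := hτ1 k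
    rw [hy, dist_self_add_left, norm_smul, he₁, mul_one,
      Real.norm_of_nonneg (mul_nonneg hR.le (by linarith))]
    simp only [hρ]
    nlinarith
  choose Z hZa hZ ι hι z σ hσ hzsub hzd hsum using fun k => hcell (ρ k) (hρ0 k) (τ k) (hτ0 k)
  set U : ℕ → Set (Euc m) := fun k => Metric.ball (y k) (ρ k) with hU
  set V : ℕ → Euc m → N := fun k x => Z k ((1 : ℝ)⁻¹ • (x - y k)) with hV
  have hmem : ∀ k x, x ∈ U k ↔ (1 : ℝ)⁻¹ • (x - y k) ∈ Metric.ball (0 : Euc m) (ρ k) := fun k x => by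
    rw [inv_one, one_smul, mem_ball_zero_iff, hU, Metric.mem_ball, dist_eq_norm]
  have hVU : ∀ k, ∀ x ∉ U k, V k x = a := fun k x hx => hZa k _ fun h => hx ((hmem k x).2 h)
  set v := patchMap U V (fun _ => a) with hv
  have hvU : ∀ k, ∀ x ∈ U k, v x = V k x := patchMap_of_mem hyd' V _
  -- All the cells equal a off their balls, so they are glued to the constant map a, which has zero
  -- energy.
  have hE : HasEnergyLE s p v (Metric.closedBall c R) (3 ^ p * (0 + ∑' k, ENNReal.ofReal (τ k))) := by
    refine (HasEnergyLE.patch (S₀ := ∅) hp (hasEnergyLE_const hp a _)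
      (fun k => ((hZ k).comp_inv_smul_sub hp (y k) one_pos).mono Subset.rfl (e' := ENNReal.ofReal (τ k)) ?_)
      (fun k => Metric.isOpen_ball.measurableSet) hyd' hVU (fun _ _ _ => rfl) hvU
      (patchMap_of_notMem V _)).mono ?_ le_rfl
    · rw [ENNReal.ofReal_one, ENNReal.one_rpow, one_mul]
    · refine union_subset (empty_subset _) (iUnion_subset fun k x hx => ?_)
      rw [mem_preimage, mem_closedBall_zero_iff, inv_one, one_smul] at hx
      refine Metric.mem_closedBall.2 ((dist_triangle x (y k) c).trans ?_)
      have h1 := hτ0 k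
      have h2 := hτ1 k
      rw [dist_eq_norm x, hy, dist_self_add_left, norm_smul, he₁, mul_one,
        Real.norm_of_nonneg (mul_nonneg hR.le (by linarith))]
      simp only [hρ, hy] at hx
      nlinarith
  have hEt : (3 : ℝ≥0∞) ^ p * (0 + ∑' k, ENNReal.ofReal (τ k)) ≠ ⊤ := by
    refine ENNReal.mul_ne_top (ENNReal.rpow_ne_top_of_nonneg hp.le (by norm_num)) ?_
    rw [zero_add]
    exact (summable_geometric_two).tsum_ofReal_ne_top
  have hva : ∀ x ∉ Metric.closedBall c R, v x = a := fun x hx =>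
    patchMap_of_notMem V _ x fun k hk => hx (Metric.ball_subset_closedBall (hysub k hk))
  have hinU : ∀ k i, Metric.ball (y k + z k i) (σ k) ⊆ U k := fun k i x hx => by
    rw [hmem, inv_one, one_smul]
    refine hzsub k i ?_
    rw [Metric.mem_ball, dist_eq_norm] at hx ⊢
    rwa [sub_sub]
  have hcount : ∀ k, Countable (ι k) := hι
  have hfin := H v a _ hEt hE hva (Σ k, ι k) (fun j => y j.1 + z j.1 j.2) (fun j => σ j.1)
    (fun j => hσ j.1) (fun j => (hinU j.1 j.2).trans (hysub j.1)) (by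
      rintro ⟨k, i⟩ ⟨l, j⟩ h
      rcases eq_or_ne k l with rfl | hkl
      · have hij : i ≠ j := fun h1 => h (by rw [h1])
        have h1 := hzd k hij
        refine disjoint_left.2 fun x hx hx' => ?_
        refine (disjoint_left.1 h1 : ∀ ⦃w⦄, w ∈ _ → w ∉ _) (?_ : x - y k ∈ _) ?_
        · rw [Metric.mem_ball, dist_eq_norm] at hx ⊢
          rwa [sub_sub]
        · rw [Metric.mem_ball, dist_eq_norm] at hx' ⊢
          rwa [sub_sub]
      · exact (hyd' hkl).mono (hinU k i) (hinU l j))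
  rw [ENNReal.tsum_sigma'] at hfin
  refine absurd hfin (not_lt.2 ?_)
  rw [top_le_iff, ← top_le_iff]
  -- Each cell contributes at least 1, the lifting energies being unchanged by the translations.
  calc (⊤ : ℝ≥0∞) = ∑' _ : ℕ, 1 := (ENNReal.tsum_const_eq_top_of_ne_zero one_ne_zero).symm
    _ ≤ _ := by
        refine ENNReal.tsum_le_tsum fun k => (hsum k).trans (ENNReal.tsum_le_tsum fun i => ?_)
        refine mul_le_mul_right (le_of_eq ?_) _
        refine liftingEnergy_congr proj r q fun x hx => ?_
        simp only
        rw [hvU k]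
        · simp only [hV]
          congr 1
          rw [inv_one, one_smul]
          abel
        · refine hinU k i ?_
          rw [Metric.mem_ball, dist_self_add_left, norm_smul, Real.norm_of_nonneg (hσ k).le]
          have := mem_ball_zero_iff.1 hx
          nlinarith [hσ k]

variable {n : ℕ} [ConnectedSpace N]
    [ChartedSpace (EuclideanSpace ℝ (Fin n)) N] [IsManifold (𝓡 n) ∞ N]
    [RiemannianBundle (fun x : N => TangentSpace (𝓡 n) x)]
    [IsContMDiffRiemannianBundle (𝓡 n) ∞ (EuclideanSpace ℝ (Fin n))
      (fun x : N => TangentSpace (𝓡 n) x)]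
    [IsRiemannianManifold (𝓡 n) N]

-- The value a outside the cells has to be the same for all cells. If points have zero capacity, any
-- a will do. Otherwise a is a cluster point of the constants of a sequence of maps that are
-- increasingly hard to lift.
include n in
theorem exists_hasCell (hm : 1 ≤ m) (hs : s ∈ Ioc (0 : ℝ) 1) (hp : 1 ≤ p)
    (hN : ((m : ℝ) < s * p ∨ (s = 1 ∧ p = 1 ∧ m = 1)) → CompactSpace N)
    (H : ¬ LinearLiftingBound m proj s p r q) :
    ∃ a : N, ∀ ρ : ℝ, 0 < ρ → ∀ ε : ℝ, 0 < ε → HasCell m proj s p r q a ρ (ENNReal.ofReal ε) := by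
  have hp0 : 0 < p := by linarith
  obtain ⟨C, hC, hhard⟩ := exists_isHardToLift hs hp edist_ne_top_of_connectedSpace H
  have h3 : (0 : ℝ) < 3 ^ p * 2 := by positivity
  have hsum : ∀ ε : ℝ, 0 < ε → (3 : ℝ≥0∞) ^ p * (ENNReal.ofReal (ε / (3 ^ p * 2)) +
      ENNReal.ofReal (ε / (3 ^ p * 2))) = ENNReal.ofReal ε := fun ε hε => by
    rw [← two_mul, ← mul_assoc, show (3 : ℝ≥0∞) = ENNReal.ofReal 3 by simp,
      show (2 : ℝ≥0∞) = ENNReal.ofReal 2 by simp, ENNReal.ofReal_rpow_of_pos (by norm_num),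
      ← ENNReal.ofReal_mul (by positivity), ← ENNReal.ofReal_mul (by positivity),
      mul_div_cancel₀ _ h3.ne']
  by_cases hcase : (m : ℝ) < s * p ∨ (s = 1 ∧ p = 1 ∧ m = 1)
  · have := hN hcase
    choose v b E hv using fun j : ℕ => hhard ((j : ℝ) + 1) (by positivity)
    obtain ⟨a, ha⟩ : ∃ a, MapClusterPt a atTop b := exists_clusterPt_of_compactSpace _
    refine ⟨a, fun ρ hρ ε hε => ?_⟩
    set ε' := ε / (3 ^ p * 2) with hε'
    have hε0 : 0 < ε' := by positivity
    obtain ⟨ρ', hρ', -, hnear⟩ := exists_isTransition_near (n := n) hm hs hp a hρ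
      (ε := ENNReal.ofReal ε') (by simpa using hε0)
    obtain ⟨Λ₀, hΛ₀⟩ := exists_forall_hasCell (proj := proj) (r := r) (q := q) hm hs.1 hp0 hC hε0 hρ'
    -- The threshold Λ₀ depends on the radius ρ' but not on the map, so a map with Λ above it and
    -- with its constant close to a can be found far in the sequence.
    obtain ⟨j, ⟨w, hw⟩, hj⟩ := ((mapClusterPt_iff_frequently.1 ha _ hnear).and_eventually
      (tendsto_natCast_atTop_atTop.eventually_ge_atTop Λ₀)).exists
    rw [← hsum ε hε]
    exact hΛ₀ _ (hj.trans (by linarith)) _ _ _ (hv j) a ρ' ρ w hw (Or.inr rfl)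
  · have hsp : s * p < m ∨ (s * p = m ∧ 1 < p) := by
      push Not at hcase
      rcases lt_or_eq_of_le hcase.1 with h | h
      · exact Or.inl h
      · refine Or.inr ⟨h, lt_of_le_of_ne hp fun h1 => ?_⟩
        rw [← h1, mul_one] at h
        have hm1 : (1 : ℝ) ≤ m := by exact_mod_cast hm
        have hs1 : s = 1 := le_antisymm hs.2 (by linarith)
        refine hcase.2 hs1 h1.symm ?_
        rw [hs1] at h
        exact_mod_cast h.symm
    obtain ⟨a⟩ := (inferInstance : Nonempty N)
    refine ⟨a, fun ρ hρ ε hε => ?_⟩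
    set ε' := ε / (3 ^ p * 2) with hε'
    have hε0 : 0 < ε' := by positivity
    obtain ⟨Λ₀, hΛ₀⟩ := exists_forall_hasCell (proj := proj) (r := r) (q := q) hm hs.1 hp0 hC hε0 one_pos
    obtain ⟨v, b, E, hv⟩ := hhard (max 1 Λ₀) (by positivity)
    obtain ⟨ρ', w, hw⟩ := hasSmallTransitions (n := n) hm hs hp hsp a b ρ hρ (ENNReal.ofReal ε')
      (by simpa using hε0)
    rw [← hsum ε hε]
    exact hΛ₀ _ (le_max_right _ _) _ _ _ hv a ρ' ρ w hw (Or.inl (hsp.elim le_of_lt fun h => h.1.le))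

include n in
theorem LiftsLocally.linearLiftingBound (hm : 1 ≤ m) (hs : s ∈ Ioc (0 : ℝ) 1) (hp : 1 ≤ p)
    (hN : ((m : ℝ) < s * p ∨ (s = 1 ∧ p = 1 ∧ m = 1)) → CompactSpace N)
    (H : LiftsLocally m proj s p r q) : LinearLiftingBound m proj s p r q := by
  by_contra hcon
  obtain ⟨a, ha⟩ := exists_hasCell (n := n) hm hs hp hN hcon
  exact not_liftsLocally_of_hasCell hm (by linarith) ha H

end Contradiction

end

/-! ### The two choices of domain. -/

theorem mainTheorem6
    (m : ℕ) (hm : 1 ≤ m) (s r p q : ℝ)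
    (hs : s ∈ Ioc (0 : ℝ) 1) (hr : r ∈ Ioc (0 : ℝ) 1) (hp : 1 ≤ p) (hq : 1 ≤ q)
    (hrq : r * q = s * p)
    -- the connected Riemannian manifold `N`
    {n : ℕ} {N : Type*} [EMetricSpace N] [SecondCountableTopology N] [ConnectedSpace N]
    [MeasurableSpace N] [BorelSpace N]
    [ChartedSpace (EuclideanSpace ℝ (Fin n)) N] [IsManifold (𝓡 n) ∞ N]
    [RiemannianBundle (fun x : N => TangentSpace (𝓡 n) x)]
    [IsContMDiffRiemannianBundle (𝓡 n) ∞ (EuclideanSpace ℝ (Fin n))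
      (fun x : N => TangentSpace (𝓡 n) x)]
    [IsRiemannianManifold (𝓡 n) N]
    (hN : ((m : ℝ) < s * p ∨ (s = 1 ∧ p = 1 ∧ m = 1)) → CompactSpace N)
    -- the Riemannian manifold `F`
    {k : ℕ} {F : Type*} [EMetricSpace F] [SecondCountableTopology F]
    [MeasurableSpace F] [BorelSpace F]
    [ChartedSpace (EuclideanSpace ℝ (Fin k)) F] [IsManifold (𝓡 k) ∞ F]
    [RiemannianBundle (fun x : F => TangentSpace (𝓡 k) x)]
    [IsContMDiffRiemannianBundle (𝓡 k) ∞ (EuclideanSpace ℝ (Fin k))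
      (fun x : F => TangentSpace (𝓡 k) x)]
    [IsRiemannianManifold (𝓡 k) F]
    (proj : F → N) :
    -- the domain is the Euclidean space
    (EverySobolevMapLifts m (EuclideanSpace ℝ (Fin m)) proj s p r q →
      LinearLiftingBound m proj s p r q) ∧
    -- the domain is a compact Riemannian manifold `M` of dimension `m`
    (∀ (M : Type*) [EMetricSpace M] [CompactSpace M] [Nonempty M]
      [MeasurableSpace M] [BorelSpace M]
      [ChartedSpace (EuclideanSpace ℝ (Fin m)) M] [IsManifold (𝓡 m) ∞ M]
      [RiemannianBundle (fun x : M => TangentSpace (𝓡 m) x)]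
      [IsContMDiffRiemannianBundle (𝓡 m) ∞ (EuclideanSpace ℝ (Fin m))
        (fun x : M => TangentSpace (𝓡 m) x)]
      [IsRiemannianManifold (𝓡 m) M],
      EverySobolevMapLifts m M proj s p r q → LinearLiftingBound m proj s p r q) := by
  have hsp : 0 < s * p := mul_pos hs.1 (by linarith)
  refine ⟨fun H => ?_, fun M => ?_⟩
  · have hsf : SFinite (μHE[m] : Measure (EuclideanSpace ℝ (Fin m))) := by
      rw [EuclideanSpace.euclideanHausdorffMeasure_eq_volume]
      infer_instance
    exact (H.liftsLocally hm hs.1 hp hr.1 hq hrq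
      (hasTailBound_euclidean (by linarith))).linearLiftingBound (n := n) hm hs hp hN
  · intros
    rename_i H
    have hfin : IsFiniteMeasure (μHE[m] : Measure M) := isFiniteMeasure_euclideanHausdorffMeasure
    exact (H.liftsLocally hm hs.1 hp hr.1 hq hrq
      (hasTailBound_of_isFiniteMeasure (by positivity))).linearLiftingBound (n := n) hm hs hp hN
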